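/- **Conventions.** Let $\mathbf k$ be an algebraically closed field of characteristic zero. Let $L\simeq\mathbb Z^n$ be a lattice with dual $L^*$, let $L_{\mathbb R}=L\otimes\mathbb R$, and let $J$ be a finite set. A *wall* in $L_{\mathbb R}$ over $\mathbb N^J$ is a pair $(\mathfrak d,f_{\mathfrak d})$, where $\mathfrak d\subset L_{\mathbb R}$ is a codimension one rational polyhedral cone and, for a primitive vector $m_0\in L$ tangent to $\mathfrak d$ (the *direction*), $$f_{\mathfrak d}=1+\sum_{\beta\in\mathbb N^J\setminus\{0\}}\ \sum_{a\ge 1}c_{\beta,a}\,t^\beta z^{-a m_0}\in\mathbf k[L][\![\mathbb N^J]\!],$$ with finitely many nonzero $c_{\beta,a}\in\mathbf k$ for each $\beta$. The wall is *incoming* if $-m_0\in\mathfrak d$ and *outgoing* otherwise. A *scattering diagram* $\mathfrak D$ is a set of walls such that for each $r$ the set $\mathfrak D_r$ of walls with $f_{\mathfrak d}\not\equiv 1$ modulo $\mathfrak m^r$ is finite, where $\mathfrak m=\mathbb N^J\setminus\{0\}$. The notions below are understood modulo $\mathfrak m^r$, using $\mathfrak D_r$, for every $r$. The support is the union of the walls.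 The singular locus $\mathrm{Sing}$ is the union of the relative boundaries of the walls and of the pairwise intersections of walls of codimension at least $2$. For $x\notin\mathrm{Sing}$ put $f_x=\prod_{\mathfrak d\ni x}f_{\mathfrak d}$. Two diagrams are *equivalent* if $f_x=f'_x$ for all $x$ outside both singular loci. A path that avoids $\mathrm{Sing}$, is transversal to the walls, and has endpoints outside the support defines the ordered composition of the automorphisms $z^m\mapsto f_x^{\langle n,m\rangle}z^m$ at its successive crossing points $x$, where $n\in L^*$ is the primitive normal of the walls at $x$ that is negative on the path just before the crossing. $\mathfrak D$ is *consistent* if this path ordered product depends only on the endpoints of the path. A *consistent completion* of a set of walls $\mathfrak D_{\rm in}$ is a consistent scattering diagram containing $\mathfrak D_{\rm in}$ all of whose other walls are outgoing. Let $\Sigma$ be a fan in $L_{\mathbb R}$ defining a smooth projective toric variety $X_\Sigma$. For $j\in J$, let $v_j$ be the primitive generator of a ray of $\Sigma$, with toric divisor $D_j$, and let $H_j\subset D_j$ be a hypersurface; put $H=\bigcup_j H_j$. The *initial HDTV scattering diagram* of $(X_\Sigma,H)$, over $\mathbb N^J$, consists of the walls $(\sigma,(1+t_jz^{v_j})^{w})$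 of direction $-v_j$, for $j\in J$ and $\sigma$ a codimension one cone of $\Sigma$ containing $v_j$, where $w=D_\sigma\cdot H_j$ is the intersection number on $D_j$ of $H_j$ with the toric curve $D_\sigma$, and only the $\sigma$ with $w>0$ are taken. Its consistent completion is the *HDTV scattering diagram* $\mathfrak D_{(X_\Sigma,H)}$. Let $\mathbf s$ be a skew-symmetric seed: a lattice $N$ with a basis $(e_i)_{i\in\overline I}$, an integral skew-symmetric form $\{\cdot,\cdot\}$ on $N$, and a subset $I\subset\overline I$ such that $v_i:=\{e_i,\cdot\}\in M:=\mathrm{Hom}(N,\mathbb Z)$ is nonzero for all $i\in I$. Let $|v_i|$ be the divisibility of $v_i$ in $M$. **Theorem.** (1) ($\mathcal X$ case.) Assume that every $v_i$, $i\in I$, is primitive and that $\mathbb R_{\ge0}v_i\ne\mathbb R_{\ge0}v_j$ for $i\neq j$. Let $\Sigma$ be a smooth projective fan in $M_{\mathbb R}$ whose rays include all $\mathbb R_{\ge0}v_i$, such that each hyperplane $e_i^\perp$ ($i\in I$) is a union of codimension one cones of $\Sigma$ and no cone of $\Sigma$ contains two distinct rays of the form $\mathbb R_{\ge0}v_i$.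 Let $H_i$ be the closure in $D_i$ of the locus $1+z^{e_i}=0$ in the big torus of $D_i$, and let $H=\bigcup_{i\in I}H_i$; thus $(X_\Sigma,H)$ is the toric model of a log Calabi–Yau compactification of the $\mathcal X$ cluster variety. Then the initial HDTV scattering diagram of $(X_\Sigma,H)$ and the set of walls $$\{(e_i^\perp,\;1+t_iz^{v_i})\}_{i\in I}$$ both have a consistent completion, unique up to equivalence, and $\mathfrak D_{(X_\Sigma,H)}$ is equivalent to the consistent completion of the latter. (2) ($\mathcal A$ case.) Let $\Sigma'$ be a smooth projective fan in $N_{\mathbb R}$ whose rays include all $\mathbb R_{\ge0}e_i$, $i\in I$, such that each hyperplane $v_i^\perp$ ($i\in I$) is a union of codimension one cones of $\Sigma'$ and no cone of $\Sigma'$ contains two distinct rays of the form $\mathbb R_{\ge0}e_i$. Let $H'_i$ be the closure in $D'_i$ of the locus $1+z^{v_i}=0$ in the big torus of $D'_i$. Then $H'_i$ has exactly $|v_i|$ connected components. Let $H'_{ij}$, $1\le j\le|v_i|$, be these components, in any order, and regard $H'=\bigcup_{i,j}H'_{ij}$ as the union of these connected hypersurfaces, with one variable $t_{ij}$ for each;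 thus $(X_{\Sigma'},H')$ is the toric model of a log Calabi–Yau compactification of the $\mathcal A$ cluster variety. Then the initial HDTV scattering diagram of $(X_{\Sigma'},H')$ and the set of walls $$\Big\{\Big(v_i^\perp,\;\prod_{j=1}^{|v_i|}(1+t_{ij}z^{e_i})\Big)\Big\}_{i\in I}$$ both have a consistent completion, unique up to equivalence, and $\mathfrak D_{(X_{\Sigma'},H')}$ is equivalent to the consistent completion of the latter. -/

import Mathlib

noncomputable section

universe u v w x

namespace HDTV

/-! ### Lattices, cones and fans

The lattice `L` carrying a fan and its dual lattice `L*` are written in dual bases indexed by `ι`: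
both are `ι → ℤ`, the duality pairing is the dot product, and `L ⊗ ℝ` is `ι → ℝ`. -/

variable {ι : Type v} [Fintype ι]

/-- The integral vector `m` as a vector of the real vector space `L ⊗ ℝ`. -/
def toReal (m : ι → ℤ) : ι → ℝ := fun i => (m i : ℝ)

/-- The pairing of `n ∈ L*` with `x ∈ L ⊗ ℝ`. -/
def pair (n : ι → ℤ) (x : ι → ℝ) : ℝ := toReal n ⬝ᵥ x

/-- The divisibility `|m|`, the largest `d` with `m ∈ d L` (for `m ≠ 0`). -/
def divisibility (m : ι → ℤ) : ℕ := (Finset.univ.gcd m).natAbs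

/-- Primitive vectors (in particular they are nonzero). -/
def IsPrimitive (m : ι → ℤ) : Prop := divisibility m = 1

/-- The ray `ℝ_{≥ 0} m`. -/
def ray (m : ι → ℤ) : PointedCone ℝ (ι → ℝ) := PointedCone.hull ℝ {toReal m}

/-- The hyperplane `n^⊥` of `L ⊗ ℝ`, as a cone. -/
def perp (n : ι → ℤ) : PointedCone ℝ (ι → ℝ) where
  carrier := {x | pair n x = 0}
  add_mem' {x y} hx hy := by
    simp only [Set.mem_ofPred_eq, pair] at hx hy ⊢
    rw [dotProduct_add, hx, hy, add_zero]
  zero_mem' := by simp [pair]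
  smul_mem' c x hx := by
    simp only [Set.mem_ofPred_eq, pair] at hx ⊢
    rw [dotProduct_smul, hx, smul_zero]

/-- The dimension of (the linear span of) a cone. -/
def coneDim (σ : PointedCone ℝ (ι → ℝ)) : ℕ :=
  Module.finrank ℝ (Submodule.span ℝ (σ : Set (ι → ℝ)))

/-- Rational polyhedral cones (not necessarily strictly convex). -/
def IsRationalPolyhedral (σ : PointedCone ℝ (ι → ℝ)) : Prop :=
  ∃ S : Finset (ι → ℤ), σ = PointedCone.hull ℝ (toReal '' (S : Set (ι → ℤ)))

/-- Smooth cones: generated by a part of a `ℤ`-basis of the lattice. -/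
def IsSmoothCone (σ : PointedCone ℝ (ι → ℝ)) : Prop :=
  ∃ (b : Module.Basis ι ℤ (ι → ℤ)) (S : Set ι),
    σ = PointedCone.hull ℝ ((fun i => toReal (b i)) '' S)

/-- `τ` is a face of `σ`: the locus where a linear form that is nonnegative on `σ` vanishes. -/
def IsFace (τ σ : PointedCone ℝ (ι → ℝ)) : Prop :=
  ∃ u : ι → ℝ, (∀ x ∈ σ, 0 ≤ u ⬝ᵥ x) ∧ (τ : Set (ι → ℝ)) = {x | x ∈ σ ∧ u ⬝ᵥ x = 0}

/-- A fan: a finite nonempty set of strictly convex rational polyhedral cones, closed under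
faces, any two of which intersect in a common face. -/
structure Fan (ι : Type v) [Fintype ι] where
  cones : Set (PointedCone ℝ (ι → ℝ))
  finite : cones.Finite
  nonempty : cones.Nonempty
  rational : ∀ σ ∈ cones, IsRationalPolyhedral σ
  strictlyConvex : ∀ σ ∈ cones, ∀ x ∈ σ, -x ∈ σ → x = 0
  face_mem : ∀ σ ∈ cones, ∀ τ, IsFace τ σ → τ ∈ cones
  inter_face : ∀ σ ∈ cones, ∀ τ ∈ cones, IsFace (σ ⊓ τ) σ ∧ IsFace (σ ⊓ τ) τ

namespace Fan

/-- The cones of codimension one. -/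
def codimOne (F : Fan ι) : Set (PointedCone ℝ (ι → ℝ)) :=
  {σ | σ ∈ F.cones ∧ coneDim σ + 1 = Fintype.card ι}

/-- The cones of full dimension. -/
def maximal (F : Fan ι) : Set (PointedCone ℝ (ι → ℝ)) :=
  {σ | σ ∈ F.cones ∧ coneDim σ = Fintype.card ι}

def IsComplete (F : Fan ι) : Prop := ∀ x : ι → ℝ, ∃ σ ∈ F.cones, x ∈ σ

def IsSmooth (F : Fan ι) : Prop := ∀ σ ∈ F.cones, IsSmoothCone σ

/-- There is a strictly convex piecewise linear function: it agrees with a linear form `ℓ τ` on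
each maximal cone `τ`, and is strictly larger than `ℓ τ` outside `τ`. -/
def HasStrictlyConvexFunction (F : Fan ι) : Prop :=
  ∃ (φ : (ι → ℝ) → ℝ) (l : PointedCone ℝ (ι → ℝ) → (ι → ℝ)), ∀ τ ∈ F.maximal,
    (∀ x ∈ τ, φ x = l τ ⬝ᵥ x) ∧ (∀ x, x ∉ τ → l τ ⬝ᵥ x < φ x)

/-- The fan defines a smooth projective toric variety. -/
def IsSmoothProjective (F : Fan ι) : Prop :=
  F.IsComplete ∧ F.IsSmooth ∧ F.HasStrictlyConvexFunction

end Fan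

/-! ### Toric divisors, hypersurfaces in them, and intersection numbers

Let `v` generate a ray of a fan `F`. The corresponding component `D_v` of the toric boundary of
`X_F` is the toric variety glued from the affine charts `Spec k[σ^∨ ∩ v^⊥]`, where `σ` runs over
the cones of `F` containing `v` (they correspond to the cones of the quotient fan `F(v)`), and
where the chart of `σ ⊆ τ` is glued to the chart of `τ` by means of
`k[τ^∨ ∩ v^⊥] ⊆ k[σ^∨ ∩ v^⊥]`. Its big torus, the chart of the ray itself, is `Spec k[v^⊥]`. -/

/-- The monoid `σ^∨ ∩ v^⊥` of exponents. -/
def chartMonoid (v : ι → ℤ) (σ : PointedCone ℝ (ι → ℝ)) : AddSubmonoid (ι → ℤ) where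
  carrier := {n | pair n (toReal v) = 0 ∧ ∀ x ∈ σ, 0 ≤ pair n x}
  add_mem' {a b} ha hb := by
    have key : ∀ x, pair (a + b) x = pair a x + pair b x := fun x => by
      simp only [pair]
      rw [← add_dotProduct]
      congr 1
      ext i
      simp [toReal]
    refine ⟨by rw [key, ha.1, hb.1, add_zero], fun x hx => ?_⟩
    rw [key]
    exact add_nonneg (ha.2 x hx) (hb.2 x hx)
  zero_mem' := by
    have h : ∀ x, pair (0 : ι → ℤ) x = 0 := fun x => by simp [pair, toReal, dotProduct]
    exact ⟨h _, fun x _ => (h x).ge⟩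

theorem chartMonoid_anti (v : ι → ℤ) {σ τ : PointedCone ℝ (ι → ℝ)} (h : σ ≤ τ) :
    chartMonoid v τ ≤ chartMonoid v σ :=
  fun _ hn => ⟨hn.1, fun x hx => hn.2 x (h hx)⟩

/-- The coordinate ring `k[σ^∨ ∩ v^⊥]` of the chart of `D_v` given by `σ`. -/
abbrev ChartRing (k : Type u) [Field k] (v : ι → ℤ) (σ : PointedCone ℝ (ι → ℝ)) : Type (max u v) :=
  AddMonoidAlgebra k (chartMonoid v σ)

/-- The inclusion `k[τ^∨ ∩ v^⊥] → k[σ^∨ ∩ v^⊥]` for `σ ⊆ τ`. -/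
def chartInclusion (k : Type u) [Field k] (v : ι → ℤ) {σ τ : PointedCone ℝ (ι → ℝ)} (h : σ ≤ τ) :
    ChartRing k v τ →+* ChartRing k v σ :=
  AddMonoidAlgebra.mapDomainRingHom k (AddSubmonoid.inclusion (chartMonoid_anti v h))

/-- The cones of `F` containing `v`. -/
def Fan.Star (F : Fan ι) (v : ι → ℤ) : Type v :=
  {σ : PointedCone ℝ (ι → ℝ) // σ ∈ F.cones ∧ toReal v ∈ σ}

/-- The disjoint union of the charts of `D_v`. -/
abbrev ToricDivisorCharts (k : Type u) [Field k] (F : Fan ι) (v : ι → ℤ) : Type (max u v) :=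
  Σ σ : F.Star v, PrimeSpectrum (ChartRing k v σ.1)

/-- The gluing of the charts: a point of the chart of `σ ⊆ τ` is identified with its image in the
chart of `τ`. -/
def toricDivisorRel (k : Type u) [Field k] (F : Fan ι) (v : ι → ℤ)
    (x y : ToricDivisorCharts k F v) : Prop :=
  ∃ h : x.1.1 ≤ y.1.1, y.2 = PrimeSpectrum.comap (chartInclusion k v h) x.2

/-- The underlying topological space of the scheme `D_v`, with its Zariski topology. -/
def ToricDivisor (k : Type u) [Field k] (F : Fan ι) (v : ι → ℤ) : Type (max u v) :=
  Quot (toricDivisorRel k F v)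

instance (k : Type u) [Field k] (F : Fan ι) (v : ι → ℤ) : TopologicalSpace (ToricDivisor k F v) :=
  inferInstanceAs (TopologicalSpace (Quot (toricDivisorRel k F v)))

/-- The inclusion of the chart of `σ` into `D_v`. -/
def chart (k : Type u) [Field k] (F : Fan ι) (v : ι → ℤ) (σ : F.Star v)
    (P : PrimeSpectrum (ChartRing k v σ.1)) : ToricDivisor k F v :=
  Quot.mk _ ⟨σ, P⟩

/-- The closure in `D_v` of the locus `1 + z^u = 0` in the big torus of `D_v`, for `u ∈ v^⊥`. -/
def binomialHypersurface (k : Type u) [Field k] (F : Fan ι) (v u : ι → ℤ) :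
    Set (ToricDivisor k F v) :=
  closure {x | ∃ (σ : F.Star v) (P : PrimeSpectrum (ChartRing k v σ.1))
    (hu : u ∈ chartMonoid v σ.1), σ.1 = ray v ∧
      1 + AddMonoidAlgebra.single ⟨u, hu⟩ (1 : k) ∈ P.asIdeal ∧ x = chart k F v σ P}

/-- The connected components of a subset of a topological space. -/
def componentsOf {Z : Type u} [TopologicalSpace Z] (H : Set Z) : Set (Set Z) :=
  {C | ∃ x ∈ H, C = connectedComponentIn H x}

/-- The ideal, in the chart of `τ`, of a closed subset `H` of `D_v` with its reduced structure. -/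
def hypersurfaceIdeal (k : Type u) [Field k] (F : Fan ι) (v : ι → ℤ)
    (H : Set (ToricDivisor k F v)) (τ : F.Star v) : Ideal (ChartRing k v τ.1) :=
  PrimeSpectrum.vanishingIdeal (chart k F v τ ⁻¹' H)

/-- For `σ ⊆ τ`, the ideal in the chart of `τ` of the closed toric stratum `D_σ ⊆ D_v`. It is
generated by the monomials whose exponent does not vanish identically on `σ`. -/
def stratumIdeal (k : Type u) [Field k] (F : Fan ι) (v : ι → ℤ) (σ : PointedCone ℝ (ι → ℝ))
    (τ : F.Star v) : Ideal (ChartRing k v τ.1) :=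
  Ideal.span {g | ∃ m : chartMonoid v τ.1, (∃ x ∈ σ, pair m.1 x ≠ 0) ∧
    g = AddMonoidAlgebra.single m (1 : k)}

/-- The length of the part of the scheme `D_σ ∩ H` contained in the chart of `τ`. -/
def intersectionLength (k : Type u) [Field k] (F : Fan ι) (v : ι → ℤ)
    (H : Set (ToricDivisor k F v)) (σ : PointedCone ℝ (ι → ℝ)) (τ : F.Star v) : ℕ :=
  Module.finrank k (ChartRing k v τ.1 ⧸ (hypersurfaceIdeal k F v H τ ⊔ stratumIdeal k F v σ τ))

/-- The intersection number `D_σ · H` on `D_v` of the toric curve `D_σ`, for `σ ∋ v` of codimension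
one, with a hypersurface `H` that does not contain `D_σ`: the length of the finite scheme
`D_σ ∩ H`. The curve `D_σ` is covered by its two affine lines in the charts of the two maximal
cones containing `σ`, and these meet in the part of `D_σ` in the chart of `σ`; so the total length
is the sum of the lengths in the charts of the maximal cones, minus the length in the
chart of `σ`. -/
def intersectionNumber (k : Type u) [Field k] (F : Fan ι) (v : ι → ℤ)
    (H : Set (ToricDivisor k F v)) (σ : F.Star v) : ℤ :=
  (∑ᶠ τ : {τ : F.Star v // σ.1 ≤ τ.1 ∧ τ.1 ∈ F.maximal},
      (intersectionLength k F v H σ.1 τ.1 : ℤ)) -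
    (intersectionLength k F v H σ.1 σ : ℤ)

/-! ### Scattering diagrams over `ℕ^J` -/

/-- The ring `k[L]⟦ℕ^J⟧`: power series in variables `t_j` over the Laurent polynomial ring `k[L]`. -/
abbrev ScatRing (k : Type u) (ι : Type v) (J : Type w) [Field k] : Type (max u v w) :=
  MvPowerSeries J (AddMonoidAlgebra k (ι → ℤ))

/-- The monomial `z^m`. -/
def zMonomial (k : Type u) [Field k] (J : Type w) (m : ι → ℤ) : ScatRing k ι J :=
  MvPowerSeries.C (AddMonoidAlgebra.single m (1 : k))

/-- Equality modulo the `r`-th power of the maximal monoid ideal `ℕ^J \ {0}`. -/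
def EqMod {k : Type u} {J : Type w} [Field k] (r : ℕ) (f g : ScatRing k ι J) : Prop :=
  ∀ β : J →₀ ℕ, β.degree < r → MvPowerSeries.coeff β f = MvPowerSeries.coeff β g

/-- A cone with an attached function and a direction vector `m₀`. -/
structure Wall (k : Type u) (ι : Type v) (J : Type w) [Fintype ι] [Field k] where
  cone : PointedCone ℝ (ι → ℝ)
  func : ScatRing k ι J
  dir : ι → ℤ

/-- The conditions on a wall: the cone is rational polyhedral of codimension one, the direction `m₀`
is primitive and tangent to it, and `f = 1 + ∑ c_{β,a} t^β z^{-a m₀}`, the sum running over `β ≠ 0`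
and `a ≥ 1`. -/
structure IsWall {k : Type u} {J : Type w} [Field k] (w : Wall k ι J) : Prop where
  rational : IsRationalPolyhedral w.cone
  codim_one : coneDim w.cone + 1 = Fintype.card ι
  primitive : IsPrimitive w.dir
  tangent : toReal w.dir ∈ Submodule.span ℝ (w.cone : Set (ι → ℝ))
  constantCoeff : MvPowerSeries.constantCoeff w.func = 1
  exponents : ∀ β : J →₀ ℕ, β ≠ 0 → ∀ m : ι → ℤ, (MvPowerSeries.coeff β w.func).coeff m ≠ 0 →
    ∃ a : ℕ, 1 ≤ a ∧ m = -((a : ℤ) • w.dir)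

/-- Incoming walls are those with `-m₀ ∈ 𝔡`. -/
def Wall.IsIncoming {k : Type u} {J : Type w} [Field k] (w : Wall k ι J) : Prop :=
  -toReal w.dir ∈ w.cone

def Wall.IsOutgoing {k : Type u} {J : Type w} [Field k] (w : Wall k ι J) : Prop := ¬ w.IsIncoming

section Scattering

variable {k : Type u} {J : Type w} [Field k]

/-- The walls of `D` that are nontrivial modulo the `r`-th power of the maximal ideal. -/
def wallsMod (D : Set (Wall k ι J)) (r : ℕ) : Set (Wall k ι J) :=
  {w | w ∈ D ∧ ¬ EqMod r w.func 1}

/-- Scattering diagrams in `L ⊗ ℝ` over `ℕ^J`. -/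
structure IsScatteringDiagram (D : Set (Wall k ι J)) : Prop where
  isWall : ∀ w ∈ D, IsWall w
  finite : ∀ r : ℕ, (wallsMod D r).Finite

/-- The support of the walls of `D` that are nontrivial to order `r`. -/
def supp (D : Set (Wall k ι J)) (r : ℕ) : Set (ι → ℝ) :=
  {x | ∃ w ∈ wallsMod D r, x ∈ w.cone}

/-- The singular locus of the walls of `D` that are nontrivial to order `r`: the union of the
relative boundaries of the walls, and of the pairwise intersections of walls of codimension at
least two. -/
def sing (D : Set (Wall k ι J)) (r : ℕ) : Set (ι → ℝ) :=
  {x | ∃ w ∈ wallsMod D r, x ∈ intrinsicFrontier ℝ (w.cone : Set (ι → ℝ))} ∪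
  {x | ∃ w ∈ wallsMod D r, ∃ w' ∈ wallsMod D r, x ∈ w.cone ∧ x ∈ w'.cone ∧
    coneDim (w.cone ⊓ w'.cone) + 2 ≤ Fintype.card ι}

/-- The function `f_x`, to order `r`: the product of the functions of the walls of `D` that are
nontrivial to order `r` and contain `x`. -/
def funcAt (D : Set (Wall k ι J)) (r : ℕ) (x : ι → ℝ) : ScatRing k ι J :=
  ∏ᶠ w ∈ {w : Wall k ι J | w ∈ wallsMod D r ∧ x ∈ w.cone}, w.func

/-- Equivalence of scattering diagrams: `f_x = f'_x` for all `x` outside the singular loci, where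
these conditions are understood to every finite order. -/
def Equivalent (D D' : Set (Wall k ι J)) : Prop :=
  ∀ (r : ℕ) (x : ι → ℝ), x ∉ sing D r → x ∉ sing D' r → EqMod r (funcAt D r x) (funcAt D' r x)

/-- The integral power `f ^ a` of a power series `f` with constant term `1`. -/
def intPow (f : ScatRing k ι J) (a : ℤ) : ScatRing k ι J :=
  if 0 ≤ a then f ^ a.toNat else MvPowerSeries.invOfUnit f 1 ^ (-a).toNat

/-- The image of a Laurent polynomial under `z^m ↦ f^⟨n, m⟩ z^m`. -/
def wallCrossingPoly (f : ScatRing k ι J) (n : ι → ℤ) (p : AddMonoidAlgebra k (ι → ℤ)) :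
    ScatRing k ι J :=
  p.coeff.sum fun m c => intPow f (n ⬝ᵥ m) * MvPowerSeries.C (AddMonoidAlgebra.single m c)

open Classical in
/-- The wall-crossing automorphism of `k[L]⟦ℕ^J⟧`, which sends `∑ p_β t^β` with `p_β ∈ k[L]` to
`∑ wallCrossingPoly p_β t^β`. -/
def wallCrossing (f : ScatRing k ι J) (n : ι → ℤ) (p : ScatRing k ι J) : ScatRing k ι J :=
  fun β => ∑ ab ∈ Finset.HasAntidiagonal.antidiagonal β,
    MvPowerSeries.coeff ab.1 (wallCrossingPoly f n (MvPowerSeries.coeff ab.2 p))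

/-- At time `t` the path `γ` transversally crosses the walls of `D` (nontrivial to order `r`), all
of which are contained in `n^⊥`, where `n` is primitive, negative on `γ` just before `t` and
positive just after. -/
def IsCrossing (D : Set (Wall k ι J)) (r : ℕ) (γ : ℝ → ι → ℝ) (t : ℝ) (n : ι → ℤ) : Prop :=
  γ t ∈ supp D r ∧ IsPrimitive n ∧
  (∀ w ∈ wallsMod D r, γ t ∈ w.cone → w.cone ≤ perp n) ∧
  ∃ ε > 0, (∀ s ∈ Set.Ioo (t - ε) t, pair n (γ s) < 0) ∧ (∀ s ∈ Set.Ioo t (t + ε), 0 < pair n (γ s))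

/-- `γ` is a path `[0,1] → L ⊗ ℝ` avoiding the singular locus, with endpoints outside the support,
crossing the walls of `D` (nontrivial to order `r`) transversally at the times
`t 0 < t 1 < ⋯ < t (s - 1)`, and `θ` is the ordered product of the wall-crossing automorphisms. -/
def IsPathOrderedProduct (D : Set (Wall k ι J)) (r : ℕ) (γ : ℝ → ι → ℝ)
    (θ : ScatRing k ι J → ScatRing k ι J) : Prop :=
  ContinuousOn γ (Set.Icc 0 1) ∧ (∀ t ∈ Set.Icc (0 : ℝ) 1, γ t ∉ sing D r) ∧
  γ 0 ∉ supp D r ∧ γ 1 ∉ supp D r ∧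
  ∃ (s : ℕ) (t : Fin s → ℝ) (n : Fin s → ι → ℤ), StrictMono t ∧
    Set.range t = {u | u ∈ Set.Icc (0 : ℝ) 1 ∧ γ u ∈ supp D r} ∧
    (∀ a, IsCrossing D r γ (t a) (n a)) ∧
    θ = (List.ofFn fun a => wallCrossing (funcAt D r (γ (t a))) (n a)).foldl
      (fun before next => next ∘ before) id

/-- Consistency: to every order, path ordered products depend only on the endpoints. -/
def IsConsistent (D : Set (Wall k ι J)) : Prop :=
  ∀ (r : ℕ) (γ γ' : ℝ → ι → ℝ) (θ θ' : ScatRing k ι J → ScatRing k ι J),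
    IsPathOrderedProduct D r γ θ → IsPathOrderedProduct D r γ' θ' →
    γ 0 = γ' 0 → γ 1 = γ' 1 → ∀ p, EqMod r (θ p) (θ' p)

/-- `D` is a consistent completion of `Din`: a consistent scattering diagram containing `Din` all of
whose other walls are outgoing. -/
structure IsConsistentCompletion (Din D : Set (Wall k ι J)) : Prop where
  isScatteringDiagram : IsScatteringDiagram D
  consistent : IsConsistent D
  subset : Din ⊆ D
  outgoing : ∀ w ∈ D, w ∉ Din → w.IsOutgoing

/-- The consistent completions of `Din` and `Din'` exist, each is unique up to equivalence, and they
are equivalent to each other. -/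
def HaveEquivalentCompletions (Din Din' : Set (Wall k ι J)) : Prop :=
  (∃ D, IsConsistentCompletion Din D) ∧ (∃ D', IsConsistentCompletion Din' D') ∧
  (∀ D₁ D₂, IsConsistentCompletion Din D₁ → IsConsistentCompletion Din D₂ → Equivalent D₁ D₂) ∧
  (∀ D₁ D₂, IsConsistentCompletion Din' D₁ → IsConsistentCompletion Din' D₂ → Equivalent D₁ D₂) ∧
  ∀ D D', IsConsistentCompletion Din D → IsConsistentCompletion Din' D' → Equivalent D D'

end Scattering

/-! ### The initial HDTV scattering diagram of a toric model -/

/-- The function `1 + t_j z^m`. -/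
def binomialFunc (k : Type u) [Field k] {J : Type w} (j : J) (m : ι → ℤ) : ScatRing k ι J :=
  1 + MvPowerSeries.X j * zMonomial k J m

/-- The widget of a primitive generator `v` of a ray of `F`, of weights `weight σ` on the
codimension one cones of the quotient fan `F(v)`, that is, on the codimension one cones `σ` of `F`
containing `v`, and of a function `f`. Cones of weight zero do not belong to the tropical
hypersurface. -/
def widget {k : Type u} {J : Type w} [Field k] (F : Fan ι) (v : ι → ℤ) (weight : F.Star v → ℤ)
    (f : ScatRing k ι J) : Set (Wall k ι J) :=
  {w | ∃ σ : F.Star v, σ.1 ∈ F.codimOne ∧ 0 < weight σ ∧ w = ⟨σ.1, f ^ (weight σ).toNat, -v⟩}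

/-- The initial HDTV scattering diagram of `(X_F, H)`, where `H` is the union of hypersurfaces `H j`
in the toric divisors of the rays generated by `v j`: the union of the widgets of the tropical
hypersurfaces of weights `D_σ · H j` and of the functions `1 + t_j z^{v j}`. -/
def hdtvInitial (k : Type u) [Field k] {J : Type w} (F : Fan ι) (v : J → ι → ℤ)
    (H : ∀ j, Set (ToricDivisor k F (v j))) : Set (Wall k ι J) :=
  ⋃ j, widget F (v j) (intersectionNumber k F (v j) (H j)) (binomialFunc k j (v j))

/-! ### Seeds and the toric models of cluster varieties -/

/-- A skew-symmetric seed in the lattice `N`, with `v_i = {e_i, ·} ≠ 0` for `i` unfrozen. -/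
structure Seed (N : Type x) (ι : Type v) [AddCommGroup N] where
  basis : Module.Basis ι ℤ N
  form : N →ₗ[ℤ] N →ₗ[ℤ] ℤ
  skew : ∀ x y, form x y = -form y x
  unfrozen : Set ι
  form_ne_zero : ∀ i ∈ unfrozen, form (basis i) ≠ 0

namespace Seed

variable {N : Type x} [AddCommGroup N]

/-- `e_i ∈ N` in the basis `e`. -/
def e (s : Seed N ι) (i : s.unfrozen) : ι → ℤ := fun j => s.basis.repr (s.basis i) j

/-- `v_i = {e_i, ·} ∈ M = Hom(N, ℤ)` in the basis dual to `e`. -/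
def v (s : Seed N ι) (i : s.unfrozen) : ι → ℤ := fun j => s.form (s.basis i) (s.basis j)

/-- The `𝒳` assumptions. -/
def XAssumptions (s : Seed N ι) : Prop :=
  (∀ i, IsPrimitive (s.v i)) ∧ ∀ i j, i ≠ j → ray (s.v i) ≠ ray (s.v j)

end Seed

/-- The conditions on the fan of the toric model of a cluster variety: it is smooth and projective,
its rays include those generated by the `v i`, no cone contains two distinct such rays,
and each hyperplane `(u i)^⊥` is a union of codimension one cones. -/
structure IsClusterFan {I : Type w} (F : Fan ι) (v u : I → ι → ℤ) : Prop where
  smoothProjective : F.IsSmoothProjective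
  ray_mem : ∀ i, ray (v i) ∈ F.cones
  separated : ∀ σ ∈ F.cones, ∀ i j, ray (v i) ≤ σ → ray (v j) ≤ σ → ray (v i) = ray (v j)
  perp_eq : ∀ i, ∃ S ⊆ F.codimOne, (perp (u i) : Set (ι → ℝ)) = ⋃ σ ∈ S, (σ : Set (ι → ℝ))

namespace Seed

variable {N : Type x} [AddCommGroup N]

/-- The hypersurface `H_i ⊆ D_i` of the `𝒳` case, for `v_i` primitive: the closure of
`1 + z^{e_i} = 0`. -/
def hypersurfaceX (k : Type u) [Field k] (s : Seed N ι) (F : Fan ι) (i : s.unfrozen) :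
    Set (ToricDivisor k F (s.v i)) :=
  binomialHypersurface k F (s.v i) (s.e i)

/-- The initial HDTV scattering diagram of the toric model of the `𝒳` cluster variety. -/
def hdtvInitialX (k : Type u) [Field k] (s : Seed N ι) (F : Fan ι) : Set (Wall k ι s.unfrozen) :=
  hdtvInitial k F s.v (s.hypersurfaceX k F)

/-- The walls `(e_i^⊥, 1 + t_i z^{v_i})`, of direction `-v_i`. -/
def wallsX (k : Type u) [Field k] (s : Seed N ι) : Set (Wall k ι s.unfrozen) :=
  Set.range fun i => ⟨perp (s.e i), binomialFunc k i (s.v i), -s.v i⟩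

/-- The hypersurface `H'_i ⊆ D'_i` of the `𝒜` case: the closure of `1 + z^{v_i} = 0`. -/
def hypersurfaceA (k : Type u) [Field k] (s : Seed N ι) (F : Fan ι) (i : s.unfrozen) :
    Set (ToricDivisor k F (s.e i)) :=
  binomialHypersurface k F (s.e i) (s.v i)

/-- The index set of the pairs `(i, j)` with `i` unfrozen and `j` one of `|v_i|` labels. -/
abbrev Pairs (s : Seed N ι) : Type v := Σ i : s.unfrozen, Fin (divisibility (s.v i))

/-- `C i j`, for the `|v_i|` values of `j`, is an enumeration without repetition of the connected
components `H'_{ij}` of `H'_i`. -/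
def IsComponentLabelling (k : Type u) [Field k] (s : Seed N ι) (F : Fan ι)
    (C : ∀ i : s.unfrozen, Fin (divisibility (s.v i)) → Set (ToricDivisor k F (s.e i))) : Prop :=
  ∀ i, Function.Injective (C i) ∧ Set.range (C i) = componentsOf (s.hypersurfaceA k F i)

/-- The initial HDTV scattering diagram of the toric model of the `𝒜` cluster variety, the
connected hypersurfaces being the `C i j`. -/
def hdtvInitialA (k : Type u) [Field k] (s : Seed N ι) (F : Fan ι)
    (C : ∀ i : s.unfrozen, Fin (divisibility (s.v i)) → Set (ToricDivisor k F (s.e i))) :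
    Set (Wall k ι s.Pairs) :=
  hdtvInitial k F (fun q : s.Pairs => s.e q.1) (fun q => C q.1 q.2)

/-- The walls `(v_i^⊥, ∏_j (1 + t_{ij} z^{e_i}))`, of direction `-e_i`. -/
def wallsA (k : Type u) [Field k] (s : Seed N ι) : Set (Wall k ι s.Pairs) :=
  Set.range fun i => ⟨perp (s.v i),
    ∏ j : Fin (divisibility (s.v i)), binomialFunc k (⟨i, j⟩ : s.Pairs) (s.e i), -s.e i⟩

end Seed

end HDTV

end

/-!
A wall-crossing is the flow of a vector field: if `δ` denotes the Euler derivation `t^β ↦ |β| t^β`,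
the automorphism attached to a wall is the solution `sol X` of `δ g = X g`, where `X` is a power
series of operators on Laurent polynomials (`crossing_eq_sol`). For a cluster seed all operators that
occur lie in one graded Lie algebra, spanned in degree `β` by `z^a ↦ ⟨n_β, a⟩ z^{a + m_β}`, where
`n_β` and `m_β` are additive in `β`; skewness of the pairing `⟨n_β, m_γ⟩` makes it closed under
brackets (`field_bracket`). It has at most one line in each degree `β`, and its pronilpotent group
consists of the series `sol X`.

*Existence of consistent completions.* For every point `u`, a group element factors uniquely into
parts supported in the degrees with `n_β(u) > 0`, `= 0` and `< 0` (`exists_signProd_eq`,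
`EqBelow.of_signProd`). The negative part is the `potential` at `u`. To every order it is locally
constant off the hyperplanes `n_β^⊥`, and its jump at a general point of such a hyperplane is the
wall-crossing whose function can be read off from the middle part (`potential_jump`). So the
diagram of all jumps is consistent: a path ordered product is a quotient of values of the potential
(`IsScatteringDiagram.isConsistent`). Solving a fixed point equation degree by degree, the group
element can be chosen such that the coefficient of degree `β` of its middle part at `m_β` takes
prescribed values (`exists_factor_eq`). With the values given by the functions on the full
hyperplanes, the walls that have to be added to these, one for each degree `β` and each chamber of
`n_β^⊥` cut out by the hyperplanes of lower degree, are absent on the chambers containing `m_β`, and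
therefore outgoing (`isOutgoing_of_mem_chamberWalls`).

*Uniqueness and comparison.* Two consistent diagrams that agree below order `r` differ in order `r`
by functions whose `z^m`-coefficients are invariant under translation in direction `m`, as one sees
from a thin parallelogram with long sides of direction `m` (`coeff_logder_sub_translate`). Far out in
direction `m` a wall contributing to `z^m` is not outgoing, so only the initial walls matter
(`equivalent_of_isConsistentCompletion`). Hence the completion depends only on the product of the
initial functions at general points, and adding outgoing walls to the initial ones does not change
it (`IsInitial.haveEquivalentCompletions`). In particular, the wall on a full hyperplane may be
replaced by its pieces on the cones of a fan, keeping only the pieces that contain `m_j`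
(`isInitial_hyperplanes`, `isInitial_fan`).

*Toric geometry.* What remains is to compute the initial walls of the toric model. Let `u = d u₀`
with `u₀` primitive. The locus `1 + z^u = 0` in the big torus of a toric divisor is the disjoint
union of the subtori `z^{u₀} = ζ` with `ζ^d = -1`. As the hyperplane `u^⊥` is a union of cones, `u₀`
has constant sign on every cone, so that `z^{u₀}` or its inverse is regular in each chart; therefore
the closures of these subtori stay disjoint. They are irreducible, being defined by the kernels of
restriction maps to domains, hence they are the `d` connected components
(`componentsOf_binomialHypersurface`). The toric curve `D_σ` meets each closure in one reduced point
if `σ ⊆ u^⊥`, where `z^{u₀}` is a coordinate on `D_σ`, and not at all otherwise, where `z^{u₀}` or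
its inverse vanishes on `D_σ` (`intersectionNumber_subtorusClosure`). So the cones carrying initial
walls are exactly those that contain the ray and lie in the hyperplane.
-/


noncomputable section

universe u v w x

set_option linter.unusedSectionVars false

namespace HDTV

/-! ### Power series and the Euler derivation -/

section Series

open Finset

variable {J : Type*} {R : Type*}

/-- Two power series agree in all degrees `< d`. -/
def EqBelow [Semiring R] (d : ℕ) (f g : MvPowerSeries J R) : Prop :=
  ∀ β : J →₀ ℕ, β.degree < d → MvPowerSeries.coeff β f = MvPowerSeries.coeff β g

namespace EqBelow

variable [Semiring R] {d : ℕ} {f g h f' g' : MvPowerSeries J R}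

theorem refl (d : ℕ) (f : MvPowerSeries J R) : EqBelow d f f := fun _ _ => rfl

theorem symm (h : EqBelow d f g) : EqBelow d g f := fun β hβ => (h β hβ).symm

theorem trans (h₁ : EqBelow d f g) (h₂ : EqBelow d g h) : EqBelow d f h :=
  fun β hβ => (h₁ β hβ).trans (h₂ β hβ)

theorem mono {e : ℕ} (hed : e ≤ d) (h : EqBelow d f g) : EqBelow e f g :=
  fun β hβ => h β (hβ.trans_le hed)

theorem mul (h₁ : EqBelow d f g) (h₂ : EqBelow d f' g') : EqBelow d (f * f') (g * g') := by
  classical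
  intro β hβ
  rw [MvPowerSeries.coeff_mul, MvPowerSeries.coeff_mul]
  refine sum_congr rfl fun p hp => ?_
  have e := mem_antidiagonal.1 hp
  have e' : p.1.degree + p.2.degree = β.degree := by rw [← map_add, e]
  rw [h₁ _ (by omega), h₂ _ (by omega)]

theorem prod {R : Type*} [CommSemiring R] {α : Type*} {s : Finset α} {f g : α → MvPowerSeries J R}
    (h : ∀ i ∈ s, EqBelow d (f i) (g i)) : EqBelow d (∏ i ∈ s, f i) (∏ i ∈ s, g i) := by
  classical
  induction s using Finset.induction_on with
  | empty => exact refl _ _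
  | insert a s ha ih =>
    rw [prod_insert ha, prod_insert ha]
    exact (h a (by simp)).mul (ih fun i hi => h i (by simp [hi]))

theorem eq_of_forall (h : ∀ d, EqBelow d f g) : f = g :=
  MvPowerSeries.ext fun β => h (β.degree + 1) β (Nat.lt_succ_self _)

end EqBelow

theorem degree_antidiagonal {β : J →₀ ℕ} [DecidableEq J] {p : (J →₀ ℕ) × (J →₀ ℕ)}
    (hp : p ∈ antidiagonal β) : p.1.degree + p.2.degree = β.degree := by
  rw [← map_add, mem_antidiagonal.1 hp]

theorem coeff_mul_of_eqBelow_zero_left [Semiring R] {d : ℕ} {a b : MvPowerSeries J R}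
    (ha : EqBelow d a 0) {β : J →₀ ℕ} (hβ : β.degree = d) :
    MvPowerSeries.coeff β (a * b) = MvPowerSeries.coeff β a * MvPowerSeries.constantCoeff b := by
  classical
  rw [MvPowerSeries.coeff_mul, sum_eq_single (β, 0)]
  · simp
  · intro p hp hne
    have e := degree_antidiagonal hp
    rcases eq_or_ne p.2 0 with h0 | h0
    · have := mem_antidiagonal.1 hp
      rw [h0, add_zero] at this
      exact absurd (Prod.ext this h0) hne
    · have : p.2.degree ≠ 0 := by rwa [Ne, Finsupp.degree_eq_zero_iff]
      rw [ha _ (by omega), map_zero, zero_mul]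
  · intro hn
    simp at hn

theorem coeff_mul_of_eqBelow_zero_right [Semiring R] {d : ℕ} {a b : MvPowerSeries J R}
    (hb : EqBelow d b 0) {β : J →₀ ℕ} (hβ : β.degree = d) :
    MvPowerSeries.coeff β (a * b) = MvPowerSeries.constantCoeff a * MvPowerSeries.coeff β b := by
  classical
  rw [MvPowerSeries.coeff_mul, sum_eq_single (0, β)]
  · simp
  · intro p hp hne
    have e := degree_antidiagonal hp
    rcases eq_or_ne p.1 0 with h0 | h0
    · have := mem_antidiagonal.1 hp
      rw [h0, zero_add] at this
      exact absurd (Prod.ext h0 this) hne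
    · have : p.1.degree ≠ 0 := by rwa [Ne, Finsupp.degree_eq_zero_iff]
      rw [hb _ (by omega), map_zero, mul_zero]
  · intro hn
    simp at hn

/-- The coefficient of least degree at which `g` and `h` may differ is additive under products of
series with constant term `1`. -/
theorem EqBelow.coeff_mul_sub_coeff_mul [Ring R] {d : ℕ} {g h g' h' : MvPowerSeries J R}
    (hg : EqBelow d g g') (hh : EqBelow d h h')
    (hh0 : MvPowerSeries.constantCoeff h = 1) (hg'0 : MvPowerSeries.constantCoeff g' = 1)
    {β : J →₀ ℕ} (hβ : β.degree = d) :
    MvPowerSeries.coeff β (g * h) - MvPowerSeries.coeff β (g' * h') =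
      (MvPowerSeries.coeff β g - MvPowerSeries.coeff β g') +
      (MvPowerSeries.coeff β h - MvPowerSeries.coeff β h') := by
  have e : g * h - g' * h' = (g - g') * h + g' * (h - h') := by
    rw [sub_mul, mul_sub]; abel
  rw [← map_sub, e, map_add, coeff_mul_of_eqBelow_zero_left _ hβ,
    coeff_mul_of_eqBelow_zero_right _ hβ, hh0, hg'0, mul_one, one_mul, map_sub, map_sub]
  · intro γ hγ; rw [map_sub, hh γ hγ, sub_self, map_zero]
  · intro γ hγ; rw [map_sub, hg γ hγ, sub_self, map_zero]

/-- An operator whose value in each degree depends only on lower degrees has a fixed point. -/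
theorem exists_fixedPoint_of_causal {S : Type*} [Semiring S]
    (T : MvPowerSeries J S → MvPowerSeries J S)
    (hT : ∀ (u u' : MvPowerSeries J S) (β : J →₀ ℕ), EqBelow β.degree u u' →
      MvPowerSeries.coeff β (T u) = MvPowerSeries.coeff β (T u')) :
    ∃ u, T u = u := by
  -- the iterates of `0` stabilize: the terms of degree less than `n` are fixed from the `n`-th on
  let s : ℕ → MvPowerSeries J S := fun n => T^[n] 0
  have hs : ∀ n, s (n + 1) = T (s n) := fun n => Function.iterate_succ_apply' T n _
  have h1 : ∀ n, EqBelow n (s (n + 1)) (s n) := by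
    intro n
    induction n with
    | zero => intro β h; omega
    | succ n ih =>
      intro β h
      rw [hs (n + 1), hs n]
      exact hT _ _ _ ((hs n ▸ ih).mono (by omega))
  have h2 : ∀ n m, EqBelow n (s (n + m)) (s n) := by
    intro n m
    induction m with
    | zero => exact EqBelow.refl _ _
    | succ m ih => exact ((h1 (n + m)).mono (by omega)).trans ih
  let u : MvPowerSeries J S := fun β => MvPowerSeries.coeff β (s (β.degree + 1))
  have hu : ∀ β, MvPowerSeries.coeff β u = MvPowerSeries.coeff β (s (β.degree + 1)) := fun _ => rfl
  refine ⟨u, MvPowerSeries.ext fun β => ?_⟩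
  rw [hu, hs]
  refine hT _ _ _ fun γ hγ => ?_
  rw [hu]
  have := h2 (γ.degree + 1) (β.degree - (γ.degree + 1)) γ (Nat.lt_succ_self _)
  rw [Nat.add_sub_cancel' hγ] at this
  exact this.symm

/-- The Euler derivation `t^β ↦ |β| t^β`. -/
def euler [Semiring R] (f : MvPowerSeries J R) : MvPowerSeries J R :=
  fun β => (β.degree : R) * MvPowerSeries.coeff β f

section Euler

variable [Ring R]

theorem coeff_euler (f : MvPowerSeries J R) (β : J →₀ ℕ) :
    MvPowerSeries.coeff β (euler f) = (β.degree : R) * MvPowerSeries.coeff β f := rfl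

theorem euler_one : euler (1 : MvPowerSeries J R) = 0 := by
  classical
  refine MvPowerSeries.ext fun β => ?_
  rw [coeff_euler, MvPowerSeries.coeff_one]
  split_ifs with h <;> simp [h]

theorem euler_mul (f g : MvPowerSeries J R) : euler (f * g) = euler f * g + f * euler g := by
  classical
  refine MvPowerSeries.ext fun β => ?_
  rw [coeff_euler, map_add, MvPowerSeries.coeff_mul, MvPowerSeries.coeff_mul,
    MvPowerSeries.coeff_mul, mul_sum, ← sum_add_distrib]
  refine sum_congr rfl fun p hp => ?_
  rw [coeff_euler, coeff_euler, ← degree_antidiagonal hp, Nat.cast_add, add_mul, ← mul_assoc, ← mul_assoc, ← mul_assoc,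
    ← (Nat.cast_commute p.2.degree (MvPowerSeries.coeff p.1 f)).eq]

end Euler

/-! ### The equation `δ g = X g` -/

section Sol

variable [Ring R]

/-- The coefficients are determined recursively: as `X` has no constant term, the coefficient of
`X * g` in degree `β` involves only lower coefficients of `g`, and `|β|` is invertible for
`β ≠ 0`. -/
theorem exists_sol (k : Type*) [Field k] [CharZero k] [Algebra k R]
    (X : MvPowerSeries J R) (hX : MvPowerSeries.constantCoeff X = 0) :
    ∃ g : MvPowerSeries J R, MvPowerSeries.constantCoeff g = 1 ∧ euler g = X * g := by
  classical
  -- a fixed point of `T` is a solution, since the coefficient of `δ g` at `β` is `|β|` times that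
  -- of `g`
  let T : MvPowerSeries J R → MvPowerSeries J R := fun g β =>
    if β = 0 then 1 else (β.degree : k)⁻¹ • MvPowerSeries.coeff β (X * g)
  have hT : ∀ g β, MvPowerSeries.coeff β (T g) =
    if β = 0 then 1 else (β.degree : k)⁻¹ • MvPowerSeries.coeff β (X * g) := fun _ _ => rfl
  obtain ⟨g, hg⟩ := exists_fixedPoint_of_causal T (by
      intro g g' β h
      rw [hT, hT]
      split_ifs with h0
      · rfl
      congr 1
      rw [MvPowerSeries.coeff_mul, MvPowerSeries.coeff_mul]
      refine sum_congr rfl fun p hp => ?_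
      rcases eq_or_ne p.1 0 with h1 | h1
      · rw [h1, MvPowerSeries.coeff_zero_eq_constantCoeff_apply, hX, zero_mul, zero_mul]
      · have := degree_antidiagonal hp
        have h1' : p.1.degree ≠ 0 := by rwa [Ne, Finsupp.degree_eq_zero_iff]
        congr 1
        exact h _ (by omega))
  refine ⟨g, ?_, MvPowerSeries.ext fun β => ?_⟩
  · rw [← MvPowerSeries.coeff_zero_eq_constantCoeff_apply, ← hg, hT, if_pos rfl]
  · rw [coeff_euler]
    rcases eq_or_ne β 0 with h0 | h0
    · subst h0
      simp [hX]
    · have hd : (β.degree : k) ≠ 0 := by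
        rw [Nat.cast_ne_zero, Ne, Finsupp.degree_eq_zero_iff]; exact h0
      conv_lhs => rw [← hg, hT, if_neg h0]
      rw [show ((β.degree : R)) = algebraMap k R (β.degree : k) by simp, ← Algebra.smul_def,
        smul_smul, mul_inv_cancel₀ hd, one_smul]

/-- The solution with constant term `1` of `δ g = X g`, for `X` without constant term. -/
def sol (X : MvPowerSeries J R) : MvPowerSeries J R :=
  open Classical in
  if h : ∃ g : MvPowerSeries J R, MvPowerSeries.constantCoeff g = 1 ∧ euler g = X * g
    then h.choose else 1

@[simp]
theorem constantCoeff_sol (X : MvPowerSeries J R) :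
    MvPowerSeries.constantCoeff (sol X) = 1 := by
  unfold sol
  split_ifs with h
  · exact h.choose_spec.1
  · simp

theorem euler_sol (k : Type*) [Field k] [CharZero k] [Algebra k R]
    {X : MvPowerSeries J R} (hX : MvPowerSeries.constantCoeff X = 0) :
    euler (sol X) = X * sol X := by
  have h := exists_sol k X hX
  unfold sol
  rw [dif_pos h]
  exact h.choose_spec.2

theorem cast_mul_cancel (k : Type*) [Field k] [CharZero k] [Algebra k R] {n : ℕ} (hn : n ≠ 0)
    {a b : R} (h : (n : R) * a = n * b) : a = b := by
  have hd : (n : k) ≠ 0 := by rwa [Nat.cast_ne_zero]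
  rw [show ((n : R)) = algebraMap k R (n : k) by simp, ← Algebra.smul_def, ← Algebra.smul_def] at h
  exact smul_right_injective R hd h

/-- Comparison of `δ g = X g` and `δ g' = X' g'` in the lowest degree in which `X` and `X'`
may differ. -/
theorem EqBelow.euler_eq (k : Type*) [Field k] [CharZero k] [Algebra k R] {d : ℕ}
    {X X' g g' : MvPowerSeries J R} (hX : MvPowerSeries.constantCoeff X = 0)
    (hX' : MvPowerSeries.constantCoeff X' = 0)
    (hg0 : MvPowerSeries.constantCoeff g = 1) (hg0' : MvPowerSeries.constantCoeff g' = 1)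
    (hg : euler g = X * g) (hg' : euler g' = X' * g') (h : EqBelow d X X') :
    EqBelow d g g' ∧ ∀ β : J →₀ ℕ, β.degree = d →
      (d : R) * (MvPowerSeries.coeff β g - MvPowerSeries.coeff β g') =
        MvPowerSeries.coeff β X - MvPowerSeries.coeff β X' := by
  classical
  have step : ∀ e ≤ d, EqBelow e g g' → ∀ β : J →₀ ℕ, β.degree = e →
      (e : R) * (MvPowerSeries.coeff β g - MvPowerSeries.coeff β g') =
        MvPowerSeries.coeff β X - MvPowerSeries.coeff β X' := by
    intro e he hgg β hβ
    have e1 := congrArg (MvPowerSeries.coeff β) hg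
    have e2 := congrArg (MvPowerSeries.coeff β) hg'
    rw [coeff_euler, hβ] at e1 e2
    rw [mul_sub, e1, e2]
    have h0 : ∀ (Y u : MvPowerSeries J R), MvPowerSeries.constantCoeff u = 1 →
        MvPowerSeries.coeff β (Y * u) = MvPowerSeries.coeff β Y +
          ∑ p ∈ (antidiagonal β).erase (β, 0),
            MvPowerSeries.coeff p.1 Y * MvPowerSeries.coeff p.2 u := by
      intro Y u hu
      rw [MvPowerSeries.coeff_mul, ← Finset.add_sum_erase _ _
        (show (β, 0) ∈ antidiagonal β by simp)]
      simp [hu]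
    rw [h0 _ _ hg0, h0 _ _ hg0', sum_congr rfl (g := fun p =>
      MvPowerSeries.coeff p.1 X' * MvPowerSeries.coeff p.2 g')]
    · abel
    intro p hp
    rw [mem_erase] at hp
    have hd := degree_antidiagonal hp.2
    rcases eq_or_ne p.1 0 with h1 | h1
    · rw [h1, MvPowerSeries.coeff_zero_eq_constantCoeff_apply,
        MvPowerSeries.coeff_zero_eq_constantCoeff_apply, hX, hX', zero_mul, zero_mul]
    have h2 : p.2 ≠ 0 := fun h2 => by
      have := mem_antidiagonal.1 hp.2
      rw [h2, add_zero] at this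
      exact hp.1 (Prod.ext this h2)
    rw [Ne, ← Finsupp.degree_eq_zero_iff] at h1 h2
    rw [h _ (by omega), hgg _ (by omega)]
  have main : ∀ e ≤ d, EqBelow e g g' := by
    intro e
    induction e with
    | zero => exact fun _ β hβ => by omega
    | succ e ih =>
      intro he β hβ
      have ih' := ih (by omega)
      rcases Nat.lt_succ_iff_lt_or_eq.1 hβ with hlt | heq
      · exact ih' β hlt
      · rcases eq_or_ne e 0 with h0 | h0
        · have : β = 0 := by rw [← Finsupp.degree_eq_zero_iff]; omega
          subst this
          simp [hg0, hg0']
        · have := step e (by omega) ih' β heq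
          rw [h β (by omega), sub_self, mul_sub, sub_eq_zero] at this
          exact cast_mul_cancel k h0 this
  exact ⟨main d le_rfl, step d le_rfl (main d le_rfl)⟩

/-- The solution of `δ g = X g` with constant term `1` is unique. -/
theorem eq_sol (k : Type*) [Field k] [CharZero k] [Algebra k R] {X g : MvPowerSeries J R}
    (hX : MvPowerSeries.constantCoeff X = 0)
    (hg0 : MvPowerSeries.constantCoeff g = 1) (hg : euler g = X * g) : g = sol X :=
  EqBelow.eq_of_forall fun d => (EqBelow.euler_eq k (d := d) hX hX hg0 (constantCoeff_sol X) hg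
    (euler_sol k hX) (EqBelow.refl _ _)).1

theorem EqBelow.sol (k : Type*) [Field k] [CharZero k] [Algebra k R] {d : ℕ}
    {X X' : MvPowerSeries J R} (hX : MvPowerSeries.constantCoeff X = 0)
    (hX' : MvPowerSeries.constantCoeff X' = 0) (h : EqBelow d X X') :
    EqBelow d (sol X) (sol X') :=
  (EqBelow.euler_eq k hX hX' (constantCoeff_sol X) (constantCoeff_sol X') (euler_sol k hX)
    (euler_sol k hX') h).1

theorem EqBelow.coeff_sol_sub (k : Type*) [Field k] [CharZero k] [Algebra k R] {d : ℕ}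
    {X X' : MvPowerSeries J R} (hX : MvPowerSeries.constantCoeff X = 0)
    (hX' : MvPowerSeries.constantCoeff X' = 0) (h : EqBelow d X X') {β : J →₀ ℕ}
    (hβ : β.degree = d) :
    (d : R) * (MvPowerSeries.coeff β (HDTV.sol X) - MvPowerSeries.coeff β (HDTV.sol X')) =
      MvPowerSeries.coeff β X - MvPowerSeries.coeff β X' :=
  (EqBelow.euler_eq k hX hX' (constantCoeff_sol X) (constantCoeff_sol X') (euler_sol k hX)
    (euler_sol k hX') h).2 β hβ

/-- `X` is determined up to degree `d` by `sol X` up to degree `d`. -/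
theorem EqBelow.of_sol (k : Type*) [Field k] [CharZero k] [Algebra k R] {d : ℕ}
    {X X' : MvPowerSeries J R} (hX : MvPowerSeries.constantCoeff X = 0)
    (hX' : MvPowerSeries.constantCoeff X' = 0) (h : EqBelow d (HDTV.sol X) (HDTV.sol X')) :
    EqBelow d X X' := by
  induction d with
  | zero => intro β hβ; omega
  | succ d ih =>
    intro β hβ
    have ih' := ih (h.mono (by omega))
    rcases Nat.lt_succ_iff_lt_or_eq.1 hβ with hlt | heq
    · exact ih' β hlt
    · have := ih'.coeff_sol_sub k hX hX' heq
      rw [h β hβ, sub_self, mul_zero] at this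
      exact (sub_eq_zero.1 this.symm)

theorem coeff_sol_mem (k : Type*) [Field k] [CharZero k] [Algebra k R] {X : MvPowerSeries J R}
    (hX : MvPowerSeries.constantCoeff X = 0) (A : Subalgebra k R)
    (hA : ∀ β, MvPowerSeries.coeff β X ∈ A) (β : J →₀ ℕ) :
    MvPowerSeries.coeff β (sol X) ∈ A := by
  classical
  induction hd : β.degree using Nat.strong_induction_on generalizing β with
  | _ d ih =>
    rcases eq_or_ne β 0 with h0 | h0
    · subst h0
      simp [A.one_mem]
    · have hd0 : (d : k) ≠ 0 := by
        rw [Nat.cast_ne_zero, ← hd, Ne, Finsupp.degree_eq_zero_iff]; exact h0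
      have e := congrArg (MvPowerSeries.coeff β) (euler_sol k hX)
      rw [coeff_euler, hd, show ((d : R)) = algebraMap k R (d : k) by simp,
        ← Algebra.smul_def] at e
      have e' := congrArg (fun y => (d : k)⁻¹ • y) e
      simp only [smul_smul, inv_mul_cancel₀ hd0, one_smul] at e'
      rw [e', MvPowerSeries.coeff_mul]
      refine A.smul_mem (A.sum_mem fun p hp => ?_) _
      have := degree_antidiagonal hp
      rcases eq_or_ne p.1 0 with h1 | h1
      · rw [h1, MvPowerSeries.coeff_zero_eq_constantCoeff_apply, hX, zero_mul]
        exact A.zero_mem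
      · rw [Ne, ← Finsupp.degree_eq_zero_iff] at h1
        exact A.mul_mem (hA _) (ih _ (by omega) _ rfl)

theorem sol_zero (k : Type*) [Field k] [CharZero k] [Algebra k R] :
    sol (0 : MvPowerSeries J R) = 1 :=
  (eq_sol k (map_zero _) (map_one _) (by rw [euler_one, zero_mul])).symm

/-- The sum of coefficientwise commuting series goes to the product. -/
theorem sol_add (k : Type*) [Field k] [CharZero k] [Algebra k R] {X Y : MvPowerSeries J R}
    (hX : MvPowerSeries.constantCoeff X = 0) (hY : MvPowerSeries.constantCoeff Y = 0)
    (h : ∀ β γ, Commute (MvPowerSeries.coeff β X) (MvPowerSeries.coeff γ Y)) :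
    sol (X + Y) = sol X * sol Y := by
  classical
  refine (eq_sol k (by rw [map_add, hX, hY, add_zero]) (by simp) ?_).symm
  have hc : sol X * Y = Y * sol X := by
    refine MvPowerSeries.ext fun β => ?_
    rw [MvPowerSeries.coeff_mul, MvPowerSeries.coeff_mul]
    refine sum_nbij' Prod.swap Prod.swap (by simp [add_comm]) (by simp [add_comm]) (by simp)
      (by simp) fun p _ => ?_
    have := coeff_sol_mem k hX (Subalgebra.centralizer k {MvPowerSeries.coeff p.2 Y}) (fun γ => by
      rw [Subalgebra.mem_centralizer_iff]
      rintro _ rfl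
      exact (h γ p.2).symm) p.1
    rw [Subalgebra.mem_centralizer_iff] at this
    exact (this _ rfl).symm
  rw [euler_mul, euler_sol k hX, euler_sol k hY, ← mul_assoc (sol X), hc, add_mul, mul_assoc,
    mul_assoc]

/-- The logarithmic derivative `δ g · g⁻¹` of a series with constant term `1`. -/
def logder (g : MvPowerSeries J R) : MvPowerSeries J R :=
  euler g * MvPowerSeries.invOfUnit g 1

theorem constantCoeff_euler (g : MvPowerSeries J R) :
    MvPowerSeries.constantCoeff (euler g) = 0 := by
  rw [← MvPowerSeries.coeff_zero_eq_constantCoeff_apply, coeff_euler]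
  simp

@[simp]
theorem constantCoeff_logder (g : MvPowerSeries J R) :
    MvPowerSeries.constantCoeff (logder g) = 0 := by
  rw [logder, map_mul, constantCoeff_euler, zero_mul]

theorem euler_eq_logder_mul {g : MvPowerSeries J R} (hg : MvPowerSeries.constantCoeff g = 1) :
    euler g = logder g * g := by
  rw [logder, mul_assoc, MvPowerSeries.invOfUnit_mul g 1 (by simp [hg]), mul_one]

theorem logder_eq {g X : MvPowerSeries J R} (hg : MvPowerSeries.constantCoeff g = 1)
    (h : euler g = X * g) : logder g = X := by
  rw [logder, h, mul_assoc, MvPowerSeries.mul_invOfUnit g 1 (by simp [hg]), mul_one]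

theorem logder_sol (k : Type*) [Field k] [CharZero k] [Algebra k R] {X : MvPowerSeries J R}
    (hX : MvPowerSeries.constantCoeff X = 0) : logder (sol X) = X :=
  logder_eq (constantCoeff_sol X) (euler_sol k hX)

theorem sol_logder (k : Type*) [Field k] [CharZero k] [Algebra k R] {g : MvPowerSeries J R}
    (hg : MvPowerSeries.constantCoeff g = 1) : sol (logder g) = g :=
  (eq_sol k (constantCoeff_logder g) hg (euler_eq_logder_mul hg)).symm

end Sol

end Series

/-! ### Pronilpotent groups of graded Lie algebras -/

section Lie

open Finset

variable {J : Type*} {R : Type*} [Ring R]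

theorem euler_eq_neg_mul {g g' X : MvPowerSeries J R} (h : g' * g = 1) (h' : g * g' = 1)
    (hg : euler g = X * g) : euler g' = -(g' * X) := by
  have e : euler g' * g = -(g' * X) * g := by
    have := euler_mul g' g
    rw [h, euler_one, hg] at this
    rw [neg_mul, mul_assoc]
    exact eq_neg_of_add_eq_zero_left this.symm
  have := congrArg (· * g') e
  simpa only [mul_assoc, h', mul_one] using this

variable {k : Type*} [Field k] [CharZero k] [Algebra k R]

/-- `X` is a series without constant term whose coefficients lie in the family `V`. -/
def LieElt (V : (J →₀ ℕ) → Submodule k R) (X : MvPowerSeries J R) : Prop :=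
  MvPowerSeries.constantCoeff X = 0 ∧ ∀ β, MvPowerSeries.coeff β X ∈ V β

/-- The graded subspace `W` is normalized by the graded subspace `V`. -/
def Normalizes (V W : (J →₀ ℕ) → Submodule k R) : Prop :=
  ∀ β γ, ∀ a ∈ V β, ∀ b ∈ W γ, a * b - b * a ∈ W (β + γ)

/-- The conjugate of `Y` by `sol X`. -/
def conj (X Y : MvPowerSeries J R) : MvPowerSeries J R :=
  sol X * Y * MvPowerSeries.invOfUnit (sol X) 1

theorem sol_mul_inv (X : MvPowerSeries J R) : sol X * MvPowerSeries.invOfUnit (sol X) 1 = 1 :=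
  MvPowerSeries.mul_invOfUnit _ 1 (by simp)

theorem inv_mul_sol (X : MvPowerSeries J R) : MvPowerSeries.invOfUnit (sol X) 1 * sol X = 1 :=
  MvPowerSeries.invOfUnit_mul _ 1 (by simp)

theorem conj_add (X Y Z : MvPowerSeries J R) : conj X (Y + Z) = conj X Y + conj X Z := by
  rw [conj, conj, conj, mul_add, add_mul]

theorem constantCoeff_conj (X Y : MvPowerSeries J R) :
    MvPowerSeries.constantCoeff (conj X Y) = MvPowerSeries.constantCoeff Y := by
  simp [conj]

theorem coeff_conj_of_eqBelow_zero (X : MvPowerSeries J R) {Y : MvPowerSeries J R} {d : ℕ}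
    (hY : EqBelow d Y 0) {β : J →₀ ℕ} (hβ : β.degree = d) :
    MvPowerSeries.coeff β (conj X Y) = MvPowerSeries.coeff β Y := by
  have h1 : EqBelow d (sol X * Y) 0 := by simpa using (EqBelow.refl d (sol X)).mul hY
  rw [conj, coeff_mul_of_eqBelow_zero_left h1 hβ, coeff_mul_of_eqBelow_zero_right hY hβ]
  simp

/-- The part of `Y` of degree `d`. -/
def degreePart (d : ℕ) (Y : MvPowerSeries J R) : MvPowerSeries J R :=
  fun β => if β.degree = d then MvPowerSeries.coeff β Y else 0

theorem coeff_degreePart (d : ℕ) (Y : MvPowerSeries J R) (β : J →₀ ℕ) :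
    MvPowerSeries.coeff β (degreePart d Y) =
      if β.degree = d then MvPowerSeries.coeff β Y else 0 := rfl

theorem euler_degreePart (d : ℕ) (Y : MvPowerSeries J R) :
    euler (degreePart d Y) = (d : MvPowerSeries J R) * degreePart d Y := by
  refine MvPowerSeries.ext fun β => ?_
  rw [coeff_euler, ← nsmul_eq_mul (d), map_nsmul, nsmul_eq_mul, coeff_degreePart]
  split_ifs with h
  · rw [h]
  · simp

/-- For homogeneous `Y` of degree `d`, the conjugate `Z` satisfies `δ Z = [X, Z] + d Z`. Hence
`(|β| - d) Z_β` is a sum of brackets of coefficients of `X` with lower coefficients of `Z`, and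
vanishes for `|β| < d`, while `Z_β = Y_β` for `|β| = d`. -/
theorem coeff_conj_degreePart_mem {V W : (J →₀ ℕ) → Submodule k R} (hVW : Normalizes V W)
    {X Y : MvPowerSeries J R} (hX : LieElt V X) (hY : LieElt W Y) (d : ℕ) (β : J →₀ ℕ) :
    MvPowerSeries.coeff β (conj X (degreePart d Y)) ∈ W β := by
  classical
  set g := sol X with hg
  set g' := MvPowerSeries.invOfUnit (sol X) 1 with hg'
  set Z := conj X (degreePart d Y) with hZ
  have hlow : EqBelow d (degreePart d Y) 0 := fun γ hγ => by
    rw [coeff_degreePart, if_neg hγ.ne, map_zero]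
  have hode : euler Z = X * Z - Z * X + (d : MvPowerSeries J R) * Z := by
    have e1 : euler g = X * g := euler_sol k hX.1
    have e2 : euler g' = -(g' * X) := euler_eq_neg_mul (inv_mul_sol X) (sol_mul_inv X) e1
    have hc : g * (d : MvPowerSeries J R) = d * g := (Nat.cast_commute d g).symm.eq
    rw [hZ, conj, ← hg, ← hg', euler_mul, euler_mul, e1, e2, euler_degreePart,
      ← mul_assoc g (d : MvPowerSeries J R), hc]
    noncomm_ring
  induction hn : β.degree using Nat.strong_induction_on generalizing β with
  | _ n ih =>
    rcases lt_trichotomy n d with h | h | h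
    · have : EqBelow d Z 0 := by
        have := ((EqBelow.refl d g).mul hlow).mul (EqBelow.refl d g')
        rwa [mul_zero, zero_mul] at this
      rw [this β (by omega), map_zero]
      exact (W β).zero_mem
    · rw [hZ, coeff_conj_of_eqBelow_zero X hlow (by omega), coeff_degreePart]
      split_ifs
      · exact hY.2 β
      · exact (W β).zero_mem
    · have e := congrArg (MvPowerSeries.coeff β) hode
      rw [coeff_euler, map_add, ← nsmul_eq_mul (d), map_nsmul, nsmul_eq_mul, ← sub_eq_iff_eq_add,
        ← sub_mul, hn, ← Nat.cast_sub h.le,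
        show (((n - d : ℕ) : R)) = algebraMap k R ((n - d : ℕ) : k) by simp, ← Algebra.smul_def] at e
      have hne : ((n - d : ℕ) : k) ≠ 0 := by rw [Nat.cast_ne_zero]; omega
      rw [← Submodule.smul_mem_iff _ hne, e, map_sub, MvPowerSeries.coeff_mul,
        MvPowerSeries.coeff_mul]
      have hswap : ∑ p ∈ antidiagonal β, MvPowerSeries.coeff p.1 Z * MvPowerSeries.coeff p.2 X =
          ∑ p ∈ antidiagonal β, MvPowerSeries.coeff p.2 Z * MvPowerSeries.coeff p.1 X :=
        sum_nbij' Prod.swap Prod.swap (by simp [add_comm]) (by simp [add_comm]) (by simp)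
          (by simp) fun p _ => rfl
      rw [hswap, ← sum_sub_distrib]
      refine (W β).sum_mem fun p hp => ?_
      have := degree_antidiagonal hp
      rcases eq_or_ne p.1 0 with h1 | h1
      · rw [h1, MvPowerSeries.coeff_zero_eq_constantCoeff_apply, hX.1, zero_mul, mul_zero, sub_zero]
        exact (W β).zero_mem
      · rw [Ne, ← Finsupp.degree_eq_zero_iff] at h1
        rw [← mem_antidiagonal.1 hp]
        exact hVW _ _ _ (hX.2 _) _ (ih _ (by omega) _ rfl)

/-- Conjugation by the group of `V` preserves what is normalized by `V`. -/
theorem LieElt.conj {V W : (J →₀ ℕ) → Submodule k R} (hVW : Normalizes V W)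
    {X Y : MvPowerSeries J R} (hX : LieElt V X) (hY : LieElt W Y) : LieElt W (conj X Y) := by
  classical
  refine ⟨by rw [constantCoeff_conj, hY.1], fun β => ?_⟩
  have h : ∀ n, EqBelow n (∑ d ∈ range n, degreePart d Y) Y := by
    intro n γ hγ
    rw [map_sum, sum_congr rfl fun d _ => coeff_degreePart d Y γ, sum_ite_eq, if_pos (by simpa)]
  have h2 : ∀ n, EqBelow n (HDTV.conj X (∑ d ∈ range n, degreePart d Y)) (HDTV.conj X Y) :=
    fun n => ((EqBelow.refl _ _).mul (h n)).mul (EqBelow.refl _ _)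
  rw [← h2 (β.degree + 1) β (Nat.lt_succ_self _)]
  have h3 : HDTV.conj X (∑ d ∈ range (β.degree + 1), degreePart d Y) =
      ∑ d ∈ range (β.degree + 1), HDTV.conj X (degreePart d Y) := by
    rw [HDTV.conj, mul_sum, sum_mul]
    rfl
  rw [h3, map_sum]
  exact (W β).sum_mem fun d _ => coeff_conj_degreePart_mem hVW hX hY d β

theorem LieElt.add {V : (J →₀ ℕ) → Submodule k R} {X Y : MvPowerSeries J R}
    (hX : LieElt V X) (hY : LieElt V Y) : LieElt V (X + Y) :=
  ⟨by rw [map_add, hX.1, hY.1, add_zero], fun β => by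
    rw [map_add]; exact (V β).add_mem (hX.2 β) (hY.2 β)⟩

theorem logder_sol_mul_sol (k : Type*) [Field k] [CharZero k] [Algebra k R]
    {X Y : MvPowerSeries J R} (hX : MvPowerSeries.constantCoeff X = 0)
    (hY : MvPowerSeries.constantCoeff Y = 0) :
    logder (sol X * sol Y) = X + conj X Y := by
  refine logder_eq (by simp) ?_
  rw [euler_mul, euler_sol k hX, euler_sol k hY, add_mul, mul_assoc X, conj]
  congr 1
  calc sol X * (Y * sol Y) = sol X * Y * (1 * sol Y) := by rw [one_mul, mul_assoc]
    _ = _ := by rw [← inv_mul_sol X]; simp only [mul_assoc]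

theorem LieElt.logder_mul {V : (J →₀ ℕ) → Submodule k R} (hV : Normalizes V V)
    {X Y : MvPowerSeries J R} (hX : LieElt V X) (hY : LieElt V Y) :
    LieElt V (logder (sol X * sol Y)) := by
  rw [logder_sol_mul_sol k hX.1 hY.1]
  exact hX.add (hX.conj hV hY)

open Classical in
/-- The part of `X` in the nonzero degrees belonging to `S`. -/
def restr (S : Set (J →₀ ℕ)) (X : MvPowerSeries J R) : MvPowerSeries J R :=
  fun β => if β ≠ 0 ∧ β ∈ S then MvPowerSeries.coeff β X else 0

open Classical in
theorem coeff_restr (S : Set (J →₀ ℕ)) (X : MvPowerSeries J R) (β : J →₀ ℕ) :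
    MvPowerSeries.coeff β (restr S X) =
      if β ≠ 0 ∧ β ∈ S then MvPowerSeries.coeff β X else 0 := rfl

@[simp]
theorem constantCoeff_restr (S : Set (J →₀ ℕ)) (X : MvPowerSeries J R) :
    MvPowerSeries.constantCoeff (restr S X) = 0 := by
  rw [← MvPowerSeries.coeff_zero_eq_constantCoeff_apply, coeff_restr, if_neg (by simp)]

open Classical in
/-- The graded subspace that agrees with `V` in the degrees belonging to `S` and is zero in the
others. -/
def restrFamily (V : (J →₀ ℕ) → Submodule k R) (S : Set (J →₀ ℕ)) (β : J →₀ ℕ) : Submodule k R :=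
  if β ∈ S then V β else ⊥

theorem LieElt.restr {V : (J →₀ ℕ) → Submodule k R} {X : MvPowerSeries J R} (hX : LieElt V X)
    (S : Set (J →₀ ℕ)) : LieElt (restrFamily V S) (restr S X) := by
  refine ⟨constantCoeff_restr S X, fun β => ?_⟩
  rw [coeff_restr, restrFamily]
  by_cases h : β ∈ S
  · rw [if_pos h]
    split_ifs
    exacts [hX.2 β, Submodule.zero_mem _]
  · rw [if_neg h, if_neg fun h' => h h'.2]
    exact Submodule.zero_mem _

theorem LieElt.mono {V W : (J →₀ ℕ) → Submodule k R} {X : MvPowerSeries J R} (hX : LieElt V X)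
    (h : ∀ β, V β ≤ W β) : LieElt W X := ⟨hX.1, fun β => h β (hX.2 β)⟩

theorem restrFamily_le (V : (J →₀ ℕ) → Submodule k R) (S : Set (J →₀ ℕ)) (β : J →₀ ℕ) :
    restrFamily V S β ≤ V β := by
  rw [restrFamily]
  split_ifs
  exacts [le_rfl, bot_le]

theorem LieElt.coeff_eq_zero {V : (J →₀ ℕ) → Submodule k R} {S : Set (J →₀ ℕ)}
    {X : MvPowerSeries J R} (hX : LieElt (restrFamily V S) X) {β : J →₀ ℕ} (hβ : β ∉ S) :
    MvPowerSeries.coeff β X = 0 := by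
  have := hX.2 β
  rwa [restrFamily, if_neg hβ, Submodule.mem_bot] at this

theorem Normalizes.restr {V : (J →₀ ℕ) → Submodule k R} (hV : Normalizes V V)
    {S : Set (J →₀ ℕ)} (hS : ∀ β ∈ S, ∀ γ ∈ S, β + γ ∈ S) :
    Normalizes (restrFamily V S) (restrFamily V S) := by
  intro β γ a ha b hb
  rw [restrFamily] at ha hb
  split_ifs at ha with h1
  · split_ifs at hb with h2
    · rw [restrFamily, if_pos (hS _ h1 _ h2)]
      exact hV _ _ _ ha _ hb
    · rw [(Submodule.mem_bot k).1 hb, mul_zero, zero_mul, sub_zero]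
      exact Submodule.zero_mem _
  · rw [(Submodule.mem_bot k).1 ha, mul_zero, zero_mul, sub_zero]
    exact Submodule.zero_mem _

/-! ### Factorization according to a sign of the degree -/

/-- The degrees on which `h` is positive, zero, or negative, according to `s`. -/
def signSet (h : (J →₀ ℕ) →+ ℝ) (s : SignType) : Set (J →₀ ℕ) := {β | SignType.sign (h β) = s}

theorem signSet_add (h : (J →₀ ℕ) →+ ℝ) (s : SignType) :
    ∀ β ∈ signSet h s, ∀ γ ∈ signSet h s, β + γ ∈ signSet h s := by
  intro β hβ γ hγ
  simp only [signSet, Set.mem_ofPred_eq, map_add] at *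
  cases s
  · simp only [SignType.zero_eq_zero, sign_eq_zero_iff] at *
    rw [hβ, hγ, add_zero]
  · simp only [SignType.neg_eq_neg_one, sign_eq_neg_one_iff] at *
    linarith
  · simp only [SignType.pos_eq_one, sign_eq_one_iff] at *
    linarith

/-- The product of the group elements of the positive, the zero and the negative part of `X`. -/
def signProd (h : (J →₀ ℕ) →+ ℝ) (X : MvPowerSeries J R) : MvPowerSeries J R :=
  sol (restr (signSet h 1) X) * sol (restr (signSet h 0) X) * sol (restr (signSet h (-1)) X)

@[simp]
theorem constantCoeff_signProd (h : (J →₀ ℕ) →+ ℝ) (X : MvPowerSeries J R) :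
    MvPowerSeries.constantCoeff (signProd h X) = 1 := by
  simp [signProd]

theorem EqBelow.restr {d : ℕ} {X X' : MvPowerSeries J R} (e : EqBelow d X X')
    (S : Set (J →₀ ℕ)) : EqBelow d (restr S X) (restr S X') := fun β hβ => by
  rw [coeff_restr, coeff_restr, e β hβ]

theorem EqBelow.signProd (k : Type*) [Field k] [CharZero k] [Algebra k R] {d : ℕ}
    {X X' : MvPowerSeries J R} (e : EqBelow d X X') (h : (J →₀ ℕ) →+ ℝ) :
    EqBelow d (signProd h X) (signProd h X') := by
  have key : ∀ s, EqBelow d (HDTV.sol (HDTV.restr (signSet h s) X))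
      (HDTV.sol (HDTV.restr (signSet h s) X')) :=
    fun s => (e.restr _).sol k (by simp) (by simp)
  exact ((key 1).mul (key 0)).mul (key (-1))

theorem restr_sign_sum (h : (J →₀ ℕ) →+ ℝ) {X : MvPowerSeries J R} {β : J →₀ ℕ} (hβ : β ≠ 0) :
    MvPowerSeries.coeff β (restr (signSet h 1) X) + MvPowerSeries.coeff β (restr (signSet h 0) X) +
      MvPowerSeries.coeff β (restr (signSet h (-1)) X) = MvPowerSeries.coeff β X := by
  simp only [coeff_restr, signSet, Set.mem_ofPred_eq, hβ, ne_eq, not_false_eq_true, true_and]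
  rcases lt_trichotomy (h β) 0 with h1 | h1 | h1 <;> simp [h1]

/-- In leading degree the three factors contribute additively. -/
theorem EqBelow.coeff_signProd_sub (k : Type*) [Field k] [CharZero k] [Algebra k R] {d : ℕ}
    {X X' : MvPowerSeries J R} (e : EqBelow d X X') (h : (J →₀ ℕ) →+ ℝ) {β : J →₀ ℕ}
    (hβ : β.degree = d) (hβ0 : β ≠ 0) :
    (d : R) * (MvPowerSeries.coeff β (HDTV.signProd h X) -
      MvPowerSeries.coeff β (HDTV.signProd h X')) =
      MvPowerSeries.coeff β X - MvPowerSeries.coeff β X' := by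
  have key : ∀ s, EqBelow d (HDTV.sol (HDTV.restr (signSet h s) X))
      (HDTV.sol (HDTV.restr (signSet h s) X')) :=
    fun s => (e.restr _).sol k (by simp) (by simp)
  have key2 : ∀ s, _ := fun s =>
    (e.restr (signSet h s)).coeff_sol_sub k (by simp) (by simp) hβ
  rw [HDTV.signProd, HDTV.signProd, ((key 1).mul (key 0)).coeff_mul_sub_coeff_mul (key (-1))
    (by simp) (by simp) hβ, (key 1).coeff_mul_sub_coeff_mul (key 0) (by simp) (by simp) hβ,
    mul_add, mul_add, key2, key2, key2, ← restr_sign_sum h hβ0 (X := X),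
    ← restr_sign_sum h hβ0 (X := X')]
  abel

/-- Uniqueness of the factorization. -/
theorem EqBelow.of_signProd (k : Type*) [Field k] [CharZero k] [Algebra k R] {d : ℕ}
    {X X' : MvPowerSeries J R} (hX : MvPowerSeries.constantCoeff X = 0)
    (hX' : MvPowerSeries.constantCoeff X' = 0) (h : (J →₀ ℕ) →+ ℝ)
    (e : EqBelow d (HDTV.signProd h X) (HDTV.signProd h X')) : EqBelow d X X' := by
  induction d with
  | zero => intro β hβ; omega
  | succ d ih =>
    intro β hβ
    have ih' := ih (e.mono (by omega))
    rcases Nat.lt_succ_iff_lt_or_eq.1 hβ with hlt | heq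
    · exact ih' β hlt
    · rcases eq_or_ne β 0 with h0 | h0
      · subst h0
        rw [MvPowerSeries.coeff_zero_eq_constantCoeff_apply,
          MvPowerSeries.coeff_zero_eq_constantCoeff_apply, hX, hX']
      · have := ih'.coeff_signProd_sub k h heq h0
        rw [e β hβ, sub_self, mul_zero] at this
        exact (sub_eq_zero.1 this.symm)

/-- The product belongs to the group of `V`. -/
theorem LieElt.logder_signProd {V : (J →₀ ℕ) → Submodule k R} (hV : Normalizes V V)
    {X : MvPowerSeries J R} (hX : LieElt V X) (h : (J →₀ ℕ) →+ ℝ) :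
    LieElt V (logder (signProd h X)) := by
  have key : ∀ s, LieElt V (HDTV.restr (signSet h s) X) := fun s =>
    (hX.restr _).mono (restrFamily_le V _)
  have h1 := (key 1).logder_mul hV (key 0)
  have h2 := h1.logder_mul hV (key (-1))
  rwa [sol_logder k (by simp)] at h2

/-- Existence of the factorization. -/
theorem exists_signProd_eq {V : (J →₀ ℕ) → Submodule k R} (hV : Normalizes V V)
    (h : (J →₀ ℕ) →+ ℝ) {X : MvPowerSeries J R} (hX : LieElt V X) :
    ∃ Y, LieElt V Y ∧ signProd h Y = sol X := by
  classical
  -- correct `Y` by the error in its logarithmic derivative; in leading degree that derivative is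
  -- `Y` itself, so that the correction is determined by lower degrees
  let T : MvPowerSeries J R → MvPowerSeries J R := fun Y β =>
    if β = 0 then 0 else MvPowerSeries.coeff β Y +
      (MvPowerSeries.coeff β X - MvPowerSeries.coeff β (logder (signProd h Y)))
  have hT : ∀ Y β, MvPowerSeries.coeff β (T Y) = if β = 0 then 0 else MvPowerSeries.coeff β Y +
      (MvPowerSeries.coeff β X - MvPowerSeries.coeff β (logder (signProd h Y))) := fun _ _ => rfl
  -- a change of `Y` shows unaltered in the leading degree of the logarithmic derivative
  have lead : ∀ (Y Y' : MvPowerSeries J R) (β : J →₀ ℕ), β ≠ 0 → EqBelow β.degree Y Y' →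
      MvPowerSeries.coeff β (logder (signProd h Y)) -
        MvPowerSeries.coeff β (logder (signProd h Y')) =
      MvPowerSeries.coeff β Y - MvPowerSeries.coeff β Y' := by
    intro Y Y' β h0 e
    rw [← e.coeff_signProd_sub k h rfl h0]
    have e1 : EqBelow β.degree (sol (logder (signProd h Y))) (sol (logder (signProd h Y'))) := by
      rw [sol_logder k (by simp), sol_logder k (by simp)]
      exact e.signProd k h
    have e2 := EqBelow.of_sol k (by simp) (by simp) e1
    rw [← e2.coeff_sol_sub k (by simp) (by simp) rfl, sol_logder k (by simp),
      sol_logder k (by simp)]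
  obtain ⟨Y, hY⟩ := exists_fixedPoint_of_causal T (by
    intro Y Y' β e
    rw [hT, hT]
    split_ifs with h0
    · rfl
    have := lead Y Y' β h0 e
    rw [sub_eq_sub_iff_add_eq_add] at this
    rw [← sub_eq_zero]
    have e3 : MvPowerSeries.coeff β Y - MvPowerSeries.coeff β (logder (signProd h Y)) =
        MvPowerSeries.coeff β Y' - MvPowerSeries.coeff β (logder (signProd h Y')) := by
      rw [sub_eq_sub_iff_add_eq_add, ← this]; abel
    rw [show ∀ a b c d e : R, a + (b - c) - (d + (b - e)) = (a - c) - (d - e) by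
      intros; abel, e3, sub_self])
  have hlog : logder (signProd h Y) = X := by
    refine MvPowerSeries.ext fun β => ?_
    rcases eq_or_ne β 0 with h0 | h0
    · subst h0
      simp [hX.1]
    · have := hT Y β
      rw [hY, if_neg h0, left_eq_add, sub_eq_zero] at this
      exact this.symm
  refine ⟨Y, ⟨?_, fun β => ?_⟩, ?_⟩
  · rw [← MvPowerSeries.coeff_zero_eq_constantCoeff_apply, ← hY, hT, if_pos rfl]
  · induction hd : β.degree using Nat.strong_induction_on generalizing β with
    | _ d ih =>
      -- the truncation of `Y` below degree `|β|` lies in `V` by induction, hence so does its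
      -- logarithmic derivative, and `Y_β` is the difference between `X_β` and the coefficient of
      -- the latter
      rcases eq_or_ne β 0 with h0 | h0
      · subst h0
        rw [← hY, hT, if_pos rfl]
        exact Submodule.zero_mem _
      · set Y' := restr {γ | γ.degree < d} Y with hY'
        have hL : LieElt V Y' := by
          refine ⟨by simp [hY'], fun γ => ?_⟩
          rw [hY', coeff_restr]
          split_ifs with hγ
          · exact ih _ hγ.2 γ rfl
          · exact Submodule.zero_mem _
        have e : EqBelow β.degree Y Y' := by
          intro γ hγ
          rw [hY', coeff_restr]
          split_ifs with h'
          · rfl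
          · have : γ = 0 := by
              by_contra h0'
              exact h' ⟨h0', by rw [Set.mem_ofPred_eq]; omega⟩
            rw [this, ← hY, hT, if_pos rfl]
        have := lead Y Y' β h0 e
        rw [hlog] at this
        have e0 : MvPowerSeries.coeff β Y' = 0 := by
          rw [hY', coeff_restr, if_neg]
          rintro ⟨-, h'⟩
          rw [Set.mem_ofPred_eq] at h'
          omega
        rw [e0, sub_zero] at this
        rw [← this]
        exact Submodule.sub_mem _ (hX.2 β) ((hL.logder_signProd hV h).2 β)
  · rw [← sol_logder k (constantCoeff_signProd h Y), hlog]

theorem restr_of_support {S : Set (J →₀ ℕ)} {X : MvPowerSeries J R}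
    (h0 : MvPowerSeries.constantCoeff X = 0)
    (hX : ∀ β, β ∉ S → MvPowerSeries.coeff β X = 0) : restr S X = X := by
  refine MvPowerSeries.ext fun β => ?_
  rw [coeff_restr]
  split_ifs with h
  · rfl
  · rcases eq_or_ne β 0 with h1 | h1
    · rw [h1, MvPowerSeries.coeff_zero_eq_constantCoeff_apply, h0]
    · exact (hX β fun h' => h ⟨h1, h'⟩).symm

theorem restr_add (S : Set (J →₀ ℕ)) (X Y : MvPowerSeries J R) :
    restr S (X + Y) = restr S X + restr S Y := by
  refine MvPowerSeries.ext fun β => ?_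
  rw [map_add, coeff_restr, coeff_restr, coeff_restr]
  split_ifs <;> simp

theorem restr_eq_zero {S : Set (J →₀ ℕ)} {X : MvPowerSeries J R}
    (hX : ∀ β ∈ S, MvPowerSeries.coeff β X = 0) : restr S X = 0 := by
  refine MvPowerSeries.ext fun β => ?_
  rw [coeff_restr]
  split_ifs with h
  exacts [hX β h.2, rfl]

theorem LieElt.restr_signSet {V : (J →₀ ℕ) → Submodule k R} {h : (J →₀ ℕ) →+ ℝ}
    {s s' : SignType} {X : MvPowerSeries J R} (hX : LieElt (restrFamily V (signSet h s)) X) :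
    HDTV.restr (signSet h s') X = if s = s' then X else 0 := by
  split_ifs with e
  · subst e
    exact restr_of_support hX.1 fun β hβ => hX.coeff_eq_zero hβ
  · refine restr_eq_zero fun β hβ => hX.coeff_eq_zero fun h' => e ?_
    exact h'.symm.trans hβ

theorem signProd_add {V : (J →₀ ℕ) → Submodule k R} (h : (J →₀ ℕ) →+ ℝ)
    {A B C : MvPowerSeries J R} (hA : LieElt (restrFamily V (signSet h 1)) A)
    (hB : LieElt (restrFamily V (signSet h 0)) B)
    (hC : LieElt (restrFamily V (signSet h (-1))) C) :
    signProd h (A + B + C) = sol A * sol B * sol C := by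
  simp [signProd, restr_add, hA.restr_signSet, hB.restr_signSet, hC.restr_signSet]

/-- Let the signs of `h` refine those of `h₀` below degree `r`. Then the factorization of `sol X`
according to `h` is obtained from the factorization according to `h₀` by factoring the middle
term according to `h`. -/
theorem signProd_refine {V : (J →₀ ℕ) → Submodule k R} (hV : Normalizes V V)
    {h₀ h : (J →₀ ℕ) →+ ℝ} {r : ℕ}
    (hpos : ∀ β : J →₀ ℕ, β.degree < r → 0 < h₀ β → 0 < h β)
    (hneg : ∀ β : J →₀ ℕ, β.degree < r → h₀ β < 0 → h β < 0)
    {p s q : MvPowerSeries J R} (hp : LieElt V p) (hs : LieElt V s) (hq : LieElt V q)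
    (hsp : signProd h s = sol (restr (signSet h₀ 0) p)) (hqp : signProd h q = signProd h₀ p) :
    EqBelow r (restr (signSet h 0) q) (restr (signSet h 0) s) ∧
    EqBelow r (sol (restr (signSet h (-1)) q))
      (sol (restr (signSet h (-1)) s) * sol (restr (signSet h₀ (-1)) p)) := by
  -- truncated below degree `r`, the outer factors for `h₀` have coefficients only where `h` has the
  -- respective sign, so that they can be merged with the outer factors of the middle term
  set p1 := restr (signSet h 1) (restr {β | β.degree < r} (restr (signSet h₀ 1) p)) with hp1
  set p2 := restr (signSet h (-1)) (restr {β | β.degree < r} (restr (signSet h₀ (-1)) p)) with hp2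
  have cut : ∀ σ, (∀ β : J →₀ ℕ, β.degree < r → β ∈ signSet h₀ σ → β ∈ signSet h σ) →
      EqBelow r (restr (signSet h₀ σ) p)
        (restr (signSet h σ) (restr {β | β.degree < r} (restr (signSet h₀ σ) p))) := by
    intro σ hσ β hβ
    simp only [coeff_restr, Set.mem_ofPred_eq]
    have := hσ β hβ
    split_ifs <;> tauto
  have e1 : EqBelow r (restr (signSet h₀ 1) p) p1 := cut 1 fun β hβ h1 => by
    simp only [signSet, Set.mem_ofPred_eq, sign_eq_one_iff] at h1 ⊢
    exact hpos β hβ h1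
  have e2 : EqBelow r (restr (signSet h₀ (-1)) p) p2 := cut (-1) fun β hβ h1 => by
    simp only [signSet, Set.mem_ofPred_eq, sign_eq_neg_one_iff] at h1 ⊢
    exact hneg β hβ h1
  have sub : ∀ (S : Set (J →₀ ℕ)) {Y : MvPowerSeries J R}, LieElt V Y → LieElt V (restr S Y) :=
    fun S Y hY => (hY.restr S).mono (restrFamily_le V S)
  have L1 : LieElt (restrFamily V (signSet h 1)) p1 := (sub _ (sub _ hp)).restr _
  have L2 : LieElt (restrFamily V (signSet h (-1))) p2 := (sub _ (sub _ hp)).restr _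
  have N : ∀ σ, Normalizes (restrFamily V (signSet h σ)) (restrFamily V (signSet h σ)) :=
    fun σ => hV.restr (signSet_add h σ)
  have LA := L1.logder_mul (N 1) (hs.restr (signSet h 1))
  have LC := (hs.restr (signSet h (-1))).logder_mul (N (-1)) L2
  set A := logder (sol p1 * sol (restr (signSet h 1) s)) with hA
  set C := logder (sol (restr (signSet h (-1)) s) * sol p2) with hC
  set B := restr (signSet h 0) s with hB
  have LB : LieElt (restrFamily V (signSet h 0)) B := hs.restr (signSet h 0)
  have sA : sol A = sol p1 * sol (restr (signSet h 1) s) := sol_logder k (by simp)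
  have sC : sol C = sol (restr (signSet h (-1)) s) * sol p2 := sol_logder k (by simp)
  have e : EqBelow r (signProd h q) (signProd h (A + B + C)) := by
    rw [signProd_add h LA LB LC, hqp, sA, sC]
    have e3 : signProd h₀ p = sol (restr (signSet h₀ 1) p) * signProd h s *
        sol (restr (signSet h₀ (-1)) p) := by rw [hsp, signProd]
    rw [e3, signProd]
    have E1 := e1.sol k (by simp) L1.1
    have E2 := e2.sol k (by simp) L2.1
    have := ((E1.mul (EqBelow.refl r (sol (restr (signSet h 1) s) * sol B *
      sol (restr (signSet h (-1)) s)))).mul E2)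
    simpa only [mul_assoc] using this
  -- uniqueness of the factorization identifies `q` with the merged factors
  have e' := EqBelow.of_signProd k hq.1 (by rw [map_add, map_add, LA.1, LB.1, LC.1]; simp) h e
  constructor
  · have := e'.restr (signSet h 0)
    simpa [restr_add, LA.restr_signSet, LB.restr_signSet, LC.restr_signSet] using this
  · have := (e'.restr (signSet h (-1))).sol k (by simp) (by simp)
    simp only [restr_add, LA.restr_signSet, LB.restr_signSet, LC.restr_signSet] at this
    simp only [show ((1 : SignType) = -1) = False by decide,
      show ((0 : SignType) = -1) = False by decide, if_false, zero_add, if_true] at this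
    refine this.trans ?_
    rw [sC]
    exact (EqBelow.refl _ _).mul (e2.symm.sol k L2.1 (by simp))

/-- If brackets landing in degree `β` vanish, conjugation does not change the coefficient of
degree `β`. -/
theorem coeff_conj_eq {V : (J →₀ ℕ) → Submodule k R} (hV : Normalizes V V) {β : J →₀ ℕ}
    (hβ : ∀ γ γ', γ + γ' = β → ∀ a ∈ V γ, ∀ b ∈ V γ', Commute a b)
    {X Y : MvPowerSeries J R} (hX : LieElt V X) (hY : LieElt V Y) :
    MvPowerSeries.coeff β (conj X Y) = MvPowerSeries.coeff β Y := by
  -- leaving out degree `β` the family is still normalized by `V`, since brackets landing there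
  -- vanish
  set W := restrFamily V {β}ᶜ with hW
  have hVW : Normalizes V W := by
    intro γ γ' a ha b hb
    rw [hW, restrFamily] at hb
    split_ifs at hb with h1
    · by_cases h2 : γ + γ' = β
      · rw [(hβ _ _ h2 a ha b hb).eq, sub_self]
        exact Submodule.zero_mem _
      · rw [hW, restrFamily, if_pos (by simpa using h2)]
        exact hV _ _ _ ha _ hb
    · rw [(Submodule.mem_bot k).1 hb, mul_zero, zero_mul, sub_zero]
      exact Submodule.zero_mem _
  rcases eq_or_ne β 0 with h0 | h0
  · subst h0
    rw [MvPowerSeries.coeff_zero_eq_constantCoeff_apply, constantCoeff_conj,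
      MvPowerSeries.coeff_zero_eq_constantCoeff_apply]
  -- split off the coefficient of degree `β`, whose conjugate has it as leading term
  have hsum : Y = restr {β} Y + restr {β}ᶜ Y := by
    refine MvPowerSeries.ext fun γ => ?_
    rw [map_add, coeff_restr, coeff_restr]
    rcases eq_or_ne γ 0 with h1 | h1
    · subst h1
      simp [hY.1]
    · by_cases h2 : γ = β <;> simp [h1, h2]
      exact fun h3 => absurd h3 h0
  conv_lhs => rw [hsum]
  rw [conj_add, map_add, (hX.conj hVW (hY.restr _)).coeff_eq_zero (by simp), add_zero,
    coeff_conj_of_eqBelow_zero X _ rfl, coeff_restr, if_pos ⟨h0, rfl⟩]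
  intro γ hγ
  rw [coeff_restr, if_neg, map_zero]
  rintro ⟨-, h⟩
  rw [Set.mem_singleton_iff] at h
  rw [h] at hγ
  exact lt_irrefl _ hγ

/-- If brackets landing in degree `β` vanish, the coefficient of degree `β` is the same on both
sides of a factorization. -/
theorem coeff_eq_of_signProd_eq {V : (J →₀ ℕ) → Submodule k R} (hV : Normalizes V V)
    {β : J →₀ ℕ} (h0 : β ≠ 0)
    (hβ : ∀ γ γ', γ + γ' = β → ∀ a ∈ V γ, ∀ b ∈ V γ', Commute a b) (h : (J →₀ ℕ) →+ ℝ)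
    {X Y : MvPowerSeries J R} (hX : LieElt V X) (hY : LieElt V Y) (e : signProd h Y = sol X) :
    MvPowerSeries.coeff β X = MvPowerSeries.coeff β Y := by
  have key : ∀ s, LieElt V (restr (signSet h s) Y) := fun s =>
    (hY.restr _).mono (restrFamily_le V _)
  have h1 : ∀ {A B : MvPowerSeries J R}, LieElt V A → LieElt V B →
      MvPowerSeries.coeff β (logder (sol A * sol B)) =
        MvPowerSeries.coeff β A + MvPowerSeries.coeff β B := by
    intro A B hA hB
    rw [logder_sol_mul_sol k hA.1 hB.1, map_add, coeff_conj_eq hV hβ hA hB]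
  have h2 := h1 ((key 1).logder_mul hV (key 0)) (key (-1))
  rw [h1 (key 1) (key 0), restr_sign_sum h h0, sol_logder k (by simp)] at h2
  rw [← h2, ← signProd, e, logder_sol k hX.1]

/-- The factorization of a group element with commuting coefficients. -/
theorem signProd_eq_sol (k : Type*) [Field k] [CharZero k] [Algebra k R]
    {X : MvPowerSeries J R} (hX : MvPowerSeries.constantCoeff X = 0)
    (hc : ∀ β γ, Commute (MvPowerSeries.coeff β X) (MvPowerSeries.coeff γ X))
    (h : (J →₀ ℕ) →+ ℝ) : signProd h X = sol X := by
  have key : ∀ s β, MvPowerSeries.coeff β (restr (signSet h s) X) = 0 ∨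
      MvPowerSeries.coeff β (restr (signSet h s) X) = MvPowerSeries.coeff β X := by
    intro s β
    rw [coeff_restr]
    split_ifs <;> simp
  have comm : ∀ s s' β γ, Commute (MvPowerSeries.coeff β (restr (signSet h s) X))
      (MvPowerSeries.coeff γ (restr (signSet h s') X)) := by
    intro s s' β γ
    rcases key s β with e | e <;> rcases key s' γ with e' | e' <;> rw [e, e']
    all_goals first | exact hc _ _ | exact Commute.zero_left _ | exact Commute.zero_right _
  rw [signProd, ← sol_add k (by simp) (by simp) (comm _ _), ← sol_add k (by simp) (by simp)]
  · congr 1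
    refine MvPowerSeries.ext fun β => ?_
    rcases eq_or_ne β 0 with h1 | h1
    · subst h1
      simp [hX]
    · rw [map_add, map_add, restr_sign_sum h h1]
  · intro β γ
    rw [map_add]
    exact (comm _ _ _ _).add_left (comm _ _ _ _)

end Lie

/-! ### The operators on Laurent polynomials underlying wall-crossing automorphisms -/

section Operators

variable {ι : Type v} [Fintype ι] {k : Type u} [Field k] {J : Type w}

/-- The linear map on `k[L]` with prescribed values on the monomials. -/
def monomialMap {M : Type*} [AddCommMonoid M] [Module k M] (F : (ι → ℤ) → M) :
    AddMonoidAlgebra k (ι → ℤ) →ₗ[k] M :=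
  (Finsupp.linearCombination k F).comp (AddMonoidAlgebra.coeffLinearEquiv k).toLinearMap

theorem monomialMap_single {M : Type*} [AddCommMonoid M] [Module k M] (F : (ι → ℤ) → M)
    (a : ι → ℤ) (c : k) : monomialMap F (AddMonoidAlgebra.single a c) = c • F a := by
  simp [monomialMap, AddMonoidAlgebra.coeffLinearEquiv, AddMonoidAlgebra.coeff_single]

theorem laurent_linearMap_ext {M : Type*} [AddCommMonoid M] [Module k M]
    {φ ψ : AddMonoidAlgebra k (ι → ℤ) →ₗ[k] M}
    (h : ∀ a, φ (AddMonoidAlgebra.single a 1) = ψ (AddMonoidAlgebra.single a 1)) : φ = ψ := by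
  refine LinearMap.ext fun p => ?_
  induction p using AddMonoidAlgebra.induction_linear with
  | zero => simp
  | add p q hp hq => rw [map_add, map_add, hp, hq]
  | single a c =>
    have : AddMonoidAlgebra.single a c = c • AddMonoidAlgebra.single a (1 : k) := by simp
    rw [this, map_smul, map_smul, h]

/-- The derivation `z^a ↦ ⟨n, a⟩ z^a` of `k[L]`. -/
def dlog (n : ι → ℤ) : Module.End k (AddMonoidAlgebra k (ι → ℤ)) :=
  monomialMap fun a => AddMonoidAlgebra.single a ((n ⬝ᵥ a : ℤ) : k)

theorem dlog_single (n a : ι → ℤ) (c : k) :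
    dlog n (AddMonoidAlgebra.single a c) = ((n ⬝ᵥ a : ℤ) : k) • AddMonoidAlgebra.single a c := by
  rw [dlog, monomialMap_single]
  simp [mul_comm]

theorem coeff_dlog (n : ι → ℤ) (p : AddMonoidAlgebra k (ι → ℤ)) (a : ι → ℤ) :
    (dlog n p).coeff a = ((n ⬝ᵥ a : ℤ) : k) * p.coeff a := by
  classical
  induction p using AddMonoidAlgebra.induction_linear with
  | zero => simp
  | add p q hp hq =>
    rw [map_add, AddMonoidAlgebra.coeff_add, AddMonoidAlgebra.coeff_add, Finsupp.add_apply, hp, hq,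
      Finsupp.add_apply, mul_add]
  | single b c =>
    rw [dlog_single, AddMonoidAlgebra.coeff_smul_apply, AddMonoidAlgebra.coeff_single,
      Finsupp.single_apply, smul_eq_mul]
    split_ifs with h
    · rw [h]
    · simp

theorem dlog_mul (n : ι → ℤ) (p q : AddMonoidAlgebra k (ι → ℤ)) :
    dlog n (p * q) = dlog n p * q + p * dlog n q := by
  induction p using AddMonoidAlgebra.induction_linear with
  | zero => simp
  | add p p' hp hp' => rw [add_mul, map_add, hp, hp', map_add, add_mul, add_mul]; abel
  | single a c =>
    induction q using AddMonoidAlgebra.induction_linear with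
    | zero => simp
    | add q q' hq hq' => rw [mul_add, map_add, hq, hq', map_add, mul_add, mul_add]; abel
    | single b c' =>
      rw [AddMonoidAlgebra.single_mul_single, dlog_single, dlog_single, dlog_single, smul_mul_assoc,
        mul_smul_comm, AddMonoidAlgebra.single_mul_single, ← add_smul, dotProduct_add]
      push_cast
      rfl

/-- The Laurent polynomials whose exponents are orthogonal to `n`. -/
def dlogKer (n : ι → ℤ) : Subalgebra k (AddMonoidAlgebra k (ι → ℤ)) where
  carrier := {p | dlog n p = 0}
  mul_mem' {p q} hp hq := by
    rw [Set.mem_ofPred_eq] at *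
    rw [dlog_mul, hp, hq, zero_mul, mul_zero, add_zero]
  add_mem' {p q} hp hq := by
    rw [Set.mem_ofPred_eq] at *
    rw [map_add, hp, hq, add_zero]
  algebraMap_mem' c := by
    rw [Set.mem_ofPred_eq, Algebra.algebraMap_eq_smul_one, map_smul, AddMonoidAlgebra.one_def,
      dlog_single]
    simp

theorem mem_dlogKer {n : ι → ℤ} {p : AddMonoidAlgebra k (ι → ℤ)} :
    p ∈ dlogKer n ↔ dlog n p = 0 := Iff.rfl

theorem mem_dlogKer_of_coeff {n : ι → ℤ} {p : AddMonoidAlgebra k (ι → ℤ)}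
    (h : ∀ a, p.coeff a ≠ 0 → n ⬝ᵥ a = 0) : p ∈ dlogKer n := by
  rw [mem_dlogKer]
  ext a
  rw [coeff_dlog]
  by_cases ha : p.coeff a = 0
  · simp [ha]
  · simp [h a ha]

/-- The operator `z^a ↦ ⟨n, a⟩ ℓ z^a` with coefficients in `k[L]⟦ℕ^J⟧`. -/
def wallField (n : ι → ℤ) (l : ScatRing k ι J) :
    MvPowerSeries J (Module.End k (AddMonoidAlgebra k (ι → ℤ))) :=
  fun β => LinearMap.mulLeft k (MvPowerSeries.coeff β l) * dlog n

theorem coeff_wallField (n : ι → ℤ) (l : ScatRing k ι J) (β : J →₀ ℕ) :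
    MvPowerSeries.coeff β (wallField n l) =
      LinearMap.mulLeft k (MvPowerSeries.coeff β l) * dlog n := rfl

theorem coeff_wallField_apply (n : ι → ℤ) (l : ScatRing k ι J) (β : J →₀ ℕ)
    (p : AddMonoidAlgebra k (ι → ℤ)) :
    MvPowerSeries.coeff β (wallField n l) p = MvPowerSeries.coeff β l * dlog n p := rfl

theorem constantCoeff_wallField (n : ι → ℤ) {l : ScatRing k ι J}
    (hl : MvPowerSeries.constantCoeff l = 0) : MvPowerSeries.constantCoeff (wallField n l) = 0 := by
  rw [← MvPowerSeries.coeff_zero_eq_constantCoeff_apply] at hl ⊢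
  rw [coeff_wallField, hl]
  ext
  simp

theorem EqBelow.wallField {d : ℕ} {l l' : ScatRing k ι J} (h : EqBelow d l l') (n : ι → ℤ) :
    EqBelow d (wallField n l) (wallField n l') := fun β hβ => by
  rw [coeff_wallField, coeff_wallField, h β hβ]

/-- The wall-crossing automorphism attached to `f` and `n`, as a series of operators. -/
def crossing (f : ScatRing k ι J) (n : ι → ℤ) :
    MvPowerSeries J (Module.End k (AddMonoidAlgebra k (ι → ℤ))) :=
  fun β => monomialMap fun a =>
    MvPowerSeries.coeff β (intPow f (n ⬝ᵥ a)) * AddMonoidAlgebra.single a 1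

theorem coeff_crossing_single (f : ScatRing k ι J) (n : ι → ℤ) (β : J →₀ ℕ) (a : ι → ℤ) (c : k) :
    MvPowerSeries.coeff β (crossing f n) (AddMonoidAlgebra.single a c) =
      MvPowerSeries.coeff β (intPow f (n ⬝ᵥ a)) * AddMonoidAlgebra.single a c := by
  show monomialMap _ _ = _
  rw [monomialMap_single, ← mul_smul_comm]
  simp

/-- The action of a series of operators on `k[L]⟦ℕ^J⟧`. -/
def act (g : MvPowerSeries J (Module.End k (AddMonoidAlgebra k (ι → ℤ)))) (p : ScatRing k ι J) :
    ScatRing k ι J :=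
  open Classical in
  fun β => ∑ ab ∈ Finset.HasAntidiagonal.antidiagonal β,
    MvPowerSeries.coeff ab.1 g (MvPowerSeries.coeff ab.2 p)

open Classical in
theorem coeff_act (g : MvPowerSeries J (Module.End k (AddMonoidAlgebra k (ι → ℤ))))
    (p : ScatRing k ι J) (β : J →₀ ℕ) : MvPowerSeries.coeff β (act g p) =
      ∑ ab ∈ Finset.HasAntidiagonal.antidiagonal β,
        MvPowerSeries.coeff ab.1 g (MvPowerSeries.coeff ab.2 p) := rfl

theorem act_mul (g h : MvPowerSeries J (Module.End k (AddMonoidAlgebra k (ι → ℤ))))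
    (p : ScatRing k ι J) : act (g * h) p = act g (act h p) := by
  classical
  refine MvPowerSeries.ext fun β => ?_
  rw [coeff_act, coeff_act]
  simp only [coeff_act, map_sum, MvPowerSeries.coeff_mul, LinearMap.sum_apply, Module.End.mul_apply]
  rw [Finset.sum_sigma', Finset.sum_sigma']
  refine Finset.sum_nbij' (fun x => ⟨(x.2.1, x.2.2 + x.1.2), (x.2.2, x.1.2)⟩)
    (fun x => ⟨(x.1.1 + x.2.1, x.2.2), (x.1.1, x.2.1)⟩) ?_ ?_ ?_ ?_ ?_
  all_goals
    rintro ⟨⟨a, b⟩, ⟨c, d⟩⟩ h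
    simp only [Finset.mem_sigma, Finset.HasAntidiagonal.mem_antidiagonal] at h
    obtain ⟨h1, h2⟩ := h
    subst h1
    subst h2
    simp [add_assoc]

theorem act_one (p : ScatRing k ι J) :
    act (1 : MvPowerSeries J (Module.End k (AddMonoidAlgebra k (ι → ℤ)))) p = p := by
  classical
  refine MvPowerSeries.ext fun β => ?_
  rw [coeff_act, Finset.sum_eq_single (0, β)]
  · simp
  · rintro ⟨a, b⟩ hab hne
    rw [MvPowerSeries.coeff_one, if_neg]
    · simp
    · rintro (rfl : a = 0)
      rw [Finset.HasAntidiagonal.mem_antidiagonal, zero_add] at hab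
      exact hne (Prod.ext rfl hab)
  · intro hn
    simp at hn

theorem EqBelow.act {d : ℕ} {g h : MvPowerSeries J (Module.End k (AddMonoidAlgebra k (ι → ℤ)))}
    (e : EqBelow d g h) (p : ScatRing k ι J) : EqMod d (act g p) (act h p) := by
  classical
  intro β hβ
  rw [coeff_act, coeff_act]
  refine Finset.sum_congr rfl fun ab hab => ?_
  have := degree_antidiagonal hab
  rw [e _ (by omega)]

/-- A series of operators is determined up to any degree by its action up to that degree. -/
theorem EqBelow.of_act {d : ℕ} {g h : MvPowerSeries J (Module.End k (AddMonoidAlgebra k (ι → ℤ)))}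
    (e : ∀ p, EqMod d (HDTV.act g p) (HDTV.act h p)) : EqBelow d g h := by
  classical
  have key : ∀ (g : MvPowerSeries J (Module.End k (AddMonoidAlgebra k (ι → ℤ)))) β a,
      MvPowerSeries.coeff β (HDTV.act g (zMonomial k J a)) =
      MvPowerSeries.coeff β g (AddMonoidAlgebra.single a 1) := by
    intro g β a
    rw [coeff_act, Finset.sum_eq_single (β, 0)]
    · simp [zMonomial]
    · rintro ⟨b, c⟩ hbc hne
      rw [zMonomial, MvPowerSeries.coeff_C, if_neg, map_zero]
      rintro (rfl : c = 0)
      rw [Finset.HasAntidiagonal.mem_antidiagonal, add_zero] at hbc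
      exact hne (Prod.ext hbc rfl)
    · intro hn
      simp at hn
  intro β hβ
  refine laurent_linearMap_ext fun a => ?_
  rw [← key, ← key, e _ β hβ]

theorem wallCrossingPoly_coeff (f : ScatRing k ι J) (n : ι → ℤ) (p : AddMonoidAlgebra k (ι → ℤ))
    (β : J →₀ ℕ) : MvPowerSeries.coeff β (wallCrossingPoly f n p) =
      MvPowerSeries.coeff β (crossing f n) p := by
  classical
  conv_rhs => rw [← AddMonoidAlgebra.sum_coeff_single p]
  rw [wallCrossingPoly, Finsupp.sum, Finsupp.sum, map_sum, map_sum]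
  refine Finset.sum_congr rfl fun a _ => ?_
  rw [coeff_crossing_single, MvPowerSeries.coeff_mul_C]

theorem wallCrossing_eq_act (f : ScatRing k ι J) (n : ι → ℤ) :
    wallCrossing f n = act (crossing f n) := by
  funext p
  refine MvPowerSeries.ext fun β => ?_
  show ∑ ab ∈ _, _ = ∑ ab ∈ _, _
  exact Finset.sum_congr rfl fun ab _ => wallCrossingPoly_coeff f n _ _

variable [CharZero k]

/-- The coefficients of `f` commute, so that powers multiply the logarithmic derivative. -/
theorem intPow_eq_sol {f : ScatRing k ι J} (hf : MvPowerSeries.constantCoeff f = 1) (a : ℤ) :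
    intPow f a = sol (a • logder f) := by
  have hl : MvPowerSeries.constantCoeff (logder f) = 0 := constantCoeff_logder f
  have comm : ∀ (X Y : ScatRing k ι J) (β γ : J →₀ ℕ),
    Commute (MvPowerSeries.coeff β X) (MvPowerSeries.coeff γ Y) := fun _ _ _ _ => Commute.all _ _
  have hpow : ∀ (X : ScatRing k ι J) (_ : MvPowerSeries.constantCoeff X = 0) (m : ℕ),
      sol X ^ m = sol ((m : ℤ) • X) := by
    intro X hX m
    induction m with
    | zero => rw [pow_zero, Nat.cast_zero, zero_smul, sol_zero k]
    | succ m ih =>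
      rw [pow_succ, ih, Nat.cast_succ, add_smul, one_smul, sol_add k _ hX (comm _ _)]
      rw [map_zsmul, hX, smul_zero]
  rw [intPow]
  split_ifs with h
  · conv_lhs => rw [← sol_logder k hf, hpow _ hl, Int.toNat_of_nonneg h]
  · have hinv : MvPowerSeries.invOfUnit f 1 = sol (-logder f) := by
      have h1 : f * sol (-logder f) = 1 := by
        have h0 : f * sol (-logder f) = sol (logder f) * sol (-logder f) := by
          rw [sol_logder k hf]
        rw [h0, ← sol_add k hl (by rw [map_neg, hl, neg_zero]) (comm _ _),
          add_neg_cancel, sol_zero k]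
      have h2 : MvPowerSeries.invOfUnit f 1 * f = 1 :=
        MvPowerSeries.invOfUnit_mul f 1 (by simp [hf])
      calc MvPowerSeries.invOfUnit f 1 = MvPowerSeries.invOfUnit f 1 * (f * sol (-logder f)) := by
            rw [h1, mul_one]
        _ = _ := by rw [← mul_assoc, h2, one_mul]
    rw [hinv, hpow _ (by rw [map_neg, hl, neg_zero]), Int.toNat_of_nonneg (by omega)]
    simp

/-- The wall-crossing automorphism is the flow of the corresponding vector field. -/
theorem crossing_eq_sol {f : ScatRing k ι J} (hf : MvPowerSeries.constantCoeff f = 1) {n : ι → ℤ}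
    (hn : ∀ β, MvPowerSeries.coeff β (logder f) ∈ dlogKer (k := k) n) :
    crossing f n = sol (wallField n (logder f)) := by
  classical
  have hl : MvPowerSeries.constantCoeff (logder f) = 0 := constantCoeff_logder f
  have hal : ∀ a : ℤ, MvPowerSeries.constantCoeff (a • logder f) = 0 := fun a => by
    rw [map_zsmul, hl, smul_zero]
  refine eq_sol k (constantCoeff_wallField n hl) ?_ ?_
  · rw [← MvPowerSeries.coeff_zero_eq_constantCoeff_apply]
    refine laurent_linearMap_ext fun a => ?_
    rw [coeff_crossing_single, intPow_eq_sol hf]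
    simp
  · refine MvPowerSeries.ext fun β => laurent_linearMap_ext fun a => ?_
    have hmem : ∀ γ, dlog n (MvPowerSeries.coeff γ (intPow f (n ⬝ᵥ a))) = 0 := by
      intro γ
      rw [intPow_eq_sol hf]
      refine coeff_sol_mem k (hal _) (dlogKer n) (fun γ => ?_) γ
      rw [map_zsmul]
      exact (dlogKer n).zsmul_mem (hn γ) _
    have e := congrArg (fun q => MvPowerSeries.coeff β q * AddMonoidAlgebra.single a (1 : k))
      (euler_sol k (hal (n ⬝ᵥ a)))
    simp only [← intPow_eq_sol hf] at e
    rw [coeff_euler, MvPowerSeries.coeff_mul, Finset.sum_mul] at e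
    have e0 : ((β.degree : Module.End k (AddMonoidAlgebra k (ι → ℤ))) *
        MvPowerSeries.coeff β (crossing f n)) (AddMonoidAlgebra.single a 1) =
        (β.degree : AddMonoidAlgebra k (ι → ℤ)) * MvPowerSeries.coeff β (intPow f (n ⬝ᵥ a)) *
          AddMonoidAlgebra.single a 1 := by
      rw [← nsmul_eq_mul, LinearMap.smul_apply, coeff_crossing_single, ← nsmul_eq_mul,
        smul_mul_assoc]
    rw [coeff_euler, e0, e, MvPowerSeries.coeff_mul, LinearMap.sum_apply]
    refine Finset.sum_congr rfl fun p _ => ?_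
    rw [Module.End.mul_apply, coeff_crossing_single, coeff_wallField_apply, dlog_mul, hmem, zero_mul,
      zero_add, dlog_single, map_zsmul, ← Int.cast_smul_eq_zsmul k, smul_mul_assoc, smul_mul_assoc,
      mul_smul_comm, mul_smul_comm, mul_assoc]

end Operators

/-! ### Polyhedral cones -/

section Cones

open Topology Set

variable {ι : Type v} [Fintype ι]

theorem mem_hull_insert {s x : ι → ℝ} {G : Set (ι → ℝ)} :
    x ∈ PointedCone.hull ℝ (insert s G) ↔ ∃ c : ℝ, 0 ≤ c ∧ x - c • s ∈ PointedCone.hull ℝ G := by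
  rw [PointedCone.hull, Submodule.mem_span_insert]
  constructor
  · rintro ⟨a, z, hz, rfl⟩
    exact ⟨a, a.2, by simpa [NNReal.smul_def] using hz⟩
  · rintro ⟨c, hc, h⟩
    exact ⟨⟨c, hc⟩, _, h, by simp [Nonneg.mk_smul]⟩

theorem mem_hull_finset {G : Finset (ι → ℝ)} {x : ι → ℝ} :
    x ∈ PointedCone.hull ℝ (G : Set (ι → ℝ)) ↔
      ∃ c : (ι → ℝ) → ℝ, (∀ s ∈ G, 0 ≤ c s) ∧ ∑ s ∈ G, c s • s = x := by
  classical
  constructor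
  · intro h
    induction G using Finset.induction_on generalizing x with
    | empty =>
      refine ⟨0, by simp, ?_⟩
      simp [PointedCone.hull] at h
      simp [h]
    | insert a G ha ih =>
      rw [Finset.coe_insert, mem_hull_insert] at h
      obtain ⟨c, hc, h⟩ := h
      obtain ⟨d, hd, e⟩ := ih h
      refine ⟨fun s => if s = a then c else d s, fun s hs => ?_, ?_⟩
      · dsimp only
        split_ifs with h1
        · exact hc
        · exact hd s ((Finset.mem_insert.1 hs).resolve_left h1)
      · rw [Finset.sum_insert ha]
        dsimp only
        rw [if_pos rfl, Finset.sum_congr rfl (g := fun s => d s • s), e]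
        · abel
        · intro s hs
          rw [if_neg]
          rintro rfl
          exact ha hs
  · rintro ⟨c, hc, rfl⟩
    exact Submodule.sum_mem _ fun s hs =>
      PointedCone.smul_mem _ (hc s hs) (PointedCone.subset_hull hs)

/-- A finitely generated cone is a finite intersection of half-spaces. -/
theorem exists_halfspaces (G : Finset (ι → ℝ)) : ∃ A : Finset ((ι → ℝ) →ₗ[ℝ] ℝ),
    ∀ x, x ∈ PointedCone.hull ℝ (G : Set (ι → ℝ)) ↔ ∀ l ∈ A, 0 ≤ l x := by
  classical
  induction G using Finset.induction_on with
  | empty =>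
    refine ⟨Finset.univ.image (fun i => LinearMap.proj i) ∪
      Finset.univ.image (fun i => -LinearMap.proj i), fun x => ?_⟩
    constructor
    · intro h
      simp [PointedCone.hull] at h
      simp [h]
    · intro h
      have : x = 0 := by
        ext i
        have h1 := h (LinearMap.proj i) (by simp)
        have h2 := h (-LinearMap.proj i) (by simp)
        simp at h1 h2
        exact le_antisymm h2 h1
      rw [this]
      exact Submodule.zero_mem _
  | insert s G _ ih =>
    obtain ⟨A, hA⟩ := ih
    -- Fourier–Motzkin elimination of the coefficient of `s`: keep the forms that are nonnegative at
    -- `s`, and combine the forms of opposite sign at `s` to forms vanishing there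
    refine ⟨A.filter (fun l => 0 ≤ l s) ∪
      ((A.filter fun l => 0 < l s) ×ˢ (A.filter fun l => l s < 0)).image
        (fun p => p.1 s • p.2 - p.2 s • p.1), fun x => ?_⟩
    rw [Finset.coe_insert, mem_hull_insert]
    constructor
    · rintro ⟨c, hc, h⟩ l hl
      rw [hA] at h
      rw [Finset.mem_union] at hl
      rcases hl with hl | hl
      · rw [Finset.mem_filter] at hl
        have := h l hl.1
        rw [map_sub, map_smul, smul_eq_mul] at this
        nlinarith [mul_nonneg hc hl.2]
      · rw [Finset.mem_image] at hl
        obtain ⟨⟨l1, l2⟩, h12, rfl⟩ := hl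
        rw [Finset.mem_product, Finset.mem_filter, Finset.mem_filter] at h12
        have h1 := h l1 h12.1.1
        have h2 := h l2 h12.2.1
        rw [map_sub, map_smul, smul_eq_mul] at h1 h2
        have p1 := h12.1.2
        have p2 := h12.2.2
        simp only [LinearMap.sub_apply, LinearMap.smul_apply, smul_eq_mul] at p1 p2 ⊢
        nlinarith
    · intro h
      -- subtract the least multiple `c • s`, `c ≥ 0`, after which the forms with negative value at
      -- `s` are nonnegative
      obtain ⟨c, hc, hmax⟩ := Finset.exists_max_image
        (insert 0 ((A.filter fun l => l s < 0).image fun l => l x / l s)) id ⟨0, by simp⟩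
      simp only [id] at hmax
      have hc0 : 0 ≤ c := hmax 0 (by simp)
      refine ⟨c, hc0, ?_⟩
      rw [hA]
      intro l hl
      rw [map_sub, map_smul, smul_eq_mul]
      rcases lt_trichotomy (l s) 0 with hs | hs | hs
      · have := hmax (l x / l s) (by
          refine Finset.mem_insert_of_mem (Finset.mem_image.2 ⟨l, ?_, rfl⟩)
          exact Finset.mem_filter.2 ⟨hl, hs⟩)
        rw [div_le_iff_of_neg hs] at this
        linarith
      · rw [hs, mul_zero, sub_zero]
        exact h l (Finset.mem_union_left _ (Finset.mem_filter.2 ⟨hl, hs.ge⟩))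
      · rw [sub_nonneg, ← le_div_iff₀ hs]
        rw [Finset.mem_insert] at hc
        rcases hc with rfl | hc
        · exact div_nonneg (h l (Finset.mem_union_left _ (Finset.mem_filter.2 ⟨hl, hs.le⟩))) hs.le
        · obtain ⟨l', hl', rfl⟩ := Finset.mem_image.1 hc
          rw [Finset.mem_filter] at hl'
          have := h (l s • l' - l' s • l) (Finset.mem_union_right _ (Finset.mem_image.2
            ⟨(l, l'), Finset.mem_product.2 ⟨Finset.mem_filter.2 ⟨hl, hs⟩,
              Finset.mem_filter.2 hl'⟩, rfl⟩))
          simp only [LinearMap.sub_apply, LinearMap.smul_apply, smul_eq_mul] at this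
          rw [div_le_iff_of_neg hl'.2, div_mul_eq_mul_div, div_le_iff₀ hs]
          linarith

theorem isClosed_hull (G : Finset (ι → ℝ)) :
    IsClosed (PointedCone.hull ℝ (G : Set (ι → ℝ)) : Set (ι → ℝ)) := by
  obtain ⟨A, hA⟩ := exists_halfspaces G
  have : (PointedCone.hull ℝ (G : Set (ι → ℝ)) : Set (ι → ℝ)) = ⋂ l ∈ A, {x | 0 ≤ l x} := by
    ext x
    simp [hA]
  rw [this]
  exact isClosed_biInter fun l _ => isClosed_le continuous_const l.continuous_of_finiteDimensional

theorem IsRationalPolyhedral.exists_finset {σ : PointedCone ℝ (ι → ℝ)}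
    (h : IsRationalPolyhedral σ) :
    ∃ S : Finset (ι → ℤ), ∃ G : Finset (ι → ℝ), (G : Set (ι → ℝ)) = toReal '' S ∧
      σ = PointedCone.hull ℝ (G : Set (ι → ℝ)) := by
  classical
  obtain ⟨S, hS⟩ := h
  exact ⟨S, S.image toReal, by simp, by simpa using hS⟩

theorem IsRationalPolyhedral.isClosed {σ : PointedCone ℝ (ι → ℝ)}
    (h : IsRationalPolyhedral σ) : IsClosed (σ : Set (ι → ℝ)) := by
  obtain ⟨S, G, -, rfl⟩ := h.exists_finset
  exact isClosed_hull G

theorem span_hull (G : Set (ι → ℝ)) :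
    Submodule.span ℝ (PointedCone.hull ℝ G : Set (ι → ℝ)) = Submodule.span ℝ G :=
  le_antisymm (Submodule.span_le.2 (PointedCone.hull_le_span ℝ G))
    (Submodule.span_mono PointedCone.subset_hull)

/-- A point with positive coefficients on a set of generators spanning the cone is an interior
point relative to the span. -/
theorem hull_mem_nhdsWithin {G T : Finset (ι → ℝ)} (hT : T ⊆ G)
    (hspan : (G : Set (ι → ℝ)) ⊆ Submodule.span ℝ (T : Set (ι → ℝ))) {c : (ι → ℝ) → ℝ}
    (hc : ∀ s ∈ T, 0 < c s) :
    (PointedCone.hull ℝ (G : Set (ι → ℝ)) : Set (ι → ℝ)) ∈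
      𝓝[(Submodule.span ℝ (G : Set (ι → ℝ)) : Set (ι → ℝ))] (∑ s ∈ T, c s • s) := by
  classical
  set W := Submodule.span ℝ (G : Set (ι → ℝ)) with hW
  have hTW : ∀ s : T, (s : ι → ℝ) ∈ W :=
    fun s => Submodule.subset_span (R := ℝ) (s := (G : Set (ι → ℝ))) (hT s.2)
  -- the points with positive coefficients are the image of an open set under a surjective, hence
  -- open, linear map onto the span
  let f : (T → ℝ) →ₗ[ℝ] W := Fintype.linearCombination ℝ fun s : T => (⟨s, hTW s⟩ : W)
  have hf : ∀ d, ((f d : W) : ι → ℝ) = ∑ s : T, d s • (s : ι → ℝ) := fun d => by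
    simp [f, Fintype.linearCombination_apply]
  have hsurj : Function.Surjective f := by
    rintro ⟨y, hy⟩
    have hy' : y ∈ Submodule.span ℝ (Set.range fun s : T => (s : ι → ℝ)) := by
      have : (Set.range fun s : T => (s : ι → ℝ)) = (T : Set (ι → ℝ)) := by simp
      rw [this]
      exact (Submodule.span_le.2 hspan) hy
    obtain ⟨d, hd⟩ := (Submodule.mem_span_range_iff_exists_fun ℝ).1 hy'
    exact ⟨d, Subtype.ext (by rw [hf, hd])⟩
  have hopen : IsOpenMap f := by
    have := (LinearMap.toContinuousLinearMap f).isOpenMap hsurj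
    exact this
  have hU : IsOpen {d : T → ℝ | ∀ s, 0 < d s} := by
    rw [Set.ofPred_forall]
    exact isOpen_iInter_of_finite fun s => isOpen_lt continuous_const (continuous_apply s)
  have hx : (∑ s ∈ T, c s • s) = ((f fun s => c s : W) : ι → ℝ) := by
    rw [hf]
    exact (Finset.sum_coe_sort T fun s => c s • s).symm
  have hmem := (hopen _ hU).mem_nhds (Set.mem_image_of_mem f
    (show (fun s : T => c s) ∈ {d : T → ℝ | ∀ s, 0 < d s} from fun s => hc s s.2))
  rw [hx, mem_nhdsWithin_iff_exists_mem_nhds_inter]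
  rw [nhds_subtype_eq_comap, Filter.mem_comap] at hmem
  obtain ⟨O, hO, hOsub⟩ := hmem
  refine ⟨O, hO, ?_⟩
  rintro y ⟨hyO, hyW⟩
  obtain ⟨d, hd, e⟩ := hOsub (show (⟨y, hyW⟩ : W) ∈ Subtype.val ⁻¹' O from hyO)
  have : y = ∑ s : T, d s • (s : ι → ℝ) := by rw [← hf, e]
  rw [this]
  exact Submodule.sum_mem _ fun s _ =>
    PointedCone.smul_mem _ (hd s).le (PointedCone.subset_hull (hT s.2))

/-- The relative boundary of a closed cone, in terms of neighbourhoods within the span. -/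
theorem mem_intrinsicFrontier_cone {σ : PointedCone ℝ (ι → ℝ)} (hσ : IsClosed (σ : Set (ι → ℝ)))
    {x : ι → ℝ} : x ∈ intrinsicFrontier ℝ (σ : Set (ι → ℝ)) ↔
      x ∈ σ ∧ (σ : Set (ι → ℝ)) ∉ 𝓝[(Submodule.span ℝ (σ : Set (ι → ℝ)) : Set (ι → ℝ))] x := by
  have haff : (affineSpan ℝ (σ : Set (ι → ℝ)) : Set (ι → ℝ)) =
      Submodule.span ℝ (σ : Set (ι → ℝ)) := by
    have h0 : (0 : ι → ℝ) ∈ (σ : Set (ι → ℝ)) := σ.zero_mem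
    rw [← Set.insert_eq_of_mem h0, affineSpan_insert_zero, Set.insert_eq_of_mem h0]
  have key : ∀ y : affineSpan ℝ (σ : Set (ι → ℝ)),
      (((↑) ⁻¹' (σ : Set (ι → ℝ)) : Set (affineSpan ℝ (σ : Set (ι → ℝ)))) ∈ 𝓝 y ↔
        (σ : Set (ι → ℝ)) ∈ 𝓝[(Submodule.span ℝ (σ : Set (ι → ℝ)) : Set (ι → ℝ))] (y : ι → ℝ)) := by
    intro y
    rw [← haff, ← map_nhds_subtype_val y, Filter.mem_map]
    rfl
  rw [mem_intrinsicFrontier]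
  constructor
  · rintro ⟨y, hy, rfl⟩
    have hcl : IsClosed ((↑) ⁻¹' (σ : Set (ι → ℝ)) : Set (affineSpan ℝ (σ : Set (ι → ℝ)))) :=
      hσ.preimage continuous_subtype_val
    rw [hcl.frontier_eq] at hy
    exact ⟨hy.1, fun h => hy.2 (mem_interior_iff_mem_nhds.2 ((key y).2 h))⟩
  · rintro ⟨hx, hn⟩
    refine ⟨⟨x, subset_affineSpan ℝ _ hx⟩, ?_, rfl⟩
    have hcl : IsClosed ((↑) ⁻¹' (σ : Set (ι → ℝ)) : Set (affineSpan ℝ (σ : Set (ι → ℝ)))) :=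
      hσ.preimage continuous_subtype_val
    rw [hcl.frontier_eq]
    exact ⟨hx, fun h => hn ((key _).1 (mem_interior_iff_mem_nhds.1 h))⟩

/-- The relative boundary of a finitely generated cone is contained in finitely many subspaces of
smaller dimension. -/
theorem exists_span_of_mem_intrinsicFrontier {G : Finset (ι → ℝ)} {x : ι → ℝ}
    (hx : x ∈ intrinsicFrontier ℝ (PointedCone.hull ℝ (G : Set (ι → ℝ)) : Set (ι → ℝ))) :
    ∃ T ⊆ G, x ∈ Submodule.span ℝ (T : Set (ι → ℝ)) ∧
      Submodule.span ℝ (T : Set (ι → ℝ)) < Submodule.span ℝ (G : Set (ι → ℝ)) := by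
  classical
  rw [mem_intrinsicFrontier_cone (isClosed_hull G), span_hull] at hx
  obtain ⟨hx, hn⟩ := hx
  obtain ⟨c, hc, rfl⟩ := mem_hull_finset.1 hx
  have hsum : ∑ s ∈ G, c s • s = ∑ s ∈ G.filter (fun s => c s ≠ 0), c s • s := by
    rw [Finset.sum_filter_of_ne]
    intro s _ h h0
    rw [h0, zero_smul] at h
    exact h rfl
  refine ⟨G.filter fun s => c s ≠ 0, Finset.filter_subset _ _, ?_, ?_⟩
  · rw [hsum]
    exact Submodule.sum_mem _ fun s hs => Submodule.smul_mem _ _ (Submodule.subset_span hs)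
  · refine lt_of_le_of_ne (Submodule.span_mono (Finset.filter_subset _ _)) fun e => hn ?_
    rw [hsum]
    refine hull_mem_nhdsWithin (Finset.filter_subset _ _) ?_ fun s hs => ?_
    · rw [e]
      exact Submodule.subset_span
    · rw [Finset.mem_filter] at hs
      exact lt_of_le_of_ne (hc s hs.1) hs.2.symm

/-! ### Integral linear forms -/

/-- The pairing with `n` as a linear form. -/
def pairL (n : ι → ℤ) : (ι → ℝ) →ₗ[ℝ] ℝ where
  toFun := pair n
  map_add' _ _ := dotProduct_add _ _ _
  map_smul' _ _ := dotProduct_smul _ _ _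

@[simp]
theorem pairL_apply (n : ι → ℤ) (x : ι → ℝ) : pairL n x = pair n x := rfl

theorem pair_add (n : ι → ℤ) (x y : ι → ℝ) : pair n (x + y) = pair n x + pair n y :=
  map_add (pairL n) x y

theorem pair_sub (n : ι → ℤ) (x y : ι → ℝ) : pair n (x - y) = pair n x - pair n y :=
  map_sub (pairL n) x y

theorem pair_smul (n : ι → ℤ) (c : ℝ) (x : ι → ℝ) : pair n (c • x) = c * pair n x :=
  map_smul (pairL n) c x

theorem pair_sum {α : Type*} (n : ι → ℤ) (s : Finset α) (f : α → ι → ℝ) :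
    pair n (∑ i ∈ s, f i) = ∑ i ∈ s, pair n (f i) :=
  map_sum (pairL n) f s

@[simp]
theorem pair_zero (n : ι → ℤ) : pair n (0 : ι → ℝ) = 0 := map_zero (pairL n)

theorem pair_toReal (n m : ι → ℤ) : pair n (toReal m) = ((n ⬝ᵥ m : ℤ) : ℝ) := by
  simp [pair, toReal, dotProduct]

theorem pair_neg_left (n : ι → ℤ) (x : ι → ℝ) : pair (-n) x = -pair n x := by
  simp [pair, toReal, dotProduct]

theorem pair_add_left (n n' : ι → ℤ) (x : ι → ℝ) : pair (n + n') x = pair n x + pair n' x := by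
  simp [pair, toReal, dotProduct, add_mul, Finset.sum_add_distrib]

theorem pair_smul_left (c : ℤ) (n : ι → ℤ) (x : ι → ℝ) : pair (c • n) x = c * pair n x := by
  simp [pair, toReal, dotProduct, mul_assoc, Finset.mul_sum]

theorem pair_zero_left (x : ι → ℝ) : pair (0 : ι → ℤ) x = 0 := by
  simp [pair, toReal, dotProduct]

theorem continuous_pair (n : ι → ℤ) : Continuous (pair n) :=
  (pairL n).continuous_of_finiteDimensional

theorem toReal_add (m m' : ι → ℤ) : toReal (m + m') = toReal m + toReal m' := by
  ext; simp [toReal]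

theorem toReal_neg (m : ι → ℤ) : toReal (-m) = -toReal m := by
  ext; simp [toReal]

theorem toReal_smul (c : ℤ) (m : ι → ℤ) : toReal (c • m) = (c : ℝ) • toReal m := by
  ext; simp [toReal]

theorem toReal_sub (m m' : ι → ℤ) : toReal (m - m') = toReal m - toReal m' := by
  ext; simp [toReal]

theorem toReal_injective : Function.Injective (toReal : (ι → ℤ) → ι → ℝ) := fun m m' h => by
  ext i
  have := congrFun h i
  simpa [toReal] using this

theorem eq_zero_of_pair_eq_zero {n : ι → ℤ} (h : ∀ x, pair n x = 0) : n = 0 := by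
  classical
  ext i
  have := h (Pi.single i 1)
  simpa [pair, toReal] using this

theorem pairL_ne_zero {n : ι → ℤ} (h : n ≠ 0) : pairL n ≠ 0 := fun h' =>
  h (eq_zero_of_pair_eq_zero fun x => by rw [← pairL_apply, h']; rfl)

/-- The solutions of finitely many integral linear inequalities form a rational polyhedral cone. -/
theorem exists_generators (A : Finset (ι → ℤ)) : ∃ S : Finset (ι → ℤ),
    ∀ x, x ∈ PointedCone.hull ℝ (toReal '' (S : Set (ι → ℤ))) ↔ ∀ n ∈ A, 0 ≤ pair n x := by
  classical
  induction A using Finset.induction_on with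
  | empty =>
    refine ⟨Finset.univ.image (fun i => Pi.single i 1) ∪
      Finset.univ.image (fun i => -Pi.single i 1), fun x => ?_⟩
    simp only [Finset.notMem_empty, false_imp_iff, implies_true, iff_true]
    have : x = ∑ i, (max (x i) 0 • toReal (Pi.single i 1) +
        max (-x i) 0 • toReal (-Pi.single i 1)) := by
      ext j
      rw [Finset.sum_apply, Finset.sum_eq_single j]
      · simp [toReal, ← sub_eq_add_neg]
      · intro i _ hij
        simp [toReal, hij.symm]
      · simp
    rw [this]
    refine Submodule.sum_mem _ fun i _ => Submodule.add_mem _ ?_ ?_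
    · refine PointedCone.smul_mem _ (le_max_right _ _) (PointedCone.subset_hull ⟨_, ?_, rfl⟩)
      simp
    · refine PointedCone.smul_mem _ (le_max_right _ _) (PointedCone.subset_hull ⟨_, ?_, rfl⟩)
      simp
  | insert n A _ ih =>
    obtain ⟨S, hS⟩ := ih
    -- double description: keep the generators on the nonnegative side of `n`, and for generators on
    -- opposite sides take their positive combination lying in `n^⊥`
    set S' := S.filter (fun s => 0 ≤ n ⬝ᵥ s) ∪
      ((S.filter fun s => 0 < n ⬝ᵥ s) ×ˢ (S.filter fun s => n ⬝ᵥ s < 0)).image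
        (fun p => (n ⬝ᵥ p.1) • p.2 - (n ⬝ᵥ p.2) • p.1) with hS'
    have hS'r : ∀ s ∈ S', toReal s ∈ PointedCone.hull ℝ (toReal '' (S' : Set (ι → ℤ))) :=
      fun s hs => PointedCone.subset_hull ⟨s, hs, rfl⟩
    refine ⟨S', fun x => ?_⟩
    rw [Finset.forall_mem_insert, ← hS]
    constructor
    · intro h
      have hle : PointedCone.hull ℝ (toReal '' (S' : Set (ι → ℤ))) ≤
          PointedCone.hull ℝ (toReal '' (S : Set (ι → ℤ))) ⊓
            PointedCone.comap (pairL n) (PointedCone.positive ℝ ℝ) := by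
        refine Submodule.span_le.2 ?_
        rintro _ ⟨s, hs, rfl⟩
        rw [SetLike.mem_coe, Submodule.mem_inf, PointedCone.mem_comap, PointedCone.mem_positive,
          pairL_apply, pair_toReal]
        rw [Finset.mem_coe, hS', Finset.mem_union] at hs
        rcases hs with hs | hs
        · rw [Finset.mem_filter] at hs
          exact ⟨PointedCone.subset_hull ⟨s, hs.1, rfl⟩, by exact_mod_cast hs.2⟩
        · obtain ⟨⟨a, b⟩, hab, rfl⟩ := Finset.mem_image.1 hs
          rw [Finset.mem_product, Finset.mem_filter, Finset.mem_filter] at hab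
          obtain ⟨⟨ha, ha'⟩, hb, hb'⟩ := hab
          dsimp only at ha ha' hb hb' ⊢
          constructor
          · rw [sub_eq_add_neg, ← neg_smul, toReal_add, toReal_smul, toReal_smul]
            refine Submodule.add_mem _ ?_ ?_
            · exact PointedCone.smul_mem _ (by exact_mod_cast ha'.le)
                (PointedCone.subset_hull ⟨b, hb, rfl⟩)
            · refine PointedCone.smul_mem _ ?_ (PointedCone.subset_hull ⟨a, ha, rfl⟩)
              have : 0 ≤ -(n ⬝ᵥ b) := by omega
              exact_mod_cast this
          · rw [dotProduct_sub, dotProduct_smul, dotProduct_smul, smul_eq_mul, smul_eq_mul,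
              mul_comm, sub_self, Int.cast_zero]
      obtain ⟨h1, h2⟩ := Submodule.mem_inf.1 (hle h)
      exact ⟨h2, h1⟩
    · rintro ⟨hn, hx⟩
      have himg : (toReal '' (S : Set (ι → ℤ)) : Set (ι → ℝ)) = (S.image toReal : Finset _) := by
        simp
      rw [himg, mem_hull_finset] at hx
      obtain ⟨c, hc, rfl⟩ := hx
      rw [Finset.sum_image toReal_injective.injOn] at hn ⊢
      set d : (ι → ℤ) → ℝ := fun s => c (toReal s) with hd
      have hd0 : ∀ s ∈ S, 0 ≤ d s := fun s hs => hc _ (Finset.mem_image_of_mem _ hs)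
      set P := S.filter fun s => 0 < n ⬝ᵥ s with hP
      set Q := S.filter fun s => n ⬝ᵥ s < 0 with hQ
      set Z := S.filter fun s => n ⬝ᵥ s = 0 with hZ
      have hsplit : ∀ {M : Type v} [AddCommMonoid M] (F : (ι → ℤ) → M),
          ∑ s ∈ S, F s = ∑ s ∈ Z, F s + (∑ s ∈ P, F s + ∑ s ∈ Q, F s) := by
        intro M _ F
        rw [← Finset.sum_filter_add_sum_filter_not S (fun s => n ⬝ᵥ s = 0)]
        congr 1
        rw [← Finset.sum_filter_add_sum_filter_not _ (fun s => 0 < n ⬝ᵥ s), Finset.filter_filter,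
          Finset.filter_filter]
        congr 1
        · refine Finset.sum_congr (Finset.filter_congr fun s _ => ?_) fun _ _ => rfl
          omega
        · refine Finset.sum_congr (Finset.filter_congr fun s _ => ?_) fun _ _ => rfl
          omega
      have hPS : ∀ s ∈ P, s ∈ S' := fun s hs => by
        rw [hP, Finset.mem_filter] at hs
        exact Finset.mem_union_left _ (Finset.mem_filter.2 ⟨hs.1, hs.2.le⟩)
      have hZm : ∑ s ∈ Z, d s • toReal s ∈ PointedCone.hull ℝ (toReal '' (S' : Set (ι → ℤ))) := by
        refine Submodule.sum_mem _ fun s hs => ?_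
        rw [hZ, Finset.mem_filter] at hs
        exact PointedCone.smul_mem _ (hd0 s hs.1) (hS'r s
          (Finset.mem_union_left _ (Finset.mem_filter.2 ⟨hs.1, hs.2.ge⟩)))
      set a := ∑ s ∈ P, d s * (n ⬝ᵥ s : ℤ) with ha
      set b := ∑ s ∈ Q, d s * (n ⬝ᵥ s : ℤ) with hb
      have hPpos : ∀ s ∈ P, s ∈ S ∧ (0 : ℝ) < (n ⬝ᵥ s : ℤ) := fun s hs => by
        rw [hP, Finset.mem_filter] at hs
        exact ⟨hs.1, by exact_mod_cast hs.2⟩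
      have hQneg : ∀ s ∈ Q, s ∈ S ∧ ((n ⬝ᵥ s : ℤ) : ℝ) < 0 := fun s hs => by
        rw [hQ, Finset.mem_filter] at hs
        exact ⟨hs.1, by exact_mod_cast hs.2⟩
      have hab : 0 ≤ a + b := by
        have e := pair_sum n S fun s => d s • toReal s
        rw [show ∑ s ∈ S, c (toReal s) • toReal s = ∑ s ∈ S, d s • toReal s from rfl, e] at hn
        have e2 : ∀ s, pair n (d s • toReal s) = d s * (n ⬝ᵥ s : ℤ) := fun s => by
          rw [pair_smul, pair_toReal]
        rw [Finset.sum_congr rfl fun s _ => e2 s,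
          ← Finset.sum_filter_add_sum_filter_not S (fun s => n ⬝ᵥ s = 0),
          ← Finset.sum_filter_add_sum_filter_not (S.filter fun s => ¬ n ⬝ᵥ s = 0)
            (fun s => 0 < n ⬝ᵥ s), Finset.filter_filter, Finset.filter_filter] at hn
        rw [Finset.sum_eq_zero (s := S.filter fun s => n ⬝ᵥ s = 0) (fun s hs => by
          rw [Finset.mem_filter] at hs; simp [hs.2]), zero_add] at hn
        convert hn using 2
        · exact Finset.sum_congr (Finset.filter_congr fun s _ => by omega) fun _ _ => rfl
        · exact Finset.sum_congr (Finset.filter_congr fun s _ => by omega) fun _ _ => rfl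
      rw [hsplit]
      refine Submodule.add_mem _ hZm ?_
      have ha0 : 0 ≤ a := Finset.sum_nonneg fun s hs =>
        mul_nonneg (hd0 s (hPpos s hs).1) (hPpos s hs).2.le
      have hb0 : ∀ s ∈ Q, d s * (n ⬝ᵥ s : ℤ) ≤ 0 := fun s hs =>
        mul_nonpos_of_nonneg_of_nonpos (hd0 s (hQneg s hs).1) (hQneg s hs).2.le
      rcases ha0.eq_or_lt with h0 | h0
      · have hb1 : b = 0 := le_antisymm (Finset.sum_nonpos hb0) (by linarith)
        have hq : ∀ s ∈ Q, d s = 0 := by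
          intro s hs
          have := (Finset.sum_eq_zero_iff_of_nonpos hb0).1 hb1 s hs
          rcases mul_eq_zero.1 this with h | h
          · exact h
          · exact absurd h (hQneg s hs).2.ne
        rw [Finset.sum_eq_zero (s := Q) fun s hs => by
          show d s • toReal s = 0
          rw [hq s hs, zero_smul], add_zero]
        exact Submodule.sum_mem _ fun s hs =>
          PointedCone.smul_mem _ (hd0 s (hPpos s hs).1) (hS'r s (hPS s hs))
      -- the negative generators are absorbed into the combinations lying on the hyperplane
      · have key : ∑ s ∈ P, d s • toReal s + ∑ s ∈ Q, d s • toReal s =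
            ∑ s ∈ P, ∑ t ∈ Q, (d s * d t / a) •
              toReal ((n ⬝ᵥ s) • t - (n ⬝ᵥ t) • s) +
            ((a + b) / a) • ∑ s ∈ P, d s • toReal s := by
          have e1 : ∑ s ∈ P, ∑ t ∈ Q, (d s * d t / a) • toReal ((n ⬝ᵥ s) • t - (n ⬝ᵥ t) • s) =
              (∑ s ∈ P, ∑ t ∈ Q, (d s * (n ⬝ᵥ s : ℤ)) • ((a⁻¹ * d t) • toReal t)) -
              ∑ s ∈ P, ∑ t ∈ Q, (d t * (n ⬝ᵥ t : ℤ)) • ((a⁻¹ * d s) • toReal s) := by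
            rw [← Finset.sum_sub_distrib]
            refine Finset.sum_congr rfl fun s _ => ?_
            rw [← Finset.sum_sub_distrib]
            refine Finset.sum_congr rfl fun t _ => ?_
            rw [toReal_sub, toReal_smul, toReal_smul, smul_sub, smul_smul, smul_smul, smul_smul,
              smul_smul]
            congr 2 <;> ring
          have e2 : ∑ s ∈ P, ∑ t ∈ Q, (d s * (n ⬝ᵥ s : ℤ)) • ((a⁻¹ * d t) • toReal t) =
              ∑ t ∈ Q, d t • toReal t := by
            rw [Finset.sum_comm]
            refine Finset.sum_congr rfl fun t _ => ?_
            rw [← Finset.sum_smul, ← ha, smul_smul, ← mul_assoc, mul_inv_cancel₀ h0.ne', one_mul]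
          have e3 : ∑ s ∈ P, ∑ t ∈ Q, (d t * (n ⬝ᵥ t : ℤ)) • ((a⁻¹ * d s) • toReal s) =
              (b / a) • ∑ s ∈ P, d s • toReal s := by
            rw [Finset.smul_sum]
            refine Finset.sum_congr rfl fun s _ => ?_
            rw [← Finset.sum_smul, ← hb, smul_smul, smul_smul]
            congr 1
            ring
          rw [e1, e2, e3, add_div, div_self h0.ne', add_smul, one_smul]
          abel
        show ∑ s ∈ P, d s • toReal s + ∑ s ∈ Q, d s • toReal s ∈ _
        rw [key]
        refine Submodule.add_mem _ (Submodule.sum_mem _ fun s hs => Submodule.sum_mem _ fun t ht => ?_)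
          (PointedCone.smul_mem _ (div_nonneg hab h0.le) (Submodule.sum_mem _ fun s hs =>
            PointedCone.smul_mem _ (hd0 s (hPpos s hs).1) (hS'r s (hPS s hs))))
        refine PointedCone.smul_mem _ (div_nonneg (mul_nonneg (hd0 s (hPpos s hs).1)
          (hd0 t (hQneg t ht).1)) h0.le) (hS'r _ (Finset.mem_union_right _
            (Finset.mem_image.2 ⟨(s, t), Finset.mem_product.2 ⟨hs, ht⟩, rfl⟩)))

end Cones

/-! ### Primitive vectors and rational hyperplanes -/

section Lattice

open Topology Set

variable {ι : Type v} [Fintype ι]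

theorem IsPrimitive.ne_zero {n : ι → ℤ} (hn : IsPrimitive n) : n ≠ 0 := by
  rintro rfl
  have : (Finset.univ.gcd (0 : ι → ℤ)) = 0 := Finset.gcd_eq_zero_iff.2 fun _ _ => rfl
  rw [IsPrimitive, divisibility, this] at hn
  exact absurd hn (by simp)

theorem exists_smul_isPrimitive {n : ι → ℤ} (hn : n ≠ 0) :
    ∃ n₀, IsPrimitive n₀ ∧ divisibility n ≠ 0 ∧ n = (divisibility n : ℤ) • n₀ := by
  obtain ⟨i, hi⟩ := Function.ne_iff.1 hn
  obtain ⟨g, hg, h1⟩ := Finset.extract_gcd n (s := Finset.univ) ⟨i, Finset.mem_univ _⟩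
  have hd : (divisibility n : ℤ) = Finset.univ.gcd n := by
    rw [divisibility, Int.natCast_natAbs]
    exact abs_of_nonneg (by rw [← Finset.normalize_gcd]; exact Int.nonneg_of_normalize_eq_self (by simp))
  refine ⟨g, ?_, ?_, ?_⟩
  · rw [IsPrimitive, divisibility, h1]
    rfl
  · intro h0
    rw [h0, Nat.cast_zero] at hd
    exact hi (Finset.gcd_eq_zero_iff.1 hd.symm i (Finset.mem_univ _))
  · ext j
    rw [hd, Pi.smul_apply, smul_eq_mul]
    exact hg j (Finset.mem_univ _)

/-- A primitive vector is part of a pair of dual vectors. -/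
theorem IsPrimitive.exists_dotProduct_eq_one {n : ι → ℤ} (hn : IsPrimitive n) :
    ∃ y : ι → ℤ, n ⬝ᵥ y = 1 := by
  have h1 : Ideal.span (Set.range n) = ⊤ := by
    obtain ⟨g, hg⟩ := (IsPrincipalIdealRing.principal (Ideal.span (Set.range n))).principal
    have hdvd : ∀ i, g ∣ n i := fun i => by
      rw [← Ideal.mem_span_singleton]
      show n i ∈ Submodule.span ℤ {g}
      rw [← hg]
      exact Ideal.subset_span ⟨i, rfl⟩
    have : g ∣ Finset.univ.gcd n := Finset.dvd_gcd fun i _ => hdvd i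
    have hu : IsUnit g := by
      rw [IsPrimitive, divisibility] at hn
      rw [Int.isUnit_iff_natAbs_eq, ← Nat.dvd_one, ← hn]
      exact Int.natAbs_dvd_natAbs.2 this
    rw [hg]
    exact Ideal.span_singleton_eq_top.2 hu
  have h2 : (1 : ℤ) ∈ Ideal.span (Set.range n) := h1 ▸ Submodule.mem_top
  obtain ⟨c, hc⟩ := (Ideal.mem_span_range_iff_exists_fun).1 h2
  exact ⟨c, by rw [← hc, dotProduct]; simp [mul_comm]⟩

theorem isPrimitive_of_dotProduct_eq_one {n y : ι → ℤ} (h : n ⬝ᵥ y = 1) : IsPrimitive n := by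
  have : Finset.univ.gcd n ∣ 1 := by
    rw [← h, dotProduct]
    exact Finset.dvd_sum fun i _ => (Finset.gcd_dvd (Finset.mem_univ i)).mul_right _
  rw [IsPrimitive, divisibility, ← Nat.dvd_one]
  exact Int.natAbs_dvd_natAbs.2 this

theorem IsPrimitive.neg {n : ι → ℤ} (hn : IsPrimitive n) : IsPrimitive (-n) := by
  obtain ⟨y, hy⟩ := hn.exists_dotProduct_eq_one
  exact isPrimitive_of_dotProduct_eq_one (y := -y) (by simp [hy])

/-- An integral linear form vanishing on the kernel of a primitive one is an integral multiple. -/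
theorem IsPrimitive.exists_smul_of_ker_le {n n' : ι → ℤ} (hn : IsPrimitive n)
    (h : ∀ x, pair n x = 0 → pair n' x = 0) : ∃ q : ℤ, n' = q • n := by
  classical
  obtain ⟨y, hy⟩ := hn.exists_dotProduct_eq_one
  refine ⟨n' ⬝ᵥ y, funext fun i => ?_⟩
  have h1 : n ⬝ᵥ (Pi.single i 1 - n i • y) = 0 := by
    rw [dotProduct_sub, dotProduct_smul, hy]
    simp
  have h2 := h (toReal (Pi.single i 1 - n i • y)) (by rw [pair_toReal, h1, Int.cast_zero])
  rw [pair_toReal, Int.cast_eq_zero, dotProduct_sub, dotProduct_smul] at h2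
  simp only [dotProduct_single, mul_one, smul_eq_mul] at h2
  rw [Pi.smul_apply, smul_eq_mul]
  linarith

theorem eq_or_eq_neg_of_smul {n n' : ι → ℤ} (hn' : IsPrimitive n') {q : ℤ}
    (h : n' = q • n) : n' = n ∨ n' = -n := by
  obtain ⟨y, hy⟩ := hn'.exists_dotProduct_eq_one
  rw [h, smul_dotProduct, smul_eq_mul] at hy
  rcases Int.isUnit_iff.1 (IsUnit.of_mul_eq_one _ hy) with rfl | rfl
  · left; simpa using h
  · right; simpa using h

/-- Positive multiples of primitive vectors determine them. -/
theorem eq_of_smul_eq_smul {m m' : ι → ℤ} (hm : IsPrimitive m) (hm' : IsPrimitive m') {a b : ℤ}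
    (ha : 0 < a) (hb : 0 < b) (h : a • m = b • m') : m = m' := by
  obtain ⟨y, hy⟩ := hm.exists_dotProduct_eq_one
  obtain ⟨y', hy'⟩ := hm'.exists_dotProduct_eq_one
  have h1 := congrArg (· ⬝ᵥ y) h
  have h2 := congrArg (· ⬝ᵥ y') h
  simp only [smul_dotProduct, hy, hy', smul_eq_mul, mul_one] at h1 h2
  have hab : a = b := Int.dvd_antisymm ha.le hb.le ⟨_, h2.symm⟩ ⟨_, h1⟩
  subst hab
  ext i
  have := congrFun h i
  simp only [Pi.smul_apply, smul_eq_mul] at this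
  exact mul_left_cancel₀ ha.ne' this

theorem mem_perp {n : ι → ℤ} {x : ι → ℝ} : x ∈ perp n ↔ pair n x = 0 := Iff.rfl

theorem finrank_ker_pairL {n : ι → ℤ} (hn : n ≠ 0) :
    Module.finrank ℝ (LinearMap.ker (pairL n)) + 1 = Fintype.card ι := by
  have := Module.Dual.finrank_ker_add_one_of_ne_zero (pairL_ne_zero hn)
  rwa [Module.finrank_fintype_fun_eq_card] at this

/-- The span of a rational cone of codimension one is a rational hyperplane. -/
theorem exists_normal {σ : PointedCone ℝ (ι → ℝ)} (hσ : IsRationalPolyhedral σ)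
    (hd : coneDim σ + 1 = Fintype.card ι) : ∃ n : ι → ℤ, IsPrimitive n ∧
      Submodule.span ℝ (σ : Set (ι → ℝ)) = LinearMap.ker (pairL n) := by
  classical
  obtain ⟨S, rfl⟩ := hσ
  rw [coneDim, span_hull] at hd
  rw [span_hull]
  -- the generators span a proper subspace over `ℚ`; a rational linear form vanishing on it becomes
  -- integral after clearing denominators
  have hlt : Submodule.span ℚ ((fun (m : ι → ℤ) i => (m i : ℚ)) '' (S : Set (ι → ℤ))) < ⊤ := by
    rw [lt_top_iff_ne_top]
    intro htop
    have : Submodule.span ℝ (toReal '' (S : Set (ι → ℤ))) = ⊤ := by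
      rw [eq_top_iff, ← (Pi.basisFun ℝ ι).span_eq, Submodule.span_le]
      rintro _ ⟨i, rfl⟩
      let c : (ι → ℚ) →ₗ[ℚ] (ι → ℝ) :=
        { toFun := fun x i => (x i : ℝ)
          map_add' := fun x y => by ext; simp
          map_smul' := fun q x => by ext; simp [Rat.smul_def] }
      have h1 : (Pi.single i 1 : ι → ℚ) ∈
          Submodule.span ℚ ((fun (m : ι → ℤ) i => (m i : ℚ)) '' (S : Set (ι → ℤ))) :=
        htop ▸ Submodule.mem_top
      have h2 := Submodule.mem_map_of_mem (f := c) h1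
      rw [Submodule.map_span, ← Set.image_comp] at h2
      have h3 := Submodule.span_le_restrictScalars ℚ ℝ _ h2
      have e1 : (c ∘ fun (m : ι → ℤ) i => (m i : ℚ)) = toReal := by
        funext m i
        simp [c, toReal]
      have e2 : c (Pi.single i 1) = Pi.basisFun ℝ ι i := by
        ext j
        rcases eq_or_ne j i with rfl | hj
        · simp [c]
        · simp [c, hj]
      rw [e1, e2] at h3
      exact h3
    rw [this, finrank_top, Module.finrank_fintype_fun_eq_card] at hd
    omega
  obtain ⟨f, hf0, hf⟩ := Submodule.exists_le_ker_of_lt_top _ hlt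
  obtain ⟨b, hb⟩ := IsLocalization.exist_integer_multiples_of_finset (nonZeroDivisors ℤ)
    (Finset.univ.image fun i : ι => f (Pi.single i 1))
  have hb' : ∀ i, ∃ z : ℤ, (z : ℚ) = (b : ℤ) * f (Pi.single i 1) := fun i => by
    obtain ⟨z, hz⟩ := hb _ (Finset.mem_image_of_mem _ (Finset.mem_univ i))
    refine ⟨z, ?_⟩
    simpa [zsmul_eq_mul] using hz
  choose n hn using hb'
  have hfx : ∀ x : ι → ℚ, ((b : ℤ) : ℚ) * f x = ∑ i, (n i : ℚ) * x i := fun x => by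
    have hx : x = ∑ i, x i • (Pi.single i 1 : ι → ℚ) := by
      ext j
      simp [Finset.sum_apply, Pi.single_apply]
    conv_lhs => rw [hx]
    rw [map_sum, Finset.mul_sum]
    refine Finset.sum_congr rfl fun i _ => ?_
    rw [map_smul, hn, smul_eq_mul]
    ring
  have hb0 : ((b : ℤ) : ℚ) ≠ 0 := by
    exact_mod_cast nonZeroDivisors.ne_zero b.2
  have hn0 : n ≠ 0 := by
    rintro rfl
    apply hf0
    ext x
    have := hfx (Pi.single x 1)
    simp only [Pi.zero_apply, Int.cast_zero, zero_mul, Finset.sum_const_zero, mul_eq_zero, hb0,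
      false_or] at this
    simpa using this
  have horth : ∀ m ∈ S, n ⬝ᵥ m = 0 := fun m hm => by
    have h1 : f (fun i => (m i : ℚ)) = 0 := hf (Submodule.subset_span ⟨m, hm, rfl⟩)
    have h2 := hfx fun i => (m i : ℚ)
    rw [h1, mul_zero] at h2
    have h3 : ((n ⬝ᵥ m : ℤ) : ℚ) = 0 := by
      rw [dotProduct]
      push_cast
      exact h2.symm
    exact_mod_cast h3
  obtain ⟨n₀, hn₀, hd0, e⟩ := exists_smul_isPrimitive hn0
  refine ⟨n₀, hn₀, ?_⟩
  refine Submodule.eq_of_le_of_finrank_eq ?_ ?_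
  · rw [Submodule.span_le]
    rintro _ ⟨m, hm, rfl⟩
    have h1 := horth m hm
    rw [e, smul_dotProduct, smul_eq_zero] at h1
    rw [SetLike.mem_coe, LinearMap.mem_ker, pairL_apply, pair_toReal,
      h1.resolve_left (by exact_mod_cast hd0), Int.cast_zero]
  · have := finrank_ker_pairL hn₀.ne_zero
    omega

/-! ### Generic points -/

/-- Linear subspaces of codimension at least two. -/
def IsSmall (S : Submodule ℝ (ι → ℝ)) : Prop := Module.finrank ℝ S + 2 ≤ Fintype.card ι

theorem IsSmall.sup_span_ne_top {S : Submodule ℝ (ι → ℝ)} (hS : IsSmall S) (y : ι → ℝ) :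
    S ⊔ Submodule.span ℝ {y} ≠ ⊤ := by
  intro h
  have h1 := Submodule.finrank_add_le_finrank_add_finrank S (Submodule.span ℝ {y})
  rw [h, finrank_top, Module.finrank_fintype_fun_eq_card] at h1
  have h2 : Module.finrank ℝ (Submodule.span ℝ {y}) ≤ 1 := by
    simpa using finrank_span_le_card (R := ℝ) ({y} : Set (ι → ℝ))
  rw [IsSmall] at hS
  omega

theorem IsSmall.not_ker_le {S : Submodule ℝ (ι → ℝ)} (hS : IsSmall S) {n : ι → ℤ} (hn : n ≠ 0) :
    ¬ LinearMap.ker (pairL n) ≤ S := fun h => by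
  have h1 := Submodule.finrank_mono h
  have h2 := finrank_ker_pairL hn
  rw [IsSmall] at hS
  omega

theorem IsSmall.ne_top {S : Submodule ℝ (ι → ℝ)} (hS : IsSmall S) : S ≠ ⊤ := fun h => by
  rw [IsSmall, h, finrank_top, Module.finrank_fintype_fun_eq_card] at hS
  omega

theorem isSmall_ker_inf_ker {n n' : ι → ℤ} (hn : n ≠ 0)
    (h : ¬ LinearMap.ker (pairL n) ≤ LinearMap.ker (pairL n')) :
    IsSmall (LinearMap.ker (pairL n) ⊓ LinearMap.ker (pairL n')) := by
  have h1 : LinearMap.ker (pairL n) ⊓ LinearMap.ker (pairL n') < LinearMap.ker (pairL n) :=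
    inf_le_left.lt_of_ne fun e => h (inf_eq_left.1 e)
  have h2 := Submodule.finrank_lt_finrank_of_lt h1
  have h3 := finrank_ker_pairL hn
  rw [IsSmall]
  omega

theorem ker_pairL_ne_top {n : ι → ℤ} (hn : n ≠ 0) : LinearMap.ker (pairL n) ≠ ⊤ := fun h =>
  pairL_ne_zero hn (LinearMap.ker_eq_top.1 h)

/-- Near any point of a subspace `W` there are points of `W` outside finitely many given subspaces
that do not contain `W`. -/
theorem exists_generic (W : Submodule ℝ (ι → ℝ)) {𝒮 : Set (Submodule ℝ (ι → ℝ))} (h𝒮 : 𝒮.Finite)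
    (h : ∀ S ∈ 𝒮, ¬ W ≤ S) {x : ι → ℝ} (hx : x ∈ W) {O : Set (ι → ℝ)} (hO : O ∈ 𝓝 x) :
    ∃ y ∈ O, y ∈ W ∧ ∀ S ∈ 𝒮, y ∉ S := by
  have hdense : ∀ S ∈ 𝒮, Dense ((S.comap W.subtype : Set W)ᶜ) ∧
      IsOpen ((S.comap W.subtype : Set W)ᶜ) := by
    intro S hS
    refine ⟨?_, (Submodule.closed_of_finiteDimensional _).isOpen_compl⟩
    rw [← interior_eq_empty_iff_dense_compl]
    by_contra hne
    have := Submodule.eq_top_of_nonempty_interior' _ (Set.nonempty_iff_ne_empty.2 hne)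
    exact h S hS (by simpa using this)
  have hD : Dense (⋂ S ∈ 𝒮, ((S.comap W.subtype : Set W)ᶜ)) :=
    dense_biInter_of_isOpen (fun S hS => (hdense S hS).2) h𝒮.countable fun S hS => (hdense S hS).1
  have hO' : (Subtype.val ⁻¹' O : Set W) ∈ 𝓝 (⟨x, hx⟩ : W) :=
    continuous_subtype_val.continuousAt.preimage_mem_nhds hO
  obtain ⟨y, hyO, hyD⟩ := hD.inter_nhds_nonempty hO'
  simp only [Set.mem_iInter] at hyO hyD
  exact ⟨y, hyD, y.2, fun S hS hyS => hyO S hS hyS⟩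

end Lattice

/-! ### Local structure of scattering diagrams -/

section Nonunital

variable {k : Type*} [Field k] [CharZero k] {R : Type*} [Ring R] [Algebra k R] {J : Type*}

theorem mem_of_cast_mul_mem (I : NonUnitalSubalgebra k R) {n : ℕ} (hn : n ≠ 0) {a : R}
    (h : (n : R) * a ∈ I) : a ∈ I := by
  have : a = (n : k)⁻¹ • ((n : R) * a) := by
    rw [← nsmul_eq_mul, ← Nat.cast_smul_eq_nsmul k, smul_smul,
      inv_mul_cancel₀ (Nat.cast_ne_zero.2 hn), one_smul]
  rw [this]
  exact SMulMemClass.smul_mem _ h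

theorem coeff_sol_mem_nonUnital {X : MvPowerSeries J R}
    (hX0 : MvPowerSeries.constantCoeff X = 0) (I : NonUnitalSubalgebra k R)
    (hX : ∀ β, MvPowerSeries.coeff β X ∈ I) {β : J →₀ ℕ} (hβ : β ≠ 0) :
    MvPowerSeries.coeff β (sol X) ∈ I := by
  classical
  induction hd : β.degree using Nat.strong_induction_on generalizing β with
  | _ d ih =>
    have h0 : β.degree ≠ 0 := by rwa [Ne, Finsupp.degree_eq_zero_iff]
    refine mem_of_cast_mul_mem I h0 ?_
    rw [← coeff_euler, euler_sol k hX0, MvPowerSeries.coeff_mul]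
    refine sum_mem fun p hp => ?_
    rcases eq_or_ne p.2 0 with h2 | h2
    · rw [h2, MvPowerSeries.coeff_zero_eq_constantCoeff_apply, constantCoeff_sol, mul_one]
      exact hX _
    rcases eq_or_ne p.1 0 with h1 | h1
    · rw [h1, MvPowerSeries.coeff_zero_eq_constantCoeff_apply, hX0, zero_mul]
      exact zero_mem _
    · have h3 := degree_antidiagonal hp
      have h4 : p.1.degree ≠ 0 := by rwa [Ne, Finsupp.degree_eq_zero_iff]
      exact mul_mem (hX _) (ih _ (by omega) h2 rfl)

theorem coeff_logder_mem_nonUnital {g : MvPowerSeries J R}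
    (hg0 : MvPowerSeries.constantCoeff g = 1) (I : NonUnitalSubalgebra k R)
    (hg : ∀ β, β ≠ 0 → MvPowerSeries.coeff β g ∈ I) (β : J →₀ ℕ) :
    MvPowerSeries.coeff β (logder g) ∈ I := by
  classical
  induction hd : β.degree using Nat.strong_induction_on generalizing β with
  | _ d ih =>
    rcases eq_or_ne β 0 with hβ | hβ
    · rw [hβ, MvPowerSeries.coeff_zero_eq_constantCoeff_apply, constantCoeff_logder]
      exact zero_mem _
    have h1 := congrArg (MvPowerSeries.coeff β) (euler_eq_logder_mul hg0)
    have hmem : (β, 0) ∈ Finset.HasAntidiagonal.antidiagonal β := by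
      simp [Finset.HasAntidiagonal.mem_antidiagonal]
    rw [coeff_euler, MvPowerSeries.coeff_mul, ← Finset.add_sum_erase _ _ hmem,
      MvPowerSeries.coeff_zero_eq_constantCoeff_apply, hg0, mul_one] at h1
    rw [← sub_eq_iff_eq_add] at h1
    rw [← h1]
    refine sub_mem ?_ (sum_mem fun p hp => ?_)
    · rw [← nsmul_eq_mul]
      exact nsmul_mem (hg β hβ) _
    · rw [Finset.mem_erase] at hp
      have h3 := degree_antidiagonal hp.2
      have h2 : p.2 ≠ 0 := fun h2 => hp.1 (by
        have := Finset.HasAntidiagonal.mem_antidiagonal.1 hp.2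
        rw [h2, add_zero] at this
        exact Prod.ext this h2)
      have h4 : p.2.degree ≠ 0 := by rwa [Ne, Finsupp.degree_eq_zero_iff]
      exact mul_mem (ih _ (by omega) _ rfl) (hg _ h2)

theorem logder_mul_comm {R : Type*} [CommRing R] [Algebra k R] {f g : MvPowerSeries J R}
    (hf : MvPowerSeries.constantCoeff f = 1) (hg : MvPowerSeries.constantCoeff g = 1) :
    logder (f * g) = logder f + logder g := by
  refine logder_eq (by rw [map_mul, hf, hg, mul_one]) ?_
  rw [euler_mul, euler_eq_logder_mul hf, euler_eq_logder_mul hg]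
  ring

theorem logder_one {R : Type*} [CommRing R] : logder (1 : MvPowerSeries J R) = 0 :=
  logder_eq (map_one _) (by rw [euler_one, zero_mul])

theorem logder_prod (k : Type*) [Field k] [CharZero k] {R : Type*} [CommRing R] [Algebra k R] {α : Type*} (s : Finset α)
    {f : α → MvPowerSeries J R} (hf : ∀ a ∈ s, MvPowerSeries.constantCoeff (f a) = 1) :
    logder (∏ a ∈ s, f a) = ∑ a ∈ s, logder (f a) := by
  classical
  induction s using Finset.induction_on with
  | empty => simpa using logder_one
  | insert a s ha ih =>
    rw [Finset.prod_insert ha, Finset.sum_insert ha, logder_mul_comm (k := k) (hf a (by simp)) ?_,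
      ih fun b hb => hf b (Finset.mem_insert_of_mem hb)]
    rw [map_prod]
    exact Finset.prod_eq_one fun b hb => hf b (Finset.mem_insert_of_mem hb)

theorem EqBelow.logder (k : Type*) [Field k] [CharZero k] [Algebra k R] {d : ℕ}
    {g h : MvPowerSeries J R} (hg : MvPowerSeries.constantCoeff g = 1)
    (hh : MvPowerSeries.constantCoeff h = 1) (e : EqBelow d g h) :
    EqBelow d (HDTV.logder g) (HDTV.logder h) := by
  refine EqBelow.of_sol k (constantCoeff_logder _) (constantCoeff_logder _) ?_
  rwa [sol_logder k hg, sol_logder k hh]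

end Nonunital

section Exponents

variable {k : Type u} [Field k] {ι : Type v}

/-- The Laurent polynomials whose exponents are positive multiples of `m`. -/
def positiveMultiples (k : Type u) [Field k] (m : ι → ℤ) :
    NonUnitalSubalgebra k (AddMonoidAlgebra k (ι → ℤ)) where
  carrier := {p | ∀ e, p.coeff e ≠ 0 → ∃ a : ℕ, 1 ≤ a ∧ e = (a : ℤ) • m}
  add_mem' {p q} hp hq e he := by
    rw [AddMonoidAlgebra.coeff_add, Finsupp.add_apply] at he
    by_cases h : p.coeff e = 0
    · exact hq e (by simpa [h] using he)
    · exact hp e h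
  zero_mem' e he := by simp at he
  smul_mem' c p hp e he := hp e fun h => he (by simp [h])
  mul_mem' {p q} hp hq e he := by
    classical
    have h1 : e ∈ (p * q).coeff.support := by simpa using he
    obtain ⟨a, ha, b, hb, rfl⟩ := Finset.mem_add.1 (AddMonoidAlgebra.support_coeff_mul_subset p q h1)
    obtain ⟨c, hc, rfl⟩ := hp a (by simpa using ha)
    obtain ⟨d, -, rfl⟩ := hq b (by simpa using hb)
    exact ⟨c + d, by omega, by push_cast; rw [add_smul]⟩

end Exponents

section Local

open Topology Set

variable {ι : Type v} [Fintype ι] {k : Type u} {J : Type w} [Field k]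

theorem wallsMod_mono (D : Set (Wall k ι J)) {r r' : ℕ} (h : r ≤ r') :
    wallsMod D r ⊆ wallsMod D r' := fun _ hw =>
  ⟨hw.1, fun h' => hw.2 fun β hβ => h' β (hβ.trans_le h)⟩

theorem sing_mono {D D' : Set (Wall k ι J)} {r r' : ℕ} (h : wallsMod D r ⊆ wallsMod D' r') :
    sing D r ⊆ sing D' r' := by
  rintro x (⟨w, hw, hx⟩ | ⟨w, hw, w', hw', hx⟩)
  · exact Or.inl ⟨w, h hw, hx⟩
  · exact Or.inr ⟨w, h hw, w', h hw', hx⟩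

theorem IsWall.isClosed {w : Wall k ι J} (hw : IsWall w) : IsClosed (w.cone : Set (ι → ℝ)) :=
  hw.rational.isClosed

theorem le_perp_iff {σ : PointedCone ℝ (ι → ℝ)} {n : ι → ℤ} :
    σ ≤ perp n ↔ Submodule.span ℝ (σ : Set (ι → ℝ)) ≤ LinearMap.ker (pairL n) := by
  rw [Submodule.span_le]
  rfl

theorem span_eq_ker {σ : PointedCone ℝ (ι → ℝ)} (hd : coneDim σ + 1 = Fintype.card ι) {n : ι → ℤ}
    (hn : n ≠ 0) (h : σ ≤ perp n) :
    Submodule.span ℝ (σ : Set (ι → ℝ)) = LinearMap.ker (pairL n) := by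
  refine Submodule.eq_of_le_of_finrank_eq (le_perp_iff.1 h) ?_
  have := finrank_ker_pairL hn
  rw [coneDim] at hd
  omega

theorem IsWall.dotProduct_dir {w : Wall k ι J} (hw : IsWall w) {n : ι → ℤ}
    (h : w.cone ≤ perp n) : n ⬝ᵥ w.dir = 0 := by
  have := le_perp_iff.1 h hw.tangent
  rw [LinearMap.mem_ker, pairL_apply, pair_toReal] at this
  exact_mod_cast this

theorem IsWall.coeff_logder_mem [CharZero k] {w : Wall k ι J} (hw : IsWall w) (β : J →₀ ℕ) :
    MvPowerSeries.coeff β (logder w.func) ∈ positiveMultiples k (-w.dir) := by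
  refine coeff_logder_mem_nonUnital (k := k) hw.constantCoeff (positiveMultiples k (-w.dir)) (fun γ hγ e he => ?_) β
  obtain ⟨a, ha, h⟩ := hw.exponents γ hγ e he
  exact ⟨a, ha, by rw [h, smul_neg]⟩

/-- The walls of `D` through `x` that are nontrivial to order `r`. -/
def wallsAt (D : Set (Wall k ι J)) (r : ℕ) (x : ι → ℝ) : Set (Wall k ι J) :=
  {w | w ∈ wallsMod D r ∧ x ∈ w.cone}

variable {D : Set (Wall k ι J)}

theorem IsScatteringDiagram.finite_wallsAt (hD : IsScatteringDiagram D) (r : ℕ) (x : ι → ℝ) :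
    (wallsAt D r x).Finite := (hD.finite r).subset fun _ hw => hw.1

theorem IsScatteringDiagram.funcAt_eq_prod (hD : IsScatteringDiagram D) (r : ℕ) (x : ι → ℝ) :
    funcAt D r x = ∏ w ∈ (hD.finite_wallsAt r x).toFinset, w.func :=
  finprod_mem_eq_finite_toFinset_prod _ (hD.finite_wallsAt r x)

theorem IsScatteringDiagram.constantCoeff_funcAt (hD : IsScatteringDiagram D) (r : ℕ)
    (x : ι → ℝ) : MvPowerSeries.constantCoeff (funcAt D r x) = 1 := by
  rw [hD.funcAt_eq_prod, map_prod]
  refine Finset.prod_eq_one fun w hw => ?_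
  rw [Set.Finite.mem_toFinset] at hw
  exact (hD.isWall w hw.1.1).constantCoeff

theorem IsScatteringDiagram.logder_funcAt [CharZero k] (hD : IsScatteringDiagram D) (r : ℕ)
    (x : ι → ℝ) :
    logder (funcAt D r x) = ∑ w ∈ (hD.finite_wallsAt r x).toFinset, logder w.func := by
  rw [hD.funcAt_eq_prod, logder_prod k]
  intro w hw
  rw [Set.Finite.mem_toFinset] at hw
  exact (hD.isWall w hw.1.1).constantCoeff

theorem IsScatteringDiagram.eqBelow_funcAt (hD : IsScatteringDiagram D) {r r' : ℕ} (h : r ≤ r')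
    (x : ι → ℝ) : EqBelow r (funcAt D r' x) (funcAt D r x) := by
  classical
  rw [hD.funcAt_eq_prod, hD.funcAt_eq_prod]
  have hsub : (hD.finite_wallsAt r x).toFinset ⊆ (hD.finite_wallsAt r' x).toFinset := by
    rw [Set.Finite.toFinset_subset_toFinset]
    exact fun w hw => ⟨wallsMod_mono D h hw.1, hw.2⟩
  rw [← Finset.prod_sdiff hsub]
  have key : EqBelow r (∏ w ∈ (hD.finite_wallsAt r' x).toFinset \
      (hD.finite_wallsAt r x).toFinset, w.func) 1 := by
    rw [← Finset.prod_const_one (s := (hD.finite_wallsAt r' x).toFinset \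
      (hD.finite_wallsAt r x).toFinset)]
    refine EqBelow.prod fun w hw => ?_
    rw [Finset.mem_sdiff, Set.Finite.mem_toFinset, Set.Finite.mem_toFinset] at hw
    by_contra hne
    exact hw.2 ⟨⟨hw.1.1.1, hne⟩, hw.1.2⟩
  have := key.mul (EqBelow.refl r (∏ w ∈ (hD.finite_wallsAt r x).toFinset, w.func))
  rwa [one_mul] at this

/-- All walls through `x` lie in the hyperplane `n^⊥`. -/
def IsNormalAt (D : Set (Wall k ι J)) (r : ℕ) (x : ι → ℝ) (n : ι → ℤ) : Prop :=
  ∀ w ∈ wallsMod D r, x ∈ w.cone → w.cone ≤ perp n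

theorem IsScatteringDiagram.coeff_logder_funcAt_mem [CharZero k] (hD : IsScatteringDiagram D)
    {r : ℕ} {x : ι → ℝ} {n : ι → ℤ} (hn : IsNormalAt D r x n) (β : J →₀ ℕ) :
    MvPowerSeries.coeff β (logder (funcAt D r x)) ∈ dlogKer (k := k) n := by
  rw [hD.logder_funcAt, map_sum]
  refine sum_mem fun w hw => ?_
  rw [Set.Finite.mem_toFinset] at hw
  refine mem_dlogKer_of_coeff fun e he => ?_
  have hW := hD.isWall w hw.1.1
  obtain ⟨a, -, rfl⟩ := hW.coeff_logder_mem β e he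
  rw [dotProduct_smul, dotProduct_neg, hW.dotProduct_dir (hn w hw.1 hw.2), neg_zero, smul_zero]

theorem IsScatteringDiagram.crossing_funcAt [CharZero k] (hD : IsScatteringDiagram D)
    {r : ℕ} {x : ι → ℝ} {n : ι → ℤ} (hn : IsNormalAt D r x n) :
    crossing (funcAt D r x) n = sol (wallField n (logder (funcAt D r x))) :=
  crossing_eq_sol (hD.constantCoeff_funcAt r x) (hD.coeff_logder_funcAt_mem hn)

theorem funcAt_of_notMem_supp {r : ℕ} {x : ι → ℝ} (hx : x ∉ supp D r) : funcAt D r x = 1 := by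
  rw [funcAt, show {w : Wall k ι J | w ∈ wallsMod D r ∧ x ∈ w.cone} = ∅ from
    Set.eq_empty_of_forall_notMem fun w hw => hx ⟨w, hw.1, hw.2⟩]
  simp

/-- Outside the singular locus the walls through a point of the support span the same
hyperplane. -/
theorem IsScatteringDiagram.exists_isNormalAt (hD : IsScatteringDiagram D) {r : ℕ} {x : ι → ℝ}
    (hx : x ∉ sing D r) (hs : x ∈ supp D r) : ∃ n, IsPrimitive n ∧ pair n x = 0 ∧
      IsNormalAt D r x n := by
  obtain ⟨w, hw, hxw⟩ := hs
  have hW := hD.isWall w hw.1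
  obtain ⟨n, hn, e⟩ := exists_normal hW.rational hW.codim_one
  have hperp : w.cone ≤ perp n := le_perp_iff.2 e.le
  refine ⟨n, hn, hperp hxw, fun w' hw' hxw' => ?_⟩
  have hW' := hD.isWall w' hw'.1
  have hlt : ¬ coneDim (w.cone ⊓ w'.cone) + 2 ≤ Fintype.card ι := fun h =>
    hx (Or.inr ⟨w, hw, w', hw', hxw, hxw', h⟩)
  have key : ∀ {v : Wall k ι J}, IsWall v → w.cone ⊓ w'.cone ≤ v.cone →
      Submodule.span ℝ ((w.cone ⊓ w'.cone : PointedCone ℝ (ι → ℝ)) : Set (ι → ℝ)) =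
        Submodule.span ℝ (v.cone : Set (ι → ℝ)) := by
    intro v hv hle
    refine Submodule.eq_of_le_of_finrank_le (Submodule.span_mono hle) ?_
    have := hv.codim_one
    rw [coneDim] at this hlt
    omega
  rw [le_perp_iff, ← key hW' inf_le_right, key hW inf_le_left, e]

/-- Near a point outside the singular locus there are no singular points, no further walls appear,
and the walls through the point fill their spans. -/
theorem IsScatteringDiagram.eventually_nhds (hD : IsScatteringDiagram D) {r : ℕ} {x : ι → ℝ}
    (hx : x ∉ sing D r) : ∀ᶠ y in 𝓝 x, y ∉ sing D r ∧
      (∀ w ∈ wallsMod D r, y ∈ w.cone → x ∈ w.cone) ∧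
      ∀ w ∈ wallsMod D r, x ∈ w.cone → y ∈ Submodule.span ℝ (w.cone : Set (ι → ℝ)) →
        y ∈ w.cone := by
  have h1 : ∀ᶠ y in 𝓝 x, ∀ w ∈ wallsMod D r, y ∈ w.cone → x ∈ w.cone := by
    rw [(hD.finite r).eventually_all]
    intro w hw
    by_cases hxw : x ∈ w.cone
    · exact Filter.Eventually.of_forall fun _ _ => hxw
    · filter_upwards [(hD.isWall w hw.1).isClosed.isOpen_compl.mem_nhds hxw] with y hy hyw
      exact absurd hyw hy
  have h2 : ∀ᶠ y in 𝓝 x, ∀ w ∈ wallsMod D r, x ∈ w.cone →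
      y ∈ Submodule.span ℝ (w.cone : Set (ι → ℝ)) → y ∈ w.cone := by
    rw [(hD.finite r).eventually_all]
    intro w hw
    by_cases hxw : x ∈ w.cone
    · have h3 : x ∉ intrinsicFrontier ℝ (w.cone : Set (ι → ℝ)) := fun h => hx (Or.inl ⟨w, hw, h⟩)
      rw [mem_intrinsicFrontier_cone (hD.isWall w hw.1).isClosed, not_and, not_not] at h3
      filter_upwards [mem_nhdsWithin_iff_eventually.1 (h3 hxw)] with y hy _ hyw
      exact hy hyw
    · exact Filter.Eventually.of_forall fun _ h => absurd h hxw
  filter_upwards [h1, eventually_eventually_nhds.2 h2, h2] with y hy1 hy2 hy3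
  refine ⟨?_, hy1, hy3⟩
  rintro (⟨w, hw, hyw⟩ | ⟨w, hw, w', hw', hyw, hyw', hd⟩)
  · rw [mem_intrinsicFrontier_cone (hD.isWall w hw.1).isClosed] at hyw
    refine hyw.2 (mem_nhdsWithin_iff_eventually.2 ?_)
    filter_upwards [hy2] with z hz hzw
    exact hz w hw (hy1 w hw hyw.1) hzw
  · exact hx (Or.inr ⟨w, hw, w', hw', hy1 w hw hyw, hy1 w' hw' hyw', hd⟩)

/-- The hyperplane containing the walls at a point outside the singular locus determines the
diagram nearby. -/
theorem IsScatteringDiagram.eventually_funcAt (hD : IsScatteringDiagram D) {r : ℕ} {x : ι → ℝ}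
    (hx : x ∉ sing D r) {n : ι → ℤ} (hn0 : n ≠ 0) (hn : IsNormalAt D r x n) :
    ∀ᶠ y in 𝓝 x, y ∉ sing D r ∧ IsNormalAt D r y n ∧ (pair n y ≠ 0 → y ∉ supp D r) ∧
      (pair n y = 0 → funcAt D r y = funcAt D r x) := by
  filter_upwards [hD.eventually_nhds hx] with y ⟨h1, h2, h3⟩
  refine ⟨h1, fun w hw hy => hn w hw (h2 w hw hy), ?_, fun h => ?_⟩
  · rintro h ⟨w, hw, hyw⟩
    exact h (hn w hw (h2 w hw hyw) hyw)
  · have : {w : Wall k ι J | w ∈ wallsMod D r ∧ y ∈ w.cone} =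
        {w : Wall k ι J | w ∈ wallsMod D r ∧ x ∈ w.cone} := by
      ext w
      refine ⟨fun hw => ⟨hw.1, h2 w hw.1 hw.2⟩, fun hw => ⟨hw.1, h3 w hw.1 hw.2 ?_⟩⟩
      rw [span_eq_ker (hD.isWall w hw.1.1).codim_one hn0 (hn w hw.1 hw.2)]
      exact h
    rw [funcAt, funcAt, this]

/-- The singular locus is contained in finitely many subspaces of codimension at least two. -/
theorem IsScatteringDiagram.exists_small_cover (hD : IsScatteringDiagram D) (r : ℕ) :
    ∃ 𝒮 : Set (Submodule ℝ (ι → ℝ)), 𝒮.Finite ∧ (∀ S ∈ 𝒮, IsSmall S) ∧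
      ∀ x ∈ sing D r, ∃ S ∈ 𝒮, x ∈ S := by
  classical
  have h1 : ∀ w ∈ wallsMod D r, ∃ 𝒮 : Set (Submodule ℝ (ι → ℝ)), 𝒮.Finite ∧
      (∀ S ∈ 𝒮, IsSmall S) ∧
      ∀ x ∈ intrinsicFrontier ℝ (w.cone : Set (ι → ℝ)), ∃ S ∈ 𝒮, x ∈ S := by
    intro w hw
    have hW := hD.isWall w hw.1
    obtain ⟨S, G, -, e⟩ := hW.rational.exists_finset
    refine ⟨{S | ∃ T ⊆ G, S = Submodule.span ℝ (T : Set (ι → ℝ)) ∧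
      S < Submodule.span ℝ (G : Set (ι → ℝ))}, ?_, ?_, ?_⟩
    · refine (G.powerset.finite_toSet.image fun T : Finset (ι → ℝ) =>
        Submodule.span ℝ (T : Set (ι → ℝ))).subset ?_
      rintro _ ⟨T, hT, rfl, -⟩
      exact ⟨T, by simpa using hT, rfl⟩
    · rintro S ⟨T, -, -, hlt⟩
      have h2 := Submodule.finrank_lt_finrank_of_lt hlt
      have h3 := hW.codim_one
      rw [e, coneDim, span_hull] at h3
      rw [IsSmall]
      omega
    · intro x hx
      rw [e] at hx
      obtain ⟨T, hT, hxT, hlt⟩ := exists_span_of_mem_intrinsicFrontier hx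
      exact ⟨_, ⟨T, hT, rfl, hlt⟩, hxT⟩
  choose! 𝒮 hfin hsmall hcov using h1
  refine ⟨(⋃ w ∈ wallsMod D r, 𝒮 w) ∪ {S | IsSmall S ∧ ∃ w ∈ wallsMod D r, ∃ w' ∈ wallsMod D r,
    S = Submodule.span ℝ ((w.cone ⊓ w'.cone : PointedCone ℝ (ι → ℝ)) : Set (ι → ℝ))},
    ((hD.finite r).biUnion hfin).union ?_, ?_, ?_⟩
  · refine (((hD.finite r).prod (hD.finite r)).image fun p : Wall k ι J × Wall k ι J =>
      Submodule.span ℝ ((p.1.cone ⊓ p.2.cone : PointedCone ℝ (ι → ℝ)) : Set (ι → ℝ))).subset ?_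
    rintro _ ⟨-, w, hw, w', hw', rfl⟩
    exact ⟨(w, w'), ⟨hw, hw'⟩, rfl⟩
  · rintro S (hS | hS)
    · obtain ⟨w, hw, hS⟩ := Set.mem_iUnion₂.1 hS
      exact hsmall w hw S hS
    · exact hS.1
  · rintro x (⟨w, hw, hx⟩ | ⟨w, hw, w', hw', hx, hx', hd⟩)
    · obtain ⟨S, hS, hxS⟩ := hcov w hw x hx
      exact ⟨S, Or.inl (Set.mem_iUnion₂.2 ⟨w, hw, hS⟩), hxS⟩
    · exact ⟨_, Or.inr ⟨hd, w, hw, w', hw', rfl⟩, Submodule.subset_span ⟨hx, hx'⟩⟩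

/-- The support is contained in finitely many rational hyperplanes. -/
theorem IsScatteringDiagram.exists_normals (hD : IsScatteringDiagram D) (r : ℕ) :
    ∃ A : Set (ι → ℤ), A.Finite ∧ (∀ n ∈ A, IsPrimitive n) ∧
      ∀ w ∈ wallsMod D r, ∃ n ∈ A, w.cone ≤ perp n := by
  have h1 : ∀ w ∈ wallsMod D r, ∃ n, IsPrimitive n ∧ w.cone ≤ perp n := by
    intro w hw
    have hW := hD.isWall w hw.1
    obtain ⟨n, hn, e⟩ := exists_normal hW.rational hW.codim_one
    exact ⟨n, hn, le_perp_iff.2 e.le⟩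
  choose! n hn hle using h1
  refine ⟨n '' wallsMod D r, (hD.finite r).image _, ?_, fun w hw => ⟨_, ⟨w, hw, rfl⟩, hle w hw⟩⟩
  rintro _ ⟨w, hw, rfl⟩
  exact hn w hw

end Local

/-! ### Path ordered products -/

section Paths

open Topology Set

variable {ι : Type v} [Fintype ι] {k : Type u} {J : Type w} [Field k]

/-- The conditions on a path `γ` in the definition of a path ordered product, with the list `l` of
the crossing times together with the normals. -/
structure IsPathList (D : Set (Wall k ι J)) (r : ℕ) (γ : ℝ → ι → ℝ)
    (l : List (ℝ × (ι → ℤ))) : Prop where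
  continuousOn : ContinuousOn γ (Icc 0 1)
  notMem_sing : ∀ t ∈ Icc (0 : ℝ) 1, γ t ∉ sing D r
  start_notMem : γ 0 ∉ supp D r
  end_notMem : γ 1 ∉ supp D r
  sorted : l.Pairwise fun p q => p.1 < q.1
  times : ∀ u, (∃ p ∈ l, p.1 = u) ↔ u ∈ Icc (0 : ℝ) 1 ∧ γ u ∈ supp D r
  crossing : ∀ p ∈ l, IsCrossing D r γ p.1 p.2

/-- The operator of a path ordered product. -/
def pathElt (D : Set (Wall k ι J)) (r : ℕ) (γ : ℝ → ι → ℝ) :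
    List (ℝ × (ι → ℤ)) → MvPowerSeries J (Module.End k (AddMonoidAlgebra k (ι → ℤ)))
  | [] => 1
  | p :: l => pathElt D r γ l * crossing (funcAt D r (γ p.1)) p.2

theorem pathElt_append (D : Set (Wall k ι J)) (r : ℕ) (γ : ℝ → ι → ℝ)
    (l l' : List (ℝ × (ι → ℤ))) :
    pathElt D r γ (l ++ l') = pathElt D r γ l' * pathElt D r γ l := by
  induction l with
  | nil => simp [pathElt]
  | cons p l ih => rw [List.cons_append, pathElt, ih, pathElt, mul_assoc]

theorem pathElt_map {D : Set (Wall k ι J)} {r : ℕ} {γ γ' : ℝ → ι → ℝ} {φ : ℝ → ℝ}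
    {l : List (ℝ × (ι → ℤ))} (h : ∀ p ∈ l, γ' (φ p.1) = γ p.1) :
    pathElt D r γ' (l.map fun p => (φ p.1, p.2)) = pathElt D r γ l := by
  induction l with
  | nil => rfl
  | cons p l ih =>
    rw [List.map_cons, pathElt, pathElt, ih fun q hq => h q (List.mem_cons_of_mem _ hq),
      h p List.mem_cons_self]

theorem foldl_wallCrossing (D : Set (Wall k ι J)) (r : ℕ) (γ : ℝ → ι → ℝ)
    (l : List (ℝ × (ι → ℤ))) (f : ScatRing k ι J → ScatRing k ι J) :
    (l.map fun p => wallCrossing (funcAt D r (γ p.1)) p.2).foldl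
      (fun before next => next ∘ before) f = act (pathElt D r γ l) ∘ f := by
  induction l generalizing f with
  | nil =>
    funext p
    simp [pathElt, act_one]
  | cons p l ih =>
    rw [List.map_cons, List.foldl_cons, ih, pathElt, wallCrossing_eq_act]
    funext q
    simp [act_mul]

theorem IsPathList.isPathOrderedProduct {D : Set (Wall k ι J)} {r : ℕ} {γ : ℝ → ι → ℝ}
    {l : List (ℝ × (ι → ℤ))} (h : IsPathList D r γ l) :
    IsPathOrderedProduct D r γ (act (pathElt D r γ l)) := by
  refine ⟨h.continuousOn, h.notMem_sing, h.start_notMem, h.end_notMem, l.length,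
    fun a => (l.get a).1, fun a => (l.get a).2, ?_, ?_, fun a => h.crossing _ (l.get_mem a), ?_⟩
  · intro a b hab
    exact List.pairwise_iff_get.1 h.sorted a b hab
  · ext u
    rw [Set.mem_ofPred_eq, ← h.times]
    constructor
    · rintro ⟨a, rfl⟩
      exact ⟨_, l.get_mem a, rfl⟩
    · rintro ⟨p, hp, rfl⟩
      obtain ⟨a, rfl⟩ := List.get_of_mem hp
      exact ⟨a, rfl⟩
  · have := foldl_wallCrossing D r γ l id
    rw [Function.comp_id] at this
    rw [← this]
    congr 1
    conv_lhs => rw [← List.ofFn_get l, List.map_ofFn]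
    rfl

theorem IsPathOrderedProduct.exists_list {D : Set (Wall k ι J)} {r : ℕ} {γ : ℝ → ι → ℝ}
    {θ : ScatRing k ι J → ScatRing k ι J} (h : IsPathOrderedProduct D r γ θ) :
    ∃ l, IsPathList D r γ l ∧ θ = act (pathElt D r γ l) := by
  obtain ⟨h1, h2, h3, h4, s, t, n, ht, hr, hc, rfl⟩ := h
  refine ⟨List.ofFn fun a => (t a, n a), ⟨h1, h2, h3, h4, ?_, ?_, ?_⟩, ?_⟩
  · rw [List.pairwise_ofFn]
    exact fun a b hab => ht hab
  · intro u
    have := Set.ext_iff.1 hr u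
    rw [Set.mem_ofPred_eq] at this
    rw [← this]
    simp [List.mem_ofFn]
  · intro p hp
    obtain ⟨a, rfl⟩ := (List.mem_ofFn' _ _).1 hp
    exact hc a
  · rw [← Function.comp_id (act _), ← foldl_wallCrossing, List.map_ofFn]
    rfl

/-- The points `a` and `b` are joined by a path with path ordered product `g`. -/
def Joined (D : Set (Wall k ι J)) (r : ℕ) (a b : ι → ℝ)
    (g : MvPowerSeries J (Module.End k (AddMonoidAlgebra k (ι → ℤ)))) : Prop :=
  ∃ γ l, IsPathList D r γ l ∧ γ 0 = a ∧ γ 1 = b ∧ g = pathElt D r γ l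

theorem IsConsistent.eqBelow {D : Set (Wall k ι J)} (hD : IsConsistent D) {r : ℕ} {a b : ι → ℝ}
    {g h : MvPowerSeries J (Module.End k (AddMonoidAlgebra k (ι → ℤ)))}
    (hg : Joined D r a b g) (hh : Joined D r a b h) : EqBelow r g h := by
  obtain ⟨γ, l, h1, h2, h3, rfl⟩ := hg
  obtain ⟨γ', l', h1', h2', h3', rfl⟩ := hh
  exact EqBelow.of_act (hD r γ γ' _ _ h1.isPathOrderedProduct h1'.isPathOrderedProduct
    (h2.trans h2'.symm) (h3.trans h3'.symm))

theorem IsPathList.mem_Ioo {D : Set (Wall k ι J)} {r : ℕ} {γ : ℝ → ι → ℝ}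
    {l : List (ℝ × (ι → ℤ))} (h : IsPathList D r γ l) {p : ℝ × (ι → ℤ)} (hp : p ∈ l) :
    p.1 ∈ Ioo (0 : ℝ) 1 := by
  obtain ⟨h1, h2⟩ := (h.times p.1).1 ⟨p, hp, rfl⟩
  refine ⟨h1.1.lt_of_ne fun e => h.start_notMem (e ▸ h2), h1.2.lt_of_ne fun e => ?_⟩
  rw [e] at h2
  exact h.end_notMem h2

/-- Crossings are insensitive to affine changes of time near the crossing time. -/
theorem IsCrossing.reparam {D : Set (Wall k ι J)} {r : ℕ} {γ γ' : ℝ → ι → ℝ} {t t' c δ : ℝ}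
    {n : ι → ℤ} (h : IsCrossing D r γ t n) (hc : 0 < c) (hδ : 0 < δ)
    (hγ : ∀ s, |s| < δ → γ' (t' + s) = γ (t + c * s)) : IsCrossing D r γ' t' n := by
  have e : γ' t' = γ t := by simpa using hγ 0 (by simpa using hδ)
  obtain ⟨h1, h2, h3, ε, hε, h4, h5⟩ := h
  refine ⟨by rwa [e], h2, by rwa [e], min δ (ε / c), lt_min hδ (div_pos hε hc), ?_, ?_⟩
  · intro s hs
    have hs1 := hs.1
    have hs2 := hs.2
    have hd := min_le_left δ (ε / c)
    have he := min_le_right δ (ε / c)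
    have := hγ (s - t') (by rw [abs_lt]; constructor <;> linarith)
    rw [add_sub_cancel] at this
    rw [this]
    refine h4 _ ⟨?_, ?_⟩
    · have h6 : c * (t' - s) < c * (ε / c) := mul_lt_mul_of_pos_left (by linarith) hc
      rw [mul_div_cancel₀ _ hc.ne'] at h6
      linarith
    · have : c * (s - t') < 0 := mul_neg_of_pos_of_neg hc (by linarith)
      linarith
  · intro s hs
    have hs1 := hs.1
    have hs2 := hs.2
    have hd := min_le_left δ (ε / c)
    have he := min_le_right δ (ε / c)
    have := hγ (s - t') (by rw [abs_lt]; constructor <;> linarith)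
    rw [add_sub_cancel] at this
    rw [this]
    refine h5 _ ⟨?_, ?_⟩
    · have : 0 < c * (s - t') := mul_pos hc (by linarith)
      linarith
    · have h6 : c * (s - t') < c * (ε / c) := mul_lt_mul_of_pos_left (by linarith) hc
      rw [mul_div_cancel₀ _ hc.ne'] at h6
      linarith

/-- Concatenation of paths, each run through in half the time. -/
theorem Joined.trans {D : Set (Wall k ι J)} {r : ℕ} {a b c : ι → ℝ}
    {g h : MvPowerSeries J (Module.End k (AddMonoidAlgebra k (ι → ℤ)))}
    (hg : Joined D r a b g) (hh : Joined D r b c h) : Joined D r a c (h * g) := by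
  classical
  obtain ⟨γ, l, hl, rfl, hb, rfl⟩ := hg
  obtain ⟨γ', l', hl', hb', rfl, rfl⟩ := hh
  set η : ℝ → ι → ℝ := fun u => if u ≤ 1 / 2 then γ (2 * u) else γ' (2 * u - 1) with hη
  have η1 : ∀ u, u ≤ 1 / 2 → η u = γ (2 * u) := fun u hu => if_pos hu
  have η2 : ∀ u, 1 / 2 ≤ u → η u = γ' (2 * u - 1) := fun u hu => by
    rcases hu.eq_or_lt with rfl | hu
    · rw [η1 _ le_rfl]
      norm_num
      rw [hb, hb']
    · exact if_neg (not_le.2 hu)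
  have e1 : ∀ p ∈ l, η (p.1 / 2) = γ p.1 := fun p hp => by
    have := (hl.mem_Ioo hp).2
    rw [η1 _ (by linarith), mul_div_cancel₀ _ two_ne_zero]
  have e2 : ∀ p ∈ l', η ((1 + p.1) / 2) = γ' p.1 := fun p hp => by
    have := (hl'.mem_Ioo hp).1
    rw [η2 _ (by linarith)]
    congr 1
    ring
  refine ⟨η, l.map (fun p => (p.1 / 2, p.2)) ++ l'.map (fun p => ((1 + p.1) / 2, p.2)),
    ⟨?_, ?_, ?_, ?_, ?_, ?_, ?_⟩, ?_, ?_, ?_⟩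
  · have c1 : ContinuousOn η (Icc 0 (1 / 2)) := by
      refine ContinuousOn.congr (f := fun u => γ (2 * u)) ?_ fun u hu => η1 u hu.2
      refine hl.continuousOn.comp (by fun_prop) fun u hu => ?_
      have := hu.1
      have := hu.2
      constructor <;> linarith
    have c2 : ContinuousOn η (Icc (1 / 2) 1) := by
      refine ContinuousOn.congr (f := fun u => γ' (2 * u - 1)) ?_ fun u hu => η2 u hu.1
      refine hl'.continuousOn.comp (by fun_prop) fun u hu => ?_
      have := hu.1
      have := hu.2
      constructor <;> linarith
    have := c1.union_of_isClosed c2 isClosed_Icc isClosed_Icc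
    rwa [Icc_union_Icc_eq_Icc (by norm_num) (by norm_num)] at this
  · intro t ht
    rcases le_total t (1 / 2) with h | h
    · rw [η1 t h]
      have := ht.1
      exact hl.notMem_sing _ ⟨by linarith, by linarith⟩
    · rw [η2 t h]
      have := ht.2
      exact hl'.notMem_sing _ ⟨by linarith, by linarith⟩
  · rw [η1 0 (by norm_num), mul_zero]
    exact hl.start_notMem
  · rw [η2 1 (by norm_num)]
    norm_num
    exact hl'.end_notMem
  · rw [List.pairwise_append]
    refine ⟨?_, ?_, ?_⟩
    · rw [List.pairwise_map]
      exact hl.sorted.imp fun h => by dsimp only; linarith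
    · rw [List.pairwise_map]
      exact hl'.sorted.imp fun h => by dsimp only; linarith
    · intro p hp q hq
      rw [List.mem_map] at hp
      obtain ⟨p, hp, rfl⟩ := hp
      rw [List.mem_map] at hq
      obtain ⟨q, hq, rfl⟩ := hq
      have := (hl.mem_Ioo hp).2
      have := (hl'.mem_Ioo hq).1
      dsimp only
      linarith
  · intro u
    constructor
    · rintro ⟨p, hp, rfl⟩
      rw [List.mem_append] at hp
      rcases hp with hp | hp
      · rw [List.mem_map] at hp
        obtain ⟨p, hp, rfl⟩ := hp
        dsimp only
        rw [e1 p hp]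
        have h1 := hl.mem_Ioo hp
        have := h1.1
        have := h1.2
        exact ⟨⟨by linarith, by linarith⟩, ((hl.times p.1).1 ⟨p, hp, rfl⟩).2⟩
      · rw [List.mem_map] at hp
        obtain ⟨p, hp, rfl⟩ := hp
        dsimp only
        rw [e2 p hp]
        have h1 := hl'.mem_Ioo hp
        have := h1.1
        have := h1.2
        exact ⟨⟨by linarith, by linarith⟩, ((hl'.times p.1).1 ⟨p, hp, rfl⟩).2⟩
    · rintro ⟨hu, hs⟩
      have hu1 := hu.1
      have hu2 := hu.2
      rcases le_total u (1 / 2) with h | h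
      · rw [η1 u h] at hs
        obtain ⟨p, hp, e⟩ := (hl.times (2 * u)).2 ⟨⟨by linarith, by linarith⟩, hs⟩
        exact ⟨_, List.mem_append_left _ (List.mem_map_of_mem hp), by dsimp only; rw [e]; ring⟩
      · rw [η2 u h] at hs
        obtain ⟨p, hp, e⟩ := (hl'.times (2 * u - 1)).2 ⟨⟨by linarith, by linarith⟩, hs⟩
        exact ⟨_, List.mem_append_right _ (List.mem_map_of_mem hp), by dsimp only; rw [e]; ring⟩
  · intro p hp
    rw [List.mem_append] at hp
    rcases hp with hp | hp
    · rw [List.mem_map] at hp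
      obtain ⟨p, hp, rfl⟩ := hp
      have h1 := (hl.mem_Ioo hp).2
      refine (hl.crossing p hp).reparam two_pos (δ := (1 - p.1) / 2) (by linarith) fun s hs => ?_
      rw [abs_lt] at hs
      dsimp only
      rw [η1 _ (by linarith)]
      congr 1
      ring
    · rw [List.mem_map] at hp
      obtain ⟨p, hp, rfl⟩ := hp
      have h1 := (hl'.mem_Ioo hp).1
      refine (hl'.crossing p hp).reparam two_pos (δ := p.1 / 2) (by linarith) fun s hs => ?_
      rw [abs_lt] at hs
      dsimp only
      rw [η2 _ (by linarith)]
      congr 1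
      ring
  · rw [η1 0 (by norm_num), mul_zero]
  · rw [η2 1 (by norm_num)]
    norm_num
  · rw [pathElt_append, pathElt_map (φ := fun t => t / 2) e1,
      pathElt_map (φ := fun t => (1 + t) / 2) e2]

theorem crossing_one [CharZero k] (n : ι → ℤ) : crossing (1 : ScatRing k ι J) n = 1 := by
  have h : logder (1 : ScatRing k ι J) = 0 := logder_one
  rw [crossing_eq_sol (map_one _) fun β => by rw [h, map_zero]; exact zero_mem _, h]
  have : wallField n (0 : ScatRing k ι J) = 0 := MvPowerSeries.ext fun β =>
    LinearMap.ext fun a => by rw [coeff_wallField_apply]; simp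
  rw [this, sol_zero k]

/-- A segment with at most one crossing. -/
theorem joined_segment [CharZero k] {D : Set (Wall k ι J)} {r : ℕ} {a b : ι → ℝ} {n : ι → ℤ}
    (hn : IsPrimitive n) (ha : pair n a < 0) (hb : 0 < pair n b) {t₀ : ℝ}
    (h0 : pair n (a + t₀ • (b - a)) = 0)
    (hsing : ∀ t ∈ Icc (0 : ℝ) 1, a + t • (b - a) ∉ sing D r)
    (hsupp : ∀ t ∈ Icc (0 : ℝ) 1, a + t • (b - a) ∈ supp D r → t = t₀)
    (hnorm : IsNormalAt D r (a + t₀ • (b - a)) n) :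
    Joined D r a b (crossing (funcAt D r (a + t₀ • (b - a))) n) := by
  have hpos : 0 < pair n b - pair n a := by linarith
  have hval : ∀ t, pair n (a + t • (b - a)) = (t - t₀) * (pair n b - pair n a) := fun t => by
    rw [pair_add, pair_smul, pair_sub] at h0 ⊢
    linarith
  have ht0 : t₀ ∈ Ioo (0 : ℝ) 1 := by
    have h1 := hval 0
    have h2 := hval 1
    rw [zero_smul, add_zero] at h1
    rw [one_smul, add_sub_cancel] at h2
    constructor <;> nlinarith
  have hγ0 : a + (0 : ℝ) • (b - a) = a := by simp
  have hγ1 : a + (1 : ℝ) • (b - a) = b := by simp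
  have hcont : ContinuousOn (fun t : ℝ => a + t • (b - a)) (Icc 0 1) := by fun_prop
  have hst : (fun t : ℝ => a + t • (b - a)) 0 ∉ supp D r := fun h =>
    ht0.1.ne (hsupp 0 ⟨le_rfl, zero_le_one⟩ h)
  have hen : (fun t : ℝ => a + t • (b - a)) 1 ∉ supp D r := fun h =>
    ht0.2.ne' (hsupp 1 ⟨zero_le_one, le_rfl⟩ h)
  by_cases hs : a + t₀ • (b - a) ∈ supp D r
  · refine ⟨fun t => a + t • (b - a), [(t₀, n)], ⟨hcont, hsing, hst, hen, by simp, ?_, ?_⟩, hγ0,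
      hγ1, by simp [pathElt]⟩
    · intro u
      simp only [List.mem_singleton, exists_eq_left]
      constructor
      · rintro rfl
        exact ⟨⟨ht0.1.le, ht0.2.le⟩, hs⟩
      · rintro ⟨hu, h⟩
        exact (hsupp u hu h).symm
    · intro p hp
      rw [List.mem_singleton] at hp
      subst hp
      refine ⟨hs, hn, hnorm, 1, one_pos, fun s hs => ?_, fun s hs => ?_⟩
      · dsimp only
        rw [hval]
        exact mul_neg_of_neg_of_pos (by have := hs.2; linarith) hpos
      · dsimp only
        rw [hval]
        exact mul_pos (by have := hs.1; linarith) hpos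
  · rw [funcAt_of_notMem_supp hs, crossing_one]
    refine ⟨fun t => a + t • (b - a), [], ⟨hcont, hsing, hst, hen, by simp, ?_, by simp⟩, hγ0, hγ1,
      by simp [pathElt]⟩
    intro u
    simp only [List.not_mem_nil, false_and, exists_false, false_iff]
    rintro ⟨hu, h⟩
    have := hsupp u hu h
    subst this
    exact hs h

theorem joined_of_disjoint {D : Set (Wall k ι J)} {r : ℕ} {a b : ι → ℝ}
    (hsing : ∀ t ∈ Icc (0 : ℝ) 1, a + t • (b - a) ∉ sing D r)
    (hsupp : ∀ t ∈ Icc (0 : ℝ) 1, a + t • (b - a) ∉ supp D r) : Joined D r a b 1 := by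
  refine ⟨fun t => a + t • (b - a), [], ⟨by fun_prop, hsing, hsupp 0 ⟨le_rfl, zero_le_one⟩,
    hsupp 1 ⟨zero_le_one, le_rfl⟩, by simp, ?_, by simp⟩, by simp, by simp, by simp [pathElt]⟩
  intro u
  simp only [List.not_mem_nil, false_and, exists_false, false_iff]
  exact fun h => hsupp u h.1 h.2

/-- Induction along an interval with finitely many exceptional times. -/
theorem interval_induction {T : Set ℝ} (hT : T.Finite) {P : ℝ → ℝ → Prop}
    (hbase : ∀ a b, a ≤ b → a ∉ T → b ∉ T → (T ∩ Icc a b).Subsingleton → P a b)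
    (htrans : ∀ a b c, a ≤ b → b ≤ c → b ∉ T → P a b → P b c → P a c) {a b : ℝ} (hab : a ≤ b)
    (ha : a ∉ T) (hb : b ∉ T) : P a b := by
  induction hc : (T ∩ Icc a b).ncard using Nat.strong_induction_on generalizing a b with
  | _ m ih =>
    have hfin : (T ∩ Icc a b).Finite := hT.inter_of_left _
    by_cases hs : (T ∩ Icc a b).Subsingleton
    · exact hbase a b hab ha hb hs
    · rw [Set.not_subsingleton_iff] at hs
      obtain ⟨t, ht, t', ht', hne⟩ := hs
      wlog hlt : t < t' generalizing t t'
      · exact this t' ht' t ht hne.symm (lt_of_le_of_ne (not_lt.1 hlt) hne.symm)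
      obtain ⟨c, hct, hcT⟩ := (Set.Ioo_infinite hlt).exists_notMem_finite hT
      have hac : a ≤ c := ht.2.1.trans hct.1.le
      have hcb : c ≤ b := hct.2.le.trans ht'.2.2
      refine htrans a c b hac hcb hcT (ih _ ?_ hac ha hcT rfl) (ih _ ?_ hcb hcT hb rfl)
      · rw [← hc]
        refine Set.ncard_lt_ncard ⟨fun s hs => ⟨hs.1, hs.2.1, hs.2.2.trans hcb⟩, fun h => ?_⟩ hfin
        have := (h ht').2.2
        linarith [hct.2]
      · rw [← hc]
        refine Set.ncard_lt_ncard ⟨fun s hs => ⟨hs.1, hac.trans hs.2.1, hs.2.2⟩, fun h => ?_⟩ hfin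
        have := (h ht).2.1
        linarith [hct.1]

end Paths

/-! ### Generic segments -/

section Frames

open Topology Set

variable {ι : Type v} [Fintype ι] {k : Type u} {J : Type w} [Field k]

/-- Finitely many rational hyperplanes, with normals `A`, and finitely many subspaces `𝒮` of
codimension at least two, that contain the support and the singular locus of `D` to order `r`. The
intersections of distinct hyperplanes belong to `𝒮`. -/
structure IsFrame (D : Set (Wall k ι J)) (r : ℕ) (A : Set (ι → ℤ))
    (𝒮 : Set (Submodule ℝ (ι → ℝ))) : Prop where
  finite_normals : A.Finite
  primitive : ∀ n ∈ A, IsPrimitive n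
  finite_small : 𝒮.Finite
  small : ∀ S ∈ 𝒮, IsSmall S
  wall : ∀ w ∈ wallsMod D r, ∃ n ∈ A, w.cone ≤ perp n
  sing : ∀ x ∈ sing D r, ∃ S ∈ 𝒮, x ∈ S
  inter : ∀ n ∈ A, ∀ n' ∈ A, ¬ LinearMap.ker (pairL n) ≤ LinearMap.ker (pairL n') →
    LinearMap.ker (pairL n) ⊓ LinearMap.ker (pairL n') ∈ 𝒮

/-- Two diagrams have a common frame, containing any given hyperplanes and small subspaces. -/
theorem exists_isFrame {D D' : Set (Wall k ι J)} (hD : IsScatteringDiagram D)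
    (hD' : IsScatteringDiagram D') (r : ℕ) {A₀ : Set (ι → ℤ)} (hA₀ : A₀.Finite)
    (hA₀p : ∀ n ∈ A₀, IsPrimitive n) {𝒮₀ : Set (Submodule ℝ (ι → ℝ))} (h𝒮₀ : 𝒮₀.Finite)
    (h𝒮₀s : ∀ S ∈ 𝒮₀, IsSmall S) :
    ∃ A 𝒮, A₀ ⊆ A ∧ 𝒮₀ ⊆ 𝒮 ∧ IsFrame D r A 𝒮 ∧ IsFrame D' r A 𝒮 := by
  obtain ⟨A, hA, hAp, hAw⟩ := hD.exists_normals r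
  obtain ⟨A', hA', hAp', hAw'⟩ := hD'.exists_normals r
  obtain ⟨𝒮, hS, hSs, hSc⟩ := hD.exists_small_cover r
  obtain ⟨𝒮', hS', hSs', hSc'⟩ := hD'.exists_small_cover r
  set B := A₀ ∪ A ∪ A' with hB
  have hBf : B.Finite := (hA₀.union hA).union hA'
  have hBp : ∀ n ∈ B, IsPrimitive n := by
    rintro n ((h | h) | h)
    exacts [hA₀p n h, hAp n h, hAp' n h]
  set 𝒯 := (𝒮 ∪ 𝒮' ∪ 𝒮₀) ∪ {S | ∃ n ∈ B, ∃ n' ∈ B,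
    ¬ LinearMap.ker (pairL n) ≤ LinearMap.ker (pairL n') ∧
    S = LinearMap.ker (pairL n) ⊓ LinearMap.ker (pairL n')} with h𝒯
  have hTf : 𝒯.Finite := by
    refine ((hS.union hS').union h𝒮₀).union (((hBf.prod hBf).image fun p : (ι → ℤ) × (ι → ℤ) =>
      LinearMap.ker (pairL p.1) ⊓ LinearMap.ker (pairL p.2)).subset ?_)
    rintro _ ⟨n, hn, n', hn', -, rfl⟩
    exact ⟨(n, n'), ⟨hn, hn'⟩, rfl⟩
  have hTs : ∀ S ∈ 𝒯, IsSmall S := by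
    rintro S (((h | h) | h) | ⟨n, hn, n', hn', h, rfl⟩)
    exacts [hSs S h, hSs' S h, h𝒮₀s S h, isSmall_ker_inf_ker (hBp n hn).ne_zero h]
  have hTi : ∀ n ∈ B, ∀ n' ∈ B, ¬ LinearMap.ker (pairL n) ≤ LinearMap.ker (pairL n') →
      LinearMap.ker (pairL n) ⊓ LinearMap.ker (pairL n') ∈ 𝒯 :=
    fun n hn n' hn' h => Or.inr ⟨n, hn, n', hn', h, rfl⟩
  refine ⟨B, 𝒯, fun n hn => Or.inl (Or.inl hn), fun S hS => Or.inl (Or.inr hS), ⟨hBf, hBp, hTf, hTs, ?_, ?_, hTi⟩,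
    ⟨hBf, hBp, hTf, hTs, ?_, ?_, hTi⟩⟩
  · intro w hw
    obtain ⟨n, hn, h⟩ := hAw w hw
    exact ⟨n, Or.inl (Or.inr hn), h⟩
  · intro x hx
    obtain ⟨S, hS, h⟩ := hSc x hx
    exact ⟨S, Or.inl (Or.inl (Or.inl hS)), h⟩
  · intro w hw
    obtain ⟨n, hn, h⟩ := hAw' w hw
    exact ⟨n, Or.inr hn, h⟩
  · intro x hx
    obtain ⟨S, hS, h⟩ := hSc' x hx
    exact ⟨S, Or.inl (Or.inl (Or.inr hS)), h⟩

theorem ker_pairL_eq {n n' : ι → ℤ} (hn : n ≠ 0) (hn' : n' ≠ 0)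
    (h : LinearMap.ker (pairL n) ≤ LinearMap.ker (pairL n')) :
    LinearMap.ker (pairL n) = LinearMap.ker (pairL n') := by
  refine Submodule.eq_of_le_of_finrank_eq h ?_
  have h1 := finrank_ker_pairL hn
  have h2 := finrank_ker_pairL hn'
  omega

namespace IsFrame

variable {D : Set (Wall k ι J)} {r : ℕ} {A : Set (ι → ℤ)} {𝒮 : Set (Submodule ℝ (ι → ℝ))}

theorem notMem_sing (hF : IsFrame D r A 𝒮) {x : ι → ℝ} (hx : ∀ S ∈ 𝒮, x ∉ S) :
    x ∉ HDTV.sing D r := fun h => by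
  obtain ⟨S, hS, h'⟩ := hF.sing x h
  exact hx S hS h'

theorem exists_of_mem_supp (hF : IsFrame D r A 𝒮) {x : ι → ℝ} (hx : x ∈ supp D r) :
    ∃ n ∈ A, pair n x = 0 := by
  obtain ⟨w, hw, hxw⟩ := hx
  obtain ⟨n, hn, h⟩ := hF.wall w hw
  exact ⟨n, hn, h hxw⟩

theorem isNormalAt (hF : IsFrame D r A 𝒮) {x : ι → ℝ} {n : ι → ℤ} (hn : n ≠ 0)
    (hx : ∀ n' ∈ A, ¬ LinearMap.ker (pairL n) ≤ LinearMap.ker (pairL n') → pair n' x ≠ 0) :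
    IsNormalAt D r x n := by
  intro w hw hxw
  obtain ⟨n', hn', h⟩ := hF.wall w hw
  by_cases hle : LinearMap.ker (pairL n) ≤ LinearMap.ker (pairL n')
  · rw [le_perp_iff] at h ⊢
    rwa [ker_pairL_eq hn (hF.primitive n' hn').ne_zero hle]
  · exact absurd (h hxw) (hx n' hn' hle)

theorem isNormalAt_of_mem (hF : IsFrame D r A 𝒮) {x : ι → ℝ} {n : ι → ℤ} (hn : n ∈ A)
    (hxn : pair n x = 0) (hx : ∀ S ∈ 𝒮, x ∉ S) : IsNormalAt D r x n :=
  hF.isNormalAt (hF.primitive n hn).ne_zero fun n' hn' h h0 =>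
    hx _ (hF.inter n hn n' hn' h) ⟨hxn, h0⟩

/-- The times at which a line meets the hyperplanes of the frame. -/
theorem finite_times (hF : IsFrame D r A 𝒮) {a d : ι → ℝ} (ha : ∀ n ∈ A, pair n a ≠ 0) :
    {t : ℝ | ∃ n ∈ A, pair n (a + t • d) = 0}.Finite := by
  have : {t : ℝ | ∃ n ∈ A, pair n (a + t • d) = 0} =
      ⋃ n ∈ A, {t : ℝ | pair n (a + t • d) = 0} := by
    ext t
    simp
  rw [this]
  refine hF.finite_normals.biUnion fun n hn => Set.Subsingleton.finite ?_
  intro t ht t' ht'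
  rw [Set.mem_ofPred_eq, pair_add, pair_smul] at ht ht'
  by_contra hne
  have h1 : (t - t') * pair n d = 0 := by linarith
  have h2 := (mul_eq_zero.1 h1).resolve_left (sub_ne_zero.2 hne)
  rw [h2, mul_zero, add_zero] at ht
  exact ha n hn ht

theorem eventually_notMem {S : Submodule ℝ (ι → ℝ)} {x : ι → ℝ} (hx : x ∉ S) (d : ι → ℝ) :
    ∀ᶠ s : ℝ in Filter.atTop, x + s • d ∉ S := by
  by_cases h : ∃ s : ℝ, x + s • d ∈ S
  · obtain ⟨s, hs⟩ := h
    filter_upwards [Filter.eventually_gt_atTop s] with s' hs' h'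
    have h1 := S.sub_mem h' hs
    rw [add_sub_add_left_eq_sub, ← sub_smul] at h1
    have h2 : d ∈ S := (S.smul_mem_iff (sub_ne_zero.2 hs'.ne')).1 h1
    exact hx ((S.add_mem_iff_left (S.smul_mem _ h2)).1 hs)
  · push Not at h
    exact Filter.Eventually.of_forall h

end IsFrame

/-- A point near `x` on the negative side of `n^⊥`, outside given proper subspaces. -/
theorem exists_generic_side {x : ι → ℝ} {n : ι → ℤ} (hn : IsPrimitive n) (hx : pair n x = 0)
    {𝒮 : Set (Submodule ℝ (ι → ℝ))} (h𝒮 : 𝒮.Finite) (h : ∀ S ∈ 𝒮, S ≠ ⊤) {O : Set (ι → ℝ)}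
    (hO : O ∈ 𝓝 x) : ∃ y ∈ O, pair n y < 0 ∧ ∀ S ∈ 𝒮, y ∉ S := by
  obtain ⟨z, hz⟩ := hn.exists_dotProduct_eq_one
  obtain ⟨O', hO', hopen, hxO'⟩ := mem_nhds_iff.1 hO
  have hc : Filter.Tendsto (fun t : ℝ => x + t • toReal z) (𝓝[<] 0) (𝓝 x) := by
    have : ContinuousAt (fun t : ℝ => x + t • toReal z) 0 := by fun_prop
    have h2 := this.tendsto
    rw [zero_smul, add_zero] at h2
    exact h2.mono_left nhdsWithin_le_nhds
  obtain ⟨t, ht, ht0⟩ := ((hc.eventually (hopen.mem_nhds hxO')).and self_mem_nhdsWithin).exists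
  have hval : pair n (x + t • toReal z) = t := by
    rw [pair_add, pair_smul, hx, pair_toReal, hz]
    simp
  have hO'' : O' ∩ {y | pair n y < 0} ∈ 𝓝 (x + t • toReal z) := by
    refine (hopen.inter (isOpen_lt (continuous_pair n) continuous_const)).mem_nhds ⟨ht, ?_⟩
    rw [Set.mem_ofPred_eq, hval]
    exact ht0
  obtain ⟨y, hy, -, hyS⟩ := exists_generic ⊤ h𝒮 (fun S hS hle => h S hS (top_le_iff.1 hle))
    Submodule.mem_top hO''
  exact ⟨y, hO' hy.1, hy.2, hyS⟩

end Frames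

/-! ### Uniqueness of consistent completions -/

section Uniqueness

open Topology Set

variable {ι : Type v} [Fintype ι] {k : Type u} {J : Type w} [Field k] [CharZero k]

/-- Two series of operators agree below degree `r`, and in degree `r` they agree in the coefficient
shifting exponents by `m`. -/
structure AgreeAt (r : ℕ) (m : ι → ℤ)
    (g h : MvPowerSeries J (Module.End k (AddMonoidAlgebra k (ι → ℤ)))) : Prop where
  left : MvPowerSeries.constantCoeff g = 1
  right : MvPowerSeries.constantCoeff h = 1
  eqBelow : EqBelow r g h
  coeff : ∀ β : J →₀ ℕ, β.degree = r → ∀ a,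
    ((MvPowerSeries.coeff β g - MvPowerSeries.coeff β h) (AddMonoidAlgebra.single a 1)).coeff
      (a + m) = 0

theorem AgreeAt.one (r : ℕ) (m : ι → ℤ) :
    AgreeAt (k := k) (J := J) r m 1 1 :=
  ⟨map_one _, map_one _, EqBelow.refl _ _, fun β _ a => by simp⟩

theorem AgreeAt.mul {r : ℕ} {m : ι → ℤ}
    {g h g' h' : MvPowerSeries J (Module.End k (AddMonoidAlgebra k (ι → ℤ)))}
    (e : AgreeAt r m g h) (e' : AgreeAt r m g' h') : AgreeAt r m (g * g') (h * h') := by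
  refine ⟨by rw [map_mul, e.left, e'.left, mul_one], by rw [map_mul, e.right, e'.right, mul_one],
    e.eqBelow.mul e'.eqBelow, fun β hβ a => ?_⟩
  rw [e.eqBelow.coeff_mul_sub_coeff_mul e'.eqBelow e'.left e.right hβ, LinearMap.add_apply,
    AddMonoidAlgebra.coeff_add, Finsupp.add_apply, e.coeff β hβ, e'.coeff β hβ, add_zero]

/-- The difference of two wall-crossings in leading degree. -/
theorem coeff_crossing_sub {f f' : ScatRing k ι J} (hf : MvPowerSeries.constantCoeff f = 1)
    (hf' : MvPowerSeries.constantCoeff f' = 1) {n : ι → ℤ}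
    (hn : ∀ β, MvPowerSeries.coeff β (logder f) ∈ dlogKer (k := k) n)
    (hn' : ∀ β, MvPowerSeries.coeff β (logder f') ∈ dlogKer (k := k) n) {r : ℕ}
    (e : EqBelow r f f') {β : J →₀ ℕ} (hβ : β.degree = r) (a m : ι → ℤ) :
    (r : k) * ((MvPowerSeries.coeff β (crossing f n) - MvPowerSeries.coeff β (crossing f' n))
      (AddMonoidAlgebra.single a 1)).coeff (a + m) =
    ((n ⬝ᵥ a : ℤ) : k) * ((MvPowerSeries.coeff β (logder f)).coeff m -
      (MvPowerSeries.coeff β (logder f')).coeff m) := by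
  have h1 := ((e.logder k hf hf').wallField n).coeff_sol_sub k
    (constantCoeff_wallField n (constantCoeff_logder f))
    (constantCoeff_wallField n (constantCoeff_logder f')) hβ
  rw [← crossing_eq_sol hf hn, ← crossing_eq_sol hf' hn'] at h1
  have h2 := congrArg (fun T : Module.End k (AddMonoidAlgebra k (ι → ℤ)) =>
    (T (AddMonoidAlgebra.single a 1)).coeff (a + m)) h1
  have h3 : ∀ l : ScatRing k ι J, (MvPowerSeries.coeff β (wallField n l)
      (AddMonoidAlgebra.single a 1)).coeff (a + m) =
      ((n ⬝ᵥ a : ℤ) : k) * (MvPowerSeries.coeff β l).coeff m := fun l => by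
    rw [coeff_wallField_apply, dlog_single, mul_smul_comm, AddMonoidAlgebra.coeff_smul_apply,
      smul_eq_mul, add_comm a m, AddMonoidAlgebra.coeff_mul_single_eq_coeff_mul m fun _ _ => add_left_inj a,
      mul_one]
  simp only [LinearMap.sub_apply, AddMonoidAlgebra.coeff_sub, Finsupp.sub_apply, h3] at h2
  rw [mul_sub, ← h2, Module.End.mul_apply, Module.End.natCast_apply, LinearMap.sub_apply,
    ← Nat.cast_smul_eq_nsmul k, AddMonoidAlgebra.coeff_smul_apply, smul_eq_mul]

theorem coeff_eq_zero_of_mem_dlogKer {n m : ι → ℤ} {p : AddMonoidAlgebra k (ι → ℤ)}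
    (hp : p ∈ dlogKer (k := k) n) (h : n ⬝ᵥ m ≠ 0) : p.coeff m = 0 := by
  have h1 := coeff_dlog n p m
  rw [mem_dlogKer.1 hp, AddMonoidAlgebra.coeff_zero, Finsupp.zero_apply] at h1
  exact (mul_eq_zero.1 h1.symm).resolve_left (by exact_mod_cast h)

theorem constantCoeff_crossing {f : ScatRing k ι J} (hf : MvPowerSeries.constantCoeff f = 1)
    {n : ι → ℤ} (hn : ∀ β, MvPowerSeries.coeff β (logder f) ∈ dlogKer (k := k) n) :
    MvPowerSeries.constantCoeff (crossing f n) = 1 := by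
  rw [crossing_eq_sol hf hn, constantCoeff_sol]

theorem EqBelow.crossing {f f' : ScatRing k ι J} (hf : MvPowerSeries.constantCoeff f = 1)
    (hf' : MvPowerSeries.constantCoeff f' = 1) {n : ι → ℤ}
    (hn : ∀ β, MvPowerSeries.coeff β (HDTV.logder f) ∈ dlogKer (k := k) n)
    (hn' : ∀ β, MvPowerSeries.coeff β (HDTV.logder f') ∈ dlogKer (k := k) n) {r : ℕ}
    (e : EqBelow r f f') : EqBelow r (HDTV.crossing f n) (HDTV.crossing f' n) := by
  rw [crossing_eq_sol hf hn, crossing_eq_sol hf' hn']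
  exact ((e.logder k hf hf').wallField n).sol k
    (constantCoeff_wallField n (constantCoeff_logder f))
    (constantCoeff_wallField n (constantCoeff_logder f'))

variable {D D' : Set (Wall k ι J)} {r : ℕ} {A : Set (ι → ℤ)} {𝒮 : Set (Submodule ℝ (ι → ℝ))}

/-- Along a generic segment of direction `m` only walls transversal to `m` are crossed; they do not
contribute to the coefficient of `z^m`. -/
theorem exists_joined_agreeAt (hD : IsScatteringDiagram D) (hD' : IsScatteringDiagram D')
    (hF : IsFrame D (r + 1) A 𝒮) (hF' : IsFrame D' (r + 1) A 𝒮)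
    (ih : ∀ x, x ∉ sing D (r + 1) → x ∉ sing D' (r + 1) →
      EqBelow r (funcAt D (r + 1) x) (funcAt D' (r + 1) x)) (hr : r ≠ 0)
    {m : ι → ℤ} {a : ι → ℝ} (ha : ∀ n ∈ A, pair n a ≠ 0)
    (haS : ∀ S ∈ 𝒮, a ∉ S ⊔ Submodule.span ℝ {toReal m}) {s : ℝ} (hs : 0 ≤ s)
    (hb : ∀ n ∈ A, pair n (a + s • toReal m) ≠ 0) :
    ∃ g g', Joined D (r + 1) a (a + s • toReal m) g ∧ Joined D' (r + 1) a (a + s • toReal m) g' ∧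
      AgreeAt r m g g' := by
  have hS : ∀ t : ℝ, ∀ S ∈ 𝒮, a + t • toReal m ∉ S := fun t S hS h => haS S hS <| by
    have h1 := (S ⊔ Submodule.span ℝ {toReal m}).sub_mem (Submodule.mem_sup_left h)
      (Submodule.mem_sup_right (Submodule.smul_mem _ t (Submodule.mem_span_singleton_self _)))
    rwa [add_sub_cancel_right] at h1
  set T := {t : ℝ | ∃ n ∈ A, pair n (a + t • toReal m) = 0} with hT
  have key := interval_induction (T := T) (hF.finite_times ha) (P := fun u v => ∃ g g',
    Joined D (r + 1) (a + u • toReal m) (a + v • toReal m) g ∧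
    Joined D' (r + 1) (a + u • toReal m) (a + v • toReal m) g' ∧ AgreeAt r m g g') ?_ ?_ hs ?_ ?_
  · simpa using key
  · intro u v huv hu hv hsub
    have hpt : ∀ t : ℝ, (a + u • toReal m) + t • ((a + v • toReal m) - (a + u • toReal m)) =
        a + (u + t * (v - u)) • toReal m := fun t => by
      rw [add_sub_add_left_eq_sub, ← sub_smul, smul_smul, add_assoc, ← add_smul]
    have hIcc : ∀ t ∈ Icc (0 : ℝ) 1, u + t * (v - u) ∈ Icc u v := fun t ht => by
      constructor <;> nlinarith [ht.1, ht.2]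
    have hsup : ∀ {E : Set (Wall k ι J)}, IsFrame E (r + 1) A 𝒮 → ∀ t ∈ Icc (0 : ℝ) 1,
        (a + u • toReal m) + t • ((a + v • toReal m) - (a + u • toReal m)) ∈ supp E (r + 1) →
        u + t * (v - u) ∈ T ∩ Icc u v := fun hE t ht h => by
      rw [hpt] at h
      exact ⟨hE.exists_of_mem_supp h, hIcc t ht⟩
    by_cases hne : (T ∩ Icc u v).Nonempty
    · obtain ⟨t₁, ⟨n₁, hn₁, h₁⟩, ht₁⟩ := hne
      have hm0 : n₁ ⬝ᵥ m ≠ 0 := fun h0 => ha n₁ hn₁ <| by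
        rw [pair_add, pair_smul, pair_toReal, h0] at h₁
        simpa using h₁
      -- orient the normal along the segment
      obtain ⟨n, hn, hnm, hny, hN, hN'⟩ : ∃ n : ι → ℤ, IsPrimitive n ∧ 0 < n ⬝ᵥ m ∧
          pair n (a + t₁ • toReal m) = 0 ∧ IsNormalAt D (r + 1) (a + t₁ • toReal m) n ∧
          IsNormalAt D' (r + 1) (a + t₁ • toReal m) n := by
        have hN := hF.isNormalAt_of_mem hn₁ h₁ (hS t₁)
        have hN' := hF'.isNormalAt_of_mem hn₁ h₁ (hS t₁)
        rcases lt_or_gt_of_ne hm0 with h | h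
        · have hneg : ∀ {E : Set (Wall k ι J)}, IsNormalAt E (r + 1) (a + t₁ • toReal m) n₁ →
              IsNormalAt E (r + 1) (a + t₁ • toReal m) (-n₁) := fun hE w hw hx y hy => by
            rw [mem_perp, pair_neg_left, hE w hw hx hy, neg_zero]
          exact ⟨-n₁, (hF.primitive n₁ hn₁).neg, by rw [neg_dotProduct]; omega,
            by rw [pair_neg_left, h₁, neg_zero], hneg hN, hneg hN'⟩
        · exact ⟨n₁, hF.primitive n₁ hn₁, h, h₁, hN, hN'⟩
      have huvne : u < t₁ ∧ t₁ < v :=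
        ⟨ht₁.1.lt_of_ne fun e => hu (e ▸ ⟨n₁, hn₁, h₁⟩),
          ht₁.2.lt_of_ne fun e => hv (e ▸ ⟨n₁, hn₁, h₁⟩)⟩
      have huv' : 0 < v - u := by linarith [huvne.1, huvne.2]
      have hval : ∀ t : ℝ, pair n (a + t • toReal m) = (t - t₁) * (n ⬝ᵥ m : ℤ) := fun t => by
        rw [pair_add, pair_smul, pair_toReal] at hny ⊢
        linarith
      have hnm' : (0 : ℝ) < (n ⬝ᵥ m : ℤ) := by exact_mod_cast hnm
      have ht0 : u + (t₁ - u) / (v - u) * (v - u) = t₁ := by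
        rw [div_mul_cancel₀ _ huv'.ne']
        ring
      have hjoin : ∀ {E : Set (Wall k ι J)}, IsFrame E (r + 1) A 𝒮 →
          IsNormalAt E (r + 1) (a + t₁ • toReal m) n →
          Joined E (r + 1) (a + u • toReal m) (a + v • toReal m)
            (crossing (funcAt E (r + 1) (a + t₁ • toReal m)) n) := by
        intro E hE hNE
        have := joined_segment (D := E) (r := r + 1) (a := a + u • toReal m)
          (b := a + v • toReal m) hn (t₀ := (t₁ - u) / (v - u)) ?_ ?_ ?_ ?_ ?_ ?_
        · rwa [hpt, ht0] at this
        · rw [hval]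
          exact mul_neg_of_neg_of_pos (by linarith [huvne.1]) hnm'
        · rw [hval]
          exact mul_pos (by linarith [huvne.2]) hnm'
        · rw [hpt, ht0]
          exact hny
        · intro t _
          rw [hpt]
          exact hE.notMem_sing (hS _)
        · intro t ht h
          have := hsub (hsup hE t ht h) ⟨⟨n₁, hn₁, h₁⟩, ht₁⟩
          rw [eq_div_iff huv'.ne']
          linarith
        · rwa [hpt, ht0]
      have hc := hD.coeff_logder_funcAt_mem hN
      have hc' := hD'.coeff_logder_funcAt_mem hN'
      have hk := hD.constantCoeff_funcAt (r + 1) (a + t₁ • toReal m)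
      have hk' := hD'.constantCoeff_funcAt (r + 1) (a + t₁ • toReal m)
      have he := ih _ (hF.notMem_sing (hS t₁)) (hF'.notMem_sing (hS t₁))
      refine ⟨_, _, hjoin hF hN, hjoin hF' hN', constantCoeff_crossing hk hc,
        constantCoeff_crossing hk' hc', he.crossing hk hk' hc hc', fun β hβ e => ?_⟩
      have h2 := coeff_crossing_sub hk hk' hc hc' he hβ e m
      rw [coeff_eq_zero_of_mem_dlogKer (hc β) hnm.ne', coeff_eq_zero_of_mem_dlogKer (hc' β) hnm.ne',
        sub_self, mul_zero] at h2
      exact (mul_eq_zero.1 h2).resolve_left (Nat.cast_ne_zero.2 hr)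
    · have hj : ∀ {E : Set (Wall k ι J)}, IsFrame E (r + 1) A 𝒮 →
          Joined E (r + 1) (a + u • toReal m) (a + v • toReal m) 1 := fun hE =>
        joined_of_disjoint (fun t _ => by rw [hpt]; exact hE.notMem_sing (hS _))
          fun t ht h => hne ⟨_, hsup hE t ht h⟩
      exact ⟨1, 1, hj hF, hj hF', AgreeAt.one r m⟩
  · rintro u v w - - - ⟨g, g', h1, h2, h3⟩ ⟨h, h', h4, h5, h6⟩
    exact ⟨_, _, h1.trans h4, h2.trans h5, h6.mul h3⟩
  · rintro ⟨n, hn, h⟩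
    rw [zero_smul, add_zero] at h
    exact ha n hn h
  · rintro ⟨n, hn, h⟩
    exact hb n hn h

/-- Short segments crossing the hyperplane that contains the walls at a point. -/
theorem IsScatteringDiagram.eventually_joined (hD : IsScatteringDiagram D) {x : ι → ℝ}
    (hx : x ∉ sing D r) {n : ι → ℤ} (hn : IsPrimitive n) (hN : IsNormalAt D r x n) :
    ∀ᶠ ε in 𝓝[>] (0 : ℝ), ∀ a ∈ Metric.ball x ε, ∀ b ∈ Metric.ball x ε, pair n a < 0 →
      0 < pair n b → Joined D r a b (crossing (funcAt D r x) n) := by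
  obtain ⟨ε, hε, hball⟩ := Metric.eventually_nhds_iff_ball.1 (hD.eventually_funcAt hx hn.ne_zero hN)
  filter_upwards [Ioo_mem_nhdsGT hε] with δ hδ a ha b hb hna hnb
  have hseg : ∀ t ∈ Icc (0 : ℝ) 1, a + t • (b - a) ∈ Metric.ball x ε := fun t ht =>
    Metric.ball_subset_ball hδ.2.le <| by
      have := (convex_ball x δ).add_smul_sub_mem ha hb ht
      exact this
  have hpos : 0 < pair n b - pair n a := by linarith
  have h0 : pair n (a + (-pair n a / (pair n b - pair n a)) • (b - a)) = 0 := by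
    rw [pair_add, pair_smul, pair_sub, div_mul_cancel₀ _ hpos.ne']
    ring
  have ht : -pair n a / (pair n b - pair n a) ∈ Icc (0 : ℝ) 1 :=
    ⟨div_nonneg (by linarith) hpos.le, (div_le_one hpos).2 (by linarith)⟩
  have := joined_segment (D := D) (r := r) hn hna hnb h0
    (fun t ht => (hball _ (hseg t ht)).1) (fun t ht hs => ?_) (hball _ (hseg _ ht)).2.1
  · rwa [(hball _ (hseg _ ht)).2.2.2 h0] at this
  · have h1 : pair n (a + t • (b - a)) = 0 := by
      by_contra h
      exact (hball _ (hseg t ht)).2.2.1 h hs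
    rw [pair_add, pair_smul, pair_sub] at h1
    rw [eq_div_iff hpos.ne']
    linarith

end Uniqueness

section Uniqueness

open Topology Set

variable {ι : Type v} [Fintype ι] {k : Type u} {J : Type w} [Field k] [CharZero k]
  {D D' : Set (Wall k ι J)} {r : ℕ} {A : Set (ι → ℤ)} {𝒮 : Set (Submodule ℝ (ι → ℝ))}

/-- A closed cone contains the directions in which one can go to infinity inside it. -/
theorem eventually_notMem_cone {σ : PointedCone ℝ (ι → ℝ)} (hσ : IsClosed (σ : Set (ι → ℝ)))
    {d : ι → ℝ} (hd : d ∉ σ) (x : ι → ℝ) : ∀ᶠ s : ℝ in Filter.atTop, x + s • d ∉ σ := by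
  have h1 : Filter.Tendsto (fun s : ℝ => s⁻¹ • x + d) Filter.atTop (𝓝 d) := by
    have := (tendsto_inv_atTop_zero (𝕜 := ℝ)).smul_const x
    rw [zero_smul] at this
    simpa using this.add_const d
  filter_upwards [h1.eventually (hσ.isOpen_compl.mem_nhds hd), Filter.eventually_gt_atTop 0]
    with s hs hs0 h
  refine hs ?_
  have := PointedCone.smul_mem σ (inv_pos.2 hs0).le h
  rwa [smul_add, smul_smul, inv_mul_cancel₀ hs0.ne', one_smul] at this

theorem IsScatteringDiagram.mono {Din : Set (Wall k ι J)} (hD : IsScatteringDiagram D)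
    (h : Din ⊆ D) : IsScatteringDiagram Din :=
  ⟨fun w hw => hD.isWall w (h hw), fun r => (hD.finite r).subset fun _ hw => ⟨h hw.1, hw.2⟩⟩

/-- Far in the direction `m`, outgoing walls do not contribute to the coefficient of `z^m`. -/
theorem IsScatteringDiagram.eventually_coeff_logder {Din : Set (Wall k ι J)}
    (hS : IsScatteringDiagram D) (hsub : Din ⊆ D) (hout : ∀ w ∈ D, w ∉ Din → w.IsOutgoing)
    (r : ℕ) (x : ι → ℝ) (m : ι → ℤ) : ∀ᶠ s : ℝ in Filter.atTop, ∀ β : J →₀ ℕ,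
      (MvPowerSeries.coeff β (logder (funcAt D r (x + s • toReal m)))).coeff m =
        (MvPowerSeries.coeff β (logder (funcAt Din r (x + s • toReal m)))).coeff m := by
  classical
  have hin := hS.mono hsub
  have h1 : ∀ᶠ s : ℝ in Filter.atTop, ∀ w ∈ wallsMod D r, toReal m ∉ w.cone →
      x + s • toReal m ∉ w.cone := by
    rw [(hS.finite r).eventually_all]
    intro w hw
    by_cases hm : toReal m ∈ w.cone
    · exact Filter.Eventually.of_forall fun _ h => absurd hm h
    · filter_upwards [eventually_notMem_cone (hS.isWall w hw.1).isClosed hm x] with s hs _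
      exact hs
  filter_upwards [h1] with s hs β
  rw [hS.logder_funcAt, hin.logder_funcAt, map_sum, map_sum, AddMonoidAlgebra.coeff_sum,
    AddMonoidAlgebra.coeff_sum, Finsupp.finsetSum_apply, Finsupp.finsetSum_apply]
  refine (Finset.sum_subset ?_ ?_).symm
  · rw [Set.Finite.toFinset_subset_toFinset]
    exact fun w hw => ⟨⟨hsub hw.1.1, hw.1.2⟩, hw.2⟩
  · intro w hw hw'
    rw [Set.Finite.mem_toFinset] at hw hw'
    have hw_out : w.IsOutgoing := hout w hw.1.1 fun h => hw' ⟨⟨h, hw.1.2⟩, hw.2⟩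
    by_contra hne
    obtain ⟨a, ha, e⟩ := (hS.isWall w hw.1.1).coeff_logder_mem β m hne
    refine hs w hw.1 (fun hm => hw_out ?_) hw.2
    have ha' : (0 : ℝ) < a := by exact_mod_cast ha
    have h2 := PointedCone.smul_mem w.cone (inv_pos.2 ha').le hm
    rw [e, toReal_smul, smul_smul, Int.cast_natCast, inv_mul_cancel₀ ha'.ne', one_smul,
      toReal_neg] at h2
    exact h2

/-- Translating a generic point of a hyperplane `n^⊥` by a multiple of `m ∈ n^⊥` does not change
the coefficient of `z^m` in the difference of two consistent diagrams, in leading degree. -/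
theorem coeff_logder_sub_translate (hD : IsScatteringDiagram D) (hD' : IsScatteringDiagram D')
    (hc : IsConsistent D) (hc' : IsConsistent D')
    (hF : IsFrame D (r + 1) A 𝒮) (hF' : IsFrame D' (r + 1) A 𝒮)
    (ih : ∀ x, x ∉ sing D (r + 1) → x ∉ sing D' (r + 1) →
      EqBelow r (funcAt D (r + 1) x) (funcAt D' (r + 1) x)) (hr : r ≠ 0)
    {n m : ι → ℤ} (hn : IsPrimitive n) (hnm : n ⬝ᵥ m = 0) {x : ι → ℝ} (hx : pair n x = 0)
    {s : ℝ} (hs : 0 ≤ s)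
    (hgen : ∀ y, y = x ∨ y = x + s • toReal m → (∀ S ∈ 𝒮, y ∉ S) ∧
      ∀ n' ∈ A, ¬ LinearMap.ker (pairL n) ≤ LinearMap.ker (pairL n') → pair n' y ≠ 0)
    {β : J →₀ ℕ} (hβ : β.degree = r) :
    (MvPowerSeries.coeff β (logder (funcAt D (r + 1) x))).coeff m -
      (MvPowerSeries.coeff β (logder (funcAt D' (r + 1) x))).coeff m =
    (MvPowerSeries.coeff β (logder (funcAt D (r + 1) (x + s • toReal m)))).coeff m -
      (MvPowerSeries.coeff β (logder (funcAt D' (r + 1) (x + s • toReal m)))).coeff m := by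
  obtain ⟨y₀, hy₀⟩ := hn.exists_dotProduct_eq_one
  set y := x + s • toReal m with hy
  have hny : pair n y = 0 := by rw [hy, pair_add, pair_smul, pair_toReal, hx, hnm]; simp
  have gx := hgen x (Or.inl rfl)
  have gy := hgen y (Or.inr rfl)
  -- a common radius for the balls around `x` and `y`
  have hball : ∀ z, ((∀ S ∈ 𝒮, z ∉ S) ∧
      ∀ n' ∈ A, ¬ LinearMap.ker (pairL n) ≤ LinearMap.ker (pairL n') → pair n' z ≠ 0) →
      ∀ᶠ ε in 𝓝[>] (0 : ℝ),
        (∀ a ∈ Metric.ball z ε, ∀ b ∈ Metric.ball z ε, pair n a < 0 → 0 < pair n b →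
          Joined D (r + 1) a b (crossing (funcAt D (r + 1) z) n)) ∧
        (∀ a ∈ Metric.ball z ε, ∀ b ∈ Metric.ball z ε, pair n a < 0 → 0 < pair n b →
          Joined D' (r + 1) a b (crossing (funcAt D' (r + 1) z) n)) ∧
        ∀ a ∈ Metric.ball z ε, pair n a ≠ 0 → ∀ n' ∈ A, pair n' a ≠ 0 := by
    intro z hz
    refine (hD.eventually_joined (hF.notMem_sing hz.1) hn
      (hF.isNormalAt hn.ne_zero hz.2)).and ((hD'.eventually_joined (hF'.notMem_sing hz.1) hn
      (hF'.isNormalAt hn.ne_zero hz.2)).and ?_)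
    have h1 : ∀ᶠ a in 𝓝 z, ∀ n' ∈ A, ¬ LinearMap.ker (pairL n) ≤ LinearMap.ker (pairL n') →
        pair n' a ≠ 0 := by
      rw [hF.finite_normals.eventually_all]
      intro n' hn'
      by_cases hle : LinearMap.ker (pairL n) ≤ LinearMap.ker (pairL n')
      · exact Filter.Eventually.of_forall fun _ h => absurd hle h
      · filter_upwards [(continuous_pair n').continuousAt.eventually_ne (hz.2 n' hn' hle)]
          with a ha _
        exact ha
    obtain ⟨ε, hε, hb⟩ := Metric.eventually_nhds_iff_ball.1 h1
    filter_upwards [Ioo_mem_nhdsGT hε] with δ hδ a ha hna n' hn'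
    by_cases hle : LinearMap.ker (pairL n) ≤ LinearMap.ker (pairL n')
    · intro h0
      have : a ∈ LinearMap.ker (pairL n) := by
        rw [ker_pairL_eq hn.ne_zero (hF.primitive n' hn').ne_zero hle]
        exact h0
      exact hna this
    · exact hb a (Metric.ball_subset_ball hδ.2.le ha) n' hn' hle
  obtain ⟨ε, ⟨hεx, hεy⟩, hε0⟩ := (((hball x gx).and (hball y gy)).and self_mem_nhdsWithin).exists
  have hε0 : 0 < ε := hε0
  -- generic points on both sides of the hyperplane
  set 𝒯 : Set (Submodule ℝ (ι → ℝ)) := (fun S => S ⊔ Submodule.span ℝ {toReal m}) '' 𝒮 with h𝒯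
  have hTf : 𝒯.Finite := hF.finite_small.image _
  have hTt : ∀ S ∈ 𝒯, S ≠ ⊤ := by
    rintro _ ⟨S, hS, rfl⟩
    exact (hF.small S hS).sup_span_ne_top _
  obtain ⟨a, ha, hna, haT⟩ := exists_generic_side hn hx hTf hTt (Metric.ball_mem_nhds x hε0)
  obtain ⟨b, hb, hnb, hbT⟩ := exists_generic_side hn.neg (by rw [pair_neg_left, hx, neg_zero]) hTf
    hTt (Metric.ball_mem_nhds x hε0)
  rw [pair_neg_left, neg_lt_zero] at hnb
  have hshift : ∀ c ∈ Metric.ball x ε, c + s • toReal m ∈ Metric.ball y ε := fun c hc => by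
    rw [hy]
    simpa [Metric.mem_ball] using hc
  have hpshift : ∀ c, pair n (c + s • toReal m) = pair n c := fun c => by
    rw [pair_add, pair_smul, pair_toReal, hnm]
    simp
  have hleg : ∀ c ∈ Metric.ball x ε, pair n c ≠ 0 → (∀ S ∈ 𝒯, c ∉ S) → ∃ g g',
      Joined D (r + 1) c (c + s • toReal m) g ∧ Joined D' (r + 1) c (c + s • toReal m) g' ∧
      AgreeAt r m g g' := fun c hc hnc hcT =>
    exists_joined_agreeAt hD hD' hF hF' ih hr (hεx.2.2 c hc hnc)
      (fun S hS => hcT _ ⟨S, hS, rfl⟩) hs (hεy.2.2 _ (hshift c hc) (by rwa [hpshift]))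
  obtain ⟨g, g', hg, hg', hgg⟩ := hleg a ha hna.ne haT
  obtain ⟨h, h', hh, hh', hhh⟩ := hleg b hb hnb.ne' hbT
  -- compare two ways around a thin parallelogram with long sides of direction `m`: translate and
  -- then cross `n^⊥` near `y`, or cross near `x` and then translate
  have e1 := hc.eqBelow (hg.trans (hεy.1 _ (hshift a ha) _ (hshift b hb) (by rwa [hpshift])
    (by rwa [hpshift]))) ((hεx.1 a ha b hb hna hnb).trans hh)
  have e2 := hc'.eqBelow (hg'.trans (hεy.2.1 _ (hshift a ha) _ (hshift b hb) (by rwa [hpshift])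
    (by rwa [hpshift]))) ((hεx.2.1 a ha b hb hna hnb).trans hh')
  -- the difference of the two crossings in leading degree, read off from the coefficient of
  -- `z^{y₀ + m}` in the image of `z^{y₀}`, where `⟨n, y₀⟩ = 1`
  have data : ∀ z, ((∀ S ∈ 𝒮, z ∉ S) ∧
      ∀ n' ∈ A, ¬ LinearMap.ker (pairL n) ≤ LinearMap.ker (pairL n') → pair n' z ≠ 0) →
      EqBelow r (crossing (funcAt D (r + 1) z) n) (crossing (funcAt D' (r + 1) z) n) ∧
      MvPowerSeries.constantCoeff (crossing (funcAt D (r + 1) z) n) = 1 ∧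
      MvPowerSeries.constantCoeff (crossing (funcAt D' (r + 1) z) n) = 1 ∧
      (r : k) * ((MvPowerSeries.coeff β (crossing (funcAt D (r + 1) z) n) -
        MvPowerSeries.coeff β (crossing (funcAt D' (r + 1) z) n))
          (AddMonoidAlgebra.single y₀ 1)).coeff (y₀ + m) =
        (MvPowerSeries.coeff β (logder (funcAt D (r + 1) z))).coeff m -
          (MvPowerSeries.coeff β (logder (funcAt D' (r + 1) z))).coeff m := by
    intro z hz
    have hk := hD.constantCoeff_funcAt (r + 1) z
    have hk' := hD'.constantCoeff_funcAt (r + 1) z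
    have hl := hD.coeff_logder_funcAt_mem (hF.isNormalAt hn.ne_zero hz.2)
    have hl' := hD'.coeff_logder_funcAt_mem (hF'.isNormalAt hn.ne_zero hz.2)
    have he := ih z (hF.notMem_sing hz.1) (hF'.notMem_sing hz.1)
    refine ⟨he.crossing hk hk' hl hl', constantCoeff_crossing hk hl, constantCoeff_crossing hk' hl',
      ?_⟩
    rw [coeff_crossing_sub hk hk' hl hl' he hβ, hy₀, Int.cast_one, one_mul]
  obtain ⟨x1, x2, x3, x4⟩ := data x gx
  obtain ⟨y1, y2, y3, y4⟩ := data y gy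
  have d1 := y1.coeff_mul_sub_coeff_mul hgg.eqBelow hgg.left y3 hβ
  have d2 := hhh.eqBelow.coeff_mul_sub_coeff_mul x1 x2 hhh.right hβ
  rw [e1 β (by omega), e2 β (by omega), d2] at d1
  rw [← x4, ← y4]
  congr 1
  -- the long sides do not contribute to this coefficient
  have d3 := congrArg (fun T : Module.End k (AddMonoidAlgebra k (ι → ℤ)) =>
    (T (AddMonoidAlgebra.single y₀ 1)).coeff (y₀ + m)) d1
  simp only [LinearMap.add_apply, AddMonoidAlgebra.coeff_add, Finsupp.add_apply, hgg.coeff β hβ,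
    hhh.coeff β hβ, zero_add, add_zero] at d3
  exact d3

/-- Two consistent diagrams whose non-initial walls are outgoing are equivalent if the initial walls
can be completed by outgoing walls to diagrams with the same functions. -/
theorem equivalent_of_isConsistentCompletion {Din Din' : Set (Wall k ι J)}
    (hD : IsConsistentCompletion Din D) (hD' : IsConsistentCompletion Din' D')
    {E E' : Set (Wall k ι J)} (hE : IsScatteringDiagram E) (hE' : IsScatteringDiagram E')
    (hsub : Din ⊆ E) (hsub' : Din' ⊆ E') (hout : ∀ w ∈ E, w ∉ Din → w.IsOutgoing)
    (hout' : ∀ w ∈ E', w ∉ Din' → w.IsOutgoing)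
    (hin : ∀ (r : ℕ) (x : ι → ℝ), x ∉ sing E r → x ∉ sing E' r →
      EqBelow r (logder (funcAt E r x)) (logder (funcAt E' r x))) :
    Equivalent D D' := by
  have hS := hD.isScatteringDiagram
  have hS' := hD'.isScatteringDiagram
  intro r
  induction r with
  | zero => intro x _ _ β hβ; omega
  | succ r ih =>
    have ih' : ∀ x, x ∉ sing D (r + 1) → x ∉ sing D' (r + 1) →
        EqBelow r (funcAt D (r + 1) x) (funcAt D' (r + 1) x) := fun x hx hx' =>
      (hS.eqBelow_funcAt r.le_succ x).trans <| EqBelow.trans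
        (ih x (fun h => hx (sing_mono (wallsMod_mono D r.le_succ) h))
          fun h => hx' (sing_mono (wallsMod_mono D' r.le_succ) h))
        (hS'.eqBelow_funcAt r.le_succ x).symm
    obtain ⟨𝒮₁, hf₁, hs₁, hc₁⟩ := hE.exists_small_cover (r + 1)
    obtain ⟨𝒮₂, hf₂, hs₂, hc₂⟩ := hE'.exists_small_cover (r + 1)
    obtain ⟨A, 𝒮, -, h𝒮, hF, hF'⟩ := exists_isFrame hS hS' (r + 1) Set.finite_empty (by simp)
      (hf₁.union hf₂) (by rintro S (h | h); exacts [hs₁ S h, hs₂ S h])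
    -- agreement at the points of `n^⊥` in general position
    have generic : ∀ n, IsPrimitive n → ∀ x, pair n x = 0 → (∀ S ∈ 𝒮, x ∉ S) →
        (∀ n' ∈ A, ¬ LinearMap.ker (pairL n) ≤ LinearMap.ker (pairL n') → pair n' x ≠ 0) →
        EqBelow (r + 1) (funcAt D (r + 1) x) (funcAt D' (r + 1) x) := by
      intro n hn x hx hxS hxA
      have hk := hS.constantCoeff_funcAt (r + 1) x
      have hk' := hS'.constantCoeff_funcAt (r + 1) x
      suffices h : EqBelow (r + 1) (logder (funcAt D (r + 1) x)) (logder (funcAt D' (r + 1) x)) by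
        have := h.sol k (constantCoeff_logder _) (constantCoeff_logder _)
        rwa [sol_logder k hk, sol_logder k hk'] at this
      intro β hβ
      rcases Nat.lt_succ_iff_lt_or_eq.1 hβ with hlt | heq
      · exact (ih' x (hF.notMem_sing hxS) (hF'.notMem_sing hxS)).logder k hk hk' β hlt
      by_cases hr : r = 0
      · have : β = 0 := by rw [← Finsupp.degree_eq_zero_iff, heq, hr]
        rw [this, MvPowerSeries.coeff_zero_eq_constantCoeff_apply, constantCoeff_logder,
          MvPowerSeries.coeff_zero_eq_constantCoeff_apply, constantCoeff_logder]
      ext m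
      -- for `m` tangent to `n^⊥`, move `x` far in direction `m`, where outgoing walls do not
      -- contribute to the coefficient of `z^m`, so that both functions have the same coefficient;
      -- the other `m` do not occur
      by_cases hnm : n ⬝ᵥ m = 0
      · have e1 := hS.eventually_coeff_logder hD.subset hD.outgoing (r + 1) x m
        have e2 := hS'.eventually_coeff_logder hD'.subset hD'.outgoing (r + 1) x m
        have i1 := hE.eventually_coeff_logder hsub hout (r + 1) x m
        have i2 := hE'.eventually_coeff_logder hsub' hout' (r + 1) x m
        have e3 : ∀ᶠ s : ℝ in Filter.atTop, ∀ S ∈ 𝒮, x + s • toReal m ∉ S := by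
          rw [hF.finite_small.eventually_all]
          exact fun S hS => IsFrame.eventually_notMem (hxS S hS) _
        have e4 : ∀ᶠ s : ℝ in Filter.atTop, ∀ n' ∈ A,
            ¬ LinearMap.ker (pairL n) ≤ LinearMap.ker (pairL n') →
            pair n' (x + s • toReal m) ≠ 0 := by
          rw [hF.finite_normals.eventually_all]
          intro n' hn'
          by_cases hle : LinearMap.ker (pairL n) ≤ LinearMap.ker (pairL n')
          · exact Filter.Eventually.of_forall fun _ h => absurd hle h
          · filter_upwards [IsFrame.eventually_notMem (S := LinearMap.ker (pairL n'))
              (hxA n' hn' hle) (toReal m)] with s hs _ h0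
            exact hs h0
        obtain ⟨s, ⟨⟨⟨⟨h1, h2⟩, h3⟩, h4⟩, ⟨h5, h5'⟩⟩, h6⟩ := (((((e1.and e2).and e3).and e4).and
          (i1.and i2)).and (Filter.eventually_ge_atTop (0 : ℝ))).exists
        have h7 := hin (r + 1) (x + s • toReal m)
          (fun h => by
            obtain ⟨S, hS, h⟩ := hc₁ _ h
            exact h3 S (h𝒮 (Or.inl hS)) h)
          (fun h => by
            obtain ⟨S, hS, h⟩ := hc₂ _ h
            exact h3 S (h𝒮 (Or.inr hS)) h) β hβ
        have := coeff_logder_sub_translate hS hS' hD.consistent hD'.consistent hF hF' ih' hr hn hnm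
          hx h6 (by rintro y (rfl | rfl); exacts [⟨hxS, hxA⟩, ⟨h3, h4⟩]) heq
        rw [h1, h2, ← h5, ← h5', h7, sub_self] at this
        exact sub_eq_zero.1 this
      · rw [coeff_eq_zero_of_mem_dlogKer
          (hS.coeff_logder_funcAt_mem (hF.isNormalAt hn.ne_zero hxA) β) hnm,
          coeff_eq_zero_of_mem_dlogKer
          (hS'.coeff_logder_funcAt_mem (hF'.isNormalAt hn.ne_zero hxA) β) hnm]
    -- perturb an arbitrary point within a hyperplane containing the walls through it
    have perturb : ∀ n, IsPrimitive n → ∀ x, pair n x = 0 → ∀ O ∈ 𝓝 x, ∃ y ∈ O, pair n y = 0 ∧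
        EqBelow (r + 1) (funcAt D (r + 1) y) (funcAt D' (r + 1) y) ∧
        ∀ n' ∈ A, ¬ LinearMap.ker (pairL n) ≤ LinearMap.ker (pairL n') → pair n' y ≠ 0 := by
      intro n hn x hx O hO
      obtain ⟨y, hyO, hny, hy⟩ := exists_generic (LinearMap.ker (pairL n))
        (𝒮 := 𝒮 ∪ {S | ¬ LinearMap.ker (pairL n) ≤ S ∧ ∃ n' ∈ A, S = LinearMap.ker (pairL n')})
        (hF.finite_small.union ((hF.finite_normals.image fun n' => LinearMap.ker (pairL n')).subset
          fun S ⟨_, n', hn', e⟩ => ⟨n', hn', e.symm⟩))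
        (by
          rintro S (hS | hS)
          · exact (hF.small S hS).not_ker_le hn.ne_zero
          · exact hS.1) hx hO
      have hyA : ∀ n' ∈ A, ¬ LinearMap.ker (pairL n) ≤ LinearMap.ker (pairL n') →
          pair n' y ≠ 0 := fun n' hn' h => hy _ (Or.inr ⟨h, n', hn', rfl⟩)
      exact ⟨y, hyO, hny, generic n hn y hny (fun S hS => hy S (Or.inl hS)) hyA, hyA⟩
    intro x hx hx'
    by_cases hs : x ∈ supp D (r + 1) ∨ x ∈ supp D' (r + 1)
    swap
    · rw [not_or] at hs
      rw [funcAt_of_notMem_supp hs.1, funcAt_of_notMem_supp hs.2]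
      exact EqBelow.refl _ _
    by_cases hcom : ∃ n, IsPrimitive n ∧ pair n x = 0 ∧ IsNormalAt D (r + 1) x n ∧
        IsNormalAt D' (r + 1) x n
    · obtain ⟨n, hn, hnx, hN, hN'⟩ := hcom
      obtain ⟨y, ⟨hy, hy'⟩, hny, he, -⟩ := perturb n hn x hnx _
        ((hS.eventually_funcAt hx hn.ne_zero hN).and (hS'.eventually_funcAt hx' hn.ne_zero hN'))
      rw [hy.2.2.2 hny, hy'.2.2.2 hny] at he
      exact he
    · have hsupp : x ∈ supp D (r + 1) ∧ x ∈ supp D' (r + 1) := by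
        rcases hs with h | h
        · obtain ⟨n, hn, hnx, hN⟩ := hS.exists_isNormalAt hx h
          refine ⟨h, by_contra fun h' => hcom ⟨n, hn, hnx, hN, fun w hw hxw => ?_⟩⟩
          exact absurd ⟨w, hw, hxw⟩ h'
        · obtain ⟨n, hn, hnx, hN⟩ := hS'.exists_isNormalAt hx' h
          refine ⟨by_contra fun h' => hcom ⟨n, hn, hnx, fun w hw hxw => ?_, hN⟩, h⟩
          exact absurd ⟨w, hw, hxw⟩ h'
      -- two different hyperplanes: both functions are trivial
      have hone : ∀ {E E' : Set (Wall k ι J)}, IsScatteringDiagram E → IsScatteringDiagram E' →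
          IsFrame E' (r + 1) A 𝒮 → x ∉ sing E (r + 1) → x ∉ sing E' (r + 1) →
          ∀ n, IsPrimitive n → pair n x = 0 → IsNormalAt E (r + 1) x n →
          ¬ IsNormalAt E' (r + 1) x n →
          (∀ y, EqBelow (r + 1) (funcAt D (r + 1) y) (funcAt D' (r + 1) y) →
            EqBelow (r + 1) (funcAt E (r + 1) y) (funcAt E' (r + 1) y)) →
          EqBelow (r + 1) (funcAt E (r + 1) x) 1 := by
        intro E E' hE hE' hFE' hxE hxE' n hn hnx hN hN' hEE'
        rw [IsNormalAt] at hN'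
        push Not at hN'
        obtain ⟨w, hw, hxw, hle⟩ := hN'
        obtain ⟨n', hn', hwn'⟩ := hFE'.wall w hw
        have hn'p := hFE'.primitive n' hn'
        have hsp := span_eq_ker (hE'.isWall w hw.1).codim_one hn'p.ne_zero hwn'
        have hnle : ¬ LinearMap.ker (pairL n) ≤ LinearMap.ker (pairL n') := fun h =>
          hle (le_perp_iff.2 (by rw [hsp, ker_pairL_eq hn.ne_zero hn'p.ne_zero h]))
        obtain ⟨m', hm', hm'x, hNm'⟩ := hE'.exists_isNormalAt hxE' ⟨w, hw, hxw⟩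
        have hnm' : IsNormalAt E' (r + 1) x n' := fun w' hw' hxw' => by
          have h1 := span_eq_ker (hE'.isWall w hw.1).codim_one hm'.ne_zero (hNm' w hw hxw)
          rw [le_perp_iff, ← hsp, h1]
          exact le_perp_iff.1 (hNm' w' hw' hxw')
        obtain ⟨y, ⟨hy, hy'⟩, hny, he, hyA⟩ := perturb n hn x hnx _
          ((hE.eventually_funcAt hxE hn.ne_zero hN).and
            (hE'.eventually_funcAt hxE' hn'p.ne_zero hnm'))
        have h2 := hEE' y he
        rwa [hy.2.2.2 hny, funcAt_of_notMem_supp (hy'.2.2.1 (hyA n' hn' hnle))] at h2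
      obtain ⟨n, hn, hnx, hN⟩ := hS.exists_isNormalAt hx hsupp.1
      obtain ⟨n', hn', hnx', hN'⟩ := hS'.exists_isNormalAt hx' hsupp.2
      have h1 := hone hS hS' hF' hx hx' n hn hnx hN (fun h => hcom ⟨n, hn, hnx, hN, h⟩)
        fun y h => h
      have h2 := hone hS' hS hF hx' hx n' hn' hnx' hN' (fun h => hcom ⟨n', hn', hnx', h, hN'⟩)
        fun y h => h.symm
      exact h1.trans h2.symm

end Uniqueness

/-! ### The Lie algebra of a toric model -/

section ScatLie

variable {ι : Type v} [Fintype ι] {k : Type u} {J : Type w} [Field k]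

/-- The additive extension `β ↦ ∑ β_j c_j` of a family of vectors. -/
def wt (c : J → ι → ℤ) : (J →₀ ℕ) →+ (ι → ℤ) :=
  Finsupp.liftAddHom fun j => (multiplesHom (ι → ℤ)) (c j)

theorem wt_single (c : J → ι → ℤ) (j : J) (l : ℕ) : wt c (Finsupp.single j l) = (l : ℤ) • c j := by
  simp [wt]

theorem wt_dotProduct_wt {nn mm : J → ι → ℤ}
    (hskew : ∀ i j, nn i ⬝ᵥ mm j = -(nn j ⬝ᵥ mm i)) (β γ : J →₀ ℕ) :
    wt nn β ⬝ᵥ wt mm γ = -(wt nn γ ⬝ᵥ wt mm β) := by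
  induction β using Finsupp.induction_linear with
  | zero => simp
  | add β β' h h' => rw [map_add, map_add, add_dotProduct, h, h', dotProduct_add]; ring
  | single i l =>
    induction γ using Finsupp.induction_linear with
    | zero => simp
    | add β β' h h' => rw [map_add, map_add, dotProduct_add, h, h', add_dotProduct]; ring
    | single j l' =>
      simp only [wt_single, smul_dotProduct, dotProduct_smul, smul_eq_mul, hskew i j]
      ring

/-- The operator `z^a ↦ ⟨n_β, a⟩ z^{a + m_β}`, where `n_β = ∑ β_j n_j` and `m_β = ∑ β_j m_j`. -/
def field (k : Type u) [Field k] (nn mm : J → ι → ℤ) (β : J →₀ ℕ) :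
    Module.End k (AddMonoidAlgebra k (ι → ℤ)) :=
  LinearMap.mulLeft k (AddMonoidAlgebra.single (wt mm β) 1) * dlog (wt nn β)

variable {nn mm : J → ι → ℤ}

theorem field_single (β : J →₀ ℕ) (a : ι → ℤ) (c : k) :
    field k nn mm β (AddMonoidAlgebra.single a c) =
      ((wt nn β ⬝ᵥ a : ℤ) : k) • AddMonoidAlgebra.single (wt mm β + a) c := by
  rw [field, Module.End.mul_apply, dlog_single, map_smul, LinearMap.mulLeft_apply,
    AddMonoidAlgebra.single_mul_single, one_mul]

/-- The terms quadratic in `a` cancel, and skewness of the pairing combines the remaining ones. -/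
theorem field_bracket (hskew : ∀ i j, nn i ⬝ᵥ mm j = -(nn j ⬝ᵥ mm i)) (β γ : J →₀ ℕ) :
    field k nn mm β * field k nn mm γ - field k nn mm γ * field k nn mm β =
      ((wt nn β ⬝ᵥ wt mm γ : ℤ) : k) • field k nn mm (β + γ) := by
  refine laurent_linearMap_ext fun a => ?_
  rw [LinearMap.sub_apply, Module.End.mul_apply, Module.End.mul_apply, LinearMap.smul_apply,
    field_single, field_single, map_smul, map_smul, field_single, field_single, field_single,
    map_add, map_add, smul_smul, smul_smul, smul_smul, ← add_assoc, ← add_assoc,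
    add_comm (wt mm γ) (wt mm β), ← sub_smul]
  congr 1
  have h := wt_dotProduct_wt hskew γ β
  rw [dotProduct_add, dotProduct_add, add_dotProduct, h]
  push_cast
  ring

/-- The graded Lie algebra spanned by the operators `z^a ↦ ⟨n_β, a⟩ z^{a + m_β}`. -/
def lieFamily (k : Type u) [Field k] (nn mm : J → ι → ℤ) (β : J →₀ ℕ) :
    Submodule k (Module.End k (AddMonoidAlgebra k (ι → ℤ))) :=
  Submodule.span k {field k nn mm β}

theorem lieFamily_bracket (hskew : ∀ i j, nn i ⬝ᵥ mm j = -(nn j ⬝ᵥ mm i)) {β γ : J →₀ ℕ}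
    {a b : Module.End k (AddMonoidAlgebra k (ι → ℤ))} (ha : a ∈ lieFamily k nn mm β)
    (hb : b ∈ lieFamily k nn mm γ) :
    ∃ c : k, a * b - b * a = (c * (wt nn β ⬝ᵥ wt mm γ : ℤ)) • field k nn mm (β + γ) := by
  obtain ⟨c, rfl⟩ := Submodule.mem_span_singleton.1 ha
  obtain ⟨d, rfl⟩ := Submodule.mem_span_singleton.1 hb
  refine ⟨c * d, ?_⟩
  rw [smul_mul_smul_comm, smul_mul_smul_comm, mul_comm d c, ← smul_sub, field_bracket hskew,
    smul_smul]

theorem normalizes_lieFamily (hskew : ∀ i j, nn i ⬝ᵥ mm j = -(nn j ⬝ᵥ mm i)) :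
    Normalizes (lieFamily k nn mm) (lieFamily k nn mm) := by
  intro β γ a ha b hb
  obtain ⟨c, e⟩ := lieFamily_bracket hskew ha hb
  rw [e]
  exact Submodule.smul_mem _ _ (Submodule.mem_span_singleton_self _)

theorem commute_lieFamily (hskew : ∀ i j, nn i ⬝ᵥ mm j = -(nn j ⬝ᵥ mm i)) {β γ : J →₀ ℕ}
    (h : wt nn β ⬝ᵥ wt mm γ = 0) {a b : Module.End k (AddMonoidAlgebra k (ι → ℤ))}
    (ha : a ∈ lieFamily k nn mm β) (hb : b ∈ lieFamily k nn mm γ) : Commute a b := by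
  obtain ⟨c, e⟩ := lieFamily_bracket hskew ha hb
  rw [h, Int.cast_zero, mul_zero, zero_smul] at e
  exact sub_eq_zero.1 e

theorem field_eq_zero {β : J →₀ ℕ} (h : wt nn β = 0) : field k nn mm β = 0 :=
  laurent_linearMap_ext fun a => by
    rw [field_single, h, zero_dotProduct, Int.cast_zero, zero_smul, LinearMap.zero_apply]

theorem field_ne_zero [CharZero k] {β : J →₀ ℕ} (h : wt nn β ≠ 0) : field k nn mm β ≠ 0 := by
  classical
  obtain ⟨i, hi⟩ := Function.ne_iff.1 h
  intro h0
  have h1 := field_single (k := k) (nn := nn) (mm := mm) β (Pi.single i 1) 1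
  rw [h0, LinearMap.zero_apply, dotProduct_single, mul_one] at h1
  have h2 := congrArg (fun p : AddMonoidAlgebra k (ι → ℤ) => p.coeff (wt mm β + Pi.single i 1)) h1
  simp only [AddMonoidAlgebra.coeff_smul_apply, AddMonoidAlgebra.coeff_single,
    Finsupp.single_eq_same, AddMonoidAlgebra.coeff_zero, Finsupp.zero_apply, smul_eq_mul,
    mul_one] at h2
  exact hi (by exact_mod_cast h2.symm)

/-- The coordinate of an element of degree `β` of the Lie algebra. -/
def fieldCoord (nn mm : J → ι → ℤ) (β : J →₀ ℕ)
    (T : Module.End k (AddMonoidAlgebra k (ι → ℤ))) : k :=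
  Classical.epsilon fun c => T = c • field k nn mm β

theorem fieldCoord_smul {β : J →₀ ℕ} {T : Module.End k (AddMonoidAlgebra k (ι → ℤ))}
    (h : T ∈ lieFamily k nn mm β) : T = fieldCoord nn mm β T • field k nn mm β := by
  obtain ⟨c, hc⟩ := Submodule.mem_span_singleton.1 h
  exact Classical.epsilon_spec (p := fun c => T = c • field k nn mm β) ⟨c, hc.symm⟩

/-- The values at `x` of the linear forms `n_β`. -/
def height (nn : J → ι → ℤ) (x : ι → ℝ) : (J →₀ ℕ) →+ ℝ where
  toFun β := pair (wt nn β) x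
  map_zero' := by rw [map_zero, pair_zero_left]
  map_add' β γ := by rw [map_add, pair_add_left]

@[simp]
theorem height_apply (nn : J → ι → ℤ) (x : ι → ℝ) (β : J →₀ ℕ) :
    height nn x β = pair (wt nn β) x := rfl

end ScatLie

section Factor

variable {ι : Type v} [Fintype ι] {k : Type u} {J : Type w} [Field k] [CharZero k]
  {nn mm : J → ι → ℤ}

theorem EqBelow.signProd_congr {R : Type*} [Ring R] [Algebra k R] {h h' : (J →₀ ℕ) →+ ℝ} {d : ℕ}
    (hs : ∀ β : J →₀ ℕ, β.degree < d → SignType.sign (h β) = SignType.sign (h' β))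
    (X : MvPowerSeries J R) : EqBelow d (HDTV.signProd h X) (HDTV.signProd h' X) := by
  have key : ∀ s, EqBelow d (HDTV.sol (HDTV.restr (signSet h s) X))
      (HDTV.sol (HDTV.restr (signSet h' s) X)) := fun s =>
    EqBelow.sol k (by simp) (by simp) fun β hβ => by
      rw [coeff_restr, coeff_restr, signSet, signSet, Set.mem_ofPred_eq, Set.mem_ofPred_eq,
        hs β hβ]
  exact ((key 1).mul (key 0)).mul (key (-1))

/-- The factorization of `sol X` with respect to the signs of the linear forms `n_β` at `u`. -/
def factor (k : Type u) [Field k] [CharZero k] (nn mm : J → ι → ℤ)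
    (X : MvPowerSeries J (Module.End k (AddMonoidAlgebra k (ι → ℤ)))) (u : ι → ℝ) :
    MvPowerSeries J (Module.End k (AddMonoidAlgebra k (ι → ℤ))) :=
  Classical.epsilon fun Y => LieElt (lieFamily k nn mm) Y ∧ signProd (height nn u) Y = sol X

theorem factor_spec (hskew : ∀ i j, nn i ⬝ᵥ mm j = -(nn j ⬝ᵥ mm i))
    {X : MvPowerSeries J (Module.End k (AddMonoidAlgebra k (ι → ℤ)))}
    (hX : LieElt (lieFamily k nn mm) X) (u : ι → ℝ) :
    LieElt (lieFamily k nn mm) (factor k nn mm X u) ∧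
      signProd (height nn u) (factor k nn mm X u) = sol X :=
  Classical.epsilon_spec (p := fun Y => LieElt (lieFamily k nn mm) Y ∧
    signProd (height nn u) Y = sol X) (exists_signProd_eq (normalizes_lieFamily hskew) _ hX)

theorem factor_congr (hskew : ∀ i j, nn i ⬝ᵥ mm j = -(nn j ⬝ᵥ mm i))
    {X : MvPowerSeries J (Module.End k (AddMonoidAlgebra k (ι → ℤ)))}
    (hX : LieElt (lieFamily k nn mm) X) {u u' : ι → ℝ} {d : ℕ}
    (hs : ∀ β : J →₀ ℕ, β.degree < d →
      SignType.sign (height nn u β) = SignType.sign (height nn u' β)) :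
    EqBelow d (factor k nn mm X u) (factor k nn mm X u') := by
  obtain ⟨h1, e1⟩ := factor_spec hskew hX u
  obtain ⟨h2, e2⟩ := factor_spec hskew hX u'
  refine EqBelow.of_signProd k h1.1 h2.1 (height nn u') ?_
  rw [e2, ← e1]
  exact EqBelow.signProd_congr (k := k) (fun β hβ => (hs β hβ).symm) _

theorem factor_causal (hskew : ∀ i j, nn i ⬝ᵥ mm j = -(nn j ⬝ᵥ mm i))
    {X X' : MvPowerSeries J (Module.End k (AddMonoidAlgebra k (ι → ℤ)))}
    (hX : LieElt (lieFamily k nn mm) X) (hX' : LieElt (lieFamily k nn mm) X') (u : ι → ℝ)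
    {β : J →₀ ℕ} (hβ : β ≠ 0) (e : EqBelow β.degree X X') :
    MvPowerSeries.coeff β (factor k nn mm X u) - MvPowerSeries.coeff β (factor k nn mm X' u) =
      MvPowerSeries.coeff β X - MvPowerSeries.coeff β X' := by
  obtain ⟨h1, e1⟩ := factor_spec hskew hX u
  obtain ⟨h2, e2⟩ := factor_spec hskew hX' u
  have h3 : EqBelow β.degree (factor k nn mm X u) (factor k nn mm X' u) := by
    refine EqBelow.of_signProd k h1.1 h2.1 (height nn u) ?_
    rw [e1, e2]
    exact e.sol k hX.1 hX'.1
  rw [← h3.coeff_signProd_sub k (height nn u) rfl hβ, e1, e2, e.coeff_sol_sub k hX.1 hX'.1 rfl]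

/-- There is a group element whose factorization at `m_β` has prescribed coefficient in degree `β`,
for all `β`. -/
theorem exists_factor_eq (hskew : ∀ i j, nn i ⬝ᵥ mm j = -(nn j ⬝ᵥ mm i)) (c : (J →₀ ℕ) → k) :
    ∃ X, LieElt (lieFamily k nn mm) X ∧ ∀ β, wt nn β ≠ 0 →
      fieldCoord nn mm β (MvPowerSeries.coeff β (factor k nn mm X (toReal (wt mm β)))) = c β := by
  classical
  let L : MvPowerSeries J k → MvPowerSeries J (Module.End k (AddMonoidAlgebra k (ι → ℤ))) :=
    fun a β => MvPowerSeries.coeff β a • field k nn mm β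
  have hLc : ∀ a β, MvPowerSeries.coeff β (L a) = MvPowerSeries.coeff β a • field k nn mm β :=
    fun a β => rfl
  have hL : ∀ a, LieElt (lieFamily k nn mm) (L a) := fun a =>
    ⟨by rw [← MvPowerSeries.coeff_zero_eq_constantCoeff_apply, hLc, field_eq_zero (map_zero _),
        smul_zero],
      fun β => Submodule.smul_mem _ _ (Submodule.mem_span_singleton_self _)⟩
  -- to leading order the coefficient of the factorization is that of the group element, so that
  -- correcting each coefficient by its error is a causal operation
  let T : MvPowerSeries J k → MvPowerSeries J k := fun a β =>
    if wt nn β = 0 then 0 else MvPowerSeries.coeff β a -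
      fieldCoord nn mm β (MvPowerSeries.coeff β (factor k nn mm (L a) (toReal (wt mm β)))) + c β
  have hTc : ∀ a β, MvPowerSeries.coeff β (T a) = if wt nn β = 0 then 0 else
      MvPowerSeries.coeff β a - fieldCoord nn mm β (MvPowerSeries.coeff β
        (factor k nn mm (L a) (toReal (wt mm β)))) + c β := fun a β => rfl
  obtain ⟨a, ha⟩ := exists_fixedPoint_of_causal T (by
    intro a a' β e
    rw [hTc, hTc]
    split_ifs with h0
    · rfl
    have hβ : β ≠ 0 := by rintro rfl; exact h0 (map_zero _)
    have h1 := factor_causal hskew (hL a) (hL a') (toReal (wt mm β)) hβ fun γ hγ => by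
      rw [hLc, hLc, e γ hγ]
    rw [fieldCoord_smul ((factor_spec hskew (hL a) _).1.2 β),
      fieldCoord_smul ((factor_spec hskew (hL a') _).1.2 β), hLc, hLc] at h1
    have h2 := smul_left_injective k (field_ne_zero (k := k) (mm := mm) h0)
      ((sub_smul _ _ _).trans (h1.trans (sub_smul _ _ _).symm))
    rw [add_left_inj]
    linear_combination -h2)
  refine ⟨L a, hL a, fun β hβ => ?_⟩
  have h1 := congrArg (MvPowerSeries.coeff β) ha
  rw [hTc, if_neg hβ] at h1
  linear_combination -h1

/-- Far in the direction `m_β`, the coefficient of degree `β` of the factorization is that of the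
factorization at `m_β`. -/
theorem eventually_coeff_factor [Finite J] (hskew : ∀ i j, nn i ⬝ᵥ mm j = -(nn j ⬝ᵥ mm i))
    {X : MvPowerSeries J (Module.End k (AddMonoidAlgebra k (ι → ℤ)))}
    (hX : LieElt (lieFamily k nn mm) X) {β : J →₀ ℕ} (hβ : β ≠ 0) {x : ι → ℝ}
    (hx : height nn x β = 0) : ∀ᶠ s : ℝ in Filter.atTop,
      MvPowerSeries.coeff β (factor k nn mm X (x + s • toReal (wt mm β))) =
        MvPowerSeries.coeff β (factor k nn mm X (toReal (wt mm β))) := by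
  have hself : wt nn β ⬝ᵥ wt mm β = 0 := by
    have := wt_dotProduct_wt hskew β β
    omega
  -- far in direction `m_β` the signs of the forms `n_γ` refine their signs at `m_β`
  have h1 : ∀ᶠ s : ℝ in Filter.atTop, ∀ γ ∈ {γ : J →₀ ℕ | γ.degree ≤ β.degree},
      (0 < height nn (toReal (wt mm β)) γ → 0 < height nn (x + s • toReal (wt mm β)) γ) ∧
      (height nn (toReal (wt mm β)) γ < 0 → height nn (x + s • toReal (wt mm β)) γ < 0) := by
    rw [(Finsupp.finite_of_degree_le β.degree).eventually_all]
    intro γ _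
    have e : ∀ s : ℝ, height nn (x + s • toReal (wt mm β)) γ =
        height nn x γ + s * height nn (toReal (wt mm β)) γ := fun s => by
      simp only [height_apply, pair_add, pair_smul]
    rcases lt_trichotomy (height nn (toReal (wt mm β)) γ) 0 with h | h | h
    · filter_upwards [(Filter.tendsto_atBot_add_const_left _ (height nn x γ)
        (Filter.tendsto_id.atTop_mul_const_of_neg h)).eventually_lt_atBot 0] with s hs
      exact ⟨fun h' => absurd h h'.not_gt, fun _ => by rw [e]; exact hs⟩
    · exact Filter.Eventually.of_forall fun s => ⟨fun h' => absurd h h'.ne', fun h' =>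
        absurd h h'.ne⟩
    · filter_upwards [(Filter.tendsto_atTop_add_const_left _ (height nn x γ)
        (Filter.tendsto_id.atTop_mul_const h)).eventually_gt_atTop 0] with s hs
      exact ⟨fun _ => by rw [e]; exact hs, fun h' => absurd h h'.not_gt⟩
  filter_upwards [h1] with s hs
  set u := x + s • toReal (wt mm β) with hu
  set h₀ := height nn (toReal (wt mm β)) with hh₀
  have hzero : β ∈ signSet (height nn u) 0 := by
    rw [signSet, Set.mem_ofPred_eq, sign_eq_zero_iff, height_apply, hu, pair_add, pair_smul,
      pair_toReal, hself, ← height_apply, hx]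
    simp
  have hzero' : β ∈ signSet h₀ 0 := by
    rw [signSet, Set.mem_ofPred_eq, sign_eq_zero_iff, hh₀, height_apply, pair_toReal, hself,
      Int.cast_zero]
  have hV := normalizes_lieFamily (k := k) hskew
  obtain ⟨hp, ep⟩ := factor_spec hskew hX (toReal (wt mm β))
  obtain ⟨hq, eq⟩ := factor_spec hskew hX u
  set V' := restrFamily (lieFamily k nn mm) (signSet h₀ 0) with hV'
  have hN' : Normalizes V' V' := hV.restr (signSet_add h₀ 0)
  have hp' : LieElt V' (restr (signSet h₀ 0) (factor k nn mm X (toReal (wt mm β)))) := hp.restr _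
  obtain ⟨s', hs', es'⟩ := exists_signProd_eq hN' (height nn u) hp'
  have h2 := (signProd_refine hV (r := β.degree + 1) (fun γ hγ => (hs γ (by
    show γ.degree ≤ β.degree
    omega)).1) (fun γ hγ => (hs γ (by
    show γ.degree ≤ β.degree
    omega)).2) hp (hs'.mono (restrFamily_le _ _)) hq es' (by rw [eq, ep])).1 β (by omega)
  rw [coeff_restr, coeff_restr, if_pos ⟨hβ, hzero⟩, if_pos ⟨hβ, hzero⟩] at h2
  have h3 := coeff_eq_of_signProd_eq hN' hβ (fun γ γ' hγ a ha b hb => ?_) (height nn u) hp' hs' es'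
  · rw [coeff_restr, if_pos ⟨hβ, hzero'⟩] at h3
    rw [h2, h3]
  · rw [hV', restrFamily] at ha hb
    split_ifs at ha with h4
    swap
    · rw [(Submodule.mem_bot k).1 ha]
      exact Commute.zero_left _
    split_ifs at hb with h5
    swap
    · rw [(Submodule.mem_bot k).1 hb]
      exact Commute.zero_right _
    refine commute_lieFamily hskew ?_ ha hb
    rw [signSet, Set.mem_ofPred_eq, sign_eq_zero_iff, hh₀, height_apply, pair_toReal,
      Int.cast_eq_zero, ← hγ, map_add, dotProduct_add] at h4
    have h6 := wt_dotProduct_wt hskew γ γ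
    omega

end Factor

/-! ### The potential and its jumps across generic points of hyperplanes -/

section Potential

variable {ι : Type v} [Fintype ι] {k : Type u} {J : Type w} [Field k] [CharZero k]
  {nn mm : J → ι → ℤ}

theorem divisibility_smul {n : ι → ℤ} (hn : IsPrimitive n) (q : ℤ) :
    divisibility (q • n) = q.natAbs := by
  have h1 : Finset.univ.gcd (q • n) = normalize q * Finset.univ.gcd n := Finset.gcd_mul_left
  rw [divisibility, h1, Int.natAbs_mul, show (Finset.univ.gcd n).natAbs = 1 from hn, mul_one]
  exact Int.natAbs_eq_iff_associated.2 (normalize_associated q)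

/-- The negative part of the factorization at `u`; on the complement of the hyperplanes `n_β^⊥` it
is locally constant to every order. -/
def potential (k : Type u) [Field k] [CharZero k] (nn mm : J → ι → ℤ)
    (X : MvPowerSeries J (Module.End k (AddMonoidAlgebra k (ι → ℤ)))) (u : ι → ℝ) :
    MvPowerSeries J (Module.End k (AddMonoidAlgebra k (ι → ℤ))) :=
  sol (restr (signSet (height nn u) (-1)) (factor k nn mm X u))

/-- The coefficient of `t^β z^{m_β}` in the logarithmic derivative of the wall function at `x`. -/
def jumpCoeff (k : Type u) [Field k] [CharZero k] (nn mm : J → ι → ℤ)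
    (X : MvPowerSeries J (Module.End k (AddMonoidAlgebra k (ι → ℤ)))) (x : ι → ℝ) (β : J →₀ ℕ) : k :=
  -(divisibility (wt nn β) : k) * fieldCoord nn mm β (MvPowerSeries.coeff β (factor k nn mm X x))

/-- The logarithmic derivative of the wall function at `x`, up to order `r`. -/
def jumpSeries (k : Type u) [Field k] [CharZero k] (nn mm : J → ι → ℤ)
    (X : MvPowerSeries J (Module.End k (AddMonoidAlgebra k (ι → ℤ)))) (r : ℕ) (x : ι → ℝ) :
    ScatRing k ι J :=
  open Classical in fun β => if β.degree < r ∧ height nn x β = 0 then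
    AddMonoidAlgebra.single (wt mm β) (jumpCoeff k nn mm X x β) else 0

open Classical in
theorem coeff_jumpSeries (X : MvPowerSeries J (Module.End k (AddMonoidAlgebra k (ι → ℤ)))) (r : ℕ)
    (x : ι → ℝ) (β : J →₀ ℕ) : MvPowerSeries.coeff β (jumpSeries k nn mm X r x) =
      if β.degree < r ∧ height nn x β = 0 then
        AddMonoidAlgebra.single (wt mm β) (jumpCoeff k nn mm X x β) else 0 := rfl

theorem constantCoeff_jumpSeries
    (X : MvPowerSeries J (Module.End k (AddMonoidAlgebra k (ι → ℤ)))) (r : ℕ)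
    (x : ι → ℝ) : MvPowerSeries.constantCoeff (jumpSeries k nn mm X r x) = 0 := by
  have h : divisibility (wt nn (0 : J →₀ ℕ)) = 0 := by
    rw [map_zero, divisibility, Int.natAbs_eq_zero]
    exact Finset.gcd_eq_zero_iff.2 fun _ _ => rfl
  rw [← MvPowerSeries.coeff_zero_eq_constantCoeff_apply, coeff_jumpSeries, jumpCoeff, h]
  simp

/-- Comparison of the potential at `u` with the one at a point `x` to which `u` is close. -/
theorem potential_refine (hskew : ∀ i j, nn i ⬝ᵥ mm j = -(nn j ⬝ᵥ mm i))
    {X : MvPowerSeries J (Module.End k (AddMonoidAlgebra k (ι → ℤ)))}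
    (hX : LieElt (lieFamily k nn mm) X) {r : ℕ} {x u : ι → ℝ}
    (hu : ∀ β : J →₀ ℕ, β.degree < r → height nn x β ≠ 0 →
      SignType.sign (height nn u β) = SignType.sign (height nn x β))
    (hcomm : ∀ β γ : J →₀ ℕ, β.degree < r → γ.degree < r → height nn x β = 0 →
      height nn x γ = 0 → ∀ a ∈ lieFamily k nn mm β, ∀ b ∈ lieFamily k nn mm γ, Commute a b) :
    EqBelow r (potential k nn mm X u)
      (sol (restr (signSet (height nn u) (-1)) (restr {β | β.degree < r}
        (restr (signSet (height nn x) 0) (factor k nn mm X x)))) * potential k nn mm X x) := by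
  have hV := normalizes_lieFamily (k := k) hskew
  obtain ⟨hp, ep⟩ := factor_spec hskew hX x
  obtain ⟨hq, eq⟩ := factor_spec hskew hX u
  set P := restr (signSet (height nn x) 0) (factor k nn mm X x) with hP
  have hPL : LieElt (lieFamily k nn mm) P := (hp.restr _).mono (restrFamily_le _ _)
  -- the middle factor at `x` is abelian, so that factoring it at `u` amounts to splitting its
  -- logarithm
  obtain ⟨s, hs, es⟩ := exists_signProd_eq hV (height nn u) hPL
  have h1 := (signProd_refine hV (r := r) (h₀ := height nn x) (h := height nn u)
    (fun β hβ h => sign_eq_one_iff.1 ((hu β hβ h.ne').trans (sign_eq_one_iff.2 h)))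
    (fun β hβ h => sign_eq_neg_one_iff.1 ((hu β hβ h.ne).trans (sign_eq_neg_one_iff.2 h)))
    hp hs hq es (by rw [eq, ep])).2
  set P' := restr {β : J →₀ ℕ | β.degree < r} P with hP'
  have hP'c : ∀ β γ, Commute (MvPowerSeries.coeff β P') (MvPowerSeries.coeff γ P') := by
    intro β γ
    simp only [hP', hP, coeff_restr, signSet, Set.mem_ofPred_eq, sign_eq_zero_iff]
    split_ifs with a1 a2 a3 a4
    · exact hcomm β γ a1.2 a3.2 a2.2 a4.2 _ (hp.2 β) _ (hp.2 γ)
    all_goals first | exact Commute.zero_left _ | exact Commute.zero_right _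
  have hs' : EqBelow r s P' := by
    refine EqBelow.of_signProd k hs.1 (by simp [hP']) (height nn u) ?_
    rw [es, signProd_eq_sol k (by simp [hP']) hP'c]
    refine EqBelow.sol k hPL.1 (by simp [hP']) fun β hβ => ?_
    rcases eq_or_ne β 0 with h0 | h0
    · rw [h0, MvPowerSeries.coeff_zero_eq_constantCoeff_apply, hPL.1,
        MvPowerSeries.coeff_zero_eq_constantCoeff_apply]
      simp [hP']
    · exact ((coeff_restr {β : J →₀ ℕ | β.degree < r} P β).trans (if_pos ⟨h0, hβ⟩)).symm
  refine h1.trans (EqBelow.mul ?_ (EqBelow.refl _ _))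
  exact (hs'.restr _).sol k (by simp) (by simp)

/-- The jump of the potential across a generic point `x` of the hyperplane `n^⊥`. -/
theorem potential_jump (hskew : ∀ i j, nn i ⬝ᵥ mm j = -(nn j ⬝ᵥ mm i))
    {X : MvPowerSeries J (Module.End k (AddMonoidAlgebra k (ι → ℤ)))}
    (hX : LieElt (lieFamily k nn mm) X) {r : ℕ} {n : ι → ℤ} (hn : IsPrimitive n) {x u u' : ι → ℝ}
    (hgen : ∀ β : J →₀ ℕ, β.degree < r → height nn x β = 0 → ∃ q : ℤ, wt nn β = q • n)
    (hu : ∀ β : J →₀ ℕ, β.degree < r → height nn x β ≠ 0 →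
      SignType.sign (height nn u β) = SignType.sign (height nn x β))
    (hu' : ∀ β : J →₀ ℕ, β.degree < r → height nn x β ≠ 0 →
      SignType.sign (height nn u' β) = SignType.sign (height nn x β))
    (hun : pair n u < 0) (hun' : 0 < pair n u') :
    EqBelow r (potential k nn mm X u')
      (sol (wallField n (jumpSeries k nn mm X r x)) * potential k nn mm X u) := by
  classical
  -- if `n_β` and `n_γ` are multiples of `n`, the pairing `⟨n_β, m_γ⟩` is proportional to
  -- `⟨n_γ, m_γ⟩ = 0`
  have hcomm : ∀ β γ : J →₀ ℕ, β.degree < r → γ.degree < r → height nn x β = 0 →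
      height nn x γ = 0 → ∀ a ∈ lieFamily k nn mm β, ∀ b ∈ lieFamily k nn mm γ, Commute a b := by
    intro β γ hβ hγ h1 h2 a ha b hb
    obtain ⟨q, hq⟩ := hgen β hβ h1
    obtain ⟨q', hq'⟩ := hgen γ hγ h2
    rcases eq_or_ne q' 0 with h0 | h0
    · rw [h0, zero_smul] at hq'
      rw [lieFamily, field_eq_zero hq'] at hb
      have hb0 : b = 0 := by simpa using hb
      rw [hb0]
      exact Commute.zero_right _
    · refine commute_lieFamily hskew ?_ ha hb
      have h3 := wt_dotProduct_wt hskew γ γ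
      rw [hq', smul_dotProduct, smul_eq_mul] at h3
      have h4 : n ⬝ᵥ wt mm γ = 0 := by
        have : q' * (n ⬝ᵥ wt mm γ) = 0 := by omega
        exact (mul_eq_zero.1 this).resolve_left h0
      rw [hq, smul_dotProduct, h4, smul_zero]
  have e1 := potential_refine hskew hX hu hcomm
  have e2 := potential_refine hskew hX hu' hcomm
  obtain ⟨hp, -⟩ := factor_spec hskew hX x
  set p := factor k nn mm X x with hpdef
  set P := restr {β : J →₀ ℕ | β.degree < r} (restr (signSet (height nn x) 0) p) with hP
  set W := wallField n (jumpSeries k nn mm X r x) with hW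
  set N := restr (signSet (height nn u) (-1)) P with hN
  set N' := restr (signSet (height nn u') (-1)) P with hN'
  have hPc : ∀ β, MvPowerSeries.coeff β P = if β ≠ 0 ∧ β.degree < r ∧ height nn x β = 0 then
      MvPowerSeries.coeff β p else 0 := by
    intro β
    simp only [hP, coeff_restr, signSet, Set.mem_ofPred_eq, sign_eq_zero_iff]
    split_ifs <;> tauto
  -- the coefficients of the wall operator are multiples of those of the Lie algebra
  have hWc : ∀ β (q : ℤ), β ≠ 0 → β.degree < r → height nn x β = 0 → wt nn β = q • n →
      MvPowerSeries.coeff β p =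
        (fieldCoord nn mm β (MvPowerSeries.coeff β p) * q) •
          (LinearMap.mulLeft k (AddMonoidAlgebra.single (wt mm β) (1 : k)) * dlog n) ∧
      MvPowerSeries.coeff β W =
        (-(fieldCoord nn mm β (MvPowerSeries.coeff β p) * (q.natAbs : k))) •
          (LinearMap.mulLeft k (AddMonoidAlgebra.single (wt mm β) (1 : k)) * dlog n) := by
    intro β q h0 h1 h2 hq
    constructor
    · conv_lhs => rw [fieldCoord_smul (hp.2 β)]
      rw [mul_smul]
      congr 1
      refine laurent_linearMap_ext fun a => ?_
      rw [field_single, hq, LinearMap.smul_apply, Module.End.mul_apply, dlog_single, map_smul,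
        LinearMap.mulLeft_apply, AddMonoidAlgebra.single_mul_single, one_mul, smul_smul,
        smul_dotProduct, smul_eq_mul, Int.cast_mul]
    · rw [hW, coeff_wallField, coeff_jumpSeries, if_pos ⟨h1, h2⟩, jumpCoeff, hq,
        divisibility_smul hn]
      refine laurent_linearMap_ext fun a => ?_
      rw [LinearMap.smul_apply, Module.End.mul_apply, Module.End.mul_apply, dlog_single, map_smul,
        map_smul, LinearMap.mulLeft_apply, LinearMap.mulLeft_apply,
        AddMonoidAlgebra.single_mul_single, AddMonoidAlgebra.single_mul_single, one_mul, smul_smul,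
        AddMonoidAlgebra.smul_single', AddMonoidAlgebra.smul_single']
      congr 1
      ring
  have hW0 : ∀ β, ¬ (β ≠ 0 ∧ β.degree < r ∧ height nn x β = 0) →
      MvPowerSeries.coeff β W = 0 := by
    intro β h
    rcases eq_or_ne β 0 with h0 | h0
    · rw [h0, MvPowerSeries.coeff_zero_eq_constantCoeff_apply]
      exact constantCoeff_wallField n (constantCoeff_jumpSeries X r x)
    · rw [hW, coeff_wallField, coeff_jumpSeries, if_neg fun h' => h ⟨h0, h'⟩]
      refine laurent_linearMap_ext fun a => ?_
      simp
  have hsign : ∀ v β (q : ℤ), wt nn β = q • n → height nn v β = q * pair n v := fun v β q h => by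
    rw [height_apply, h, pair_smul_left]
  -- the coefficients with `n_β = q n` belong to the negative part at `u` for `q > 0` and to that at
  -- `u'` for `q < 0`; in both cases the difference is `-|q|` times the coordinate, as in the wall
  -- operator
  have hsum : N' = W + N := by
    refine MvPowerSeries.ext fun β => ?_
    rw [map_add]
    by_cases h : β ≠ 0 ∧ β.degree < r ∧ height nn x β = 0
    swap
    · rw [hW0 β h, show MvPowerSeries.coeff β N = _ from coeff_restr _ P β,
        show MvPowerSeries.coeff β N' = _ from coeff_restr _ P β, hPc, if_neg h]
      simp
    · obtain ⟨q, hq⟩ := hgen β h.2.1 h.2.2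
      obtain ⟨c1, c2⟩ := hWc β q h.1 h.2.1 h.2.2 hq
      have hside : ∀ v, MvPowerSeries.coeff β (restr (signSet (height nn v) (-1)) P) =
          if (q : ℝ) * pair n v < 0 then (fieldCoord nn mm β (MvPowerSeries.coeff β p) * q) •
            (LinearMap.mulLeft k (AddMonoidAlgebra.single (wt mm β) (1 : k)) * dlog n) else 0 := by
        intro v
        rw [coeff_restr, hPc, if_pos h, signSet, Set.mem_ofPred_eq, sign_eq_neg_one_iff,
          hsign _ _ _ hq, ← c1]
        exact if_congr (and_iff_right h.1) rfl rfl
      rw [c2, hN, hN', hside, hside]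
      generalize fieldCoord nn mm β (MvPowerSeries.coeff β p) = c
      rcases lt_trichotomy q 0 with h3 | h3 | h3
      · have h4 : (q : ℝ) < 0 := by exact_mod_cast h3
        rw [if_pos (mul_neg_of_neg_of_pos h4 hun'),
          if_neg (mul_pos_of_neg_of_neg h4 hun).not_gt, add_zero]
        congr 1
        have : (q : k) = -(q.natAbs : k) := by
          rw [← Int.cast_natCast, Int.ofNat_natAbs_of_nonpos h3.le]
          simp
        rw [this]
        ring
      · simp [h3]
      · have h4 : (0 : ℝ) < q := by exact_mod_cast h3
        rw [if_neg (mul_pos h4 hun').not_gt, if_pos (mul_neg_of_pos_of_neg h4 hun), ← add_smul]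
        have : (q : k) = (q.natAbs : k) := by
          rw [← Int.cast_natCast, Int.natAbs_of_nonneg h3.le]
        rw [this, neg_add_cancel, zero_smul]
  have hfin : sol N' = sol W * sol N := by
    rw [hsum]
    refine sol_add k (constantCoeff_wallField n (constantCoeff_jumpSeries X r x)) (by simp [hN])
      fun β γ => ?_
    by_cases h : β ≠ 0 ∧ β.degree < r ∧ height nn x β = 0
    swap
    · rw [hW0 β h]
      exact Commute.zero_left _
    rw [show MvPowerSeries.coeff γ N = _ from coeff_restr _ P γ, hPc]
    split_ifs with h2 h3
    · obtain ⟨q, hq⟩ := hgen β h.2.1 h.2.2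
      rcases eq_or_ne q 0 with hq0 | hq0
      · rw [(hWc β q h.1 h.2.1 h.2.2 hq).2, hq0]
        simp
      · refine hcomm β γ h.2.1 h3.2.1 h.2.2 h3.2.2 _ ?_ _ (hp.2 γ)
        rw [(hWc β q h.1 h.2.1 h.2.2 hq).2, lieFamily, Submodule.mem_span_singleton]
        refine ⟨-(fieldCoord nn mm β (MvPowerSeries.coeff β p) * (q.natAbs : k)) * (q : k)⁻¹, ?_⟩
        have hf : field k nn mm β = (q : k) •
            (LinearMap.mulLeft k (AddMonoidAlgebra.single (wt mm β) (1 : k)) * dlog n) := by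
          refine laurent_linearMap_ext fun a => ?_
          rw [field_single, hq, LinearMap.smul_apply, Module.End.mul_apply, dlog_single, map_smul,
            LinearMap.mulLeft_apply, AddMonoidAlgebra.single_mul_single, one_mul, smul_smul,
            smul_dotProduct, smul_eq_mul, Int.cast_mul]
        rw [hf, smul_smul, mul_assoc, inv_mul_cancel₀ (by exact_mod_cast hq0), mul_one]
    · exact Commute.zero_right _
    · exact Commute.zero_right _
  rw [hfin] at e2
  refine e2.trans ?_
  rw [mul_assoc]
  exact (EqBelow.refl r (sol W)).mul e1.symm

end Potential

/-! ### The outgoing walls -/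

section Chambers

open Topology

variable {ι : Type v} [Fintype ι] {k : Type u} {J : Type w} [Field k] [CharZero k]
  {nn mm : J → ι → ℤ}

/-- The point `x` of the hyperplane `n_β^⊥` lies on no other hyperplane `n_γ^⊥` with
`|γ| ≤ |β|`. -/
structure IsGeneric (nn : J → ι → ℤ) (β : J →₀ ℕ) (x : ι → ℝ) : Prop where
  ne_zero : wt nn β ≠ 0
  height_eq_zero : height nn x β = 0
  ker_le : ∀ γ : J →₀ ℕ, γ.degree ≤ β.degree → height nn x γ = 0 →
    ∀ y, height nn y β = 0 → height nn y γ = 0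

/-- The closure of the chamber of `x` in the arrangement induced on the hyperplane `n_β^⊥` by the
hyperplanes `n_γ^⊥` with `|γ| ≤ |β|`. -/
def chamber (nn : J → ι → ℤ) (β : J →₀ ℕ) (x : ι → ℝ) : PointedCone ℝ (ι → ℝ) where
  carrier := {y | height nn y β = 0 ∧ ∀ γ : J →₀ ℕ, γ.degree ≤ β.degree →
    0 ≤ ((SignType.sign (height nn x γ) : ℤ) : ℝ) * height nn y γ}
  add_mem' {y y'} h h' := by
    simp only [Set.mem_ofPred_eq, height_apply, pair_add] at h h' ⊢
    refine ⟨by rw [h.1, h'.1, add_zero], fun γ hγ => ?_⟩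
    rw [mul_add]
    exact add_nonneg (h.2 γ hγ) (h'.2 γ hγ)
  zero_mem' := by simp
  smul_mem' c y h := by
    simp only [Set.mem_ofPred_eq, height_apply] at h ⊢
    have e : ∀ n : ι → ℤ, pair n (c • y) = (c : ℝ) * pair n y := fun n => pair_smul n (c : ℝ) y
    refine ⟨by rw [e, h.1, mul_zero], fun γ hγ => ?_⟩
    rw [e, mul_left_comm]
    exact mul_nonneg c.2 (h.2 γ hγ)

theorem mem_chamber {β : J →₀ ℕ} {x y : ι → ℝ} : y ∈ chamber nn β x ↔ height nn y β = 0 ∧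
    ∀ γ : J →₀ ℕ, γ.degree ≤ β.degree →
      0 ≤ ((SignType.sign (height nn x γ) : ℤ) : ℝ) * height nn y γ := Iff.rfl

theorem sign_mul_self_nonneg (a : ℝ) : 0 ≤ ((SignType.sign a : ℤ) : ℝ) * a := by
  rcases lt_trichotomy a 0 with h | h | h
  · simp [sign_neg h, h.le]
  · simp [h]
  · simp [sign_pos h, h.le]

theorem sign_eq_of_mul_nonneg {a b : ℝ} (ha : a ≠ 0) (hb : b ≠ 0)
    (h : 0 ≤ ((SignType.sign a : ℤ) : ℝ) * b) : SignType.sign a = SignType.sign b := by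
  rcases lt_or_gt_of_ne ha with h1 | h1
  · rw [sign_neg h1] at h ⊢
    have : b ≤ 0 := by simpa using h
    rw [sign_neg (lt_of_le_of_ne this hb)]
  · rw [sign_pos h1] at h ⊢
    have : 0 ≤ b := by simpa using h
    rw [sign_pos (lt_of_le_of_ne this hb.symm)]

theorem chamber_congr {β : J →₀ ℕ} {x x' : ι → ℝ} (h : ∀ γ : J →₀ ℕ, γ.degree ≤ β.degree →
    SignType.sign (height nn x γ) = SignType.sign (height nn x' γ)) :
    chamber nn β x = chamber nn β x' := by
  ext y
  rw [mem_chamber, mem_chamber]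
  exact and_congr_right fun _ => forall₂_congr fun γ hγ => by rw [h γ hγ]

theorem IsGeneric.self_mem {β : J →₀ ℕ} {x : ι → ℝ} (hx : IsGeneric nn β x) :
    x ∈ chamber nn β x := ⟨hx.height_eq_zero, fun _ _ => sign_mul_self_nonneg _⟩

/-- The chambers of the arrangement do not overlap. -/
theorem IsGeneric.sign_eq {β : J →₀ ℕ} {x y : ι → ℝ} (hx : IsGeneric nn β x)
    (hy : IsGeneric nn β y) (h : y ∈ chamber nn β x) {γ : J →₀ ℕ} (hγ : γ.degree ≤ β.degree) :
    SignType.sign (height nn x γ) = SignType.sign (height nn y γ) := by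
  by_cases h1 : height nn x γ = 0
  · rw [h1, hx.ker_le γ hγ h1 y hy.height_eq_zero]
  · refine sign_eq_of_mul_nonneg h1 (fun h2 => h1 ?_) (h.2 γ hγ)
    exact hy.ker_le γ hγ h2 x hx.height_eq_zero

theorem isRationalPolyhedral_chamber [Finite J] (β : J →₀ ℕ) (x : ι → ℝ) :
    IsRationalPolyhedral (chamber nn β x) := by
  classical
  have hf := Finsupp.finite_of_degree_le (σ := J) β.degree
  obtain ⟨S, hS⟩ := exists_generators ({wt nn β, -wt nn β} ∪
    hf.toFinset.image fun γ => (SignType.sign (height nn x γ) : ℤ) • wt nn γ)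
  refine ⟨S, ?_⟩
  ext y
  rw [hS, mem_chamber]
  simp only [Finset.mem_union, Finset.mem_insert, Finset.mem_singleton, Finset.mem_image,
    Set.Finite.mem_toFinset]
  constructor
  · rintro ⟨h1, h2⟩ n ((rfl | rfl) | ⟨γ, hγ, rfl⟩)
    · exact h1.ge
    · rw [pair_neg_left, ← height_apply, h1, neg_zero]
    · rw [pair_smul_left]
      exact h2 γ hγ
  · intro h
    refine ⟨le_antisymm ?_ (h _ (Or.inl (Or.inl rfl))), fun γ hγ => ?_⟩
    · have := h _ (Or.inl (Or.inr rfl))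
      rw [pair_neg_left] at this
      rw [height_apply]
      linarith
    · have := h _ (Or.inr ⟨γ, hγ, rfl⟩)
      rwa [pair_smul_left] at this

/-- The defining inequalities of the chamber that do not vanish on the hyperplane are strict at `x`,
so that they persist under small displacements within the hyperplane. -/
theorem IsGeneric.span_chamber [Finite J] {β : J →₀ ℕ} {x : ι → ℝ} (hx : IsGeneric nn β x) :
    Submodule.span ℝ (chamber nn β x : Set (ι → ℝ)) = LinearMap.ker (pairL (wt nn β)) := by
  refine le_antisymm (Submodule.span_le.2 fun y hy => hy.1) fun y hy => ?_
  have hy : height nn y β = 0 := hy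
  have hev : ∀ᶠ ε in 𝓝 (0 : ℝ), ∀ γ ∈ {γ : J →₀ ℕ | γ.degree ≤ β.degree},
      0 ≤ ((SignType.sign (height nn x γ) : ℤ) : ℝ) * height nn (x + ε • y) γ := by
    rw [(Finsupp.finite_of_degree_le (σ := J) β.degree).eventually_all]
    intro γ _
    have hc : ContinuousAt (fun ε : ℝ => ((SignType.sign (height nn x γ) : ℤ) : ℝ) *
        height nn (x + ε • y) γ) 0 := by
      simp only [height_apply, pair_add, pair_smul]
      fun_prop
    by_cases h0 : height nn x γ = 0
    · exact Filter.Eventually.of_forall fun ε => by simp [h0]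
    · have h1 : 0 < ((SignType.sign (height nn x γ) : ℤ) : ℝ) * height nn x γ :=
        (sign_mul_self_nonneg _).lt_of_ne (Ne.symm (mul_ne_zero (by
          rcases lt_or_gt_of_ne h0 with h | h
          · rw [sign_neg h]; simp
          · rw [sign_pos h]; simp) h0))
      have h2 := hc.eventually (lt_mem_nhds (by simpa using h1 : 0 <
        ((SignType.sign (height nn x γ) : ℤ) : ℝ) * height nn (x + (0 : ℝ) • y) γ))
      exact h2.mono fun ε h => h.le
  obtain ⟨ε, h1, h2⟩ := ((hev.filter_mono nhdsWithin_le_nhds).and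
    (self_mem_nhdsWithin : Set.Ioi (0 : ℝ) ∈ 𝓝[>] 0)).exists
  have h2 : 0 < ε := h2
  have hmem : x + ε • y ∈ chamber nn β x := ⟨by
    rw [height_apply, pair_add, pair_smul, ← height_apply, ← height_apply, hx.height_eq_zero, hy,
      mul_zero, add_zero], h1⟩
  have h3 := Submodule.sub_mem _ (Submodule.subset_span (R := ℝ) hmem)
    (Submodule.subset_span (R := ℝ) hx.self_mem)
  rw [add_sub_cancel_left] at h3
  exact (Submodule.smul_mem_iff _ h2.ne').1 h3

/-- A primitive vector on the ray of `m`. -/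
def primitivePart (m : ι → ℤ) : ι → ℤ :=
  Classical.epsilon fun m₀ => IsPrimitive m₀ ∧ m = (divisibility m : ℤ) • m₀

theorem primitivePart_spec {m : ι → ℤ} (h : m ≠ 0) : IsPrimitive (primitivePart m) ∧
    divisibility m ≠ 0 ∧ m = (divisibility m : ℤ) • primitivePart m := by
  obtain ⟨m₀, h1, h2, h3⟩ := exists_smul_isPrimitive h
  have := Classical.epsilon_spec (p := fun m₀ => IsPrimitive m₀ ∧ m = (divisibility m : ℤ) • m₀)
    ⟨m₀, h1, h3⟩
  exact ⟨this.1, h2, this.2⟩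

/-- The wall on the chamber of `x` in the hyperplane `n_β^⊥` that accounts for the difference
between the wall function prescribed by the factorizations and the initial one, given by `p`. -/
def chamberWall (k : Type u) [Field k] [CharZero k] (nn mm : J → ι → ℤ)
    (X : MvPowerSeries J (Module.End k (AddMonoidAlgebra k (ι → ℤ)))) (p : (J →₀ ℕ) → k)
    (β : J →₀ ℕ) (x : ι → ℝ) : Wall k ι J where
  cone := chamber nn β x
  func := sol (MvPowerSeries.monomial β
    (AddMonoidAlgebra.single (wt mm β) (jumpCoeff k nn mm X x β - p β)))
  dir := -primitivePart (wt mm β)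

/-- The walls on the chambers of all hyperplanes `n_β^⊥`. -/
def chamberWalls (k : Type u) [Field k] [CharZero k] (nn mm : J → ι → ℤ)
    (X : MvPowerSeries J (Module.End k (AddMonoidAlgebra k (ι → ℤ)))) (p : (J →₀ ℕ) → k) :
    Set (Wall k ι J) :=
  {w | ∃ β x, IsGeneric nn β x ∧ jumpCoeff k nn mm X x β ≠ p β ∧
    w = chamberWall k nn mm X p β x}

variable {X : MvPowerSeries J (Module.End k (AddMonoidAlgebra k (ι → ℤ)))} {p : (J →₀ ℕ) → k}

theorem constantCoeff_monomial_single {β : J →₀ ℕ} (hβ : β ≠ 0) (m : ι → ℤ) (c : k) :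
    MvPowerSeries.constantCoeff (MvPowerSeries.monomial β (AddMonoidAlgebra.single m c)) = 0 := by
  classical
  rw [← MvPowerSeries.coeff_zero_eq_constantCoeff_apply, MvPowerSeries.coeff_monomial,
    if_neg hβ.symm]

theorem IsGeneric.degree_ne_zero {β : J →₀ ℕ} {x : ι → ℝ} (hx : IsGeneric nn β x) : β ≠ 0 := by
  rintro rfl
  exact hx.ne_zero (map_zero _)

theorem logder_chamberWall {β : J →₀ ℕ} (hβ : β ≠ 0) (x : ι → ℝ) :
    logder (chamberWall k nn mm X p β x).func = MvPowerSeries.monomial β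
      (AddMonoidAlgebra.single (wt mm β) (jumpCoeff k nn mm X x β - p β)) :=
  logder_sol k (constantCoeff_monomial_single hβ _ _)

theorem jumpCoeff_congr (hskew : ∀ i j, nn i ⬝ᵥ mm j = -(nn j ⬝ᵥ mm i))
    (hX : LieElt (lieFamily k nn mm) X) {β : J →₀ ℕ} {x x' : ι → ℝ}
    (h : ∀ γ : J →₀ ℕ, γ.degree ≤ β.degree →
      SignType.sign (height nn x γ) = SignType.sign (height nn x' γ)) :
    jumpCoeff k nn mm X x β = jumpCoeff k nn mm X x' β := by
  rw [jumpCoeff, jumpCoeff, factor_congr hskew hX (d := β.degree + 1)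
    (fun γ hγ => h γ (Nat.lt_succ_iff.1 hγ)) β (Nat.lt_succ_self _)]

theorem chamberWall_congr (hskew : ∀ i j, nn i ⬝ᵥ mm j = -(nn j ⬝ᵥ mm i))
    (hX : LieElt (lieFamily k nn mm) X) {β : J →₀ ℕ} {x x' : ι → ℝ}
    (h : ∀ γ : J →₀ ℕ, γ.degree ≤ β.degree →
      SignType.sign (height nn x γ) = SignType.sign (height nn x' γ)) :
    chamberWall k nn mm X p β x = chamberWall k nn mm X p β x' := by
  rw [chamberWall, chamberWall, chamber_congr h, jumpCoeff_congr hskew hX h]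

/-- On the chambers containing `m_β` the initial wall function is the prescribed one. -/
theorem IsGeneric.jumpCoeff_eq [Finite J] (hskew : ∀ i j, nn i ⬝ᵥ mm j = -(nn j ⬝ᵥ mm i))
    (hX : LieElt (lieFamily k nn mm) X)
    (hp : ∀ β, wt nn β ≠ 0 → fieldCoord nn mm β (MvPowerSeries.coeff β
      (factor k nn mm X (toReal (wt mm β)))) = -p β / (divisibility (wt nn β) : k))
    {β : J →₀ ℕ} {x : ι → ℝ} (hx : IsGeneric nn β x)
    (hm : toReal (wt mm β) ∈ chamber nn β x) : jumpCoeff k nn mm X x β = p β := by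
  obtain ⟨s, hs, hs0⟩ := ((eventually_coeff_factor hskew hX hx.degree_ne_zero
    hx.height_eq_zero).and (Filter.eventually_ge_atTop (0 : ℝ))).exists
  have hsign : ∀ γ : J →₀ ℕ, γ.degree ≤ β.degree → SignType.sign (height nn x γ) =
      SignType.sign (height nn (x + s • toReal (wt mm β)) γ) := by
    intro γ hγ
    have h1 := hm.2 γ hγ
    have e : height nn (x + s • toReal (wt mm β)) γ =
        height nn x γ + s * height nn (toReal (wt mm β)) γ := by
      simp only [height_apply, pair_add, pair_smul]
    rw [e]
    rcases lt_trichotomy (height nn x γ) 0 with h | h | h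
    · rw [sign_neg h] at h1 ⊢
      have h2 : height nn (toReal (wt mm β)) γ ≤ 0 := by simpa using h1
      rw [sign_neg (by nlinarith)]
    · rw [h, hx.ker_le γ hγ h _ hm.1]
      simp
    · rw [sign_pos h] at h1 ⊢
      have h2 : 0 ≤ height nn (toReal (wt mm β)) γ := by simpa using h1
      rw [sign_pos (by nlinarith)]
  have hd : (divisibility (wt nn β) : k) ≠ 0 :=
    Nat.cast_ne_zero.2 (primitivePart_spec hx.ne_zero).2.1
  rw [jumpCoeff_congr hskew hX hsign, jumpCoeff, hs, hp β hx.ne_zero]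
  field_simp

theorem toReal_primitivePart_mem {m : ι → ℤ} (hm : m ≠ 0) {σ : PointedCone ℝ (ι → ℝ)}
    (h : toReal (primitivePart m) ∈ σ) : toReal m ∈ σ := by
  rw [(primitivePart_spec hm).2.2, toReal_smul]
  exact PointedCone.smul_mem σ (by positivity) h

section Walls

variable [Finite J] (hskew : ∀ i j, nn i ⬝ᵥ mm j = -(nn j ⬝ᵥ mm i))
  (hX : LieElt (lieFamily k nn mm) X)
  (hp : ∀ β, wt nn β ≠ 0 → fieldCoord nn mm β (MvPowerSeries.coeff β
    (factor k nn mm X (toReal (wt mm β)))) = -p β / (divisibility (wt nn β) : k))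

include hskew hX hp

theorem chamberWalls_wt_ne_zero {β : J →₀ ℕ} {x : ι → ℝ} (hx : IsGeneric nn β x)
    (hne : jumpCoeff k nn mm X x β ≠ p β) : wt mm β ≠ 0 := fun h0 => by
  refine hne (hx.jumpCoeff_eq hskew hX hp ?_)
  rw [h0, show toReal (0 : ι → ℤ) = 0 by ext; simp [toReal]]
  exact zero_mem _

/-- Skewness gives `⟨n_β, m_β⟩ = 0`, so that the direction is tangent to the chamber. -/
theorem isWall_of_mem_chamberWalls {w : Wall k ι J} (hw : w ∈ chamberWalls k nn mm X p) :
    IsWall w := by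
  classical
  obtain ⟨β, x, hx, hne, rfl⟩ := hw
  have hm := chamberWalls_wt_ne_zero hskew hX hp hx hne
  obtain ⟨h1, h2, h3⟩ := primitivePart_spec hm
  refine ⟨isRationalPolyhedral_chamber β x, ?_, h1.neg, ?_, constantCoeff_sol _, ?_⟩
  · show Module.finrank ℝ (Submodule.span ℝ (chamber nn β x : Set (ι → ℝ))) + 1 = _
    rw [hx.span_chamber]
    exact finrank_ker_pairL hx.ne_zero
  · show toReal (-primitivePart (wt mm β)) ∈ Submodule.span ℝ (chamber nn β x : Set (ι → ℝ))
    rw [hx.span_chamber, toReal_neg, LinearMap.mem_ker, map_neg, pairL_apply, pair_toReal, neg_eq_zero,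
      Int.cast_eq_zero]
    have h4 := wt_dotProduct_wt hskew β β
    rw [h3, dotProduct_smul, smul_eq_mul] at h4
    have h5 : (divisibility (wt mm β) : ℤ) * (wt nn β ⬝ᵥ primitivePart (wt mm β)) = 0 := by omega
    exact (mul_eq_zero.1 h5).resolve_left (by exact_mod_cast h2)
  · intro γ hγ e he
    have h4 := coeff_sol_mem_nonUnital (k := k) (constantCoeff_monomial_single hx.degree_ne_zero
      (wt mm β) (jumpCoeff k nn mm X x β - p β)) (positiveMultiples k (primitivePart (wt mm β)))
      (fun δ => by
        rw [MvPowerSeries.coeff_monomial]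
        split_ifs
        · intro e' he'
          rw [AddMonoidAlgebra.coeff_single, Finsupp.single_apply] at he'
          split_ifs at he' with h5
          · exact ⟨divisibility (wt mm β), Nat.one_le_iff_ne_zero.2 h2, by rw [← h5]; exact h3⟩
          · exact absurd rfl he'
        · exact zero_mem _) hγ
    obtain ⟨a, ha, e'⟩ := h4 e he
    exact ⟨a, ha, by rw [e']; simp [chamberWall]⟩

/-- On a chamber containing `m_β` there is no wall, since the initial function already accounts for
the jump there. -/
theorem isOutgoing_of_mem_chamberWalls {w : Wall k ι J} (hw : w ∈ chamberWalls k nn mm X p) :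
    w.IsOutgoing := by
  obtain ⟨β, x, hx, hne, rfl⟩ := hw
  intro h
  have hm := chamberWalls_wt_ne_zero hskew hX hp hx hne
  refine hne (hx.jumpCoeff_eq hskew hX hp (toReal_primitivePart_mem hm ?_))
  have h' : -toReal (-primitivePart (wt mm β)) ∈ chamber nn β x := h
  rwa [toReal_neg, neg_neg] at h'

end Walls

theorem eqMod_chamberWall {β : J →₀ ℕ} (hβ : β ≠ 0) (x : ι → ℝ) {r : ℕ} (h : r ≤ β.degree) :
    EqMod r (chamberWall k nn mm X p β x).func 1 := by
  classical
  have h1 := EqBelow.sol (d := r) k (constantCoeff_monomial_single hβ (wt mm β)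
    (jumpCoeff k nn mm X x β - p β)) (map_zero _) fun γ hγ => by
      rw [MvPowerSeries.coeff_monomial, if_neg (by rintro rfl; omega), map_zero]
  rw [sol_zero k] at h1
  exact h1

theorem not_eqMod_chamberWall {β : J →₀ ℕ} (hβ : β ≠ 0) {x : ι → ℝ} {r : ℕ} (h : β.degree < r)
    (hne : jumpCoeff k nn mm X x β ≠ p β) :
    ¬ EqMod r (chamberWall k nn mm X p β x).func 1 := by
  classical
  intro h1
  have h2 := EqBelow.logder k (constantCoeff_sol _) (map_one _) h1 β h
  rw [logder_sol k (constantCoeff_monomial_single hβ _ _), logder_one, map_zero,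
    MvPowerSeries.coeff_monomial_same] at h2
  have h3 := congrArg (fun q : AddMonoidAlgebra k (ι → ℤ) => q.coeff (wt mm β)) h2
  simp only [AddMonoidAlgebra.coeff_single, Finsupp.single_eq_same, AddMonoidAlgebra.coeff_zero,
    Finsupp.zero_apply] at h3
  exact hne (sub_eq_zero.1 h3)

/-- To order `r` only the degrees `|β| < r` matter, and a chamber is determined by the signs of the
finitely many forms `n_γ` with `|γ| ≤ |β|`. -/
theorem finite_wallsMod_chamberWalls [Finite J] (hskew : ∀ i j, nn i ⬝ᵥ mm j = -(nn j ⬝ᵥ mm i))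
    (hX : LieElt (lieFamily k nn mm) X) (r : ℕ) :
    (wallsMod (chamberWalls k nn mm X p) r).Finite := by
  have hβ : ∀ β : J →₀ ℕ, (Set.range (chamberWall k nn mm X p β)).Finite := by
    intro β
    have hfin : Finite {γ : J →₀ ℕ // γ.degree ≤ β.degree} :=
      (Finsupp.finite_of_degree_le (σ := J) β.degree).to_subtype
    let s : (ι → ℝ) → {γ : J →₀ ℕ // γ.degree ≤ β.degree} → SignType :=
      fun x γ => SignType.sign (height nn x γ)
    refine (Set.finite_range fun a => chamberWall k nn mm X p β (Function.invFun s a)).subset ?_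
    rintro _ ⟨x, rfl⟩
    refine ⟨s x, chamberWall_congr hskew hX fun γ hγ => ?_⟩
    exact congrFun (Function.invFun_eq (f := s) ⟨x, rfl⟩) ⟨γ, hγ⟩
  refine ((Finsupp.finite_of_degree_le (σ := J) r).biUnion fun β _ => hβ β).subset ?_
  rintro _ ⟨⟨β, x, hx, -, rfl⟩, h⟩
  refine Set.mem_iUnion₂.2 ⟨β, ?_, x, rfl⟩
  by_contra h'
  exact h (eqMod_chamberWall hx.degree_ne_zero x (le_of_not_ge h'))

end Chambers

/-! ### Consistency from a potential -/

section Consistency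

open Topology Set

variable {ι : Type v} [Fintype ι] {k : Type u} {J : Type w} [Field k] [CharZero k]
  {nn mm : J → ι → ℤ}
  {X : MvPowerSeries J (Module.End k (AddMonoidAlgebra k (ι → ℤ)))}

theorem sign_eq_of_affine {p q v w : ℝ} (h : ∀ t ∈ Icc v w, p + t * q ≠ 0) {a b : ℝ}
    (ha : a ∈ Icc v w) (hb : b ∈ Icc v w) :
    SignType.sign (p + a * q) = SignType.sign (p + b * q) := by
  have hcont : ContinuousOn (fun t : ℝ => p + t * q) (Icc v w) := by fun_prop
  have hpre : OrdConnected ((fun t : ℝ => p + t * q) '' Icc v w) :=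
    (isPreconnected_Icc.image _ hcont).ordConnected
  have key : ∀ a ∈ Icc v w, ∀ b ∈ Icc v w, p + a * q < 0 → 0 < p + b * q → False := by
    intro a ha b hb h1 h2
    obtain ⟨t, ht, e⟩ := hpre.out ⟨a, ha, rfl⟩ ⟨b, hb, rfl⟩ ⟨h1.le, h2.le⟩
    exact h t ht e
  rcases lt_or_gt_of_ne (h a ha) with h1 | h1 <;> rcases lt_or_gt_of_ne (h b hb) with h2 | h2
  · rw [sign_neg h1, sign_neg h2]
  · exact (key a ha b hb h1 h2).elim
  · exact (key b hb a ha h2 h1).elim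
  · rw [sign_pos h1, sign_pos h2]

theorem potential_congr (hskew : ∀ i j, nn i ⬝ᵥ mm j = -(nn j ⬝ᵥ mm i))
    (hX : LieElt (lieFamily k nn mm) X) {u u' : ι → ℝ} {r : ℕ}
    (hs : ∀ β : J →₀ ℕ, β.degree < r →
      SignType.sign (height nn u β) = SignType.sign (height nn u' β)) :
    EqBelow r (potential k nn mm X u) (potential k nn mm X u') := by
  have h := factor_congr hskew hX hs
  refine EqBelow.sol k (by simp) (by simp) fun β hβ => ?_
  rw [coeff_restr, coeff_restr, signSet, signSet, Set.mem_ofPred_eq, Set.mem_ofPred_eq, hs β hβ,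
    h β hβ]

/-- The diagram `D` has, to order `r` and at generic points, the wall functions prescribed by the
jumps of the potential. -/
def HasJumps (k : Type u) [Field k] [CharZero k] (nn mm : J → ι → ℤ)
    (X : MvPowerSeries J (Module.End k (AddMonoidAlgebra k (ι → ℤ)))) (D : Set (Wall k ι J))
    (r : ℕ) : Prop :=
  ∀ (n : ι → ℤ) (x : ι → ℝ), IsPrimitive n → pair n x = 0 → x ∉ sing D r →
    (∀ β : J →₀ ℕ, β.degree < r → height nn x β = 0 → ∃ q : ℤ, wt nn β = q • n) →
    EqBelow r (logder (funcAt D r x)) (jumpSeries k nn mm X r x)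

/-- The normals in `A` represent all hyperplanes `n_β^⊥` with `|β| < r`. -/
def Represents (nn : J → ι → ℤ) (r : ℕ) (A : Set (ι → ℤ)) : Prop :=
  ∀ β : J →₀ ℕ, β.degree < r → wt nn β ≠ 0 → ∃ n ∈ A, ∃ q : ℤ, q ≠ 0 ∧ wt nn β = q • n

variable {D : Set (Wall k ι J)} {r : ℕ} {A : Set (ι → ℤ)} {𝒮 : Set (Submodule ℝ (ι → ℝ))}

/-- The points outside all hyperplanes and subspaces of a frame. -/
structure IsOff (A : Set (ι → ℤ)) (𝒮 : Set (Submodule ℝ (ι → ℝ))) (u : ι → ℝ) : Prop where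
  normals : ∀ n ∈ A, pair n u ≠ 0
  small : ∀ S ∈ 𝒮, u ∉ S

section

variable (hskew : ∀ i j, nn i ⬝ᵥ mm j = -(nn j ⬝ᵥ mm i)) (hX : LieElt (lieFamily k nn mm) X)
  (hD : IsScatteringDiagram D) (hF : IsFrame D r A 𝒮) (hA : Represents nn r A)
  (hjump : HasJumps k nn mm X D r)

include hskew hX hD hF hA hjump

/-- Crossing one hyperplane of the frame. -/
theorem potential_crossing {n : ι → ℤ} (hn : n ∈ A ∨ -n ∈ A) {x u u' : ι → ℝ} (hx : pair n x = 0)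
    (hxS : ∀ S ∈ 𝒮, x ∉ S)
    (hu : ∀ β : J →₀ ℕ, β.degree < r → height nn x β ≠ 0 →
      SignType.sign (height nn u β) = SignType.sign (height nn x β))
    (hu' : ∀ β : J →₀ ℕ, β.degree < r → height nn x β ≠ 0 →
      SignType.sign (height nn u' β) = SignType.sign (height nn x β))
    (hun : pair n u < 0) (hun' : 0 < pair n u') :
    EqBelow r (potential k nn mm X u') (crossing (funcAt D r x) n * potential k nn mm X u) := by
  obtain ⟨n₁, hn₁, hx₁, hker⟩ : ∃ n₁ ∈ A, pair n₁ x = 0 ∧ ∀ y, pair n₁ y = 0 ↔ pair n y = 0 := by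
    rcases hn with hn | hn
    · exact ⟨n, hn, hx, fun _ => Iff.rfl⟩
    · exact ⟨-n, hn, by rw [pair_neg_left, hx, neg_zero], fun y => by
        rw [pair_neg_left, neg_eq_zero]⟩
  have hnp : IsPrimitive n := by
    rcases hn with hn | hn
    · exact hF.primitive n hn
    · rw [← neg_neg n]
      exact (hF.primitive _ hn).neg
  have hN : IsNormalAt D r x n := fun w hw hxw y hy => by
    rw [mem_perp, ← hker]
    exact hF.isNormalAt_of_mem hn₁ hx₁ hxS w hw hxw hy
  have hgen : ∀ β : J →₀ ℕ, β.degree < r → height nn x β = 0 → ∃ q : ℤ, wt nn β = q • n := by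
    intro β hβ h0
    by_cases hw : wt nn β = 0
    · exact ⟨0, by rw [hw, zero_smul]⟩
    obtain ⟨n', hn', q, hq, e⟩ := hA β hβ hw
    have h1 : pair n' x = 0 := by
      rw [height_apply, e, pair_smul_left] at h0
      exact (mul_eq_zero.1 h0).resolve_left (by exact_mod_cast hq)
    refine hnp.exists_smul_of_ker_le fun y hy => ?_
    have hle : LinearMap.ker (pairL n₁) ≤ LinearMap.ker (pairL n') := by
      by_contra hle
      exact hxS _ (hF.inter n₁ hn₁ n' hn' hle) ⟨hx₁, h1⟩
    have h2 : pair n' y = 0 := hle ((hker y).2 hy)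
    rw [e, pair_smul_left, h2, mul_zero]
  have h1 := potential_jump hskew hX hnp hgen hu hu' hun hun'
  have hs := hF.notMem_sing hxS
  rw [hD.crossing_funcAt hN]
  refine h1.trans (EqBelow.mul (EqBelow.sol k
    (constantCoeff_wallField n (constantCoeff_jumpSeries X r x))
    (constantCoeff_wallField n (constantCoeff_logder _)) ?_) (EqBelow.refl _ _))
  exact ((hjump n x hnp hx hs hgen).wallField n).symm

open Classical in
/-- A segment off the small subspaces meets the hyperplanes of the frame one at a time. The
potential changes by the wall-crossing on `n^⊥`, and at the other hyperplanes it does not change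
since they carry no walls here. -/
theorem potential_segment_of_le {n : ι → ℤ} (hn : n ∈ A) {f₀ : ScatRing k ι J}
    {u u' : ι → ℝ} (hO : ∀ y ∈ segment ℝ u u', (pair n y ≠ 0 → y ∉ supp D r) ∧
      (pair n y = 0 → funcAt D r y = f₀))
    (hS : ∀ y ∈ segment ℝ u u', ∀ S ∈ 𝒮, y ∉ S) (hu : ∀ n ∈ A, pair n u ≠ 0)
    (hu' : ∀ n ∈ A, pair n u' ≠ 0) (hle : pair n u ≤ pair n u') :
    EqBelow r (potential k nn mm X u')
      ((if pair n u < 0 ∧ 0 < pair n u' then crossing f₀ n else 1) * potential k nn mm X u) := by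
  set d := u' - u with hd
  have hpt : ∀ (n : ι → ℤ) (t : ℝ), pair n (u + t • d) = pair n u + t * pair n d :=
    fun n t => by rw [pair_add, pair_smul]
  have hnd : 0 ≤ pair n d := by rw [hd, pair_sub]; linarith
  have hseg : ∀ t ∈ Icc (0 : ℝ) 1, u + t • d ∈ segment ℝ u u' := fun t ht => by
    rw [segment_eq_image']
    exact ⟨t, ht, rfl⟩
  set T := {t : ℝ | ∃ n ∈ A, pair n (u + t • d) = 0} with hT
  have key := interval_induction (T := T) (hF.finite_times hu) (P := fun a b => 0 ≤ a → b ≤ 1 →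
    EqBelow r (potential k nn mm X (u + b • d))
      ((if pair n (u + a • d) < 0 ∧ 0 < pair n (u + b • d) then crossing f₀ n else 1) *
        potential k nn mm X (u + a • d))) ?_ ?_ zero_le_one ?_ ?_ le_rfl le_rfl
  · simpa [hd] using key
  · intro a b hab ha hb hsub h0 h1
    have hab01 : ∀ t ∈ Icc a b, t ∈ Icc (0 : ℝ) 1 := fun t ht => ⟨h0.trans ht.1, ht.2.trans h1⟩
    have haI : a ∈ Icc a b := ⟨le_rfl, hab⟩
    have hbI : b ∈ Icc a b := ⟨hab, le_rfl⟩
    have hzero : ∀ β : J →₀ ℕ, β.degree < r → wt nn β ≠ 0 → ∀ t, height nn (u + t • d) β = 0 →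
        t ∈ T := by
      intro β hβ hw t ht
      obtain ⟨n', hn', q, hq, e⟩ := hA β hβ hw
      rw [height_apply, e, pair_smul_left] at ht
      exact ⟨n', hn', (mul_eq_zero.1 ht).resolve_left (by exact_mod_cast hq)⟩
    by_cases hne : (T ∩ Icc a b).Nonempty
    · obtain ⟨t₁, ⟨n₁, hn₁, hz⟩, ht₁⟩ := hne
      have honly : ∀ t ∈ Icc a b, t ∈ T → t = t₁ := fun t ht h =>
        hsub ⟨h, ht⟩ ⟨⟨n₁, hn₁, hz⟩, ht₁⟩
      have ha₁ : a < t₁ := ht₁.1.lt_of_ne fun e => ha (e ▸ ⟨n₁, hn₁, hz⟩)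
      have hb₁ : t₁ < b := ht₁.2.lt_of_ne fun e => hb (e ▸ ⟨n₁, hn₁, hz⟩)
      -- no form `n_β` with nonzero value at the crossing point changes sign between `a` and `b`
      have hside : ∀ c ∈ Icc a b, ∀ β : J →₀ ℕ, β.degree < r → height nn (u + t₁ • d) β ≠ 0 →
          SignType.sign (height nn (u + c • d) β) = SignType.sign (height nn (u + t₁ • d) β) := by
        intro c hc β hβ hx
        have hw : wt nn β ≠ 0 := fun h => hx (by rw [height_apply, h, pair_zero_left])
        rw [height_apply, height_apply, hpt, hpt]
        refine sign_eq_of_affine (v := a) (w := b) (fun t ht h => hx ?_) hc ht₁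
        rw [← hpt, ← height_apply] at h
        rwa [← honly t ht (hzero β hβ hw t h)]
      have hxS := hS _ (hseg t₁ (hab01 t₁ ht₁))
      have hOx := hO _ (hseg t₁ (hab01 t₁ ht₁))
      have hd₁ : pair n₁ d ≠ 0 := fun h => hu n₁ hn₁ (by
        rw [hpt, h, mul_zero, add_zero] at hz
        exact hz)
      have hlin : ∀ n' : ι → ℤ, pair n' (u + t₁ • d) = 0 → ∀ t,
          pair n' (u + t • d) = (t - t₁) * pair n' d := fun n' h t => by
        rw [hpt] at h ⊢
        linarith
      -- the wall function at the crossing point is `f₀` on `n^⊥` and trivial off `n^⊥`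
      by_cases hnx : pair n (u + t₁ • d) = 0
      · have hnd' : 0 < pair n d := hnd.lt_of_ne fun h => hu n hn (by
          rw [hpt, ← h, mul_zero, add_zero] at hnx
          exact hnx)
        have hneg : pair n (u + a • d) < 0 := by
          rw [hlin n hnx]
          exact mul_neg_of_neg_of_pos (by linarith) hnd'
        have hpos : 0 < pair n (u + b • d) := by
          rw [hlin n hnx]
          exact mul_pos (by linarith) hnd'
        rw [if_pos ⟨hneg, hpos⟩, ← hOx.2 hnx]
        exact potential_crossing hskew hX hD hF hA hjump (Or.inl hn) hnx hxS (hside a haI)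
          (hside b hbI) hneg hpos
      · rw [if_neg, one_mul]
        · have hcr : ∀ n₂, (n₂ ∈ A ∨ -n₂ ∈ A) → pair n₂ (u + t₁ • d) = 0 → 0 < pair n₂ d →
              EqBelow r (potential k nn mm X (u + b • d)) (potential k nn mm X (u + a • d)) := by
            intro n₂ hn₂ hz₂ hd₂
            have h2 := potential_crossing hskew hX hD hF hA hjump hn₂ hz₂ hxS (hside a haI)
              (hside b hbI) (by
                rw [hlin n₂ hz₂]
                exact mul_neg_of_neg_of_pos (by linarith) hd₂) (by
                rw [hlin n₂ hz₂]
                exact mul_pos (by linarith) hd₂)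
            rwa [funcAt_of_notMem_supp (hOx.1 hnx), crossing_one, one_mul] at h2
          rcases lt_or_gt_of_ne hd₁ with h | h
          · exact hcr (-n₁) (Or.inr (by rwa [neg_neg])) (by rw [pair_neg_left, hz, neg_zero])
              (by rw [pair_neg_left]; linarith)
          · exact hcr n₁ (Or.inl hn₁) hz h
        · rintro ⟨h2, h3⟩
          have h4 := sign_eq_of_affine (p := pair n u) (q := pair n d) (v := a) (w := b)
            (fun t ht h => hnx (by
              rw [← hpt] at h
              rwa [← honly t ht ⟨n, hn, h⟩])) haI hbI
          rw [← hpt, ← hpt, sign_neg h2, sign_pos h3] at h4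
          exact absurd h4 (by decide)
    · have hnone : ∀ t ∈ Icc a b, t ∉ T := fun t ht h => hne ⟨t, h, ht⟩
      rw [if_neg, one_mul]
      · refine potential_congr hskew hX fun β hβ => ?_
        by_cases hw : wt nn β = 0
        · rw [height_apply, height_apply, hw, pair_zero_left, pair_zero_left]
        · rw [height_apply, height_apply, hpt, hpt]
          refine sign_eq_of_affine (v := a) (w := b) (fun t ht h => ?_) hbI haI
          rw [← hpt, ← height_apply] at h
          exact hnone t ht (hzero β hβ hw t h)
      · rintro ⟨h2, h3⟩
        have h4 := sign_eq_of_affine (p := pair n u) (q := pair n d) (v := a) (w := b)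
          (fun t ht h => hnone t ht ⟨n, hn, by rwa [← hpt] at h⟩) haI hbI
        rw [← hpt, ← hpt, sign_neg h2, sign_pos h3] at h4
        exact absurd h4 (by decide)
  · intro a b c hab hbc hb h1 h2 h0 hc
    have e1 := h1 h0 (hbc.trans hc)
    have e2 := h2 (h0.trans hab) hc
    have e3 := e2.trans ((EqBelow.refl r _).mul e1)
    rw [← mul_assoc] at e3
    convert e3 using 2
    have hb0 : pair n (u + b • d) ≠ 0 := fun h => hb ⟨n, hn, h⟩
    have m1 : pair n (u + a • d) ≤ pair n (u + b • d) := by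
      rw [hpt, hpt]
      nlinarith
    have m2 : pair n (u + b • d) ≤ pair n (u + c • d) := by
      rw [hpt, hpt]
      nlinarith
    rcases lt_or_gt_of_ne hb0 with h | h
    · rw [if_neg (c := _ ∧ 0 < pair n (u + b • d)) fun h' => h.not_gt h'.2, mul_one]
      exact if_congr (and_congr_left fun _ => iff_of_true (m1.trans_lt h) h) rfl rfl
    · rw [if_neg (c := pair n (u + b • d) < 0 ∧ _) fun h' => h.not_gt h'.1, one_mul]
      exact if_congr (and_congr_right fun _ => iff_of_true (h.trans_le m2) h) rfl rfl
  · rintro ⟨n', hn', h⟩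
    rw [zero_smul, add_zero] at h
    exact hu n' hn' h
  · rintro ⟨n', hn', h⟩
    rw [one_smul, hd, add_sub_cancel] at h
    exact hu' n' hn' h

open Classical in
/-- The segment may also run against `n`, as long as it does not cross `n^⊥` then. -/
theorem potential_segment {n : ι → ℤ} (hn : n ∈ A) {f₀ : ScatRing k ι J}
    {u u' : ι → ℝ} (hO : ∀ y ∈ segment ℝ u u', (pair n y ≠ 0 → y ∉ supp D r) ∧
      (pair n y = 0 → funcAt D r y = f₀))
    (hS : ∀ y ∈ segment ℝ u u', ∀ S ∈ 𝒮, y ∉ S) (hu : ∀ n ∈ A, pair n u ≠ 0)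
    (hu' : ∀ n ∈ A, pair n u' ≠ 0) (hside : pair n u' < 0 → pair n u < 0) :
    EqBelow r (potential k nn mm X u')
      ((if pair n u < 0 ∧ 0 < pair n u' then crossing f₀ n else 1) * potential k nn mm X u) := by
  rcases le_total (pair n u) (pair n u') with h | h
  · exact potential_segment_of_le hskew hX hD hF hA hjump hn hO hS hu hu' h
  · rw [segment_symm] at hO hS
    have h1 := potential_segment_of_le hskew hX hD hF hA hjump hn hO hS hu' hu h
    rw [if_neg fun h' => (hside h'.1).not_gt h'.2, one_mul] at h1
    rw [if_neg fun h' => by linarith [h'.1, h'.2], one_mul]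
    exact h1.symm

open Classical in
/-- Near a point outside the singular locus, the potentials on both sides of the walls are related
by the wall-crossing. -/
theorem potential_local {n : ι → ℤ} (hn : n ∈ A) {f₀ : ScatRing k ι J} {c : ι → ℝ} {ε : ℝ}
    (hO : ∀ y ∈ Metric.ball c ε, (pair n y ≠ 0 → y ∉ supp D r) ∧
      (pair n y = 0 → funcAt D r y = f₀)) {u u' : ι → ℝ} (huB : u ∈ Metric.ball c ε)
    (huB' : u' ∈ Metric.ball c ε) (hu : IsOff A 𝒮 u) (hu' : IsOff A 𝒮 u')
    (hside : pair n u' < 0 → pair n u < 0) :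
    EqBelow r (potential k nn mm X u')
      ((if pair n u < 0 ∧ 0 < pair n u' then crossing f₀ n else 1) * potential k nn mm X u) := by
  -- an intermediate point close to `u` makes both segments generic
  have hnbhd : Metric.ball c ε ∩ {v | SignType.sign (pair n v) = SignType.sign (pair n u)} ∈ 𝓝 u := by
    refine Filter.inter_mem (Metric.isOpen_ball.mem_nhds huB) ?_
    rcases lt_or_gt_of_ne (hu.normals n hn) with h | h
    · filter_upwards [(isOpen_lt (continuous_pair n) continuous_const).mem_nhds h] with v hv
      show SignType.sign (pair n v) = SignType.sign (pair n u)
      rw [sign_neg h, sign_neg hv]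
    · filter_upwards [(isOpen_lt continuous_const (continuous_pair n)).mem_nhds h] with v hv
      show SignType.sign (pair n v) = SignType.sign (pair n u)
      rw [sign_pos h, sign_pos hv]
  obtain ⟨v, ⟨hvB, hvs⟩, -, hv⟩ := exists_generic ⊤ (𝒮 := ((fun S => S ⊔ Submodule.span ℝ {u}) '' 𝒮 ∪
      (fun S => S ⊔ Submodule.span ℝ {u'}) '' 𝒮) ∪ (fun n => LinearMap.ker (pairL n)) '' A)
    (((hF.finite_small.image _).union (hF.finite_small.image _)).union
      (hF.finite_normals.image _)) (by
      rintro _ ((⟨S, hS, rfl⟩ | ⟨S, hS, rfl⟩) | ⟨n', hn', rfl⟩) h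
      · exact (hF.small S hS).sup_span_ne_top u (top_le_iff.1 h)
      · exact (hF.small S hS).sup_span_ne_top u' (top_le_iff.1 h)
      · exact ker_pairL_ne_top (hF.primitive n' hn').ne_zero (top_le_iff.1 h))
    Submodule.mem_top hnbhd
  have hvs : SignType.sign (pair n v) = SignType.sign (pair n u) := hvs
  have hvA : ∀ n' ∈ A, pair n' v ≠ 0 := fun n' hn' => hv _ (Or.inr ⟨n', hn', rfl⟩)
  have hsegS : ∀ a : ι → ℝ, (∀ S ∈ 𝒮, a ∉ S) → (∀ S ∈ 𝒮, v ∉ S ⊔ Submodule.span ℝ {a}) →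
      ∀ y ∈ segment ℝ a v, ∀ S ∈ 𝒮, y ∉ S := by
    intro a ha hva y hy S hS hyS
    rw [segment_eq_image'] at hy
    obtain ⟨t, -, rfl⟩ := hy
    rcases eq_or_ne t 0 with rfl | ht
    · exact ha S hS (by simpa using hyS)
    · refine hva S hS ?_
      have h1 : t • v ∈ S ⊔ Submodule.span ℝ {a} := by
        have e : t • v = (a + t • (v - a)) + (t - 1) • a := by module
        rw [e]
        exact Submodule.add_mem _ (Submodule.mem_sup_left hyS) (Submodule.mem_sup_right
          (Submodule.smul_mem _ _ (Submodule.mem_span_singleton_self a)))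
      exact (Submodule.smul_mem_iff _ ht).1 h1
  have hball : ∀ {a b}, a ∈ Metric.ball c ε → b ∈ Metric.ball c ε → ∀ y ∈ segment ℝ a b,
      (pair n y ≠ 0 → y ∉ supp D r) ∧ (pair n y = 0 → funcAt D r y = f₀) := fun ha hb y hy =>
    hO y ((convex_ball c ε).segment_subset ha hb hy)
  have hneg : pair n v < 0 ↔ pair n u < 0 := by
    rw [← sign_eq_neg_one_iff, hvs, sign_eq_neg_one_iff]
  have hpos : 0 < pair n v ↔ 0 < pair n u := by
    rw [← sign_eq_one_iff, hvs, sign_eq_one_iff]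
  have e1 := potential_segment hskew hX hD hF hA hjump hn (hball huB hvB)
    (hsegS u hu.small fun S hS => hv _ (Or.inl (Or.inl ⟨S, hS, rfl⟩))) hu.normals hvA hneg.1
  have hseg' := hsegS u' hu'.small fun S hS => hv _ (Or.inl (Or.inr ⟨S, hS, rfl⟩))
  rw [segment_symm] at hseg'
  have e2 := potential_segment hskew hX hD hF hA hjump hn (hball hvB huB') hseg' hvA hu'.normals
    fun h => hneg.2 (hside h)
  rw [if_neg fun h => h.1.not_gt (hpos.1 h.2), one_mul] at e1
  simp only [hneg] at e2
  exact e2.trans ((EqBelow.refl _ _).mul e1)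

end

/-- At the generic points near `x` the potential is `g`, to order `r`. -/
def PotentialNear (k : Type u) [Field k] [CharZero k] (nn mm : J → ι → ℤ)
    (X : MvPowerSeries J (Module.End k (AddMonoidAlgebra k (ι → ℤ)))) (r : ℕ)
    (A : Set (ι → ℤ)) (𝒮 : Set (Submodule ℝ (ι → ℝ))) (x : ι → ℝ)
    (g : MvPowerSeries J (Module.End k (AddMonoidAlgebra k (ι → ℤ)))) : Prop :=
  ∀ᶠ u in 𝓝 x, IsOff A 𝒮 u → EqBelow r (potential k nn mm X u) g

theorem IsFrame.exists_isOff (hF : IsFrame D r A 𝒮) {x : ι → ℝ} {O : Set (ι → ℝ)}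
    (hO : O ∈ 𝓝 x) : ∃ u ∈ O, IsOff A 𝒮 u := by
  obtain ⟨u, hu, -, h⟩ := exists_generic ⊤ (𝒮 := 𝒮 ∪ (fun n => LinearMap.ker (pairL n)) '' A)
    (hF.finite_small.union (hF.finite_normals.image _)) (by
      rintro _ (hS | ⟨n', hn', rfl⟩) h
      · exact (hF.small _ hS).ne_top (top_le_iff.1 h)
      · exact ker_pairL_ne_top (hF.primitive n' hn').ne_zero (top_le_iff.1 h))
    Submodule.mem_top hO
  exact ⟨u, hu, fun n hn => h _ (Or.inr ⟨n, hn, rfl⟩), fun S hS => h S (Or.inl hS)⟩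

section

variable (hskew : ∀ i j, nn i ⬝ᵥ mm j = -(nn j ⬝ᵥ mm i)) (hX : LieElt (lieFamily k nn mm) X)
  (hD : IsScatteringDiagram D) (hF : IsFrame D r A 𝒮) (hA : Represents nn r A)
  (hjump : HasJumps k nn mm X D r)

include hskew hX hD hF hA hjump

theorem eventually_potentialNear_crossing {x : ι → ℝ} (hx : x ∉ sing D r) {n : ι → ℤ}
    (hn : n ∈ A) (hN : IsNormalAt D r x n) :
    ∀ᶠ y in 𝓝 x, pair n y < 0 → ∀ g, PotentialNear k nn mm X r A 𝒮 y g →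
      ∀ᶠ y' in 𝓝 x, 0 < pair n y' →
        PotentialNear k nn mm X r A 𝒮 y' (crossing (funcAt D r x) n * g) := by
  classical
  obtain ⟨ε, hε, hb⟩ := Metric.eventually_nhds_iff_ball.1
    (hD.eventually_funcAt hx (hF.primitive n hn).ne_zero hN)
  filter_upwards [Metric.ball_mem_nhds x hε] with y hy hny g hg
  obtain ⟨u, ⟨⟨hu1, hu2⟩, hu3⟩, hu4⟩ := hF.exists_isOff (hg.and (Metric.isOpen_ball.mem_nhds hy)
    |>.and ((isOpen_lt (continuous_pair n) continuous_const).mem_nhds hny))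
  have hu3 : pair n u < 0 := hu3
  filter_upwards [Metric.ball_mem_nhds x hε] with y' hy' hny'
  filter_upwards [Metric.isOpen_ball.mem_nhds hy',
    (isOpen_lt continuous_const (continuous_pair n)).mem_nhds hny'] with u' h1 h2 h3
  have h2 : 0 < pair n u' := h2
  have h4 := potential_local hskew hX hD hF hA hjump hn (fun y hy => (hb y hy).2.2) hu2 h1 hu4 h3
    fun h => (h.not_gt h2).elim
  rw [if_pos ⟨hu3, h2⟩] at h4
  exact h4.trans ((EqBelow.refl _ _).mul (hu1 hu4))

/-- The potential is locally constant outside the support. -/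
theorem eventually_potentialNear {x : ι → ℝ} (hx : x ∉ supp D r) (hs : x ∉ sing D r) :
    ∀ᶠ y in 𝓝 x, ∀ g, PotentialNear k nn mm X r A 𝒮 x g ↔ PotentialNear k nn mm X r A 𝒮 y g := by
  classical
  obtain ⟨ε, hε, hconst⟩ : ∃ ε > 0, ∀ u ∈ Metric.ball x ε, ∀ u' ∈ Metric.ball x ε,
      IsOff A 𝒮 u → IsOff A 𝒮 u' →
        EqBelow r (potential k nn mm X u) (potential k nn mm X u') := by
    by_cases hne : A.Nonempty
    · obtain ⟨n, hn⟩ := hne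
      obtain ⟨ε, hε, hb⟩ := Metric.eventually_nhds_iff_ball.1
        (hD.eventually_funcAt hs (hF.primitive n hn).ne_zero
          (fun w hw h => absurd ⟨w, hw, h⟩ hx))
      rw [funcAt_of_notMem_supp hx] at hb
      have key : ∀ u ∈ Metric.ball x ε, ∀ u' ∈ Metric.ball x ε, IsOff A 𝒮 u → IsOff A 𝒮 u' →
          (pair n u' < 0 → pair n u < 0) →
          EqBelow r (potential k nn mm X u') (potential k nn mm X u) := by
        intro u hu u' hu' h1 h2 h3
        have h4 := potential_local hskew hX hD hF hA hjump hn (fun y hy => (hb y hy).2.2) hu hu' h1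
          h2 h3
        rwa [crossing_one, ite_self, one_mul] at h4
      refine ⟨ε, hε, fun u hu u' hu' h1 h2 => ?_⟩
      by_cases h3 : pair n u < 0
      · exact (key u hu u' hu' h1 h2 fun _ => h3).symm
      · exact key u' hu' u hu h2 h1 fun h => absurd h h3
    · refine ⟨1, one_pos, fun u _ u' _ _ _ => potential_congr hskew hX fun β hβ => ?_⟩
      have hw : wt nn β = 0 := by
        by_contra hw
        obtain ⟨n, hn, -⟩ := hA β hβ hw
        exact hne ⟨n, hn⟩
      rw [height_apply, height_apply, hw, pair_zero_left, pair_zero_left]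
  have key : ∀ y ∈ Metric.ball x ε, ∀ y' ∈ Metric.ball x ε, ∀ g,
      PotentialNear k nn mm X r A 𝒮 y g → PotentialNear k nn mm X r A 𝒮 y' g := by
    intro y hy y' hy' g hg
    obtain ⟨u, ⟨hu1, hu2⟩, hu3⟩ := hF.exists_isOff (hg.and (Metric.isOpen_ball.mem_nhds hy))
    filter_upwards [Metric.isOpen_ball.mem_nhds hy'] with u' h1 h2
    exact (hconst u' h1 u hu2 h2 hu3).trans (hu1 hu3)
  filter_upwards [Metric.ball_mem_nhds x hε] with y hy g
  exact ⟨key x (Metric.mem_ball_self hε) y hy g, key y hy x (Metric.mem_ball_self hε) g⟩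

/-- Along a part of a path that does not meet the support the potential does not change. -/
theorem potentialNear_of_disjoint {γ : ℝ → ι → ℝ} {a b : ℝ} (hab : a ≤ b)
    (hγ : ContinuousOn γ (Icc a b)) (hsing : ∀ t ∈ Icc a b, γ t ∉ sing D r)
    (hsupp : ∀ t ∈ Icc a b, γ t ∉ supp D r)
    {g : MvPowerSeries J (Module.End k (AddMonoidAlgebra k (ι → ℤ)))}
    (hg : PotentialNear k nn mm X r A 𝒮 (γ a) g) : PotentialNear k nn mm X r A 𝒮 (γ b) g := by
  have h := isPreconnected_Icc.induction₂ (s := Icc a b) (fun s t => ∀ g,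
    PotentialNear k nn mm X r A 𝒮 (γ s) g ↔ PotentialNear k nn mm X r A 𝒮 (γ t) g)
    (fun t ht => (hγ t ht).eventually
      (eventually_potentialNear hskew hX hD hF hA hjump (hsupp t ht) (hsing t ht)))
    (fun s t u _ _ _ h1 h2 g => (h1 g).trans (h2 g)) (fun s t _ _ h g => (h g).symm)
    (left_mem_Icc.2 hab) (right_mem_Icc.2 hab)
  exact (h g).1 hg

/-- Along a path the potential is multiplied by the successive wall-crossings. The induction is on
the list of remaining crossings, the path starting at time `a`. -/
theorem potentialNear_path (hsymm : ∀ n ∈ A, -n ∈ A) {γ : ℝ → ι → ℝ}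
    (hγ : ContinuousOn γ (Icc 0 1)) (hsing : ∀ t ∈ Icc (0 : ℝ) 1, γ t ∉ sing D r)
    (hend : γ 1 ∉ supp D r) (l : List (ℝ × (ι → ℤ))) :
    ∀ a ∈ Icc (0 : ℝ) 1, γ a ∉ supp D r → (l.Pairwise fun p q => p.1 < q.1) →
    (∀ u, (∃ p ∈ l, p.1 = u) ↔ u ∈ Icc a 1 ∧ γ u ∈ supp D r) →
    (∀ p ∈ l, IsCrossing D r γ p.1 p.2) → ∀ g, PotentialNear k nn mm X r A 𝒮 (γ a) g →
    PotentialNear k nn mm X r A 𝒮 (γ 1) (pathElt D r γ l * g) := by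
  induction l with
  | nil =>
    intro a ha hsa _ htimes _ g hg
    rw [pathElt, one_mul]
    refine potentialNear_of_disjoint hskew hX hD hF hA hjump ha.2
      (hγ.mono (Icc_subset_Icc_left ha.1)) (fun t ht => hsing t ⟨ha.1.trans ht.1, ht.2⟩)
      (fun t ht h => ?_) hg
    obtain ⟨p, hp, -⟩ := (htimes t).2 ⟨ht, h⟩
    exact absurd hp List.not_mem_nil
  | cons p l ih =>
    intro a ha hsa hsort htimes hcross g hg
    obtain ⟨hpa, hps⟩ := (htimes p.1).1 ⟨p, List.mem_cons_self, rfl⟩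
    have hap : a < p.1 := hpa.1.lt_of_ne fun e => hsa (e ▸ hps)
    have hp1 : p.1 < 1 := hpa.2.lt_of_ne fun e => hend (e ▸ hps)
    have hp01 : p.1 ∈ Icc (0 : ℝ) 1 := ⟨ha.1.trans hpa.1, hpa.2⟩
    obtain ⟨-, hn, hN, ε, hε, hneg, hpos⟩ := hcross p List.mem_cons_self
    rw [List.pairwise_cons] at hsort
    -- the crossing normal is, up to sign, that of a hyperplane of the frame
    have hnA : p.2 ∈ A := by
      obtain ⟨w, hw, hxw⟩ := hps
      obtain ⟨n, hnA, hle⟩ := hF.wall w hw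
      have e1 := span_eq_ker (hD.isWall w hw.1).codim_one hn.ne_zero (hN w hw hxw)
      have e2 := span_eq_ker (hD.isWall w hw.1).codim_one (hF.primitive n hnA).ne_zero hle
      obtain ⟨q, hq⟩ := (hF.primitive n hnA).exists_smul_of_ker_le (n' := p.2) fun x hx => by
        have h1 : x ∈ LinearMap.ker (pairL n) := hx
        rw [← e2, e1] at h1
        exact h1
      rcases eq_or_eq_neg_of_smul hn hq with h | h
      · rwa [h]
      · rw [h]
        exact hsymm n hnA
    have hcont : ContinuousAt γ p.1 :=
      (hγ p.1 hp01).continuousAt (Icc_mem_nhds (ha.1.trans_lt hap) hp1)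
    have hloc := hcont.eventually (eventually_potentialNear_crossing hskew hX hD hF hA hjump
      (hsing p.1 hp01) hnA hN)
    -- a time `c` shortly before the crossing
    obtain ⟨c, hc, hca, hcε⟩ : ∃ c, (pair p.2 (γ c) < 0 → ∀ g,
        PotentialNear k nn mm X r A 𝒮 (γ c) g → ∀ᶠ y' in 𝓝 (γ p.1), 0 < pair p.2 y' →
        PotentialNear k nn mm X r A 𝒮 y' (crossing (funcAt D r (γ p.1)) p.2 * g)) ∧
        c ∈ Ioo a p.1 ∧ c ∈ Ioo (p.1 - ε) p.1 :=
      (((hloc.filter_mono nhdsWithin_le_nhds).and (Ioo_mem_nhdsLT hap)).and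
        (Ioo_mem_nhdsLT (by linarith : p.1 - ε < p.1))).exists.imp fun c h => ⟨h.1.1, h.1.2, h.2⟩
    have hgc : PotentialNear k nn mm X r A 𝒮 (γ c) g := by
      refine potentialNear_of_disjoint hskew hX hD hF hA hjump hca.1.le
        (hγ.mono (Icc_subset_Icc ha.1 (hca.2.trans hp1).le))
        (fun t ht => hsing t ⟨ha.1.trans ht.1, ht.2.trans (hca.2.trans hp1).le⟩)
        (fun t ht h => ?_) hg
      obtain ⟨q, hq, e⟩ := (htimes t).2 ⟨⟨ht.1, ht.2.trans (hca.2.trans hp1).le⟩, h⟩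
      have h1 : p.1 ≤ q.1 := by
        rcases List.mem_cons.1 hq with rfl | hq
        · exact le_rfl
        · exact (hsort.1 q hq).le
      have := ht.2
      have := hca.2
      linarith
    have hev := hcont.eventually (hc (hneg c hcε) g hgc)
    have hnext : ∀ᶠ d in 𝓝 p.1, ∀ q ∈ {q | q ∈ l}, d < q.1 := by
      rw [(List.finite_toSet l).eventually_all]
      exact fun q hq => gt_mem_nhds (hsort.1 q hq)
    -- a time `d` shortly after the crossing and before the next one
    obtain ⟨d, hd, hdq, hd1, hdε⟩ : ∃ d, (0 < pair p.2 (γ d) →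
        PotentialNear k nn mm X r A 𝒮 (γ d) (crossing (funcAt D r (γ p.1)) p.2 * g)) ∧
        (∀ q ∈ {q | q ∈ l}, d < q.1) ∧ d ∈ Ioo p.1 1 ∧ d ∈ Ioo p.1 (p.1 + ε) :=
      ((((hev.and hnext).filter_mono nhdsWithin_le_nhds).and (Ioo_mem_nhdsGT hp1)).and
        (Ioo_mem_nhdsGT (by linarith : p.1 < p.1 + ε))).exists.imp
          fun d h => ⟨h.1.1.1, h.1.1.2, h.1.2, h.2⟩
    have hd0 : a ≤ d := (hap.trans hd1.1).le
    have htimes' : ∀ u, (∃ q ∈ l, q.1 = u) ↔ u ∈ Icc d 1 ∧ γ u ∈ supp D r := by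
      intro u
      constructor
      · rintro ⟨q, hq, rfl⟩
        obtain ⟨h1, h2⟩ := (htimes q.1).1 ⟨q, List.mem_cons_of_mem _ hq, rfl⟩
        exact ⟨⟨(hdq q hq).le, h1.2⟩, h2⟩
      · rintro ⟨h1, h2⟩
        obtain ⟨q, hq, e⟩ := (htimes u).2 ⟨⟨hd0.trans h1.1, h1.2⟩, h2⟩
        rcases List.mem_cons.1 hq with rfl | hq
        · have := h1.1
          have := hd1.1
          linarith
        · exact ⟨q, hq, e⟩
    rw [pathElt, mul_assoc]
    refine ih d ⟨ha.1.trans hd0, hd1.2.le⟩ (fun h => ?_) hsort.2 htimes'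
      (fun q hq => hcross q (List.mem_cons_of_mem _ hq)) _ (hd (hpos d hdε))
    obtain ⟨q, hq, e⟩ := (htimes' d).2 ⟨⟨le_rfl, hd1.2.le⟩, h⟩
    have := hdq q hq
    linarith

end

theorem IsFrame.union_neg (hF : IsFrame D r A 𝒮) : IsFrame D r (A ∪ (fun n => -n) ⁻¹' A) 𝒮 := by
  have hker : ∀ n : ι → ℤ, LinearMap.ker (pairL (-n)) = LinearMap.ker (pairL n) := fun n => by
    ext x
    simp [pair_neg_left]
  have hrep : ∀ n ∈ A ∪ (fun n => -n) ⁻¹' A, ∃ n' ∈ A,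
      LinearMap.ker (pairL n) = LinearMap.ker (pairL n') := by
    rintro n (hn | hn)
    · exact ⟨n, hn, rfl⟩
    · exact ⟨-n, hn, (hker n).symm⟩
  refine ⟨hF.finite_normals.union (hF.finite_normals.preimage neg_injective.injOn), ?_,
    hF.finite_small, hF.small, ?_, hF.sing, ?_⟩
  · rintro n (hn | hn)
    · exact hF.primitive n hn
    · rw [← neg_neg n]
      exact (hF.primitive _ hn).neg
  · intro w hw
    obtain ⟨n, hn, h⟩ := hF.wall w hw
    exact ⟨n, Or.inl hn, h⟩
  · intro n hn n' hn' h
    obtain ⟨n₁, hn₁, e₁⟩ := hrep n hn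
    obtain ⟨n₂, hn₂, e₂⟩ := hrep n' hn'
    rw [e₁, e₂] at h ⊢
    exact hF.inter n₁ hn₁ n₂ hn₂ h

theorem exists_represents [Finite J] (nn : J → ι → ℤ) (r : ℕ) :
    ∃ A : Set (ι → ℤ), A.Finite ∧ (∀ n ∈ A, IsPrimitive n) ∧ Represents nn r A := by
  have hf : {β : J →₀ ℕ | β.degree < r ∧ wt nn β ≠ 0}.Finite :=
    (Finsupp.finite_of_degree_le (σ := J) r).subset fun β hβ => hβ.1.le
  refine ⟨_, hf.image fun β => primitivePart (wt nn β), ?_, fun β hβ hw => ?_⟩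
  · rintro _ ⟨β, hβ, rfl⟩
    exact (primitivePart_spec hβ.2).1
  · obtain ⟨-, h2, h3⟩ := primitivePart_spec hw
    exact ⟨_, ⟨β, ⟨hβ, hw⟩, rfl⟩, _, by exact_mod_cast h2, h3⟩

/-- A diagram is consistent if its wall functions are the jumps of a potential. -/
theorem IsScatteringDiagram.isConsistent [Finite J]
    (hskew : ∀ i j, nn i ⬝ᵥ mm j = -(nn j ⬝ᵥ mm i)) (hX : LieElt (lieFamily k nn mm) X)
    (hD : IsScatteringDiagram D) (hjump : ∀ r, HasJumps k nn mm X D r) : IsConsistent D := by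
  intro r γ γ' θ θ' hθ hθ' h0 h1
  obtain ⟨l, hl, rfl⟩ := hθ.exists_list
  obtain ⟨l', hl', rfl⟩ := hθ'.exists_list
  obtain ⟨A₀, hA₀, hA₀p, hA₀r⟩ := exists_represents nn r
  obtain ⟨A₁, 𝒮, hsub, -, hF₁, -⟩ := exists_isFrame hD hD r hA₀ hA₀p Set.finite_empty (by simp)
  have hF := hF₁.union_neg
  set A := A₁ ∪ (fun n => -n) ⁻¹' A₁ with hAdef
  have hA : Represents nn r A := fun β hβ hw => by
    obtain ⟨n, hn, h⟩ := hA₀r β hβ hw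
    exact ⟨n, Or.inl (hsub hn), h⟩
  have hsymm : ∀ n ∈ A, -n ∈ A := by
    rintro n (hn | hn)
    · exact Or.inr (by simpa using hn)
    · exact Or.inl hn
  obtain ⟨ε, hε, hb⟩ := Metric.eventually_nhds_iff_ball.1
    (eventually_potentialNear hskew hX hD hF hA (hjump r) hl.start_notMem
      (hl.notMem_sing 0 ⟨le_rfl, zero_le_one⟩))
  -- the potential near the starting point
  obtain ⟨g, hg0, hg⟩ : ∃ g, MvPowerSeries.constantCoeff g = 1 ∧
      PotentialNear k nn mm X r A 𝒮 (γ 0) g := by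
    obtain ⟨u, hu, hoff⟩ := hF.exists_isOff (Metric.ball_mem_nhds (γ 0) hε)
    refine ⟨potential k nn mm X u, constantCoeff_sol _, (hb u hu _).2 ?_⟩
    have hnear : ∀ᶠ v in 𝓝 u, ∀ β ∈ {β : J →₀ ℕ | β.degree < r ∧ wt nn β ≠ 0},
        SignType.sign (height nn v β) = SignType.sign (height nn u β) := by
      rw [((Finsupp.finite_of_degree_le (σ := J) r).subset fun β hβ => hβ.1.le :
        {β : J →₀ ℕ | β.degree < r ∧ wt nn β ≠ 0}.Finite).eventually_all]
      intro β hβ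
      have hne : height nn u β ≠ 0 := by
        obtain ⟨n, hn, q, hq, e⟩ := hA β hβ.1 hβ.2
        rw [height_apply, e, pair_smul_left]
        exact mul_ne_zero (by exact_mod_cast hq) (hoff.normals n hn)
      rcases lt_or_gt_of_ne hne with h | h
      · filter_upwards [(isOpen_lt (continuous_pair (wt nn β)) continuous_const).mem_nhds h]
          with v hv
        rw [sign_neg h, height_apply, sign_neg hv]
      · filter_upwards [(isOpen_lt continuous_const (continuous_pair (wt nn β))).mem_nhds h]
          with v hv
        rw [sign_pos h, height_apply, sign_pos hv]
    filter_upwards [hnear] with v hv _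
    refine potential_congr hskew hX fun β hβ => ?_
    by_cases hw : wt nn β = 0
    · rw [height_apply, height_apply, hw, pair_zero_left, pair_zero_left]
    · exact hv β ⟨hβ, hw⟩
  -- the potential near the endpoint is the path ordered product times `g`, for both paths; cancel
  -- the invertible `g`
  have e1 := potentialNear_path hskew hX hD hF hA (hjump r) hsymm hl.continuousOn hl.notMem_sing
    hl.end_notMem l 0 ⟨le_rfl, zero_le_one⟩ hl.start_notMem hl.sorted hl.times hl.crossing g hg
  rw [h0] at hg
  have e2 := potentialNear_path hskew hX hD hF hA (hjump r) hsymm hl'.continuousOn hl'.notMem_sing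
    hl'.end_notMem l' 0 ⟨le_rfl, zero_le_one⟩ hl'.start_notMem hl'.sorted hl'.times hl'.crossing g hg
  rw [← h1] at e2
  obtain ⟨u, ⟨hu1, hu2⟩, hoff⟩ := hF.exists_isOff (e1.and e2)
  have e3 := ((hu1 hoff).symm.trans (hu2 hoff)).mul
    (EqBelow.refl r (MvPowerSeries.invOfUnit g 1))
  rw [mul_assoc, mul_assoc, MvPowerSeries.mul_invOfUnit g 1 (by simp [hg0]), mul_one,
    mul_one] at e3
  exact e3.act

end Consistency

/-! ### Existence and comparison of consistent completions -/

section Completion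

open Topology Set

variable {ι : Type v} [Fintype ι] {k : Type u} {J : Type w} [Field k] [CharZero k]
  {nn mm : J → ι → ℤ} {p : (J →₀ ℕ) → k}

/-- The diagram `E` arises from `Din` by adding outgoing walls, and the logarithmic derivative of
its wall function at a general point `x` is the sum of the terms `p_β t^β z^{m_β}` with
`x ∈ n_β^⊥`. -/
structure IsInitial (nn mm : J → ι → ℤ) (p : (J →₀ ℕ) → k) (Din E : Set (Wall k ι J)) : Prop where
  isScatteringDiagram : IsScatteringDiagram E
  subset : Din ⊆ E
  outgoing : ∀ w ∈ E, w ∉ Din → w.IsOutgoing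
  exists_ne : ∀ w ∈ E, ∃ β β', β ≠ β' ∧ MvPowerSeries.coeff β (logder w.func) ≠ 0 ∧
    MvPowerSeries.coeff β' (logder w.func) ≠ 0
  coeff_eq : ∀ (r : ℕ) (x : ι → ℝ), x ∉ sing E r → ∀ β : J →₀ ℕ, β.degree < r →
    height nn x β = 0 →
    MvPowerSeries.coeff β (logder (funcAt E r x)) = AddMonoidAlgebra.single (wt mm β) (p β)
  coeff_eq_zero : ∀ (r : ℕ) (x : ι → ℝ), x ∉ sing E r → ∀ β : J →₀ ℕ, β.degree < r →
    height nn x β ≠ 0 → MvPowerSeries.coeff β (logder (funcAt E r x)) = 0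

variable {X : MvPowerSeries J (Module.End k (AddMonoidAlgebra k (ι → ℤ)))}
  {Din E : Set (Wall k ι J)}

theorem wallsMod_union (D D' : Set (Wall k ι J)) (r : ℕ) :
    wallsMod (D ∪ D') r = wallsMod D r ∪ wallsMod D' r := by
  ext w
  simp only [wallsMod, Set.mem_union, Set.mem_ofPred_eq, or_and_right]

theorem IsScatteringDiagram.union {D D' : Set (Wall k ι J)} (hD : IsScatteringDiagram D)
    (hD' : IsScatteringDiagram D') : IsScatteringDiagram (D ∪ D') :=
  ⟨fun w hw => hw.elim (hD.isWall w) (hD'.isWall w), fun r => by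
    rw [wallsMod_union]
    exact (hD.finite r).union (hD'.finite r)⟩

theorem IsScatteringDiagram.logder_funcAt_union {D D' : Set (Wall k ι J)}
    (hD : IsScatteringDiagram D) (hD' : IsScatteringDiagram D') (hdis : Disjoint D D') (r : ℕ)
    (x : ι → ℝ) :
    logder (funcAt (D ∪ D') r x) = logder (funcAt D r x) + logder (funcAt D' r x) := by
  classical
  rw [(hD.union hD').logder_funcAt, hD.logder_funcAt, hD'.logder_funcAt, ← Finset.sum_union]
  · congr 1
    ext w
    simp only [Finset.mem_union, Set.Finite.mem_toFinset, wallsAt, wallsMod_union, Set.mem_union,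
      Set.mem_ofPred_eq, or_and_right]
  · rw [Finset.disjoint_left]
    intro w h h'
    rw [Set.Finite.mem_toFinset] at h h'
    exact Set.disjoint_left.1 hdis h.1.1 h'.1.1

/-- The walls on chambers have logarithmic derivatives with a single term, those of `E` have
several. -/
theorem IsInitial.disjoint (hI : IsInitial nn mm p Din E) :
    Disjoint E (chamberWalls k nn mm X p) := by
  classical
  rw [Set.disjoint_left]
  rintro w hw ⟨β, x, hx, -, rfl⟩
  obtain ⟨γ, γ', hne, h1, h2⟩ := hI.exists_ne _ hw
  rw [logder_chamberWall hx.degree_ne_zero, MvPowerSeries.coeff_monomial] at h1 h2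
  have e1 : γ = β := by
    by_contra h
    exact h1 (if_neg h)
  have e2 : γ' = β := by
    by_contra h
    exact h2 (if_neg h)
  exact hne (e1.trans e2.symm)

variable [Finite J]

/-- The sum over the chambers through a generic point has one term in each degree. -/
theorem coeff_logder_funcAt_chamberWalls (hskew : ∀ i j, nn i ⬝ᵥ mm j = -(nn j ⬝ᵥ mm i))
    (hX : LieElt (lieFamily k nn mm) X) (hp0 : ∀ β, wt nn β = 0 → p β = 0)
    (h𝒞 : IsScatteringDiagram (chamberWalls k nn mm X p)) {r : ℕ} {n : ι → ℤ} {x : ι → ℝ}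
    (hgen : ∀ β : J →₀ ℕ, β.degree < r → height nn x β = 0 → ∃ q : ℤ, wt nn β = q • n)
    {β : J →₀ ℕ} (hβ : β.degree < r) :
    MvPowerSeries.coeff β (logder (funcAt (chamberWalls k nn mm X p) r x)) =
      if height nn x β = 0 then
        AddMonoidAlgebra.single (wt mm β) (jumpCoeff k nn mm X x β - p β) else 0 := by
  classical
  have hgeneric : ∀ γ : J →₀ ℕ, γ.degree < r → wt nn γ ≠ 0 → height nn x γ = 0 →
      IsGeneric nn γ x := by
    intro γ hγ hw h0
    refine ⟨hw, h0, fun δ hδ hδ0 y hy => ?_⟩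
    obtain ⟨q, e⟩ := hgen γ hγ h0
    obtain ⟨q', e'⟩ := hgen δ (hδ.trans_lt hγ) hδ0
    have hq : q ≠ 0 := by
      rintro rfl
      exact hw (by rw [e, zero_smul])
    rw [height_apply, e, pair_smul_left] at hy
    rw [height_apply, e', pair_smul_left,
      (mul_eq_zero.1 hy).resolve_left (by exact_mod_cast hq), mul_zero]
  -- every wall through `x` is the one on the chamber of `x`
  have hwall : ∀ w ∈ wallsAt (chamberWalls k nn mm X p) r x, ∃ γ : J →₀ ℕ, γ.degree < r ∧ γ ≠ 0 ∧
      height nn x γ = 0 ∧ w = chamberWall k nn mm X p γ x := by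
    rintro _ ⟨⟨⟨γ, y, hy, -, rfl⟩, hne⟩, hxw⟩
    have hγ : γ.degree < r := by
      by_contra h
      exact hne (eqMod_chamberWall hy.degree_ne_zero y (not_lt.1 h))
    have hxw : x ∈ chamber nn γ y := hxw
    exact ⟨γ, hγ, hy.degree_ne_zero, hxw.1, chamberWall_congr hskew hX fun δ hδ =>
      hy.sign_eq (hgeneric γ hγ hy.ne_zero hxw.1) hxw hδ⟩
  rw [h𝒞.logder_funcAt, map_sum]
  have hzero : ∀ w ∈ (h𝒞.finite_wallsAt r x).toFinset, w ≠ chamberWall k nn mm X p β x →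
      MvPowerSeries.coeff β (logder w.func) = 0 := by
    intro w hw hne
    rw [Set.Finite.mem_toFinset] at hw
    obtain ⟨γ, -, hγ0, -, rfl⟩ := hwall w hw
    rw [logder_chamberWall hγ0, MvPowerSeries.coeff_monomial, if_neg]
    rintro rfl
    exact hne rfl
  by_cases h0 : height nn x β = 0
  swap
  · rw [if_neg h0]
    refine Finset.sum_eq_zero fun w hw => ?_
    have hw' := hw
    rw [Set.Finite.mem_toFinset] at hw'
    obtain ⟨γ, -, hγ0, hγx, rfl⟩ := hwall w hw'
    rw [logder_chamberWall hγ0, MvPowerSeries.coeff_monomial, if_neg]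
    rintro rfl
    exact h0 hγx
  rw [if_pos h0]
  by_cases hc : jumpCoeff k nn mm X x β = p β
  · rw [hc, sub_self, AddMonoidAlgebra.single_zero]
    refine Finset.sum_eq_zero fun w hw => ?_
    by_cases hw' : w = chamberWall k nn mm X p β x
    · rw [Set.Finite.mem_toFinset] at hw
      obtain ⟨γ, -, hγ0, hγx, e⟩ := hwall w hw
      rw [e, logder_chamberWall hγ0, MvPowerSeries.coeff_monomial]
      split_ifs with h
      · rw [← h, hc, sub_self, AddMonoidAlgebra.single_zero]
      · rfl
    · exact hzero w hw hw'
  · have hw : wt nn β ≠ 0 := fun h => hc (by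
      rw [hp0 β h, jumpCoeff, h, divisibility, show Finset.univ.gcd (0 : ι → ℤ) = 0 from
        Finset.gcd_eq_zero_iff.2 fun _ _ => rfl]
      simp)
    have hg := hgeneric β hβ hw h0
    rw [Finset.sum_eq_single_of_mem (chamberWall k nn mm X p β x) ?_ hzero,
      logder_chamberWall hg.degree_ne_zero, MvPowerSeries.coeff_monomial_same]
    rw [Set.Finite.mem_toFinset]
    exact ⟨⟨⟨β, x, hg, hc, rfl⟩, not_eqMod_chamberWall hg.degree_ne_zero hβ hc⟩, hg.self_mem⟩

/-- The wall functions of `E` account for the terms `p_β t^β z^{m_β}` of the jumps, and the chamber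
walls for the remainder. -/
theorem IsInitial.exists_isConsistentCompletion
    (hskew : ∀ i j, nn i ⬝ᵥ mm j = -(nn j ⬝ᵥ mm i)) (hp0 : ∀ β, wt nn β = 0 → p β = 0)
    (hI : IsInitial nn mm p Din E) : ∃ D, IsConsistentCompletion Din D := by
  classical
  -- the prescribed coefficients make the jump at `m_β` equal to `p_β`
  obtain ⟨X, hX, hp⟩ := exists_factor_eq (k := k) hskew
    fun β => -p β / (divisibility (wt nn β) : k)
  have h𝒞 : IsScatteringDiagram (chamberWalls k nn mm X p) :=
    ⟨fun w hw => isWall_of_mem_chamberWalls hskew hX hp hw,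
      finite_wallsMod_chamberWalls hskew hX⟩
  have hE := hI.isScatteringDiagram
  refine ⟨E ∪ chamberWalls k nn mm X p, hE.union h𝒞,
    (hE.union h𝒞).isConsistent hskew hX fun r n x hn hnx hx hgen β hβ => ?_,
    hI.subset.trans Set.subset_union_left, ?_⟩
  · have hxE : x ∉ sing E r := fun h => hx (sing_mono (by
      rw [wallsMod_union]
      exact Set.subset_union_left) h)
    rw [hE.logder_funcAt_union h𝒞 hI.disjoint, map_add, coeff_jumpSeries,
      coeff_logder_funcAt_chamberWalls hskew hX hp0 h𝒞 hgen hβ]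
    by_cases h0 : height nn x β = 0
    · rw [if_pos h0, if_pos ⟨hβ, h0⟩, hI.coeff_eq r x hxE β hβ h0, ← AddMonoidAlgebra.single_add,
        add_sub_cancel]
    · rw [if_neg h0, if_neg fun h => h0 h.2, hI.coeff_eq_zero r x hxE β hβ h0, add_zero]
  · rintro w (hw | hw) hwD
    · exact hI.outgoing w hw hwD
    · exact isOutgoing_of_mem_chamberWalls hskew hX hp hw

/-- Two diagrams that have the same initial wall functions, up to outgoing walls, have equivalent
consistent completions. -/
theorem IsInitial.haveEquivalentCompletions {Din' E' : Set (Wall k ι J)}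
    (hskew : ∀ i j, nn i ⬝ᵥ mm j = -(nn j ⬝ᵥ mm i)) (hp0 : ∀ β, wt nn β = 0 → p β = 0)
    (hI : IsInitial nn mm p Din E) (hI' : IsInitial nn mm p Din' E') :
    HaveEquivalentCompletions Din Din' := by
  have key : ∀ {Din Din' E E' D D' : Set (Wall k ι J)}, IsInitial nn mm p Din E →
      IsInitial nn mm p Din' E' → IsConsistentCompletion Din D → IsConsistentCompletion Din' D' →
      Equivalent D D' := by
    intro Din Din' E E' D D' hI hI' hD hD'
    refine equivalent_of_isConsistentCompletion hD hD' hI.isScatteringDiagram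
      hI'.isScatteringDiagram hI.subset hI'.subset hI.outgoing hI'.outgoing
      fun r x hx hx' β hβ => ?_
    by_cases h0 : height nn x β = 0
    · rw [hI.coeff_eq r x hx β hβ h0, hI'.coeff_eq r x hx' β hβ h0]
    · rw [hI.coeff_eq_zero r x hx β hβ h0, hI'.coeff_eq_zero r x hx' β hβ h0]
  exact ⟨hI.exists_isConsistentCompletion hskew hp0, hI'.exists_isConsistentCompletion hskew hp0,
    fun _ _ => key hI hI, fun _ _ => key hI' hI', fun _ _ => key hI hI'⟩

end Completion

/-! ### Initial diagrams -/

section Initial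

open Topology Set

variable {ι : Type v} [Fintype ι] {k : Type u} {J : Type w} [Field k] [CharZero k]

theorem constantCoeff_binomialFunc (j : J) (m : ι → ℤ) :
    MvPowerSeries.constantCoeff (binomialFunc k j m) = 1 := by
  rw [binomialFunc, map_add, map_mul, MvPowerSeries.constantCoeff_X, zero_mul, map_one, add_zero]

open Classical in
/-- The expansion `t d/dt log (1 + t z^m) = ∑_{l ≥ 1} (-1)^{l+1} t^l z^{l m}`. -/
theorem coeff_logder_binomialFunc (j : J) (m : ι → ℤ) (β : J →₀ ℕ) :
    MvPowerSeries.coeff β (logder (binomialFunc k j m)) =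
      if ∃ l, l ≠ 0 ∧ β = Finsupp.single j l then
        AddMonoidAlgebra.single ((β.degree : ℤ) • m) ((-1) ^ (β.degree + 1)) else 0 := by
  set Y : ScatRing k ι J := fun β => if ∃ l, l ≠ 0 ∧ β = Finsupp.single j l then
        AddMonoidAlgebra.single ((β.degree : ℤ) • m) ((-1) ^ (β.degree + 1)) else 0 with hY
  have hYc : ∀ β, MvPowerSeries.coeff β Y = if ∃ l, l ≠ 0 ∧ β = Finsupp.single j l then
        AddMonoidAlgebra.single ((β.degree : ℤ) • m) ((-1) ^ (β.degree + 1)) else 0 := fun _ => rfl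
  have hY1 : ∀ l, l ≠ 0 → MvPowerSeries.coeff (Finsupp.single j l) Y =
      AddMonoidAlgebra.single ((l : ℤ) • m) ((-1) ^ (l + 1)) := fun l hl => by
    rw [hYc, if_pos ⟨l, hl, rfl⟩, Finsupp.degree_single]
  have hY0 : MvPowerSeries.coeff 0 Y = 0 := by
    rw [hYc, if_neg]
    rintro ⟨l, hl, e⟩
    exact hl (by simpa using e.symm)
  have hb : binomialFunc k j m =
      1 + MvPowerSeries.monomial (Finsupp.single j 1) (AddMonoidAlgebra.single m (1 : k)) := by
    rw [binomialFunc, zMonomial, MvPowerSeries.X_def, ← MvPowerSeries.monomial_zero_eq_C_apply,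
      MvPowerSeries.monomial_mul_monomial, one_mul, add_zero]
  have hl : logder (binomialFunc k j m) = Y := by
    refine logder_eq (constantCoeff_binomialFunc j m) (MvPowerSeries.ext fun β => ?_)
    rw [hb, coeff_euler, mul_add, map_add, map_add, mul_one, MvPowerSeries.coeff_mul_monomial,
      MvPowerSeries.coeff_one, MvPowerSeries.coeff_monomial, mul_add]
    by_cases hβ : ∃ l, β = Finsupp.single j l
    · obtain ⟨l, rfl⟩ := hβ
      rcases l with _ | _ | l
      · simp [hY0]
      · rw [if_pos le_rfl, tsub_self, hY0, zero_mul, hY1 1 one_ne_zero, if_neg (by simp),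
          if_pos rfl, Finsupp.degree_single]
        simp
      · have e : Finsupp.single j (l + 2) - Finsupp.single j 1 = Finsupp.single j (l + 1) := by
          rw [← Finsupp.single_tsub]
          rfl
        have c0 : ¬ Finsupp.single j (l + 1 + 1) = 0 := by simp
        have c1 : ¬ Finsupp.single j (l + 1 + 1) = Finsupp.single j 1 := fun h => by
          have := Finsupp.single_injective j h
          omega
        have c2 : Finsupp.single j 1 ≤ Finsupp.single j (l + 1 + 1) :=
          Finsupp.single_le_single.2 (by omega)
        rw [if_neg c0, if_neg c1, if_pos c2, e, hY1 _ (by omega), hY1 _ (by omega),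
          AddMonoidAlgebra.single_mul_single, ← add_one_zsmul]
        push_cast
        rw [mul_one, mul_zero, add_zero, add_assoc (l : ℤ) 1 1, ← AddMonoidAlgebra.single_add,
          pow_succ (-1 : k) (l + 1 + 1), mul_neg_one, neg_add_cancel, AddMonoidAlgebra.single_zero]
    · have h1 : MvPowerSeries.coeff β Y = 0 := by
        rw [hYc, if_neg]
        rintro ⟨l, -, e⟩
        exact hβ ⟨l, e⟩
      rw [h1, if_neg (fun h => hβ ⟨0, by simpa using h⟩), if_neg (fun h => hβ ⟨1, h⟩)]
      split_ifs with h2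
      · rw [hYc, if_neg]
        · simp
        · rintro ⟨l, -, e⟩
          refine hβ ⟨l + 1, ?_⟩
          rw [← tsub_add_cancel_of_le h2, e, Finsupp.single_add]
      · simp
  rw [hl, hYc]

open Classical in
theorem coeff_logder_prod (S : Finset J) (m : ι → ℤ) (β : J →₀ ℕ) :
    MvPowerSeries.coeff β (logder (∏ j ∈ S, binomialFunc k j m)) =
      if ∃ j ∈ S, ∃ l, l ≠ 0 ∧ β = Finsupp.single j l then
        AddMonoidAlgebra.single ((β.degree : ℤ) • m) ((-1) ^ (β.degree + 1)) else 0 := by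
  rw [logder_prod k S fun j _ => constantCoeff_binomialFunc j m, map_sum]
  simp only [coeff_logder_binomialFunc]
  split_ifs with h
  · obtain ⟨j, hj, l, hl, e⟩ := h
    rw [Finset.sum_eq_single_of_mem j hj fun j' _ hne => if_neg ?_, if_pos ⟨l, hl, e⟩]
    rintro ⟨l', -, e'⟩
    rw [e, Finsupp.single_eq_single_iff] at e'
    rcases e' with e' | e'
    · exact hne e'.1.symm
    · exact hl e'.1
  · exact Finset.sum_eq_zero fun j hj => if_neg fun h' => h ⟨j, hj, h'⟩

theorem isWall_prod_binomialFunc {σ : PointedCone ℝ (ι → ℝ)} (hσ : IsRationalPolyhedral σ)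
    (hd : coneDim σ + 1 = Fintype.card ι) {m : ι → ℤ} (hm : IsPrimitive m)
    (ht : toReal m ∈ Submodule.span ℝ (σ : Set (ι → ℝ))) (S : Finset J) :
    IsWall (⟨σ, ∏ j ∈ S, binomialFunc k j m, -m⟩ : Wall k ι J) := by
  classical
  have h1 : MvPowerSeries.constantCoeff (∏ j ∈ S, binomialFunc k j m) = 1 := by
    rw [map_prod]
    exact Finset.prod_eq_one fun j _ => constantCoeff_binomialFunc j m
  refine ⟨hσ, hd, hm.neg, ?_, h1, fun β hβ e he => ?_⟩
  · show toReal (-m) ∈ _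
    rw [toReal_neg]
    exact Submodule.neg_mem _ ht
  · have h2 := coeff_sol_mem_nonUnital (k := k) (constantCoeff_logder _) (positiveMultiples k m)
      (X := logder (∏ j ∈ S, binomialFunc k j m)) (fun β => ?_) hβ
    · rw [sol_logder k h1] at h2
      obtain ⟨a, ha, e'⟩ := h2 e he
      exact ⟨a, ha, by rw [e']; simp⟩
    · rw [coeff_logder_prod]
      split_ifs with h
      · obtain ⟨j, -, l, hl, rfl⟩ := h
        intro e' he'
        rw [AddMonoidAlgebra.coeff_single, Finsupp.single_apply] at he'
        split_ifs at he' with h5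
        · exact ⟨_, Nat.one_le_iff_ne_zero.2 (by rwa [Finsupp.degree_single]), h5.symm⟩
        · exact absurd rfl he'
      · exact zero_mem _

variable {nn mm : J → ι → ℤ}

open Classical in
/-- The coefficient of `t^β z^{m_β}` in `∑_j log (1 + t_j z^{m_j})`, multiplied by `|β|`. -/
def logCoeff (k : Type u) [Field k] (β : J →₀ ℕ) : k :=
  if ∃ j l, l ≠ 0 ∧ β = Finsupp.single j l then (-1) ^ (β.degree + 1) else 0

theorem logCoeff_eq_zero (h : ∀ j, nn j ≠ 0) {β : J →₀ ℕ} (hβ : wt nn β = 0) :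
    logCoeff k β = 0 := by
  rw [logCoeff, if_neg]
  rintro ⟨j, l, hl, rfl⟩
  rw [wt_single, smul_eq_zero] at hβ
  exact hβ.elim (by exact_mod_cast hl) (h j)

/-- A finite set of walls with functions `∏_{j ∈ S} (1 + t_j z^{m_j})` is initial if, for every `j`
and every general `x` in `n_j^⊥`, exactly one wall through `x` involves `t_j`. -/
theorem isInitial_of_existsUnique {Din E : Set (Wall k ι J)} (hfin : E.Finite) (hsub : Din ⊆ E)
    (hout : ∀ w ∈ E, w ∉ Din → w.IsOutgoing) (hwall : ∀ w ∈ E, IsWall w)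
    (hfunc : ∀ w ∈ E, ∃ (S : Finset J) (m : ι → ℤ), S.Nonempty ∧
      (∀ j ∈ S, mm j = m ∧ w.cone ≤ perp (nn j)) ∧ w.func = ∏ j ∈ S, binomialFunc k j m)
    (huniq : ∀ (r : ℕ) (x : ι → ℝ), x ∉ sing E r → 1 < r → ∀ j, pair (nn j) x = 0 →
      ∃ w ∈ E, x ∈ w.cone ∧ MvPowerSeries.coeff (Finsupp.single j 1) (logder w.func) ≠ 0 ∧
        ∀ w' ∈ E, x ∈ w'.cone → w' ∈ wallsMod E r →
          MvPowerSeries.coeff (Finsupp.single j 1) (logder w'.func) ≠ 0 → w' = w) :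
    IsInitial nn mm (logCoeff k) Din E := by
  classical
  have hE : IsScatteringDiagram E := ⟨hwall, fun r => hfin.subset fun w hw => hw.1⟩
  have hform : ∀ w ∈ E, ∃ S : Finset J, S.Nonempty ∧ (∀ j ∈ S, w.cone ≤ perp (nn j)) ∧
      ∀ β, MvPowerSeries.coeff β (logder w.func) =
        if ∃ j ∈ S, ∃ l, l ≠ 0 ∧ β = Finsupp.single j l then
          AddMonoidAlgebra.single (wt mm β) (logCoeff k β) else 0 := by
    intro w hw
    obtain ⟨S, m, hS, h1, h2⟩ := hfunc w hw
    refine ⟨S, hS, fun j hj => (h1 j hj).2, fun β => ?_⟩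
    rw [h2, coeff_logder_prod]
    refine ite_congr rfl (fun h => ?_) fun _ => rfl
    obtain ⟨j, hj, l, hl, rfl⟩ := h
    rw [logCoeff, if_pos ⟨j, l, hl, rfl⟩, wt_single, (h1 j hj).1, Finsupp.degree_single]
  have hne : ∀ (j : J) (l : ℕ), l ≠ 0 → AddMonoidAlgebra.single (wt mm (Finsupp.single j l))
      (logCoeff k (Finsupp.single j l)) ≠ 0 := by
    intro j l hl h
    rw [AddMonoidAlgebra.single_eq_zero, logCoeff, if_pos ⟨j, l, hl, rfl⟩] at h
    exact pow_ne_zero _ (neg_ne_zero.2 one_ne_zero) h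
  have hvar : ∀ w ∈ E, ∀ j l, l ≠ 0 →
      (MvPowerSeries.coeff (Finsupp.single j l) (logder w.func) ≠ 0 ↔
        MvPowerSeries.coeff (Finsupp.single j 1) (logder w.func) ≠ 0) := by
    intro w hw j l hl
    obtain ⟨S, -, -, h2⟩ := hform w hw
    have key : ∀ l, l ≠ 0 → (MvPowerSeries.coeff (Finsupp.single j l) (logder w.func) ≠ 0 ↔
        j ∈ S) := by
      intro l hl
      rw [h2]
      constructor
      · intro h
        by_contra hj
        refine h (if_neg ?_)
        rintro ⟨j', hj', l', hl', e⟩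
        rw [Finsupp.single_eq_single_iff] at e
        rcases e with e | e
        · exact hj (by rwa [e.1])
        · exact hl e.1
      · intro hj
        rw [if_pos ⟨j, hj, l, hl, rfl⟩]
        exact hne j l hl
    rw [key l hl, key 1 one_ne_zero]
  refine ⟨hE, hsub, hout, ?_, ?_, ?_⟩
  · intro w hw
    obtain ⟨S, ⟨j, hj⟩, -, h2⟩ := hform w hw
    refine ⟨Finsupp.single j 1, Finsupp.single j 2, fun h => ?_, ?_, ?_⟩
    · have := Finsupp.single_injective j h
      omega
    · rw [h2, if_pos ⟨j, hj, 1, one_ne_zero, rfl⟩]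
      exact hne j 1 one_ne_zero
    · rw [h2, if_pos ⟨j, hj, 2, two_ne_zero, rfl⟩]
      exact hne j 2 two_ne_zero
  · intro r x hx β hβ h0
    rw [hE.logder_funcAt, map_sum]
    by_cases hβj : ∃ j l, l ≠ 0 ∧ β = Finsupp.single j l
    · obtain ⟨j, l, hl, rfl⟩ := hβj
      rw [Finsupp.degree_single] at hβ
      have hx0 : pair (nn j) x = 0 := by
        rw [height_apply, wt_single, pair_smul_left] at h0
        exact (mul_eq_zero.1 h0).resolve_left (by exact_mod_cast hl)
      obtain ⟨w, hw, hxw, hwj, hw'⟩ := huniq r x hx (by omega) j hx0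
      rw [Finset.sum_eq_single_of_mem w]
      · obtain ⟨S, -, -, h2⟩ := hform w hw
        have h3 := (hvar w hw j l hl).2 hwj
        rw [h2] at h3 ⊢
        exact if_pos (by by_contra h; exact h3 (if_neg h))
      · rw [Set.Finite.mem_toFinset]
        refine ⟨⟨hw, fun h => hwj ?_⟩, hxw⟩
        have h3 := EqBelow.logder k (hwall w hw).constantCoeff (map_one _) h (Finsupp.single j 1)
          (by rw [Finsupp.degree_single]; omega)
        rwa [logder_one, map_zero] at h3
      · intro w₁ hw₁ hne₁
        rw [Set.Finite.mem_toFinset] at hw₁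
        by_contra h
        exact hne₁ (hw' w₁ hw₁.1.1 hw₁.2 hw₁.1 ((hvar w₁ hw₁.1.1 j l hl).1 h))
    · rw [logCoeff, if_neg hβj, AddMonoidAlgebra.single_zero]
      refine Finset.sum_eq_zero fun w hw => ?_
      rw [Set.Finite.mem_toFinset] at hw
      obtain ⟨S, -, -, h2⟩ := hform w hw.1.1
      rw [h2, if_neg]
      rintro ⟨j, -, l, hl, e⟩
      exact hβj ⟨j, l, hl, e⟩
  · intro r x _ β _ h0
    rw [hE.logder_funcAt, map_sum]
    refine Finset.sum_eq_zero fun w hw => ?_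
    rw [Set.Finite.mem_toFinset] at hw
    obtain ⟨S, -, h1, h2⟩ := hform w hw.1.1
    rw [h2, if_neg]
    rintro ⟨j, hj, l, hl, rfl⟩
    have h3 : pair (nn j) x = 0 := h1 j hj hw.2
    rw [height_apply, wt_single, pair_smul_left, h3, mul_zero] at h0
    exact h0 rfl

theorem isRationalPolyhedral_perp (n : ι → ℤ) : IsRationalPolyhedral (perp n) := by
  classical
  obtain ⟨S, hS⟩ := exists_generators {n, -n}
  refine ⟨S, ?_⟩
  ext y
  rw [hS, mem_perp]
  simp only [Finset.mem_insert, Finset.mem_singleton, forall_eq_or_imp, forall_eq, pair_neg_left,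
    Left.nonneg_neg_iff]
  exact ⟨fun h => ⟨h.ge, h.le⟩, fun h => le_antisymm h.2 h.1⟩

theorem span_perp (n : ι → ℤ) :
    Submodule.span ℝ (perp n : Set (ι → ℝ)) = LinearMap.ker (pairL n) :=
  le_antisymm (Submodule.span_le.2 fun _ h => h) fun _ h => Submodule.subset_span h

/-- The set of walls supported on full hyperplanes. -/
theorem isInitial_hyperplanes {α : Type*} [Finite α] {N M : α → ι → ℤ} {S : α → Finset J}
    (hN : ∀ a, N a ≠ 0) (hM : ∀ a, IsPrimitive (M a)) (hNM : ∀ a, N a ⬝ᵥ M a = 0)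
    (hS : ∀ a, (S a).Nonempty) (hSN : ∀ a, ∀ j ∈ S a, nn j = N a ∧ mm j = M a)
    (hcover : ∀ j, ∃! a, j ∈ S a) :
    IsInitial nn mm (logCoeff k)
      (Set.range fun a => (⟨perp (N a), ∏ j ∈ S a, binomialFunc k j (M a), -M a⟩ : Wall k ι J))
      (Set.range fun a => ⟨perp (N a), ∏ j ∈ S a, binomialFunc k j (M a), -M a⟩) := by
  classical
  refine isInitial_of_existsUnique (Set.finite_range _) subset_rfl (fun w h h' => absurd h h')
    ?_ ?_ ?_
  · rintro _ ⟨a, rfl⟩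
    refine isWall_prod_binomialFunc (isRationalPolyhedral_perp _) ?_ (hM a) ?_ _
    · rw [coneDim, span_perp]
      exact finrank_ker_pairL (hN a)
    · refine Submodule.subset_span ?_
      show pair (N a) (toReal (M a)) = 0
      rw [pair_toReal, hNM, Int.cast_zero]
  · rintro _ ⟨a, rfl⟩
    refine ⟨S a, M a, hS a, fun j hj => ⟨(hSN a j hj).2, ?_⟩, rfl⟩
    rw [(hSN a j hj).1]
  · intro r x _ _ j hx
    have hvar : ∀ a, MvPowerSeries.coeff (Finsupp.single j 1)
        (logder (∏ j ∈ S a, binomialFunc k j (M a))) ≠ 0 ↔ j ∈ S a := by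
      intro a
      rw [coeff_logder_prod]
      constructor
      · intro h
        by_contra hj
        refine h (if_neg ?_)
        rintro ⟨j', hj', l', hl', e⟩
        rw [Finsupp.single_eq_single_iff] at e
        rcases e with e | e
        · exact hj (by rwa [e.1])
        · exact one_ne_zero e.1
      · intro hj
        rw [if_pos ⟨j, hj, 1, one_ne_zero, rfl⟩, Ne, AddMonoidAlgebra.single_eq_zero]
        exact pow_ne_zero _ (neg_ne_zero.2 one_ne_zero)
    obtain ⟨a, ha, hau⟩ := hcover j
    refine ⟨_, ⟨a, rfl⟩, ?_, (hvar a).2 ha, ?_⟩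
    · show pair (N a) x = 0
      rwa [← (hSN a j ha).1]
    · rintro _ ⟨b, rfl⟩ _ _ hb
      rw [hau b ((hvar b).1 hb)]

theorem eq_of_isFace {σ τ : PointedCone ℝ (ι → ℝ)} (h : IsFace τ σ) (hd : coneDim σ ≤ coneDim τ) :
    τ = σ := by
  obtain ⟨u, -, e⟩ := h
  have hle : τ ≤ σ := fun x hx => by
    have : x ∈ (τ : Set (ι → ℝ)) := hx
    rw [e] at this
    exact this.1
  have hspan := Submodule.eq_of_le_of_finrank_le (Submodule.span_mono (R := ℝ) hle) hd
  refine le_antisymm hle fun x hx => ?_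
  have h1 : x ∈ Submodule.span ℝ (τ : Set (ι → ℝ)) := by
    rw [hspan]
    exact Submodule.subset_span hx
  have h2 : u ⬝ᵥ x = 0 := by
    have h3 : Submodule.span ℝ (τ : Set (ι → ℝ)) ≤ LinearMap.ker (dotProductBilin ℝ ℝ u) := by
      rw [Submodule.span_le, e]
      exact fun y hy => hy.2
    exact h3 h1
  show x ∈ (τ : Set (ι → ℝ))
  rw [e]
  exact ⟨hx, h2⟩

/-- The set of walls supported on the codimension one cones of a fan that subdivide the hyperplanes
`n_j^⊥`. -/
theorem isInitial_fan [Finite J] (F : Fan ι) (hnn : ∀ j, nn j ≠ 0) (hmm : ∀ j, IsPrimitive (mm j))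
    (horth : ∀ j, nn j ⬝ᵥ mm j = 0)
    (hperp : ∀ j, ∃ S ⊆ F.codimOne, (perp (nn j) : Set (ι → ℝ)) = ⋃ σ ∈ S, (σ : Set (ι → ℝ)))
    {Din : Set (Wall k ι J)} (hDin : Din = {w | ∃ j, ∃ σ ∈ F.codimOne, toReal (mm j) ∈ σ ∧
      σ ≤ perp (nn j) ∧ w = ⟨σ, binomialFunc k j (mm j), -mm j⟩}) :
    ∃ E, IsInitial nn mm (logCoeff k) Din E := by
  classical
  have hfunc : ∀ j, binomialFunc k j (mm j) = ∏ j' ∈ {j}, binomialFunc k j' (mm j) := fun j => by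
    rw [Finset.prod_singleton]
  have hvar : ∀ j j', MvPowerSeries.coeff (Finsupp.single j 1)
        (logder (binomialFunc k j' (mm j'))) ≠ 0 ↔ j = j' := by
      intro j j'
      rw [coeff_logder_binomialFunc]
      constructor
      · intro h
        by_contra hj
        refine h (if_neg ?_)
        rintro ⟨l', hl', e⟩
        rw [Finsupp.single_eq_single_iff] at e
        rcases e with e | e
        · exact hj e.1
        · exact one_ne_zero e.1
      · rintro rfl
        rw [if_pos ⟨1, one_ne_zero, rfl⟩, Ne, AddMonoidAlgebra.single_eq_zero]
        exact pow_ne_zero _ (neg_ne_zero.2 one_ne_zero)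
  -- besides the initial walls take those on the cones in `n_j^⊥` not containing `m_j`; these are
  -- outgoing, and together the cones fill `n_j^⊥`
  refine ⟨{w | ∃ j, ∃ σ ∈ F.codimOne, σ ≤ perp (nn j) ∧
    w = ⟨σ, binomialFunc k j (mm j), -mm j⟩}, isInitial_of_existsUnique ?_ ?_ ?_ ?_ ?_ ?_⟩
  · have hf : F.codimOne.Finite := F.finite.subset fun σ hσ => hσ.1
    refine (((Set.finite_univ (α := J)).prod hf).image fun q : J × PointedCone ℝ (ι → ℝ) =>
        (⟨q.2, binomialFunc k q.1 (mm q.1), -mm q.1⟩ : Wall k ι J)).subset ?_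
    rintro _ ⟨j, σ, hσ, -, rfl⟩
    exact ⟨(j, σ), ⟨Set.mem_univ _, hσ⟩, rfl⟩
  · rw [hDin]
    rintro _ ⟨j, σ, hσ, -, h, rfl⟩
    exact ⟨j, σ, hσ, h, rfl⟩
  · rintro _ ⟨j, σ, hσ, h, rfl⟩ hw h'
    rw [hDin] at hw
    refine hw ⟨j, σ, hσ, ?_, h, rfl⟩
    have h2 : -toReal (-mm j) ∈ σ := h'
    rwa [toReal_neg, neg_neg] at h2
  · rintro _ ⟨j, σ, hσ, h, rfl⟩
    rw [hfunc]
    refine isWall_prod_binomialFunc (F.rational σ hσ.1) hσ.2 (hmm j) ?_ _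
    rw [span_eq_ker hσ.2 (hnn j) h, LinearMap.mem_ker, pairL_apply, pair_toReal, horth,
      Int.cast_zero]
  · rintro _ ⟨j, σ, hσ, h, rfl⟩
    refine ⟨{j}, mm j, Finset.singleton_nonempty j, fun j' hj' => ?_, hfunc j⟩
    rw [Finset.mem_singleton] at hj'
    subst hj'
    exact ⟨rfl, h⟩
  · intro r x hx hr j hxj
    obtain ⟨S, hS, e⟩ := hperp j
    have hxS : x ∈ ⋃ σ ∈ S, (σ : Set (ι → ℝ)) := by
      rw [← e]
      exact hxj
    obtain ⟨σ, hσ, hxσ⟩ := Set.mem_iUnion₂.1 hxS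
    have hle : σ ≤ perp (nn j) := fun y hy => by
      show y ∈ (perp (nn j) : Set (ι → ℝ))
      rw [e]
      exact Set.mem_iUnion₂.2 ⟨σ, hσ, hy⟩
    refine ⟨⟨σ, binomialFunc k j (mm j), -mm j⟩, ⟨j, σ, hS hσ, hle, rfl⟩, hxσ, (hvar j j).2 rfl, ?_⟩
    rintro _ ⟨j', τ, hτ, -, rfl⟩ hxτ hw' hj'
    obtain rfl := (hvar j j').1 hj'
    have hw : (⟨σ, binomialFunc k j (mm j), -mm j⟩ : Wall k ι J) ∈ wallsMod {w | ∃ j,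
        ∃ σ ∈ F.codimOne, σ ≤ perp (nn j) ∧ w = ⟨σ, binomialFunc k j (mm j), -mm j⟩} r :=
      ⟨⟨j, σ, hS hσ, hle, rfl⟩, hw'.2⟩
    -- two cones of codimension one through a point outside the singular locus coincide
    have hlt : ¬ coneDim (σ ⊓ τ) + 2 ≤ Fintype.card ι := fun h =>
      hx (Or.inr ⟨_, hw, _, hw', hxσ, hxτ, h⟩)
    have h1 := (hS hσ).2
    have h2 := hτ.2
    obtain ⟨f1, f2⟩ := F.inter_face σ (hS hσ).1 τ hτ.1
    have e1 := eq_of_isFace f1 (by omega)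
    have e2 := eq_of_isFace f2 (by omega)
    rw [e2] at e1
    rw [e1]

end Initial

/-! ### Fans and hyperplanes that are unions of codimension one cones -/

variable {ι : Type v} [Fintype ι]

/-- `z` is an interior point of `σ` relative to the linear span of `σ`. -/
def IsRelInterior (z : ι → ℝ) (σ : PointedCone ℝ (ι → ℝ)) : Prop :=
  z ∈ σ ∧ ∀ y ∈ Submodule.span ℝ (σ : Set (ι → ℝ)), ∃ δ > (0 : ℝ), z + δ • y ∈ σ

theorem IsRationalPolyhedral.exists_isRelInterior {σ : PointedCone ℝ (ι → ℝ)}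
    (hσ : IsRationalPolyhedral σ) : ∃ z, IsRelInterior z σ := by
  obtain ⟨S, G, hG, rfl⟩ := hσ.exists_finset
  have hmem : ∑ s ∈ G, (1 : ℝ) • s ∈ PointedCone.hull ℝ (G : Set (ι → ℝ)) :=
    Submodule.sum_mem _ fun s hs => by
      rw [one_smul]
      exact Submodule.subset_span hs
  refine ⟨∑ s ∈ G, (1 : ℝ) • s, hmem, fun y hy => ?_⟩
  rw [span_hull] at hy
  have hN := hull_mem_nhdsWithin (G := G) (T := G) (c := fun _ => 1) subset_rfl
    Submodule.subset_span (fun _ _ => one_pos)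
  have hlim : Filter.Tendsto (fun δ : ℝ => ∑ s ∈ G, (1 : ℝ) • s + δ • y) (nhdsWithin 0 (Set.Ioi 0))
      (nhdsWithin (∑ s ∈ G, (1 : ℝ) • s) (Submodule.span ℝ (G : Set (ι → ℝ)) : Set (ι → ℝ))) := by
    refine tendsto_nhdsWithin_iff.2 ⟨?_, Filter.Eventually.of_forall fun δ => ?_⟩
    · have : Filter.Tendsto (fun δ : ℝ => ∑ s ∈ G, (1 : ℝ) • s + δ • y) (nhds 0)
          (nhds (∑ s ∈ G, (1 : ℝ) • s + (0 : ℝ) • y)) := by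
        apply Continuous.tendsto
        fun_prop
      rw [zero_smul, add_zero] at this
      exact this.mono_left nhdsWithin_le_nhds
    · exact Submodule.add_mem _ (Submodule.sum_mem _ fun s hs =>
        Submodule.smul_mem _ _ (Submodule.subset_span hs)) (Submodule.smul_mem _ _ hy)
  obtain ⟨δ, h1, h2⟩ := ((hlim.eventually hN).and self_mem_nhdsWithin).exists
  exact ⟨δ, h2, h1⟩

/-- A face that contains a relative interior point is the whole cone. -/
theorem IsFace.le_of_isRelInterior {σ τ : PointedCone ℝ (ι → ℝ)} (h : IsFace τ σ) {z : ι → ℝ}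
    (hz : IsRelInterior z σ) (hzτ : z ∈ τ) : σ ≤ τ := by
  obtain ⟨l, hl, hτ⟩ := h
  have hz0 : l ⬝ᵥ z = 0 := (hτ.le hzτ).2
  intro x hx
  obtain ⟨δ, hδ, hm⟩ := hz.2 (-x) (Submodule.neg_mem _ (Submodule.subset_span hx))
  have h1 := hl _ hm
  rw [dotProduct_add, dotProduct_smul, dotProduct_neg, hz0, zero_add, smul_eq_mul] at h1
  have h2 := hl x hx
  have h3 : l ⬝ᵥ x = 0 := by nlinarith
  exact hτ.ge ⟨hx, h3⟩

/-- A hyperplane that is a union of cones of a fan does not separate points of a cone. -/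
theorem Fan.nonneg_or_nonpos (F : Fan ι) {u : ι → ℤ}
    (hperp : ∃ S ⊆ F.codimOne, (perp u : Set (ι → ℝ)) = ⋃ σ ∈ S, (σ : Set (ι → ℝ)))
    {σ : PointedCone ℝ (ι → ℝ)} (hσ : σ ∈ F.cones) :
    (∀ x ∈ σ, 0 ≤ pair u x) ∨ (∀ x ∈ σ, pair u x ≤ 0) := by
  obtain ⟨S, hS, hperp⟩ := hperp
  by_contra! hcon
  obtain ⟨⟨x, hx, hx0⟩, ⟨x', hx', hx0'⟩⟩ := hcon
  obtain ⟨z, hz⟩ := (F.rational σ hσ).exists_isRelInterior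
  -- A point of `u^⊥ ∩ σ` to which the relative interior point `z` contributes.
  obtain ⟨a, b, y, ha, hb, hy, hay⟩ : ∃ (a b : ℝ) (y : ι → ℝ), 0 < a ∧ 0 ≤ b ∧ y ∈ σ ∧
      pair u (a • z + b • y) = 0 := by
    simp only [pair_add, pair_smul]
    rcases lt_trichotomy (pair u z) 0 with h | h | h
    · exact ⟨pair u x', -pair u z, x', hx0', by linarith, hx', by ring⟩
    · exact ⟨1, 0, 0, one_pos, le_rfl, σ.zero_mem, by simp [h]⟩
    · exact ⟨-pair u x, pair u z, x, by linarith, h.le, hx, by ring⟩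
  have hmem : a • z + b • y ∈ (perp u : Set (ι → ℝ)) := hay
  rw [hperp] at hmem
  simp only [Set.mem_iUnion] at hmem
  obtain ⟨τ, hτ, hmem⟩ := hmem
  obtain ⟨l, hl, hface⟩ := (F.inter_face σ hσ τ (hS hτ).1).1
  have hzσ : a • z + b • y ∈ σ :=
    Submodule.add_mem _ (σ.smul_mem ha.le hz.1) (σ.smul_mem hb hy)
  have hl0 : l ⬝ᵥ (a • z + b • y) = 0 := (hface.le (⟨hzσ, hmem⟩ : a • z + b • y ∈ σ ⊓ τ)).2
  rw [dotProduct_add, dotProduct_smul, dotProduct_smul, smul_eq_mul, smul_eq_mul] at hl0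
  have h1 := hl z hz.1
  have h2 := mul_nonneg hb (hl y hy)
  have hlz : l ⬝ᵥ z = 0 := by nlinarith
  have hle : σ ≤ σ ⊓ τ := (F.inter_face σ hσ τ (hS hτ).1).1.le_of_isRelInterior hz
    (hface.ge ⟨hz.1, hlz⟩)
  have : x ∈ (perp u : Set (ι → ℝ)) := by
    rw [hperp]
    exact Set.mem_biUnion hτ (hle hx).2
  exact hx0.ne this

theorem span_eq_ker_of_le_perp {σ : PointedCone ℝ (ι → ℝ)} {n : ι → ℤ} (hn : n ≠ 0)
    (hσ : coneDim σ + 1 = Fintype.card ι) (hle : σ ≤ perp n) :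
    Submodule.span ℝ (σ : Set (ι → ℝ)) = LinearMap.ker (pairL n) := by
  refine Submodule.eq_of_le_of_finrank_eq (Submodule.span_le.2 fun x hx => hle hx) ?_
  have h := finrank_ker_pairL hn
  rw [coneDim] at hσ
  omega

theorem coneDim_eq_card {σ τ : PointedCone ℝ (ι → ℝ)} {n : ι → ℤ} (hle : σ ≤ τ)
    (hσ : coneDim σ + 1 = Fintype.card ι) (hperp : σ ≤ perp n) {x : ι → ℝ} (hx : x ∈ τ)
    (hnx : pair n x ≠ 0) : coneDim τ = Fintype.card ι := by
  have hlt : Submodule.span ℝ (σ : Set (ι → ℝ)) < Submodule.span ℝ (τ : Set (ι → ℝ)) := by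
    refine lt_of_le_of_ne (Submodule.span_mono hle) fun h => hnx ?_
    have h1 : x ∈ Submodule.span ℝ (σ : Set (ι → ℝ)) := h ▸ Submodule.subset_span hx
    have h2 : Submodule.span ℝ (σ : Set (ι → ℝ)) ≤ LinearMap.ker (pairL n) :=
      Submodule.span_le.2 fun y hy => hperp hy
    exact h2 h1
  have h1 := Submodule.finrank_lt_finrank_of_lt hlt
  have h2 := Submodule.finrank_le (Submodule.span ℝ (τ : Set (ι → ℝ)))
  rw [Module.finrank_fintype_fun_eq_card] at h2
  simp only [coneDim] at hσ ⊢
  omega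

/-- There is a maximal cone on the positive side of a wall of a complete fan. -/
theorem Fan.exists_maximal_pos (F : Fan ι) (hF : F.IsComplete) {n y : ι → ℤ} (hy : n ⬝ᵥ y = 1)
    {σ : PointedCone ℝ (ι → ℝ)} (hσ : σ ∈ F.codimOne) (hle : σ ≤ perp n) :
    ∃ τ ∈ F.maximal, σ ≤ τ ∧ ∃ x ∈ τ, 0 < pair n x := by
  obtain ⟨z, hz⟩ := (F.rational σ hσ.1).exists_isRelInterior
  -- one of the finitely many cones contains `z + ε y` for arbitrarily small `ε > 0`
  have hfreq : ∃ τ ∈ F.cones, ∃ᶠ ε : ℝ in nhdsWithin 0 (Set.Ioi 0), z + ε • toReal y ∈ τ := by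
    by_contra! h
    have hall : ∀ᶠ ε : ℝ in nhdsWithin 0 (Set.Ioi 0), ∀ τ ∈ F.cones, z + ε • toReal y ∉ τ :=
      (Filter.eventually_all_finite F.finite).2 h
    obtain ⟨ε, hε⟩ := hall.exists
    obtain ⟨τ, hτ, hm⟩ := hF (z + ε • toReal y)
    exact hε τ hτ hm
  obtain ⟨τ, hτ, hfr⟩ := hfreq
  have hlim : Filter.Tendsto (fun ε : ℝ => z + ε • toReal y) (nhdsWithin 0 (Set.Ioi 0)) (nhds z) := by
    have : Filter.Tendsto (fun ε : ℝ => z + ε • toReal y) (nhds 0)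
        (nhds (z + (0 : ℝ) • toReal y)) := by
      apply Continuous.tendsto
      fun_prop
    rw [zero_smul, add_zero] at this
    exact this.mono_left nhdsWithin_le_nhds
  have hzτ : z ∈ τ := (F.rational τ hτ).isClosed.mem_of_frequently_of_tendsto hfr hlim
  have hστ : σ ≤ τ := ((F.inter_face σ hσ.1 τ hτ).1.le_of_isRelInterior hz ⟨hz.1, hzτ⟩).trans
    inf_le_right
  obtain ⟨ε, hε, hε0⟩ := (hfr.and_eventually self_mem_nhdsWithin).exists
  have hpos : 0 < pair n (z + ε • toReal y) := by
    have h0 : pair n z = 0 := hle hz.1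
    rw [pair_add, pair_smul, pair_toReal, hy, h0, Int.cast_one, zero_add, mul_one]
    exact hε0
  exact ⟨τ, ⟨hτ, coneDim_eq_card hστ hσ.2 hle hε hpos.ne'⟩, hστ, _, hε, hpos⟩

/-- There is at most one maximal cone on the positive side of a wall of a fan. -/
theorem Fan.eq_of_maximal_pos (F : Fan ι) {n : ι → ℤ} (hn : n ≠ 0)
    {σ τ τ' : PointedCone ℝ (ι → ℝ)} (hσ : σ ∈ F.codimOne) (hle : σ ≤ perp n)
    (hτ : τ ∈ F.maximal) (hτ' : τ' ∈ F.maximal) (hστ : σ ≤ τ) (hστ' : σ ≤ τ')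
    {x x' : ι → ℝ} (hx : x ∈ τ) (hx' : x' ∈ τ') (hx0 : 0 < pair n x) (hx0' : 0 < pair n x') :
    τ = τ' := by
  obtain ⟨z, hz⟩ := (F.rational σ hσ.1).exists_isRelInterior
  have hker : pair n x' • x - pair n x • x' ∈ Submodule.span ℝ (σ : Set (ι → ℝ)) := by
    rw [span_eq_ker_of_le_perp hn hσ.2 hle]
    show pair n _ = 0
    rw [pair_sub, pair_smul, pair_smul]
    ring
  obtain ⟨δ, hδ, hm⟩ := hz.2 _ hker
  -- A point off `n^⊥` that lies in both maximal cones.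
  have hp : z + (δ * pair n x') • x ∈ τ ⊓ τ' := by
    refine ⟨Submodule.add_mem _ (hστ hz.1) (τ.smul_mem (mul_pos hδ hx0').le hx), ?_⟩
    have h1 : z + (δ * pair n x') • x =
        (z + δ • (pair n x' • x - pair n x • x')) + (δ * pair n x) • x' := by module
    rw [h1]
    exact Submodule.add_mem _ (hστ' hm) (τ'.smul_mem (mul_pos hδ hx0).le hx')
  have hp0 : pair n (z + (δ * pair n x') • x) ≠ 0 := by
    have h0 : pair n z = 0 := hle hz.1
    rw [pair_add, pair_smul, h0, zero_add]
    positivity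
  have hdim := coneDim_eq_card (le_inf hστ hστ') hσ.2 hle hp hp0
  have hf := F.inter_face τ hτ.1 τ' hτ'.1
  have h1 := eq_of_isFace hf.1 (by rw [hdim, hτ.2])
  have h2 := eq_of_isFace hf.2 (by rw [hdim, hτ'.2])
  rw [← h1, h2]

/-- A codimension one cone of a complete fan is contained in exactly two maximal cones. -/
theorem Fan.exists_two_maximal (F : Fan ι) (hF : F.IsComplete) {n y : ι → ℤ} (hy : n ⬝ᵥ y = 1)
    (hn : n ≠ 0) (hsign : ∀ σ ∈ F.cones, (∀ x ∈ σ, 0 ≤ pair n x) ∨ (∀ x ∈ σ, pair n x ≤ 0))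
    {σ : PointedCone ℝ (ι → ℝ)} (hσ : σ ∈ F.codimOne) (hle : σ ≤ perp n) :
    ∃ τ τ', τ ≠ τ' ∧ ∀ ρ, (σ ≤ ρ ∧ ρ ∈ F.maximal) ↔ (ρ = τ ∨ ρ = τ') := by
  obtain ⟨τ, hτ, hστ, x, hx, hx0⟩ := F.exists_maximal_pos hF hy hσ hle
  have hle' : σ ≤ perp (-n) := fun z hz => by
    rw [mem_perp, pair_neg_left, neg_eq_zero]
    exact hle hz
  obtain ⟨τ', hτ', hστ', x', hx', hx0'⟩ := F.exists_maximal_pos hF (n := -n) (y := -y)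
    (by rw [neg_dotProduct_neg, hy]) hσ hle'
  refine ⟨τ, τ', fun h => ?_, fun ρ => ⟨fun ⟨hσρ, hρ⟩ => ?_, ?_⟩⟩
  · rw [pair_neg_left] at hx0'
    rcases hsign τ hτ.1 with h1 | h1
    · have := h1 x' (h ▸ hx')
      linarith
    · have := h1 x hx
      linarith
  · obtain ⟨y', hy', hy0⟩ : ∃ y' ∈ ρ, pair n y' ≠ 0 := by
      by_contra! h
      have h1 : Submodule.span ℝ (ρ : Set (ι → ℝ)) ≤ LinearMap.ker (pairL n) :=
        Submodule.span_le.2 h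
      have h2 := Submodule.finrank_mono h1
      have h3 := finrank_ker_pairL hn
      have h4 := hρ.2
      rw [coneDim] at h4
      omega
    rcases lt_or_gt_of_ne hy0 with h | h
    · exact Or.inr (F.eq_of_maximal_pos (neg_ne_zero.2 hn) hσ hle' hρ hτ' hσρ hστ' hy' hx'
        (by rw [pair_neg_left]; linarith) hx0')
    · exact Or.inl (F.eq_of_maximal_pos hn hσ hle hρ hτ hσρ hστ hy' hx h hx0)
  · rintro (rfl | rfl)
    exacts [⟨hστ, hτ⟩, ⟨hστ', hτ'⟩]

/-! ### Subtori of a toric divisor and their closures -/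

variable {k : Type u} [Field k] {ι : Type v} [Fintype ι]

/-- For `u ⬝ y = 1`, the retraction `z^m ↦ ζ^⟨m, y⟩ z^{m - ⟨m, y⟩ u}` of the ring of Laurent
polynomials onto the coordinate ring of the subtorus `z^u = ζ`. -/
def restrictHom (u y : ι → ℤ) (ζ : kˣ) :
    AddMonoidAlgebra k (ι → ℤ) →ₐ[k] AddMonoidAlgebra k (ι → ℤ) :=
  AddMonoidAlgebra.lift k (AddMonoidAlgebra k (ι → ℤ)) (ι → ℤ)
    { toFun := fun m => AddMonoidAlgebra.single
        (m.toAdd - (m.toAdd ⬝ᵥ y) • u) ((ζ ^ (m.toAdd ⬝ᵥ y) : kˣ) : k)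
      map_one' := by simp [AddMonoidAlgebra.one_def]
      map_mul' := fun a b => by
        rw [AddMonoidAlgebra.single_mul_single, toAdd_mul, add_dotProduct, zpow_add, Units.val_mul]
        congr 1
        module }

theorem restrictHom_single (u y : ι → ℤ) (ζ : kˣ) (m : ι → ℤ) (c : k) :
    restrictHom u y ζ (AddMonoidAlgebra.single m c) =
      AddMonoidAlgebra.single (m - (m ⬝ᵥ y) • u) (c * (ζ ^ (m ⬝ᵥ y) : kˣ)) := by
  rw [restrictHom, AddMonoidAlgebra.lift_single]
  simp

theorem restrictHom_neg (u y : ι → ℤ) (ζ : kˣ) :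
    restrictHom (-u) (-y) ζ⁻¹ = restrictHom u y ζ := by
  refine AddMonoidAlgebra.algHom_ext (fun m => ?_) (Subsingleton.elim _ _)
  rw [restrictHom_single, restrictHom_single, dotProduct_neg, neg_smul_neg, inv_zpow', neg_neg]

/-- The inclusion of the ring of a chart of `D_v` in the ring of Laurent polynomials. -/
def chartEmbedding (k : Type u) [Field k] (v : ι → ℤ) (σ : PointedCone ℝ (ι → ℝ)) :
    ChartRing k v σ →+* AddMonoidAlgebra k (ι → ℤ) :=
  AddMonoidAlgebra.mapDomainRingHom k (chartMonoid v σ).subtype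

theorem chartEmbedding_single (v : ι → ℤ) (σ : PointedCone ℝ (ι → ℝ)) (m : chartMonoid v σ) (c : k) :
    chartEmbedding k v σ (AddMonoidAlgebra.single m c) = AddMonoidAlgebra.single m.1 c := by
  rw [chartEmbedding, AddMonoidAlgebra.mapDomainRingHom_apply, AddMonoidAlgebra.mapDomain_single]
  rfl

theorem chartEmbedding_injective (v : ι → ℤ) (σ : PointedCone ℝ (ι → ℝ)) :
    Function.Injective (chartEmbedding k v σ) := fun _ _ h =>
  AddMonoidAlgebra.mapDomain_injective Subtype.val_injective h

theorem chartInclusion_single (v : ι → ℤ) {σ τ : PointedCone ℝ (ι → ℝ)} (h : σ ≤ τ)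
    (m : chartMonoid v τ) (c : k) :
    chartInclusion k v h (AddMonoidAlgebra.single m c) =
      AddMonoidAlgebra.single ⟨m.1, chartMonoid_anti v h m.2⟩ c := by
  rw [chartInclusion, AddMonoidAlgebra.mapDomainRingHom_apply, AddMonoidAlgebra.mapDomain_single]
  rfl

theorem chartEmbedding_chartInclusion (v : ι → ℤ) {σ τ : PointedCone ℝ (ι → ℝ)} (h : σ ≤ τ)
    (f : ChartRing k v τ) :
    chartEmbedding k v σ (chartInclusion k v h f) = chartEmbedding k v τ f := by
  induction f using AddMonoidAlgebra.induction_linear with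
  | zero => simp
  | add f g hf hg => rw [map_add, map_add, map_add, hf, hg]
  | single m c => rw [chartInclusion_single, chartEmbedding_single, chartEmbedding_single]

/-- The ideal, in the chart of `σ`, of the closure of the subtorus `z^u = ζ`. -/
def subtorusIdeal (k : Type u) [Field k] (v : ι → ℤ) (σ : PointedCone ℝ (ι → ℝ)) (u y : ι → ℤ)
    (ζ : kˣ) : Ideal (ChartRing k v σ) :=
  RingHom.ker ((restrictHom u y ζ : _ →+* AddMonoidAlgebra k (ι → ℤ)).comp (chartEmbedding k v σ))

theorem mem_subtorusIdeal {v : ι → ℤ} {σ : PointedCone ℝ (ι → ℝ)} {u y : ι → ℤ} {ζ : kˣ}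
    {f : ChartRing k v σ} :
    f ∈ subtorusIdeal k v σ u y ζ ↔ restrictHom u y ζ (chartEmbedding k v σ f) = 0 := Iff.rfl

instance (v : ι → ℤ) (σ : PointedCone ℝ (ι → ℝ)) (u y : ι → ℤ) (ζ : kˣ) :
    (subtorusIdeal k v σ u y ζ).IsPrime := RingHom.ker_isPrime _

theorem subtorusIdeal_neg (v : ι → ℤ) (σ : PointedCone ℝ (ι → ℝ)) (u y : ι → ℤ) (ζ : kˣ) :
    subtorusIdeal k v σ (-u) (-y) ζ⁻¹ = subtorusIdeal k v σ u y ζ := by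
  rw [subtorusIdeal, restrictHom_neg, subtorusIdeal]

theorem comap_subtorusIdeal (v : ι → ℤ) {σ τ : PointedCone ℝ (ι → ℝ)} (h : σ ≤ τ) (u y : ι → ℤ)
    (ζ : kˣ) : (subtorusIdeal k v σ u y ζ).comap (chartInclusion k v h) =
      subtorusIdeal k v τ u y ζ := by
  ext f
  rw [Ideal.mem_comap, mem_subtorusIdeal, mem_subtorusIdeal, chartEmbedding_chartInclusion]

/-- On a multiple of `u`, a monomial is congruent to a constant. -/
theorem single_sub_single_mem_subtorusIdeal {v : ι → ℤ} {σ : PointedCone ℝ (ι → ℝ)} {u y : ι → ℤ}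
    (hy : u ⬝ᵥ y = 1) (ζ : kˣ) {m : chartMonoid v σ} {a : ℤ} (hm : m.1 = a • u) :
    AddMonoidAlgebra.single m (1 : k) - AddMonoidAlgebra.single 0 ((ζ ^ a : kˣ) : k) ∈
      subtorusIdeal k v σ u y ζ := by
  rw [mem_subtorusIdeal, map_sub, map_sub, chartEmbedding_single, chartEmbedding_single,
    restrictHom_single, restrictHom_single, hm, smul_dotProduct, hy]
  simp

/-- If `z^u` is a regular function on the chart, then the ideal of the subtorus `z^u = ζ` is
generated by `z^u - ζ`. Indeed, modulo `z^u - ζ` every function is congruent to one all of whose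
exponents have the same, large, pairing with `y`, and `restrictHom` is injective on those. -/
theorem subtorusIdeal_eq_span {v : ι → ℤ} {σ : PointedCone ℝ (ι → ℝ)} {u y : ι → ℤ}
    (hy : u ⬝ᵥ y = 1) (ζ : kˣ) (hu : u ∈ chartMonoid v σ) :
    subtorusIdeal k v σ u y ζ =
      Ideal.span {AddMonoidAlgebra.single ⟨u, hu⟩ (1 : k) - AddMonoidAlgebra.single 0 (ζ : k)} := by
  refine le_antisymm (fun f hf => ?_) ?_
  · have key : ∀ f : ChartRing k v σ, ∃ B₀ : ℤ, ∀ B ≥ B₀, ∃ g : ChartRing k v σ,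
        f - g ∈ Ideal.span
          {AddMonoidAlgebra.single ⟨u, hu⟩ (1 : k) - AddMonoidAlgebra.single 0 (ζ : k)} ∧
        chartEmbedding k v σ g = AddMonoidAlgebra.single (B • u) ((ζ ^ (-B) : kˣ) : k) *
          restrictHom u y ζ (chartEmbedding k v σ f) := by
      intro f
      induction f using AddMonoidAlgebra.induction_linear with
      | zero => exact ⟨0, fun B _ => ⟨0, by simp, by simp⟩⟩
      | add f g hf hg =>
        obtain ⟨A₀, hA⟩ := hf
        obtain ⟨B₀, hB⟩ := hg
        refine ⟨max A₀ B₀, fun B hle => ?_⟩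
        obtain ⟨f', hf1, hf2⟩ := hA B (le_trans (le_max_left _ _) hle)
        obtain ⟨g', hg1, hg2⟩ := hB B (le_trans (le_max_right _ _) hle)
        refine ⟨f' + g', ?_, ?_⟩
        · rw [add_sub_add_comm]
          exact Ideal.add_mem _ hf1 hg1
        · simp only [map_add, mul_add, hf2, hg2]
      | single m c =>
        refine ⟨m.1 ⬝ᵥ y, fun B hB => ?_⟩
        obtain ⟨n, hn⟩ := Int.eq_ofNat_of_zero_le (sub_nonneg.2 hB)
        refine ⟨AddMonoidAlgebra.single (m + n • ⟨u, hu⟩) (c * (ζ ^ (-(n : ℤ)) : kˣ)), ?_, ?_⟩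
        · have h1 := sub_dvd_pow_sub_pow (AddMonoidAlgebra.single (⟨u, hu⟩ : chartMonoid v σ) (1 : k))
            (AddMonoidAlgebra.single 0 (ζ : k)) n
          have h2 : (AddMonoidAlgebra.single m c -
              AddMonoidAlgebra.single (m + n • ⟨u, hu⟩) (c * (ζ ^ (-(n : ℤ)) : kˣ)) :
                ChartRing k v σ) =
              -(AddMonoidAlgebra.single m (c * (ζ ^ (-(n : ℤ)) : kˣ)) *
                (AddMonoidAlgebra.single (⟨u, hu⟩ : chartMonoid v σ) (1 : k) ^ n -
                  AddMonoidAlgebra.single 0 (ζ : k) ^ n)) := by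
            rw [AddMonoidAlgebra.single_pow, AddMonoidAlgebra.single_pow, mul_sub,
              AddMonoidAlgebra.single_mul_single, AddMonoidAlgebra.single_mul_single, one_pow,
              mul_one, smul_zero, add_zero, mul_assoc, ← Units.val_pow_eq_pow_val, ← Units.val_mul,
              zpow_neg, zpow_natCast, inv_mul_cancel, Units.val_one, mul_one, neg_sub]
          rw [h2]
          exact neg_mem (Ideal.mul_mem_left _ _ (Ideal.mem_span_singleton.2 h1))
        · have hB' : B = n + m.1 ⬝ᵥ y := by omega
          rw [chartEmbedding_single, chartEmbedding_single, restrictHom_single,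
            AddMonoidAlgebra.single_mul_single]
          congr 1
          · show m.1 + n • u = _
            rw [hB']
            module
          · rw [mul_left_comm, ← Units.val_mul, ← zpow_add, hB']
            congr 3
            ring
    obtain ⟨B, hB⟩ := key f
    obtain ⟨g, hg1, hg2⟩ := hB B le_rfl
    rw [mem_subtorusIdeal.1 hf, mul_zero, map_eq_zero_iff _ (chartEmbedding_injective v σ)] at hg2
    rwa [hg2, sub_zero] at hg1
  · rw [Ideal.span_singleton_le_iff_mem]
    have := single_sub_single_mem_subtorusIdeal (v := v) (σ := σ) hy ζ (m := ⟨u, hu⟩) (a := 1)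
      (one_smul ℤ u).symm
    rwa [zpow_one] at this

theorem mem_chartMonoid_or {v u : ι → ℤ} (huv : u ⬝ᵥ v = 0) {σ : PointedCone ℝ (ι → ℝ)}
    (hsign : (∀ x ∈ σ, 0 ≤ pair u x) ∨ (∀ x ∈ σ, pair u x ≤ 0)) :
    u ∈ chartMonoid v σ ∨ -u ∈ chartMonoid v σ := by
  rcases hsign with h | h
  · exact Or.inl ⟨by rw [pair_toReal, huv, Int.cast_zero], h⟩
  · refine Or.inr ⟨by rw [pair_neg_left, pair_toReal, huv, Int.cast_zero, neg_zero], fun x hx => ?_⟩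
    rw [pair_neg_left]
    linarith [h x hx]

/-- The ideals of the closures of a subtorus in the charts of `σ ⊆ τ` are compatible. -/
theorem map_subtorusIdeal {v u y : ι → ℤ} (hy : u ⬝ᵥ y = 1) (huv : u ⬝ᵥ v = 0) (ζ : kˣ)
    {σ τ : PointedCone ℝ (ι → ℝ)} (h : σ ≤ τ)
    (hsign : (∀ x ∈ τ, 0 ≤ pair u x) ∨ (∀ x ∈ τ, pair u x ≤ 0)) :
    (subtorusIdeal k v τ u y ζ).map (chartInclusion k v h) = subtorusIdeal k v σ u y ζ := by
  have key : ∀ {u y : ι → ℤ} (ζ : kˣ), u ⬝ᵥ y = 1 → u ∈ chartMonoid v τ →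
      (subtorusIdeal k v τ u y ζ).map (chartInclusion k v h) = subtorusIdeal k v σ u y ζ := by
    intro u y ζ hy hu
    rw [subtorusIdeal_eq_span hy ζ hu, subtorusIdeal_eq_span hy ζ (chartMonoid_anti v h hu),
      Ideal.map_span, Set.image_singleton, map_sub, chartInclusion_single, chartInclusion_single]
    rfl
  rcases mem_chartMonoid_or huv hsign with hu | hu
  · exact key ζ hy hu
  · rw [← subtorusIdeal_neg, ← subtorusIdeal_neg v σ]
    exact key ζ⁻¹ (by rw [neg_dotProduct_neg, hy]) hu

/-- The closure in `D_v` of the subtorus `z^u = ζ` of the big torus of `D_v`. -/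
def subtorusClosure (k : Type u) [Field k] (F : Fan ι) (v u y : ι → ℤ) (ζ : kˣ) :
    Set (ToricDivisor k F v) :=
  {x | ∃ τ Q, x = chart k F v τ Q ∧ subtorusIdeal k v τ.1 u y ζ ≤ Q.asIdeal}

section Closure

variable {F : Fan ι} {v u y : ι → ℤ}

theorem chart_comap (F : Fan ι) (v : ι → ℤ) {σ τ : F.Star v} (h : σ.1 ≤ τ.1)
    (P : PrimeSpectrum (ChartRing k v σ.1)) :
    chart k F v τ (PrimeSpectrum.comap (chartInclusion k v h) P) = chart k F v σ P :=
  (Quot.sound ⟨h, rfl⟩).symm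

theorem continuous_chart (F : Fan ι) (v : ι → ℤ) (σ : F.Star v) : Continuous (chart k F v σ) :=
  continuous_quot_mk.comp continuous_sigmaMk

theorem chart_mem_subtorusClosure (hy : u ⬝ᵥ y = 1) (huv : u ⬝ᵥ v = 0)
    (hsign : ∀ σ ∈ F.cones, (∀ x ∈ σ, 0 ≤ pair u x) ∨ (∀ x ∈ σ, pair u x ≤ 0)) (ζ : kˣ)
    {τ : F.Star v} {Q : PrimeSpectrum (ChartRing k v τ.1)} :
    chart k F v τ Q ∈ subtorusClosure k F v u y ζ ↔ subtorusIdeal k v τ.1 u y ζ ≤ Q.asIdeal := by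
  let p : ToricDivisor k F v → Prop :=
    Quot.lift (fun x => subtorusIdeal k v x.1.1 u y ζ ≤ x.2.asIdeal) (by
      rintro ⟨σ, P⟩ ⟨τ, Q⟩ ⟨h, hPQ⟩
      replace h : σ.1 ≤ τ.1 := h
      replace hPQ : Q = PrimeSpectrum.comap (chartInclusion k v h) P := hPQ
      subst hPQ
      refine propext ?_
      show subtorusIdeal k v σ.1 u y ζ ≤ P.asIdeal ↔
        subtorusIdeal k v τ.1 u y ζ ≤ P.asIdeal.comap (chartInclusion k v h)
      rw [← map_subtorusIdeal hy huv ζ h (hsign τ.1 τ.2.1), Ideal.map_le_iff_le_comap])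
  constructor
  · rintro ⟨τ', Q', h, hle⟩
    have h1 : p (chart k F v τ' Q') := hle
    rw [← h] at h1
    exact h1
  · exact fun h => ⟨τ, Q, rfl, h⟩

theorem preimage_chart_subtorusClosure (hy : u ⬝ᵥ y = 1) (huv : u ⬝ᵥ v = 0)
    (hsign : ∀ σ ∈ F.cones, (∀ x ∈ σ, 0 ≤ pair u x) ∨ (∀ x ∈ σ, pair u x ≤ 0)) (ζ : kˣ)
    (τ : F.Star v) : chart k F v τ ⁻¹' subtorusClosure k F v u y ζ =
      PrimeSpectrum.zeroLocus (subtorusIdeal k v τ.1 u y ζ : Set (ChartRing k v τ.1)) := by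
  ext Q
  exact chart_mem_subtorusClosure hy huv hsign ζ

theorem isClosed_subtorusClosure (hy : u ⬝ᵥ y = 1) (huv : u ⬝ᵥ v = 0)
    (hsign : ∀ σ ∈ F.cones, (∀ x ∈ σ, 0 ≤ pair u x) ∨ (∀ x ∈ σ, pair u x ≤ 0)) (ζ : kˣ) :
    IsClosed (subtorusClosure k F v u y ζ) := by
  refine (isQuotientMap_quot_mk (r := toricDivisorRel k F v)).isClosed_preimage.1
    (isClosed_sigma_iff.2 fun τ => ?_)
  have h := PrimeSpectrum.isClosed_zeroLocus
    (subtorusIdeal k v τ.1 u y ζ : Set (ChartRing k v τ.1))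
  rw [← preimage_chart_subtorusClosure hy huv hsign ζ τ] at h
  exact h

/-- The generic point of the subtorus `z^u = ζ` lies in the chart of the ray. -/
theorem subtorusClosure_eq_closure (hy : u ⬝ᵥ y = 1) (huv : u ⬝ᵥ v = 0)
    (hsign : ∀ σ ∈ F.cones, (∀ x ∈ σ, 0 ≤ pair u x) ∨ (∀ x ∈ σ, pair u x ≤ 0)) (ζ : kˣ)
    {ρ : F.Star v} (hρ : ρ.1 = ray v) :
    subtorusClosure k F v u y ζ =
      closure {chart k F v ρ ⟨subtorusIdeal k v ρ.1 u y ζ, inferInstance⟩} := by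
  refine Set.Subset.antisymm ?_ (closure_minimal (Set.singleton_subset_iff.2
    ⟨ρ, _, rfl, le_rfl⟩) (isClosed_subtorusClosure hy huv hsign ζ))
  rintro _ ⟨τ, Q, rfl, hle⟩
  have hρτ : ρ.1 ≤ τ.1 := by
    rw [hρ, ray]
    exact Submodule.span_le.2 (Set.singleton_subset_iff.2 τ.2.2)
  have h1 : (⟨subtorusIdeal k v τ.1 u y ζ, inferInstance⟩ : PrimeSpectrum (ChartRing k v τ.1)) =
      PrimeSpectrum.comap (chartInclusion k v hρτ)
        ⟨subtorusIdeal k v ρ.1 u y ζ, inferInstance⟩ :=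
    PrimeSpectrum.ext (comap_subtorusIdeal v hρτ u y ζ).symm
  rw [← chart_comap F v hρτ, ← h1]
  have h2 := (PrimeSpectrum.le_iff_mem_closure
    (⟨subtorusIdeal k v τ.1 u y ζ, inferInstance⟩ : PrimeSpectrum (ChartRing k v τ.1)) Q).1 hle
  have h3 := image_closure_subset_closure_image (continuous_chart F v τ) (Set.mem_image_of_mem _ h2)
  rwa [Set.image_singleton] at h3

/-- In each chart `z^u` or `z^{-u}` is a regular function, with a different value on each
closure. -/
theorem disjoint_subtorusClosure (hy : u ⬝ᵥ y = 1) (huv : u ⬝ᵥ v = 0)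
    (hsign : ∀ σ ∈ F.cones, (∀ x ∈ σ, 0 ≤ pair u x) ∨ (∀ x ∈ σ, pair u x ≤ 0)) {ζ ζ' : kˣ}
    (hne : ζ ≠ ζ') :
    Disjoint (subtorusClosure k F v u y ζ) (subtorusClosure k F v u y ζ') := by
  rw [Set.disjoint_left]
  rintro _ ⟨τ, Q, rfl, hle⟩ h'
  rw [chart_mem_subtorusClosure hy huv hsign] at h'
  have key : ∀ {u y : ι → ℤ} {ζ ζ' : kˣ}, u ⬝ᵥ y = 1 → u ∈ chartMonoid v τ.1 →
      subtorusIdeal k v τ.1 u y ζ ≤ Q.asIdeal → subtorusIdeal k v τ.1 u y ζ' ≤ Q.asIdeal →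
      ζ = ζ' := by
    intro u y ζ ζ' hy hu h h'
    by_contra hne
    -- the difference of the equations `z^u - ζ` and `z^u - ζ'` is a nonzero constant
    have h1 := Q.asIdeal.sub_mem
      (h (single_sub_single_mem_subtorusIdeal hy ζ (m := ⟨u, hu⟩) (a := 1) (one_smul ℤ u).symm))
      (h' (single_sub_single_mem_subtorusIdeal hy ζ' (m := ⟨u, hu⟩) (a := 1) (one_smul ℤ u).symm))
    rw [sub_sub_sub_cancel_left, zpow_one, zpow_one, ← AddMonoidAlgebra.single_sub] at h1
    have h2 : (ζ' : k) - ζ ≠ 0 := sub_ne_zero.2 fun h => hne (Units.ext h).symm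
    refine Q.2.ne_top (Ideal.eq_top_of_isUnit_mem _ h1 ?_)
    exact (IsUnit.mk0 _ h2).map (algebraMap k (ChartRing k v τ.1))
  rcases mem_chartMonoid_or huv (hsign τ.1 τ.2.1) with hu | hu
  · exact hne (key hy hu hle h')
  · rw [← subtorusIdeal_neg] at hle h'
    exact hne (inv_injective (key (by rw [neg_dotProduct_neg, hy]) hu hle h'))

end Closure

/-! ### Components of binomial hypersurfaces -/

variable {k : Type u} [Field k] {ι : Type v} [Fintype ι]

section Components

variable {F : Fan ι} {v u y : ι → ℤ}

open Polynomial in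
/-- The factorization of `1 + z^{d u}` in the chart of a cone on which `z^u` is regular. -/
theorem exists_root_mem_of_binomial_mem [IsAlgClosed k] {A : Type*} [CommRing A] [Algebra k A]
    {d : ℕ} (hd : d ≠ 0) {P : Ideal A} [P.IsPrime] {x : A} (h : 1 + x ^ d ∈ P) :
    ∃ ζ : kˣ, (ζ : k) ^ d = -1 ∧ x - algebraMap k A ζ ∈ P := by
  have hmonic : (X ^ d - C (-1 : k)).Monic := monic_X_pow_sub_C _ hd
  have hprod := (IsAlgClosed.splits (X ^ d - C (-1 : k))).eq_prod_roots_of_monic hmonic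
  have h1 := congrArg (aeval x) hprod
  rw [map_sub, map_pow, aeval_X, aeval_C, map_neg, map_one, sub_neg_eq_add, add_comm,
    map_multiset_prod, Multiset.map_map] at h1
  rw [h1, Ideal.IsPrime.multiset_prod_mem_iff_exists_mem ‹P.IsPrime›] at h
  obtain ⟨a, ha, haP⟩ := h
  obtain ⟨ζ, hζ, rfl⟩ := Multiset.mem_map.1 ha
  have hroot : ζ ^ d = -1 := by
    have := (mem_roots hmonic.ne_zero).1 hζ
    rw [IsRoot.def, eval_sub, eval_pow, eval_X, eval_C, sub_eq_zero] at this
    exact this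
  have hne : ζ ≠ 0 := fun h0 => by
    rw [h0, zero_pow hd] at hroot
    exact neg_ne_zero.2 one_ne_zero hroot.symm
  refine ⟨Units.mk0 ζ hne, hroot, ?_⟩
  simpa using haP

open Polynomial in
theorem card_units_pow_eq_neg_one [IsAlgClosed k] [CharZero k] {d : ℕ} (hd : d ≠ 0) :
    Nat.card {ζ : kˣ // (ζ : k) ^ d = -1} = d := by
  have hsep : (X ^ d - C (-1 : k)).Separable :=
    separable_X_pow_sub_C _ (Nat.cast_ne_zero.2 hd) (neg_ne_zero.2 one_ne_zero)
  have hcard := card_rootSet_eq_natDegree hsep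
    (IsAlgClosed.splits ((X ^ d - C (-1 : k)).map (algebraMap k k)))
  rw [natDegree_X_pow_sub_C, ← Nat.card_eq_fintype_card] at hcard
  have hmonic : (X ^ d - C (-1 : k)).Monic := monic_X_pow_sub_C _ hd
  have hmem : ∀ ζ : k, ζ ∈ (X ^ d - C (-1 : k)).rootSet k ↔ ζ ^ d = -1 := fun ζ => by
    rw [mem_rootSet, and_iff_right hmonic.ne_zero, map_sub, map_pow, aeval_X, aeval_C, sub_eq_zero]
    rfl
  have hne : ∀ ζ : k, ζ ^ d = -1 → ζ ≠ 0 := fun ζ h h0 => by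
    rw [h0, zero_pow hd] at h
    exact neg_ne_zero.2 one_ne_zero h.symm
  refine (Nat.card_congr (β := (X ^ d - C (-1 : k)).rootSet k)
    { toFun := fun ζ => ⟨ζ.1, (hmem _).2 ζ.2⟩
      invFun := fun ζ => ⟨Units.mk0 ζ.1 (hne _ ((hmem _).1 ζ.2)), (hmem _).1 ζ.2⟩
      left_inv := fun ζ => Subtype.ext (Units.ext rfl)
      right_inv := fun _ => rfl }).trans hcard

/-- The closure of the locus `1 + z^{d u} = 0` is the union of the closures of the subtori
`z^u = ζ`, where `ζ` runs through the `d`-th roots of `-1`. -/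
theorem binomialHypersurface_eq [IsAlgClosed k] [CharZero k] {ρ : F.Star v} (hρ : ρ.1 = ray v)
    (hy : u ⬝ᵥ y = 1) (huv : u ⬝ᵥ v = 0)
    (hsign : ∀ σ ∈ F.cones, (∀ x ∈ σ, 0 ≤ pair u x) ∨ (∀ x ∈ σ, pair u x ≤ 0)) {d : ℕ} (hd : d ≠ 0) :
    binomialHypersurface k F v ((d : ℤ) • u) =
      ⋃ ζ : {ζ : kˣ // (ζ : k) ^ d = -1}, subtorusClosure k F v u y ζ := by
  have hfin : Finite {ζ : kˣ // (ζ : k) ^ d = -1} :=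
    Nat.finite_of_card_ne_zero (by rwa [card_units_pow_eq_neg_one hd])
  have huray : ∀ σ : F.Star v, σ.1 = ray v → ∀ a : ι → ℤ, a ⬝ᵥ v = 0 → a ∈ chartMonoid v σ.1 := by
    intro σ hσ a ha
    rw [hσ]
    have h0 : pair a (toReal v) = 0 := by rw [pair_toReal, ha, Int.cast_zero]
    have h1 : ray v ≤ perp a := Submodule.span_le.2 (Set.singleton_subset_iff.2 h0)
    exact ⟨h0, fun x hx => (h1 hx).ge⟩
  have hclosed : IsClosed (⋃ ζ : {ζ : kˣ // (ζ : k) ^ d = -1}, subtorusClosure k F v u y ζ) :=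
    isClosed_iUnion_of_finite fun ζ => isClosed_subtorusClosure hy huv hsign ζ.1
  refine Set.Subset.antisymm (closure_minimal ?_ hclosed) ?_
  · rintro _ ⟨σ, P, hu, hσ, hP, rfl⟩
    have hu0 : u ∈ chartMonoid v σ.1 := huray σ hσ u huv
    have hpow : (AddMonoidAlgebra.single ⟨(d : ℤ) • u, hu⟩ (1 : k) : ChartRing k v σ.1) =
        AddMonoidAlgebra.single ⟨u, hu0⟩ (1 : k) ^ d := by
      rw [AddMonoidAlgebra.single_pow, one_pow]
      exact congrArg (fun m => AddMonoidAlgebra.single m (1 : k))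
        (Subtype.ext (natCast_zsmul u d))
    rw [hpow] at hP
    -- a prime ideal containing `1 + (z^u)^d` contains one of its linear factors
    obtain ⟨ζ, hζ, hmem⟩ := exists_root_mem_of_binomial_mem (k := k) hd hP
    refine Set.mem_iUnion.2 ⟨⟨ζ, hζ⟩, (chart_mem_subtorusClosure hy huv hsign ζ).2 ?_⟩
    rw [subtorusIdeal_eq_span hy ζ hu0, Ideal.span_singleton_le_iff_mem]
    exact hmem
  · refine Set.iUnion_subset fun ζ => ?_
    rw [subtorusClosure_eq_closure hy huv hsign ζ.1 hρ]
    have hu : (d : ℤ) • u ∈ chartMonoid v ρ.1 :=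
      huray ρ hρ _ (by rw [smul_dotProduct, huv, smul_zero])
    refine closure_mono (Set.singleton_subset_iff.2 ⟨ρ, _, hu, hρ, ?_, rfl⟩)
    have h1 := single_sub_single_mem_subtorusIdeal (k := k) hy ζ.1 (m := ⟨(d : ℤ) • u, hu⟩)
      (a := d) rfl
    rw [zpow_natCast, Units.val_pow_eq_pow_val, ζ.2, AddMonoidAlgebra.single_neg,
      sub_neg_eq_add, add_comm] at h1
    exact h1

/-- Finitely many disjoint closed connected sets are the connected components of their union. -/
theorem componentsOf_iUnion {Z : Type u} [TopologicalSpace Z] {A : Type*} [Finite A]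
    {C : A → Set Z} (hclosed : ∀ a, IsClosed (C a)) (hpre : ∀ a, IsPreconnected (C a))
    (hne : ∀ a, (C a).Nonempty) (hdisj : ∀ a b, a ≠ b → Disjoint (C a) (C b)) :
    componentsOf (⋃ a, C a) = Set.range C := by
  have key : ∀ a, ∀ x ∈ C a, connectedComponentIn (⋃ a, C a) x = C a := by
    intro a x hx
    have hsub := Set.subset_iUnion C a
    refine Set.Subset.antisymm ?_ ((hpre a).subset_connectedComponentIn hx hsub)
    have hcov : connectedComponentIn (⋃ a, C a) x ⊆ C a ∪ ⋃ b : {b // b ≠ a}, C b := by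
      refine (connectedComponentIn_subset _ _).trans (Set.iUnion_subset fun b => ?_)
      by_cases h : b = a
      · rw [h]
        exact Set.subset_union_left
      · exact (Set.subset_iUnion (fun b : {b // b ≠ a} => C b) ⟨b, h⟩).trans Set.subset_union_right
    have hd : Disjoint (C a) (⋃ b : {b // b ≠ a}, C b) :=
      Set.disjoint_iUnion_right.2 fun b => hdisj a b b.2.symm
    rcases isPreconnected_iff_subset_of_disjoint_closed.1 isPreconnected_connectedComponentIn _ _
      (hclosed a) (isClosed_iUnion_of_finite fun b => hclosed _) hcov
      (by rw [hd.inter_eq, Set.inter_empty]) with h | h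
    · exact h
    · exact absurd (h (mem_connectedComponentIn (hsub hx))) (Set.disjoint_left.1 hd hx)
  ext D
  constructor
  · rintro ⟨x, hx, rfl⟩
    obtain ⟨a, ha⟩ := Set.mem_iUnion.1 hx
    exact ⟨a, (key a x ha).symm⟩
  · rintro ⟨a, rfl⟩
    obtain ⟨x, hx⟩ := hne a
    exact ⟨x, Set.subset_iUnion C a hx, (key a x hx).symm⟩

theorem subtorusClosure_nonempty (ρ : F.Star v) (ζ : kˣ) :
    (subtorusClosure k F v u y ζ).Nonempty :=
  ⟨chart k F v ρ ⟨subtorusIdeal k v ρ.1 u y ζ, inferInstance⟩, _, _, rfl, le_rfl⟩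

/-- The connected components of a binomial hypersurface are the closures of subtori. -/
theorem componentsOf_binomialHypersurface [IsAlgClosed k] [CharZero k] {ρ : F.Star v}
    (hρ : ρ.1 = ray v) (hy : u ⬝ᵥ y = 1) (huv : u ⬝ᵥ v = 0)
    (hsign : ∀ σ ∈ F.cones, (∀ x ∈ σ, 0 ≤ pair u x) ∨ (∀ x ∈ σ, pair u x ≤ 0)) {d : ℕ} (hd : d ≠ 0) :
    componentsOf (binomialHypersurface k F v ((d : ℤ) • u)) =
      Set.range fun ζ : {ζ : kˣ // (ζ : k) ^ d = -1} => subtorusClosure k F v u y ζ := by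
  have hfin : Finite {ζ : kˣ // (ζ : k) ^ d = -1} :=
    Nat.finite_of_card_ne_zero (by rwa [card_units_pow_eq_neg_one hd])
  rw [binomialHypersurface_eq hρ hy huv hsign hd]
  refine componentsOf_iUnion (fun ζ => isClosed_subtorusClosure hy huv hsign ζ.1) (fun ζ => ?_)
    (fun ζ => subtorusClosure_nonempty ρ ζ.1)
    (fun ζ ζ' h => disjoint_subtorusClosure hy huv hsign fun h' => h (Subtype.ext h'))
  rw [subtorusClosure_eq_closure hy huv hsign ζ.1 hρ]
  exact isPreconnected_singleton.closure

theorem subtorusClosure_injective (ρ : F.Star v) (hy : u ⬝ᵥ y = 1) (huv : u ⬝ᵥ v = 0)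
    (hsign : ∀ σ ∈ F.cones, (∀ x ∈ σ, 0 ≤ pair u x) ∨ (∀ x ∈ σ, pair u x ≤ 0)) :
    Function.Injective (subtorusClosure k F v u y) := by
  intro ζ ζ' h
  by_contra hne
  obtain ⟨x, hx⟩ := subtorusClosure_nonempty (u := u) (y := y) ρ ζ
  exact Set.disjoint_left.1 (disjoint_subtorusClosure hy huv hsign hne) hx (h ▸ hx)

end Components

/-! ### Intersection numbers with toric curves -/

section Intersection

variable {F : Fan ι} {v u y : ι → ℤ}

theorem hypersurfaceIdeal_subtorusClosure (hy : u ⬝ᵥ y = 1) (huv : u ⬝ᵥ v = 0)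
    (hsign : ∀ σ ∈ F.cones, (∀ x ∈ σ, 0 ≤ pair u x) ∨ (∀ x ∈ σ, pair u x ≤ 0)) (ζ : kˣ)
    (τ : F.Star v) :
    hypersurfaceIdeal k F v (subtorusClosure k F v u y ζ) τ = subtorusIdeal k v τ.1 u y ζ := by
  rw [hypersurfaceIdeal, preimage_chart_subtorusClosure hy huv hsign,
    PrimeSpectrum.vanishingIdeal_zeroLocus_eq_radical]
  exact (inferInstance : (subtorusIdeal k v τ.1 u y ζ).IsPrime).isRadical.radical

/-- The curve `D_σ` lies in the locus `z^u = 0` or `z^{-u} = 0` if `u` does not vanish on `σ`. -/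
theorem intersectionLength_eq_zero (hy : u ⬝ᵥ y = 1) (huv : u ⬝ᵥ v = 0)
    (hsign : ∀ σ ∈ F.cones, (∀ x ∈ σ, 0 ≤ pair u x) ∨ (∀ x ∈ σ, pair u x ≤ 0)) (ζ : kˣ)
    {σ : PointedCone ℝ (ι → ℝ)} (hσ : ¬ σ ≤ perp u) (τ : F.Star v) :
    intersectionLength k F v (subtorusClosure k F v u y ζ) σ τ = 0 := by
  obtain ⟨x, hx, hx0⟩ := SetLike.not_le_iff_exists.1 hσ
  have key : ∀ {u y : ι → ℤ} (ζ : kˣ), u ⬝ᵥ y = 1 → u ∈ chartMonoid v τ.1 → pair u x ≠ 0 →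
      subtorusIdeal k v τ.1 u y ζ ⊔ stratumIdeal k F v σ τ = ⊤ := by
    intro u y ζ hy hu hx0
    have h1 : (AddMonoidAlgebra.single ⟨u, hu⟩ (1 : k) : ChartRing k v τ.1) ∈
        stratumIdeal k F v σ τ := Ideal.subset_span ⟨⟨u, hu⟩, ⟨x, hx, hx0⟩, rfl⟩
    have h2 := single_sub_single_mem_subtorusIdeal hy ζ (m := ⟨u, hu⟩) (a := 1) (one_smul ℤ u).symm
    have h3 := Ideal.sub_mem _ (Ideal.mem_sup_right (S := subtorusIdeal k v τ.1 u y ζ) h1)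
      (Ideal.mem_sup_left h2)
    rw [sub_sub_cancel] at h3
    exact Ideal.eq_top_of_isUnit_mem _ h3 ((ζ ^ (1 : ℤ)).isUnit.map (algebraMap k (ChartRing k v τ.1)))
  have htop : subtorusIdeal k v τ.1 u y ζ ⊔ stratumIdeal k F v σ τ = ⊤ := by
    rcases mem_chartMonoid_or huv (hsign τ.1 τ.2.1) with hu | hu
    · exact key ζ hy hu hx0
    · rw [← subtorusIdeal_neg]
      exact key ζ⁻¹ (by rw [neg_dotProduct_neg, hy]) hu
        (by rwa [pair_neg_left, neg_ne_zero])
  rw [intersectionLength, hypersurfaceIdeal_subtorusClosure hy huv hsign, htop]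
  have : Subsingleton (ChartRing k v τ.1 ⧸ (⊤ : Ideal (ChartRing k v τ.1))) :=
    Ideal.Quotient.subsingleton_iff.2 rfl
  exact Module.finrank_zero_of_subsingleton

/-- If `σ` spans `u^⊥`, then `z^u` is a coordinate on the big torus of the curve `D_σ`, so that the
curve meets the closure of `z^u = ζ` in a reduced point. -/
theorem intersectionLength_eq_one (hu : IsPrimitive u) (hy : u ⬝ᵥ y = 1) (huv : u ⬝ᵥ v = 0)
    (hsign : ∀ σ ∈ F.cones, (∀ x ∈ σ, 0 ≤ pair u x) ∨ (∀ x ∈ σ, pair u x ≤ 0)) (ζ : kˣ)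
    {σ : PointedCone ℝ (ι → ℝ)} (hσ : coneDim σ + 1 = Fintype.card ι) (hle : σ ≤ perp u)
    (τ : F.Star v) (hστ : σ ≤ τ.1) :
    intersectionLength k F v (subtorusClosure k F v u y ζ) σ τ = 1 := by
  have hmul : ∀ m : ι → ℤ, (∀ x ∈ σ, pair m x = 0) → ∃ a : ℤ, m = a • u := fun m hm => by
    refine hu.exists_smul_of_ker_le fun x hx => ?_
    have h1 : Submodule.span ℝ (σ : Set (ι → ℝ)) ≤ LinearMap.ker (pairL m) := Submodule.span_le.2 hm
    rw [span_eq_ker_of_le_perp hu.ne_zero hσ hle] at h1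
    exact h1 hx
  rw [intersectionLength, hypersurfaceIdeal_subtorusClosure hy huv hsign]
  set I := subtorusIdeal k v τ.1 u y ζ ⊔ stratumIdeal k F v σ τ with hI
  refine finrank_eq_one (Ideal.Quotient.mk I 1) ?_ fun q => ?_
  · rw [Ne, Ideal.Quotient.eq_zero_iff_mem]
    intro h1
    -- The value at the intersection point is the constant term of the restriction to `z^u = ζ`.
    obtain ⟨f, hf, g, hg, hfg⟩ := Submodule.mem_sup.1 h1
    have hg0 : ∀ h : ChartRing k v τ.1,
        (restrictHom u y ζ (chartEmbedding k v τ.1 (h * g))).coeff 0 = 0 := by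
      refine Submodule.span_induction (p := fun g _ => ∀ h : ChartRing k v τ.1,
        (restrictHom u y ζ (chartEmbedding k v τ.1 (h * g))).coeff 0 = 0) ?_ (by simp) ?_ ?_ hg
      · rintro _ ⟨m, ⟨x, hx, hmx⟩, rfl⟩ h
        induction h using AddMonoidAlgebra.induction_linear with
        | zero => simp
        | add f g hf hg => simp only [add_mul, map_add, AddMonoidAlgebra.coeff_add, Finsupp.add_apply,
            hf, hg, add_zero]
        | single p c =>
          rw [AddMonoidAlgebra.single_mul_single, chartEmbedding_single, restrictHom_single,
            AddMonoidAlgebra.coeff_single, Finsupp.single_apply, if_neg]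
          intro h0
          have h2 : pair ((p + m).1) x = 0 := by
            rw [sub_eq_zero.1 h0, pair_smul_left, show pair u x = 0 from hle hx, mul_zero]
          rw [AddSubmonoid.coe_add, pair_add_left] at h2
          have h3 := p.2.2 x (hστ hx)
          have h4 := m.2.2 x (hστ hx)
          exact hmx (by linarith)
      · intro g g' _ _ hg hg' h
        rw [mul_add, map_add, map_add, AddMonoidAlgebra.coeff_add, Finsupp.add_apply, hg, hg',
          add_zero]
      · intro a g _ hg h
        rw [smul_eq_mul, ← mul_assoc]
        exact hg _
    have h2 := congrArg (fun f => (restrictHom u y ζ (chartEmbedding k v τ.1 f)).coeff 0) hfg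
    simp only [map_add, map_one, AddMonoidAlgebra.coeff_add, Finsupp.add_apply,
      mem_subtorusIdeal.1 hf] at h2
    have h3 := hg0 1
    rw [one_mul] at h3
    rw [h3, AddMonoidAlgebra.one_def, AddMonoidAlgebra.coeff_single, Finsupp.single_eq_same] at h2
    simp at h2
  · obtain ⟨f, rfl⟩ := Ideal.Quotient.mk_surjective q
    induction f using AddMonoidAlgebra.induction_linear with
    | zero => exact ⟨0, by simp⟩
    | add f g hf hg =>
      obtain ⟨a, ha⟩ := hf
      obtain ⟨b, hb⟩ := hg
      exact ⟨a + b, by rw [add_smul, ha, hb, map_add]⟩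
    | single m c =>
      by_cases hm : ∀ x ∈ σ, pair m.1 x = 0
      · obtain ⟨a, ha⟩ := hmul m.1 hm
        refine ⟨c * (ζ ^ a : kˣ), ?_⟩
        have h1 : (c * (ζ ^ a : kˣ)) • Ideal.Quotient.mk I 1 =
            Ideal.Quotient.mk I (AddMonoidAlgebra.single 0 (c * (ζ ^ a : kˣ))) := by
          have h0 : (AddMonoidAlgebra.single 0 (c * (ζ ^ a : kˣ)) : ChartRing k v τ.1) =
              (c * (ζ ^ a : kˣ)) • 1 := by
            rw [AddMonoidAlgebra.one_def, AddMonoidAlgebra.smul_single', mul_one]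
          rw [h0]
          rfl
        have h2 := Ideal.mul_mem_left _ (AddMonoidAlgebra.single 0 c)
          (single_sub_single_mem_subtorusIdeal (σ := τ.1) hy ζ ha)
        rw [mul_sub, AddMonoidAlgebra.single_mul_single, AddMonoidAlgebra.single_mul_single, zero_add,
          zero_add, mul_one] at h2
        rw [h1, eq_comm, Ideal.Quotient.eq]
        exact Ideal.mem_sup_left h2
      · refine ⟨0, ?_⟩
        push Not at hm
        rw [zero_smul, eq_comm, Ideal.Quotient.eq_zero_iff_mem]
        refine Ideal.mem_sup_right ?_
        have h1 : (AddMonoidAlgebra.single m c : ChartRing k v τ.1) =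
            AddMonoidAlgebra.single 0 c * AddMonoidAlgebra.single m 1 := by
          rw [AddMonoidAlgebra.single_mul_single, zero_add, mul_one]
        rw [h1]
        exact Ideal.mul_mem_left _ _ (Ideal.subset_span ⟨m, hm, rfl⟩)

/-- The two maximal charts around `σ` each see the intersection point, which lies in their
intersection, the chart of `σ`. -/
theorem intersectionNumber_subtorusClosure (hF : F.IsComplete) (hu : IsPrimitive u)
    (hy : u ⬝ᵥ y = 1) (huv : u ⬝ᵥ v = 0)
    (hsign : ∀ σ ∈ F.cones, (∀ x ∈ σ, 0 ≤ pair u x) ∨ (∀ x ∈ σ, pair u x ≤ 0)) (ζ : kˣ)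
    (σ : F.Star v) (hσ : σ.1 ∈ F.codimOne) [Decidable (σ.1 ≤ perp u)] :
    intersectionNumber k F v (subtorusClosure k F v u y ζ) σ = if σ.1 ≤ perp u then 1 else 0 := by
  classical
  rw [intersectionNumber]
  split_ifs with hle
  · obtain ⟨τ, τ', hne, hτ⟩ := F.exists_two_maximal hF hy hu.ne_zero hsign hσ hle
    have h1 := (hτ τ).2 (Or.inl rfl)
    have h2 := (hτ τ').2 (Or.inr rfl)
    let a : {τ : F.Star v // σ.1 ≤ τ.1 ∧ τ.1 ∈ F.maximal} := ⟨⟨τ, h1.2.1, h1.1 σ.2.2⟩, h1⟩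
    let b : {τ : F.Star v // σ.1 ≤ τ.1 ∧ τ.1 ∈ F.maximal} := ⟨⟨τ', h2.2.1, h2.1 σ.2.2⟩, h2⟩
    have hab : a ≠ b := fun h => hne (congrArg (fun c => c.1.1) h)
    rw [finsum_eq_sum_of_support_subset (s := {a, b}), Finset.sum_pair hab,
      intersectionLength_eq_one hu hy huv hsign ζ hσ.2 hle a.1 a.2.1,
      intersectionLength_eq_one hu hy huv hsign ζ hσ.2 hle b.1 b.2.1,
      intersectionLength_eq_one hu hy huv hsign ζ hσ.2 hle σ le_rfl]
    · norm_num
    · intro c _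
      rcases (hτ c.1.1).1 c.2 with h | h
      · rw [show c = a from Subtype.ext (Subtype.ext h)]
        simp
      · rw [show c = b from Subtype.ext (Subtype.ext h)]
        simp
  · simp only [intersectionLength_eq_zero hy huv hsign ζ hle, Nat.cast_zero, finsum_zero, sub_zero]

/-- The widget of the closure of a subtorus consists of the cones in the hyperplane `u^⊥`. -/
theorem mem_widget_subtorusClosure {J : Type w} (hF : F.IsComplete) (hu : IsPrimitive u)
    (hy : u ⬝ᵥ y = 1) (huv : u ⬝ᵥ v = 0)
    (hsign : ∀ σ ∈ F.cones, (∀ x ∈ σ, 0 ≤ pair u x) ∨ (∀ x ∈ σ, pair u x ≤ 0)) (ζ : kˣ)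
    (f : ScatRing k ι J) (w : Wall k ι J) :
    w ∈ widget F v (intersectionNumber k F v (subtorusClosure k F v u y ζ)) f ↔
      ∃ σ ∈ F.codimOne, toReal v ∈ σ ∧ σ ≤ perp u ∧ w = ⟨σ, f, -v⟩ := by
  classical
  constructor
  · rintro ⟨σ, hσ, h0, rfl⟩
    rw [intersectionNumber_subtorusClosure hF hu hy huv hsign ζ σ hσ] at h0 ⊢
    split_ifs at h0 ⊢ with h
    · exact ⟨σ.1, hσ, σ.2.2, h, by rw [Int.toNat_one, pow_one]⟩
    · exact absurd h0 (lt_irrefl 0)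
  · rintro ⟨σ, hσ, hv, hle, rfl⟩
    let σ' : F.Star v := ⟨σ, hσ.1, hv⟩
    have h1 := intersectionNumber_subtorusClosure hF hu hy huv hsign ζ σ' hσ
    rw [if_pos hle] at h1
    exact ⟨σ', hσ, by rw [h1]; exact one_pos, by rw [h1, Int.toNat_one, pow_one]⟩

end Intersection

/-! ### The toric models of cluster varieties -/

variable {k : Type u} [Field k] {ι : Type v} [Fintype ι]

theorem perp_smul {d : ℕ} (hd : d ≠ 0) (u : ι → ℤ) : perp ((d : ℤ) • u) = perp u := by
  ext x
  rw [mem_perp, mem_perp, pair_smul_left, mul_eq_zero, Int.cast_natCast, Nat.cast_eq_zero,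
    or_iff_right hd]

section ToricModel

variable {I : Type w} {F : Fan ι} {v u : I → ι → ℤ}

/-- As `u_i^⊥` is a union of cones of the fan, it does not cut through any cone. -/
theorem IsClusterFan.nonneg_or_nonpos (hF : IsClusterFan F v u) (i : I) {d : ℕ} (hd : d ≠ 0)
    {u₀ : ι → ℤ} (hu : u i = (d : ℤ) • u₀) :
    ∀ σ ∈ F.cones, (∀ x ∈ σ, 0 ≤ pair u₀ x) ∨ (∀ x ∈ σ, pair u₀ x ≤ 0) := by
  have h := hF.perp_eq i
  rw [hu, perp_smul hd] at h
  exact fun σ hσ => F.nonneg_or_nonpos h hσ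

/-- The star of a ray contains the ray. -/
def IsClusterFan.rayStar (hF : IsClusterFan F v u) (i : I) : F.Star (v i) :=
  ⟨ray (v i), hF.ray_mem i, Submodule.subset_span rfl⟩

/-- `C` is the closure of a subtorus of codimension one on which `z^u` is constant. -/
def IsSubtorusClosure (k : Type u) [Field k] (F : Fan ι) (v u : ι → ℤ)
    (C : Set (ToricDivisor k F v)) : Prop :=
  ∃ (d : ℕ) (u₀ y : ι → ℤ) (ζ : kˣ), d ≠ 0 ∧ u = (d : ℤ) • u₀ ∧ IsPrimitive u₀ ∧ u₀ ⬝ᵥ y = 1 ∧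
    C = subtorusClosure k F v u₀ y ζ

theorem dotProduct_eq_zero_of_smul {d : ℕ} (hd : d ≠ 0) {u u₀ v : ι → ℤ} (hu : u = (d : ℤ) • u₀)
    (h : u ⬝ᵥ v = 0) : u₀ ⬝ᵥ v = 0 := by
  rw [hu, smul_dotProduct, smul_eq_mul] at h
  exact (mul_eq_zero.1 h).resolve_left (Nat.cast_ne_zero.2 hd)

/-- The intersection numbers single out the cones contained in `u_i^⊥`. -/
theorem IsClusterFan.hdtvInitial_eq (hF : IsClusterFan F v u) {J : Type x} (p : J → I)
    (horth : ∀ i, u i ⬝ᵥ v i = 0) {H : ∀ j, Set (ToricDivisor k F (v (p j)))}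
    (hH : ∀ j, IsSubtorusClosure k F (v (p j)) (u (p j)) (H j)) :
    hdtvInitial k F (fun j => v (p j)) H = {w | ∃ j, ∃ σ ∈ F.codimOne, toReal (v (p j)) ∈ σ ∧
      σ ≤ perp (u (p j)) ∧ w = ⟨σ, binomialFunc k j (v (p j)), -v (p j)⟩} := by
  ext w
  rw [hdtvInitial, Set.mem_iUnion]
  refine exists_congr fun j => ?_
  obtain ⟨d, u₀, y, ζ, hd, hu, hu₀, hy, hC⟩ := hH j
  rw [hC, mem_widget_subtorusClosure hF.smoothProjective.1 hu₀ hy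
    (dotProduct_eq_zero_of_smul hd hu (horth _)) (hF.nonneg_or_nonpos _ hd hu), hu, perp_smul hd]

theorem IsClusterFan.componentsOf_eq [IsAlgClosed k] [CharZero k] (hF : IsClusterFan F v u) (i : I)
    (hu : u i ≠ 0) (horth : u i ⬝ᵥ v i = 0) :
    ∃ f : Fin (divisibility (u i)) → Set (ToricDivisor k F (v i)), Function.Injective f ∧
      Set.range f = componentsOf (binomialHypersurface k F (v i) (u i)) ∧
      ∀ j, IsSubtorusClosure k F (v i) (u i) (f j) := by
  obtain ⟨u₀, hu₀, hd, h⟩ := exists_smul_isPrimitive hu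
  obtain ⟨y, hy⟩ := hu₀.exists_dotProduct_eq_one
  have hsign := hF.nonneg_or_nonpos i hd h
  have h0 := dotProduct_eq_zero_of_smul hd h horth
  have hcard := card_units_pow_eq_neg_one (k := k) hd
  have hfin : Finite {ζ : kˣ // (ζ : k) ^ divisibility (u i) = -1} :=
    Nat.finite_of_card_ne_zero (by rwa [hcard])
  let e := Finite.equivFinOfCardEq hcard
  have hcomp := componentsOf_binomialHypersurface (k := k) (ρ := hF.rayStar i) rfl hy h0 hsign hd
  rw [← h] at hcomp
  refine ⟨fun j => subtorusClosure k F (v i) u₀ y (e.symm j).1, fun j j' hj => ?_, ?_,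
    fun j => ⟨_, u₀, y, _, hd, h, hu₀, hy, rfl⟩⟩
  · exact e.symm.injective (Subtype.ext (subtorusClosure_injective (hF.rayStar i) hy h0 hsign hj))
  · rw [hcomp]
    exact e.symm.surjective.range_comp
      (fun ζ : {ζ : kˣ // (ζ : k) ^ divisibility (u i) = -1} => subtorusClosure k F (v i) u₀ y ζ)

/-- For primitive `u` the locus `1 + z^u = 0` is connected. -/
theorem IsClusterFan.isSubtorusClosure_binomialHypersurface [IsAlgClosed k] [CharZero k]
    (hF : IsClusterFan F v u) (i : I) (hu : IsPrimitive (u i)) (horth : u i ⬝ᵥ v i = 0) :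
    IsSubtorusClosure k F (v i) (u i) (binomialHypersurface k F (v i) (u i)) := by
  obtain ⟨y, hy⟩ := hu.exists_dotProduct_eq_one
  have h1 : u i = ((1 : ℕ) : ℤ) • u i := (one_smul ℤ _).symm
  have h2 := binomialHypersurface_eq (k := k) (ρ := hF.rayStar i) rfl hy horth
    (hF.nonneg_or_nonpos i one_ne_zero h1) one_ne_zero
  rw [← h1] at h2
  refine ⟨1, u i, y, -1, one_ne_zero, h1, hu, hy, ?_⟩
  rw [h2]
  refine Set.Subset.antisymm (Set.iUnion_subset fun ζ => ?_)
    (Set.subset_iUnion (fun ζ : {ζ : kˣ // (ζ : k) ^ 1 = -1} =>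
      subtorusClosure k F (v i) (u i) y ζ) ⟨-1, by simp⟩)
  have h3 : ζ.1 = -1 := Units.ext (by rw [← pow_one (ζ.1 : k), ζ.2, Units.val_neg, Units.val_one])
  rw [h3]

end ToricModel

namespace Seed

variable {N : Type x} [AddCommGroup N] (s : Seed N ι)

theorem e_dotProduct (i : s.unfrozen) (m : ι → ℤ) : s.e i ⬝ᵥ m = m i := by
  classical
  have h : s.e i = Pi.single i.1 1 := by
    ext j
    rw [e, Module.Basis.repr_self, Finsupp.single_apply, Pi.single_apply]
    simp only [eq_comm]
  rw [h, single_dotProduct, one_mul]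

theorem isPrimitive_e (i : s.unfrozen) : IsPrimitive (s.e i) :=
  isPrimitive_of_dotProduct_eq_one (y := s.e i) (by
    rw [e_dotProduct, e, Module.Basis.repr_self, Finsupp.single_eq_same])

theorem e_dotProduct_v (i j : s.unfrozen) : s.e i ⬝ᵥ s.v j = -(s.e j ⬝ᵥ s.v i) := by
  rw [e_dotProduct, e_dotProduct]
  exact s.skew _ _

theorem e_dotProduct_v_self (i : s.unfrozen) : s.e i ⬝ᵥ s.v i = 0 := by
  have := s.e_dotProduct_v i i
  omega

theorem v_ne_zero (i : s.unfrozen) : s.v i ≠ 0 := fun h =>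
  s.form_ne_zero i i.2 (s.basis.ext fun j => congrFun h j)

/-- Both diagrams are initial for the normals `e_i` and the exponents `v_i`. -/
theorem haveEquivalentCompletions_X [IsAlgClosed k] [CharZero k] (hs : s.XAssumptions) {F : Fan ι}
    (hF : IsClusterFan F s.v s.e) :
    HaveEquivalentCompletions (s.hdtvInitialX k F) (s.wallsX k) := by
  have he : ∀ i, s.e i ≠ 0 := fun i => (s.isPrimitive_e i).ne_zero
  have horth := s.e_dotProduct_v_self
  obtain ⟨E, hE⟩ := isInitial_fan (k := k) F he hs.1 horth hF.perp_eq
    (hF.hdtvInitial_eq id horth fun i =>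
      hF.isSubtorusClosure_binomialHypersurface i (s.isPrimitive_e i) (horth i))
  have hW : IsInitial s.e s.v (logCoeff k) (s.wallsX k) (s.wallsX k) := by
    have h := isInitial_hyperplanes (k := k) (nn := s.e) (mm := s.v) (S := fun i => {i}) he hs.1
      horth (fun i => Finset.singleton_nonempty i)
      (fun i j hj => by rw [Finset.mem_singleton.1 hj]; exact ⟨rfl, rfl⟩)
      (fun j => ⟨j, Finset.mem_singleton_self j, fun i hi => (Finset.mem_singleton.1 hi).symm⟩)
    simp only [Finset.prod_singleton] at h
    exact h
  exact hE.haveEquivalentCompletions s.e_dotProduct_v (fun β hβ => logCoeff_eq_zero he hβ) hW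

theorem exists_isComponentLabelling [IsAlgClosed k] [CharZero k] {F : Fan ι}
    (hF : IsClusterFan F s.e s.v) : ∃ C, s.IsComponentLabelling k F C := by
  choose f hinj hrange _ using fun i => hF.componentsOf_eq (k := k) i (s.v_ne_zero i)
    (by rw [dotProduct_comm]; exact s.e_dotProduct_v_self i)
  exact ⟨f, fun i => ⟨hinj i, hrange i⟩⟩

/-- Both diagrams are initial for the normals `v_i` and the exponents `e_i`, one copy for each
component. -/
theorem haveEquivalentCompletions_A [IsAlgClosed k] [CharZero k] {F : Fan ι}
    (hF : IsClusterFan F s.e s.v)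
    {C : ∀ i : s.unfrozen, Fin (divisibility (s.v i)) → Set (ToricDivisor k F (s.e i))}
    (hC : s.IsComponentLabelling k F C) :
    HaveEquivalentCompletions (s.hdtvInitialA k F C) (s.wallsA k) := by
  have horth : ∀ i, s.v i ⬝ᵥ s.e i = 0 := fun i => by
    rw [dotProduct_comm]
    exact s.e_dotProduct_v_self i
  have hv : ∀ q : s.Pairs, s.v q.1 ≠ 0 := fun q => s.v_ne_zero q.1
  have hsub : ∀ q : s.Pairs, IsSubtorusClosure k F (s.e q.1) (s.v q.1) (C q.1 q.2) := fun q => by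
    obtain ⟨f, _, hf, hsub⟩ := hF.componentsOf_eq (k := k) q.1 (s.v_ne_zero q.1) (horth q.1)
    obtain ⟨j, hj⟩ : C q.1 q.2 ∈ Set.range f := by
      rw [hf]
      exact (hC q.1).2 ▸ Set.mem_range_self q.2
    rw [← hj]
    exact hsub j
  obtain ⟨E, hE⟩ := isInitial_fan (k := k) (nn := fun q : s.Pairs => s.v q.1)
    (mm := fun q : s.Pairs => s.e q.1) F hv (fun q => s.isPrimitive_e q.1) (fun q => horth q.1)
    (fun q => hF.perp_eq q.1) (hF.hdtvInitial_eq (fun q : s.Pairs => q.1) horth hsub)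
  have hW : IsInitial (fun q : s.Pairs => s.v q.1) (fun q : s.Pairs => s.e q.1) (logCoeff k)
      (s.wallsA k) (s.wallsA k) := by
    have h := isInitial_hyperplanes (k := k) (nn := fun q : s.Pairs => s.v q.1)
      (mm := fun q : s.Pairs => s.e q.1) (N := s.v) (M := s.e)
      (S := fun i => Finset.univ.map (Function.Embedding.sigmaMk i)) s.v_ne_zero s.isPrimitive_e horth
      (fun i => ?_) (fun i q hq => ?_) (fun q => ⟨q.1, ?_, fun i hi => ?_⟩)
    · simp only [Finset.prod_map] at h
      exact h
    · obtain ⟨_, _, hd, _⟩ := exists_smul_isPrimitive (s.v_ne_zero i)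
      have : NeZero (divisibility (s.v i)) := ⟨hd⟩
      exact Finset.map_nonempty.2 Finset.univ_nonempty
    · obtain ⟨j, _, rfl⟩ := Finset.mem_map.1 hq
      exact ⟨rfl, rfl⟩
    · exact Finset.mem_map.2 ⟨q.2, Finset.mem_univ _, rfl⟩
    · obtain ⟨j, _, rfl⟩ := Finset.mem_map.1 hi
      rfl
  refine hE.haveEquivalentCompletions (fun q q' => ?_) (fun β hβ => logCoeff_eq_zero hv hβ) hW
  rw [dotProduct_comm, dotProduct_comm (s.v q'.1)]
  exact s.e_dotProduct_v _ _

end Seed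

end HDTV

end

theorem mainTheorem12 (k : Type*) [Field k] [IsAlgClosed k] [CharZero k]
    (N : Type*) [AddCommGroup N] (ι : Type*) [Fintype ι] (s : HDTV.Seed N ι) :
    (s.XAssumptions → ∀ F : HDTV.Fan ι, HDTV.IsClusterFan F s.v s.e →
      HDTV.HaveEquivalentCompletions (s.hdtvInitialX k F) (s.wallsX k)) ∧
    (∀ F : HDTV.Fan ι, HDTV.IsClusterFan F s.e s.v →
      (∃ C, s.IsComponentLabelling k F C) ∧
      ∀ C, s.IsComponentLabelling k F C →
        HDTV.HaveEquivalentCompletions (s.hdtvInitialA k F C) (s.wallsA k)) :=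
  ⟨fun hs _ hF => s.haveEquivalentCompletions_X hs hF, fun _ hF =>
    ⟨s.exists_isComponentLabelling hF, fun _ hC => s.haveEquivalentCompletions_A hF hC⟩⟩
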